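/- Let $X_1,\dots,X_n$ ($n\ge 1$) be integer variables with non-empty domains $D(X_i)\subseteq\{1,\dots,d\}$, and let $S\cup T=\{1,\dots,n\}$. The constraint $\mathrm{OverlappingAllDiff}([X],S,T)$ holds iff the variables $X_i$, $i\in S$, are pairwise different and the variables $X_i$, $i\in T$, are pairwise different. A constraint is *bound consistent* (BC) if, whenever one of its variables is assigned the minimum or the maximum of its domain, the constraint has a satisfying assignment extending this in which every variable takes a value between the minimum and the maximum of its domain (a *bound support*); it is *bound disentailed* if it has no bound support. Enforcing BC on a set of constraints means computing the greatest subdomains on which all of them are BC; it *fails* if some domain becomes empty. Introduce Boolean variables $b_{il}$ ($0\le l\le d$) and $a_{ilu}$ and counters $C^{ST}_{lu},C^S_{lu},C^T_{lu}$ with initial domain $\{0,\dots,n\}$, and, for $1\le i\le n$, $1\le l\le u\le d$, $u-l<n$, the constraints 1. $b_{il}=1\iff X_i\le l$ (for all $0\le l\le d$); 2. $a_{ilu}=1\iff (b_{i(l-1)}=0\wedge b_{iu}=1)$; 3. $C^{ST}_{lu}=\sum_{i\in S\cap T}a_{ilu}$; 4. $C^{S}_{lu}=\sum_{i\in S\setminus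 T}a_{ilu}$; 5. $C^{T}_{lu}=\sum_{i\in T\setminus S}a_{ilu}$; 6. $C^{ST}_{1u}=C^{ST}_{1l}+C^{ST}_{(l+1)u}$ (for $l<u$); 7. $C^{ST}_{lu}+C^{S}_{lu}\le u-l+1$; 8. $C^{ST}_{lu}+C^{T}_{lu}\le u-l+1$. Then: (i) If $\mathrm{OverlappingAllDiff}([X],S,T)$ is bound disentailed, then enforcing BC on constraints 1–8 fails; and it fails only if $\mathrm{OverlappingAllDiff}([X],S,T)$ has no solution with $X_i\in D(X_i)$ for all $i$. (ii) BC on constraints 1–8 can be enforced in $O(nd^2)$ time: a single program for a unit-cost random access machine, with words of $O(\log(n+d))$ bits, decides from $n,d,S,T$ and the domains whether enforcing BC fails and, if it does not, returns the minimum and maximum of the resulting domain of every variable of the decomposition, in at most $c\,nd^2$ steps for a constant $c$. (iii) Enforcing BC on constraints 1–8 does not enforce BC on $\mathrm{OverlappingAllDiff}$: for $n=d=4$, $S=\{1,2,3\}$, $T=\{2,3,4\}$, $D(X_1)=[2,3]$, $D(X_2)=[2,4]$, $D(X_3)=[1,3]$, $D(X_4)=[1,2]$, it does not fail and leaves $2$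 as the minimum of the domain of $X_2$, although $X_2=2$ has no bound support. -/

import Mathlib

/-! ## Constraints, domains and bound consistency -/

/-- A constraint over integer variables indexed by `V`: the set of the variables it
mentions, and the assignments that satisfy it. -/
structure Constr (V : Type) where
  scope : Set V
  holds : (V → ℤ) → Prop

/-- All the integers between the smallest and the greatest element of `E`. -/
def boundHull (E : Set ℤ) : Set ℤ :=
  {v | ∃ p ∈ E, ∃ q ∈ E, p ≤ v ∧ v ≤ q}

/-- `σ` is a bound support of `c` in the domains `D`: it satisfies `c`, and gives each variable
of `c` a value between the minimum and the maximum of the domain of this variable. -/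
def Constr.IsBoundSupport {V : Type} (c : Constr V) (D : V → Set ℤ) (σ : V → ℤ) : Prop :=
  c.holds σ ∧ ∀ y ∈ c.scope, σ y ∈ boundHull (D y)

/-- `c` is bound consistent: each variable of `c`, when assigned the minimum or the maximum of
its domain, has a bound support. -/
def Constr.BoundConsistent {V : Type} (c : Constr V) (D : V → Set ℤ) : Prop :=
  ∀ x ∈ c.scope, ∀ v : ℤ, (IsLeast (D x) v ∨ IsGreatest (D x) v) →
    ∃ σ : V → ℤ, σ x = v ∧ c.IsBoundSupport D σ

/-- `c` is bound disentailed: no assignment is a bound support. -/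
def Constr.BoundDisentailed {V : Type} (c : Constr V) (D : V → Set ℤ) : Prop :=
  ¬ ∃ σ : V → ℤ, c.IsBoundSupport D σ

/-- The result of enforcing bound consistency on a set of constraints: the greatest domains
below `D` in which all the constraints are bound consistent. (A union of such domains is again
such, so this union of all of them is one.) -/
def bcClosure {V : Type} (Γ : Set (Constr V)) (D : V → Set ℤ) : V → Set ℤ :=
  fun x => {v | ∃ E : V → Set ℤ, (∀ y, E y ⊆ D y) ∧ (∀ c ∈ Γ, c.BoundConsistent E) ∧ v ∈ E x}

/-- Enforcing bound consistency fails: it empties the domain of some variable. -/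
def BCFails {V : Type} (Γ : Set (Constr V)) (D : V → Set ℤ) : Prop :=
  ∃ x, bcClosure Γ D x = ∅

/-! ## The overlapping all-different constraint and its decomposition -/

/-- Input: `n` variables with non-empty domains of values in `1, …, d`, and two sets
`S`, `T` of variables that together contain all the variables. -/
structure OADInstance (n d : ℕ) where
  dom : Fin n → Finset ℤ
  dom_nonempty : ∀ i, (dom i).Nonempty
  dom_subset : ∀ i, dom i ⊆ Finset.Icc 1 (d : ℤ)
  S : Finset (Fin n)
  T : Finset (Fin n)
  cover : S ∪ T = Finset.univ

/-- The constraint: the variables in `S` are pairwise different, and so are those in `T`. -/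
def OADInstance.overlappingAllDiff {n d : ℕ} (I : OADInstance n d) : Constr (Fin n) where
  scope := Set.univ
  holds := fun x => Set.InjOn x (I.S : Set (Fin n)) ∧ Set.InjOn x (I.T : Set (Fin n))

/-- The given domains, as sets. -/
def OADInstance.domains {n d : ℕ} (I : OADInstance n d) : Fin n → Set ℤ :=
  fun i => (I.dom i : Set ℤ)

/-- The three families of counters: for `S ∩ T`, `S \ T` and `T \ S`. -/
inductive CKind
  | st
  | s
  | t

/-- The variables counted by a family of counters. -/
def OADInstance.counted {n d : ℕ} (I : OADInstance n d) : CKind → Finset (Fin n)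
  | .st => I.S ∩ I.T
  | .s => I.S \ I.T
  | .t => I.T \ I.S

/-- The variables of the decomposition: `X i`; `b i l` and `a i l u` (Boolean, with values
`0` and `1`); and the counters `C k l u`. -/
inductive DVar (n : ℕ)
  | X (i : Fin n)
  | b (i : Fin n) (l : ℕ)
  | a (i : Fin n) (l u : ℕ)
  | C (k : CKind) (l u : ℕ)

/-- The intervals `[l, u]` that the decomposition considers. -/
def InWindow (n d l u : ℕ) : Prop :=
  1 ≤ l ∧ l ≤ u ∧ u ≤ d ∧ u < l + n

/-- `b i l = 1 ↔ X i ≤ l`. -/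
def cBool {n : ℕ} (i : Fin n) (l : ℕ) : Constr (DVar n) where
  scope := {.b i l, .X i}
  holds := fun σ => σ (.b i l) = 1 ↔ σ (.X i) ≤ (l : ℤ)

/-- `a i l u = 1 ↔ b i (l - 1) = 0 ∧ b i u = 1`, used for `1 ≤ l`. -/
def cInterval {n : ℕ} (i : Fin n) (l u : ℕ) : Constr (DVar n) where
  scope := {.a i l u, .b i (l - 1), .b i u}
  holds := fun σ => σ (.a i l u) = 1 ↔ (σ (.b i (l - 1)) = 0 ∧ σ (.b i u) = 1)

/-- `C k l u = ∑ a i l u` over the variables `i` that `C k` counts. -/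
def OADInstance.cCount {n d : ℕ} (I : OADInstance n d) (k : CKind) (l u : ℕ) :
    Constr (DVar n) where
  scope := {.C k l u} ∪ {x | ∃ i ∈ I.counted k, x = .a i l u}
  holds := fun σ => σ (.C k l u) = ∑ i ∈ I.counted k, σ (.a i l u)

/-- The pyramid constraint `C^ST 1 u = C^ST 1 l + C^ST (l+1) u`. -/
def cPyramid {n : ℕ} (l u : ℕ) : Constr (DVar n) where
  scope := {.C .st 1 u, .C .st 1 l, .C .st (l + 1) u}
  holds := fun σ => σ (.C .st 1 u) = σ (.C .st 1 l) + σ (.C .st (l + 1) u)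

/-- The capacity constraint `C^ST l u + C^k l u ≤ u - l + 1`. -/
def cCapacity {n : ℕ} (k : CKind) (l u : ℕ) : Constr (DVar n) where
  scope := {.C .st l u, .C k l u}
  holds := fun σ => σ (.C .st l u) + σ (.C k l u) ≤ (u : ℤ) - (l : ℤ) + 1

/-- The constraints of the decomposition. -/
def OADInstance.decomposition {n d : ℕ} (I : OADInstance n d) : Set (Constr (DVar n)) :=
  {c | ∃ i l, l ≤ d ∧ c = cBool i l} ∪
  {c | ∃ i l u, InWindow n d l u ∧ c = cInterval i l u} ∪
  {c | ∃ k l u, InWindow n d l u ∧ c = I.cCount k l u} ∪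
  {c | ∃ l u, InWindow n d l u ∧ l < u ∧ c = cPyramid l u} ∪
  {c | ∃ l u, InWindow n d l u ∧ c = cCapacity .s l u} ∪
  {c | ∃ l u, InWindow n d l u ∧ c = cCapacity .t l u}

/-- The initial domains of the variables of the decomposition. -/
def OADInstance.initDom {n d : ℕ} (I : OADInstance n d) : DVar n → Set ℤ
  | .X i => (I.dom i : Set ℤ)
  | .b _ _ => {0, 1}
  | .a _ _ _ => {0, 1}
  | .C _ _ _ => Set.Icc 0 (n : ℤ)

/-- The domains after enforcing bound consistency on the decomposition. -/
def OADInstance.closure {n d : ℕ} (I : OADInstance n d) : DVar n → Set ℤ :=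
  bcClosure I.decomposition I.initDom

/-- Enforcing bound consistency on the decomposition fails. -/
def OADInstance.Fails {n d : ℕ} (I : OADInstance n d) : Prop :=
  BCFails I.decomposition I.initDom

/-! ## Machine model: programs for a random access machine with unit costs

The memory has integer registers `0, 1, 2, …` and arrays `0, 1, 2, …` of integers. Every
constant, register access, array access and arithmetic operation counts one step, and no value
computed may exceed a given word bound `W` in absolute value. -/

/-- Contents of the memory. -/
structure RState where
  reg : ℕ → ℤ
  mem : ℕ → ℕ → ℤ

/-- Expressions; `read A e` is the entry of the array `A` at the index `e`. -/
inductive RExpr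
  | const (k : ℤ)
  | reg (r : ℕ)
  | read (A : ℕ) (e : RExpr)
  | add (e f : RExpr)
  | sub (e f : RExpr)
  | mul (e f : RExpr)

/-- The value of an expression. -/
def RExpr.eval (m : RState) : RExpr → ℤ
  | .const k => k
  | .reg r => m.reg r
  | .read A e => m.mem A (e.eval m).toNat
  | .add e f => e.eval m + f.eval m
  | .sub e f => e.eval m - f.eval m
  | .mul e f => e.eval m * f.eval m

/-- The number of steps for evaluating an expression. -/
def RExpr.cost : RExpr → ℕ
  | .const _ => 1
  | .reg _ => 1
  | .read _ e => e.cost + 1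
  | .add e f => e.cost + f.cost + 1
  | .sub e f => e.cost + f.cost + 1
  | .mul e f => e.cost + f.cost + 1

/-- The expression can be evaluated with words bounded by `W`: no intermediate result is
larger, and no array index is negative. -/
def RExpr.Fits (W : ℤ) (m : RState) : RExpr → Prop
  | .const k => |k| ≤ W
  | .reg _ => True
  | .read _ e => e.Fits W m ∧ 0 ≤ e.eval m
  | .add e f => e.Fits W m ∧ f.Fits W m ∧ |e.eval m + f.eval m| ≤ W
  | .sub e f => e.Fits W m ∧ f.Fits W m ∧ |e.eval m - f.eval m| ≤ W
  | .mul e f => e.Fits W m ∧ f.Fits W m ∧ |e.eval m * f.eval m| ≤ W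

/-- Programs: `skip`, `r := e`, `A[e] := f`, sequence, `if e ≤ f then p else q`,
`while e ≤ f do p`. -/
inductive RProg
  | skip
  | assign (r : ℕ) (e : RExpr)
  | store (A : ℕ) (e f : RExpr)
  | seq (p q : RProg)
  | ite (e f : RExpr) (p q : RProg)
  | loop (e f : RExpr) (p : RProg)

/-- Memory after writing `v` to the register `r`. -/
def RState.setReg (m : RState) (r : ℕ) (v : ℤ) : RState where
  reg := Function.update m.reg r v
  mem := m.mem

/-- Memory after writing `v` to the array `A` at the index `j`. -/
def RState.setMem (m : RState) (A j : ℕ) (v : ℤ) : RState where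
  reg := m.reg
  mem := Function.update m.mem A (Function.update (m.mem A) j v)

/-- `RExec W p m t m'`: started in the memory `m`, the program `p` halts after exactly `t`
steps in the memory `m'`, with all words bounded by `W`. -/
inductive RExec (W : ℤ) : RProg → RState → ℕ → RState → Prop
  | skip (m : RState) : RExec W .skip m 1 m
  | assign (r : ℕ) (e : RExpr) (m : RState) (he : e.Fits W m) :
      RExec W (.assign r e) m (e.cost + 1) (m.setReg r (e.eval m))
  | store (A : ℕ) (e f : RExpr) (m : RState) (he : e.Fits W m) (hf : f.Fits W m)
      (hj : 0 ≤ e.eval m) :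
      RExec W (.store A e f) m (e.cost + f.cost + 1) (m.setMem A (e.eval m).toNat (f.eval m))
  | seq (p q : RProg) (m m' m'' : RState) (t t' : ℕ)
      (hp : RExec W p m t m') (hq : RExec W q m' t' m'') :
      RExec W (.seq p q) m (t + t') m''
  | ite_true (e f : RExpr) (p q : RProg) (m m' : RState) (t : ℕ)
      (he : e.Fits W m) (hf : f.Fits W m) (h : e.eval m ≤ f.eval m) (hp : RExec W p m t m') :
      RExec W (.ite e f p q) m (e.cost + f.cost + 1 + t) m'
  | ite_false (e f : RExpr) (p q : RProg) (m m' : RState) (t : ℕ)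
      (he : e.Fits W m) (hf : f.Fits W m) (h : f.eval m < e.eval m) (hq : RExec W q m t m') :
      RExec W (.ite e f p q) m (e.cost + f.cost + 1 + t) m'
  | loop_done (e f : RExpr) (p : RProg) (m : RState)
      (he : e.Fits W m) (hf : f.Fits W m) (h : f.eval m < e.eval m) :
      RExec W (.loop e f p) m (e.cost + f.cost + 1) m
  | loop_step (e f : RExpr) (p : RProg) (m m' m'' : RState) (t t' : ℕ)
      (he : e.Fits W m) (hf : f.Fits W m) (h : e.eval m ≤ f.eval m)
      (hp : RExec W p m t m') (hl : RExec W (.loop e f p) m' t' m'') :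
      RExec W (.loop e f p) m (e.cost + f.cost + 1 + t + t') m''

/-- The memory at the start. Register `0` holds `n` and register `1` holds `d`; array `0` is
the table of the domains (entry `i * (d + 1) + v` is `1` if the value `v` is in the domain of
variable `i`); arrays `1` and `2` are the tables of `S` and `T`. All the rest is `0`. -/
noncomputable def OADInstance.input {n d : ℕ} (I : OADInstance n d) : RState where
  reg := fun r => if r = 0 then (n : ℤ) else if r = 1 then (d : ℤ) else 0
  mem := fun A j =>
    open Classical in
    if A = 0 then
      if ∃ (i : Fin n) (v : ℕ), v ≤ d ∧ (v : ℤ) ∈ I.dom i ∧ j = i * (d + 1) + v then 1 else 0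
    else if A = 1 then
      if ∃ i ∈ I.S, j = (i : ℕ) then 1 else 0
    else if A = 2 then
      if ∃ i ∈ I.T, j = (i : ℕ) then 1 else 0
    else 0

/-- The variables that occur in the decomposition. -/
def DVar.Occurs {n : ℕ} (d : ℕ) : DVar n → Prop
  | .X _ => True
  | .b _ l => l ≤ d
  | .a _ l u => InWindow n d l u
  | .C .st l u => InWindow n d l u ∨ (l = 1 ∧ 1 ≤ u ∧ u ≤ d)
  | .C .s l u => InWindow n d l u
  | .C .t l u => InWindow n d l u

/-- The array in which the minimum of the domain of a variable is returned; the maximum is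
returned in the next array. -/
def DVar.outArray {n : ℕ} : DVar n → ℕ
  | .X _ => 3
  | .b _ _ => 5
  | .a _ _ _ => 7
  | .C .st _ _ => 9
  | .C .s _ _ => 11
  | .C .t _ _ => 13

/-- The index at which the minimum and the maximum are returned. -/
def DVar.outIndex {n : ℕ} (d : ℕ) : DVar n → ℕ
  | .X i => i
  | .b i l => i * (d + 1) + l
  | .a i l u => (i * (d + 1) + l) * (d + 1) + u
  | .C _ l u => l * (d + 1) + u

/-- The memory `m` holds the result of enforcing bound consistency on the decomposition:
register `2` says whether this fails, and if not, the arrays `3, …, 14` hold the minimum and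
the maximum of the resulting domain of each variable. -/
def OADInstance.IsResult {n d : ℕ} (I : OADInstance n d) (m : RState) : Prop :=
  (I.Fails ∧ m.reg 2 = 1) ∨
  (¬ I.Fails ∧ m.reg 2 = 0 ∧
    ∀ x : DVar n, x.Occurs d →
      IsLeast (I.closure x) (m.mem x.outArray (x.outIndex d)) ∧
      IsGreatest (I.closure x) (m.mem (x.outArray + 1) (x.outIndex d)))

/-! ## The example with four variables -/

/-- Domains `[2,3]`, `[2,4]`, `[1,3]`, `[1,2]`; the first three variables must be pairwise
different, and so must the last three. -/
noncomputable def fourVarExample : OADInstance 4 4 where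
  dom := ![Finset.Icc 2 3, Finset.Icc 2 4, Finset.Icc 1 3, Finset.Icc 1 2]
  dom_nonempty := by decide
  dom_subset := by decide
  S := {0, 1, 2}
  T := {1, 2, 3}
  cover := by decide

/-! Bound consistency depends only on the minimum `lo` and the maximum `hi` of each domain. For the
decomposition it is a list of inequalities between these bounds, `OADInstance.Cons`, and `cons_iff`
proves the equivalence constraint by constraint. Enforcing consistency does not fail exactly when
some bounds inside the initial domains satisfy `Cons`.

Part (i). A solution gives one-point domains that satisfy `Cons` (`cons_extend`), so failure
excludes solutions. Conversely, consistent bounds yield a bound support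
(`exists_boundSupport_of_cons`). Let `p v` be the minimum of the counter of `S ∩ T` on `[1, v]`,
with `p 0 = 0`. The pyramid constraints put `p u - p (l - 1)` between the bounds of the counter on
`[l, u]`, and capacity for `l = u` makes the increments `0` or `1`; hence `p` counts a set `Q` of
values. On every interval with fewer than `n` values, `Q` has enough elements for the variables of
`S ∩ T`, and its complement has enough for those of `S \ T` and, separately, of `T \ S`. Replace `Q`
by a feasible set of maximal size. If an interval with at least `n` values had too few elements of
`Q`, more than `|S \ T| + |T \ S|` of its values would lie outside `Q`, each blocked by one of the
two families. But a union of tight intervals is tight, so each family blocks at most as many values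
as it has members (`card_blocked_le`). So `Q` suffices for `S ∩ T` everywhere, and Hall's theorem
for interval domains assigns first the variables of `S ∩ T` inside `Q`, then the two other families
independently (`exists_overlapping_matching`).

Part (ii). Bounds are written in unary, by literals `X ≥ v`, `X < v`, `a = 1`, `a = 0`, `C ≥ y` and
`C ≤ n - y`. The conditions of `Cons` become threshold rules, a fixed number of them at each of `O(n
d ^ 2)` points. A rule is a gate that counts its true inputs and makes consecutive literals true as
the count grows, so propagation follows every edge at most once and takes time linear in the network
(`engineProg_exec`). Every derived literal is correct for all consistent bounds
(`IsBounds.rulesPreserve`); conversely, a closed set of literals without contradiction defines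
consistent bounds (`RulesClosed.isBounds`). So the derived bounds are those of the closure, and a
contradiction is derived exactly on failure. One kind of rule is not monotone: when the maximum of a
counter is exhausted, a variable `a` becomes `0` unless `a = 1` has been derived. It is sound
because only sets are considered in which each literal is an output supported by the set itself.

Part (iii) is a finite check of explicit consistent bounds in which no domain of an `X` shrinks. -/

/-! ## Bounds of domains and bound consistency -/

/-- `lo x` and `hi x` are the least and the greatest element of `E x`. -/
def HasBounds {V : Type} (E : V → Set ℤ) (lo hi : V → ℤ) : Prop :=
  ∀ x, IsLeast (E x) (lo x) ∧ IsGreatest (E x) (hi x)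

theorem HasBounds.le {V : Type} {E : V → Set ℤ} {lo hi : V → ℤ} (h : HasBounds E lo hi) (x : V) :
    lo x ≤ hi x :=
  (h x).1.2 (h x).2.1

theorem HasBounds.mem_boundHull {V : Type} {E : V → Set ℤ} {lo hi : V → ℤ}
    (h : HasBounds E lo hi) (x : V) (v : ℤ) : v ∈ boundHull (E x) ↔ lo x ≤ v ∧ v ≤ hi x := by
  constructor
  · rintro ⟨p, hp, q, hq, h1, h2⟩
    exact ⟨((h x).1.2 hp).trans h1, h2.trans ((h x).2.2 hq)⟩
  · rintro ⟨h1, h2⟩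
    exact ⟨lo x, (h x).1.1, hi x, (h x).2.1, h1, h2⟩

theorem exists_hasBounds {V : Type} {E D : V → Set ℤ} (hED : ∀ x, E x ⊆ D x)
    (hD : ∀ x, (D x).Finite) (hE : ∀ x, (E x).Nonempty) : ∃ lo hi, HasBounds E lo hi := by
  have h : ∀ x, ∃ p q, IsLeast (E x) p ∧ IsGreatest (E x) q := fun x => by
    have hf := (hD x).subset (hED x)
    obtain ⟨p, hp⟩ := hf.exists_minimal (hE x)
    obtain ⟨q, hq⟩ := hf.exists_maximal (hE x)
    exact ⟨p, q, ⟨hp.1, fun y hy => by rcases le_total p y with h | h; exacts [h, hp.2 hy h]⟩,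
      ⟨hq.1, fun y hy => by rcases le_total y q with h | h; exacts [h, hq.2 hy h]⟩⟩
  choose lo hi h1 using h
  exact ⟨lo, hi, h1⟩

/-- Bound consistency, in terms of the bounds of the domains. -/
def Constr.BCBounds {V : Type} (c : Constr V) (lo hi : V → ℤ) : Prop :=
  ∀ x ∈ c.scope, ∀ v, (v = lo x ∨ v = hi x) →
    ∃ σ : V → ℤ, σ x = v ∧ c.holds σ ∧ ∀ y ∈ c.scope, lo y ≤ σ y ∧ σ y ≤ hi y

theorem HasBounds.boundConsistent_iff {V : Type} {E : V → Set ℤ} {lo hi : V → ℤ}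
    (h : HasBounds E lo hi) (c : Constr V) : c.BoundConsistent E ↔ c.BCBounds lo hi := by
  have h1 : ∀ x v, (IsLeast (E x) v ∨ IsGreatest (E x) v) ↔ (v = lo x ∨ v = hi x) := by
    intro x v
    constructor
    · rintro (h1 | h1)
      · exact Or.inl (h1.unique (h x).1)
      · exact Or.inr (h1.unique (h x).2)
    · rintro (rfl | rfl)
      exacts [Or.inl (h x).1, Or.inr (h x).2]
  unfold Constr.BoundConsistent Constr.BCBounds Constr.IsBoundSupport
  simp only [h1, h.mem_boundHull]

theorem bcClosure_subset {V : Type} (Γ : Set (Constr V)) (D : V → Set ℤ) (x : V) :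
    bcClosure Γ D x ⊆ D x := by
  rintro v ⟨E, hE, -, hv⟩
  exact hE x hv

theorem subset_bcClosure {V : Type} {Γ : Set (Constr V)} {D E : V → Set ℤ} (h : ∀ y, E y ⊆ D y)
    (hE : ∀ c ∈ Γ, c.BoundConsistent E) (x : V) : E x ⊆ bcClosure Γ D x :=
  fun _ hv => ⟨E, h, hE, hv⟩

theorem boundHull_mono {E F : Set ℤ} (h : E ⊆ F) : boundHull E ⊆ boundHull F := by
  rintro v ⟨p, hp, q, hq, h1, h2⟩
  exact ⟨p, h hp, q, h hq, h1, h2⟩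

/-- A bound of the closure belongs to some consistent subdomain `E`, and is a bound of `E` too
because `E` lies inside the closure. Its support in `E` remains one in the larger hulls. -/
theorem bcClosure_boundConsistent {V : Type} (Γ : Set (Constr V)) (D : V → Set ℤ) :
    ∀ c ∈ Γ, c.BoundConsistent (bcClosure Γ D) := by
  intro c hc x hx v hv
  have hmem : v ∈ bcClosure Γ D x := by rcases hv with h | h <;> exact h.1
  obtain ⟨E, hED, hE, hvE⟩ := hmem
  have hsub := subset_bcClosure hED hE
  have hv' : IsLeast (E x) v ∨ IsGreatest (E x) v := by
    rcases hv with h | h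
    · exact Or.inl ⟨hvE, fun y hy => h.2 (hsub x hy)⟩
    · exact Or.inr ⟨hvE, fun y hy => h.2 (hsub x hy)⟩
  obtain ⟨σ, h1, h2, h3⟩ := hE c hc x hx v hv'
  exact ⟨σ, h1, h2, fun y hy => boundHull_mono (hsub y) (h3 y hy)⟩

/-! ## Bound consistency of the constraints of the decomposition -/

/-- Discrete intermediate values: the new summand takes its minimum unless the others cannot absorb
the rest, in which case they take their maxima. -/
theorem exists_sum_eq_of_le {ι : Type*} (K : Finset ι) (f g : ι → ℤ) (hfg : ∀ i ∈ K, f i ≤ g i)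
    (c : ℤ) (h1 : ∑ i ∈ K, f i ≤ c) (h2 : c ≤ ∑ i ∈ K, g i) :
    ∃ s : ι → ℤ, (∀ i ∈ K, f i ≤ s i ∧ s i ≤ g i) ∧ ∑ i ∈ K, s i = c := by
  classical
  induction K using Finset.induction_on generalizing c with
  | empty =>
    simp only [Finset.sum_empty] at h1 h2 ⊢
    exact ⟨f, by simp, by omega⟩
  | insert a K ha ih =>
    rw [Finset.sum_insert ha] at h1 h2
    have hle : ∑ i ∈ K, f i ≤ ∑ i ∈ K, g i :=
      Finset.sum_le_sum fun i hi => hfg i (Finset.mem_insert_of_mem hi)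
    have ha' := hfg a (Finset.mem_insert_self a K)
    obtain ⟨x, hx1, hx2, hx3, hx4⟩ : ∃ x, f a ≤ x ∧ x ≤ g a ∧ ∑ i ∈ K, f i ≤ c - x ∧
        c - x ≤ ∑ i ∈ K, g i := by
      rcases le_total (c - f a) (∑ i ∈ K, g i) with h | h
      · exact ⟨f a, le_refl _, ha', by omega, h⟩
      · exact ⟨c - ∑ i ∈ K, g i, by omega, by omega, by omega, by omega⟩
    obtain ⟨s, hs, hsum⟩ := ih (fun i hi => hfg i (Finset.mem_insert_of_mem hi)) (c - x) hx3 hx4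
    refine ⟨Function.update s a x, ?_, ?_⟩
    · intro i hi
      by_cases hia : i = a
      · subst hia; simp [hx1, hx2]
      · rw [Function.update_of_ne hia]
        exact hs i ((Finset.mem_insert.1 hi).resolve_left hia)
    · rw [Finset.sum_insert ha, Function.update_self, Finset.sum_congr rfl
        (fun i hi => Function.update_of_ne (ne_of_mem_of_not_mem hi ha) x s), hsum]
      omega

section Local

variable {n : ℕ} {lo hi : DVar n → ℤ}

/-- A support is determined by the pair of values `(β, ξ)`, so both directions are linear arithmetic
in the bounds: `key` extracts such pairs from consistency, and `mk` turns a pair into an assignment.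
The scheme recurs for the other constraints. -/
theorem cBool_bcBounds_iff (hle : ∀ x, lo x ≤ hi x) (i : Fin n) (l : ℕ)
    (h0 : 0 ≤ lo (.b i l)) (h1 : hi (.b i l) ≤ 1) :
    (cBool i l).BCBounds lo hi ↔ (lo (.b i l) = 1 ↔ hi (.X i) ≤ l) ∧
      (hi (.b i l) = 0 ↔ (l : ℤ) < lo (.X i)) := by
  have hb := hle (.b i l)
  have hX := hle (.X i)
  constructor
  · intro h
    have key : ∀ x ∈ (cBool i l).scope, ∀ v, (v = lo x ∨ v = hi x) → ∃ β ξ : ℤ,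
        (β = 1 ↔ ξ ≤ l) ∧ lo (.b i l) ≤ β ∧ β ≤ hi (.b i l) ∧ lo (.X i) ≤ ξ ∧ ξ ≤ hi (.X i) ∧
        (x = .b i l → β = v) ∧ (x = .X i → ξ = v) := by
      intro x hx v hv
      obtain ⟨σ, h2, h3, h4⟩ := h x hx v hv
      have h5 := h4 (.b i l) (by simp [cBool])
      have h6 := h4 (.X i) (by simp [cBool])
      exact ⟨σ (.b i l), σ (.X i), h3, h5.1, h5.2, h6.1, h6.2, fun h => h ▸ h2, fun h => h ▸ h2⟩
    obtain ⟨β1, ξ1, p1⟩ := key (.b i l) (by simp [cBool]) _ (Or.inl rfl)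
    obtain ⟨β2, ξ2, p2⟩ := key (.b i l) (by simp [cBool]) _ (Or.inr rfl)
    obtain ⟨β3, ξ3, p3⟩ := key (.X i) (by simp [cBool]) _ (Or.inl rfl)
    obtain ⟨β4, ξ4, p4⟩ := key (.X i) (by simp [cBool]) _ (Or.inr rfl)
    simp only [forall_const, reduceCtorEq, false_imp_iff, and_true, true_and] at p1 p2 p3 p4
    omega
  · rintro ⟨ha, hc⟩
    have mk : ∀ β ξ : ℤ, (β = 1 ↔ ξ ≤ l) → lo (.b i l) ≤ β → β ≤ hi (.b i l) →
        lo (.X i) ≤ ξ → ξ ≤ hi (.X i) → ∀ x ∈ (cBool i l).scope, ∀ v,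
        (x = .b i l → β = v) → (x = .X i → ξ = v) →
        ∃ σ : DVar n → ℤ, σ x = v ∧ (cBool i l).holds σ ∧
          ∀ y ∈ (cBool i l).scope, lo y ≤ σ y ∧ σ y ≤ hi y := by
      intro β ξ h1 h2 h3 h4 h5 x hx v h6 h7
      refine ⟨fun y => match y with | .b _ _ => β | .X _ => ξ | _ => 0, ?_, h1, ?_⟩
      · rcases hx with rfl | rfl
        exacts [h6 rfl, h7 rfl]
      · rintro y (rfl | rfl)
        exacts [⟨h2, h3⟩, ⟨h4, h5⟩]
    intro x hx v hv
    have hx' := hx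
    rcases hx' with rfl | rfl
    · obtain ⟨ξ, e1, e2, e3⟩ : ∃ ξ : ℤ, (v = 1 ↔ ξ ≤ l) ∧ lo (.X i) ≤ ξ ∧ ξ ≤ hi (.X i) := by
        by_cases h : v = 1
        · exact ⟨lo (.X i), by omega, le_refl _, hX⟩
        · exact ⟨hi (.X i), by omega, hX, le_refl _⟩
      exact mk v ξ e1 (by omega) (by omega) e2 e3 _ hx v (fun _ => rfl) (by simp)
    · by_cases h : v ≤ l
      · exact mk 1 v (by omega) (by omega) (by omega) (by omega) (by omega) _ hx v (by simp)
          (fun _ => rfl)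
      · exact mk 0 v (by omega) (by omega) (by omega) (by omega) (by omega) _ hx v (by simp)
          (fun _ => rfl)

/-- When `a` is fixed to `0`, a value is pruned from one of the Booleans `b` only if the other one
already forces its half of the conjunction; hence the two nested implications. The bounds `1 ≤ l ≤
u` make `l - 1` and `u` different, so the two Booleans are different variables. -/
theorem cInterval_bcBounds_iff (hle : ∀ x, lo x ≤ hi x) (i : Fin n) (l u : ℕ) (hl : 1 ≤ l)
    (hlu : l ≤ u) (hr : ∀ x ∈ (cInterval i l u).scope, 0 ≤ lo x ∧ hi x ≤ 1) :
    (cInterval i l u).BCBounds lo hi ↔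
      (lo (.a i l u) = 1 ↔ hi (.b i (l - 1)) = 0 ∧ lo (.b i u) = 1) ∧
      (hi (.a i l u) = 0 → (hi (.b i (l - 1)) = 0 → hi (.b i u) = 0) ∧
        (lo (.b i u) = 1 → lo (.b i (l - 1)) = 1)) ∧
      (lo (.b i (l - 1)) = 1 → hi (.a i l u) = 0) ∧ (hi (.b i u) = 0 → hi (.a i l u) = 0) := by
  have ha := hle (.a i l u)
  have hp := hle (.b i (l - 1))
  have hq := hle (.b i u)
  have ra := hr (.a i l u) (by simp [cInterval])
  have rp := hr (.b i (l - 1)) (by simp [cInterval])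
  have rq := hr (.b i u) (by simp [cInterval])
  have hne : l - 1 ≠ u := by omega
  constructor
  · intro h
    have key : ∀ x ∈ (cInterval i l u).scope, ∀ v, (v = lo x ∨ v = hi x) → ∃ α p q : ℤ,
        (α = 1 ↔ p = 0 ∧ q = 1) ∧ lo (.a i l u) ≤ α ∧ α ≤ hi (.a i l u) ∧
        lo (.b i (l - 1)) ≤ p ∧ p ≤ hi (.b i (l - 1)) ∧ lo (.b i u) ≤ q ∧ q ≤ hi (.b i u) ∧
        (x = .a i l u → α = v) ∧ (x = .b i (l - 1) → p = v) ∧ (x = .b i u → q = v) := by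
      intro x hx v hv
      obtain ⟨σ, h2, h3, h4⟩ := h x hx v hv
      have h5 := h4 (.a i l u) (by simp [cInterval])
      have h6 := h4 (.b i (l - 1)) (by simp [cInterval])
      have h7 := h4 (.b i u) (by simp [cInterval])
      exact ⟨σ (.a i l u), σ (.b i (l - 1)), σ (.b i u), h3, h5.1, h5.2, h6.1, h6.2, h7.1, h7.2,
        fun h => h ▸ h2, fun h => h ▸ h2, fun h => h ▸ h2⟩
    obtain ⟨α1, p1, q1, e1⟩ := key (.a i l u) (by simp [cInterval]) _ (Or.inl rfl)
    obtain ⟨α2, p2, q2, e2⟩ := key (.a i l u) (by simp [cInterval]) _ (Or.inr rfl)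
    obtain ⟨α3, p3, q3, e3⟩ := key (.b i (l - 1)) (by simp [cInterval]) _ (Or.inl rfl)
    obtain ⟨α4, p4, q4, e4⟩ := key (.b i (l - 1)) (by simp [cInterval]) _ (Or.inr rfl)
    obtain ⟨α5, p5, q5, e5⟩ := key (.b i u) (by simp [cInterval]) _ (Or.inl rfl)
    obtain ⟨α6, p6, q6, e6⟩ := key (.b i u) (by simp [cInterval]) _ (Or.inr rfl)
    simp only [forall_const, reduceCtorEq, false_imp_iff, and_true, true_and, DVar.b.injEq, hne,
      hne.symm] at e1 e2 e3 e4 e5 e6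
    omega
  · intro h
    have mk : ∀ α p q : ℤ, (α = 1 ↔ p = 0 ∧ q = 1) → lo (.a i l u) ≤ α → α ≤ hi (.a i l u) →
        lo (.b i (l - 1)) ≤ p → p ≤ hi (.b i (l - 1)) → lo (.b i u) ≤ q → q ≤ hi (.b i u) →
        ∀ x ∈ (cInterval i l u).scope, ∀ v,
        (x = .a i l u → α = v) → (x = .b i (l - 1) → p = v) → (x = .b i u → q = v) →
        ∃ σ : DVar n → ℤ, σ x = v ∧ (cInterval i l u).holds σ ∧
          ∀ y ∈ (cInterval i l u).scope, lo y ≤ σ y ∧ σ y ≤ hi y := by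
      intro α p q h1 h2 h3 h4 h5 h6 h7 x hx v h8 h9 h10
      refine ⟨fun y => match y with | .a _ _ _ => α | .b _ m => if m = u then q else p | _ => 0,
        ?_, ?_, ?_⟩
      · rcases hx with rfl | rfl | rfl
        · exact h8 rfl
        · simpa [hne] using h9 rfl
        · simpa using h10 rfl
      · simpa [cInterval, hne] using h1
      · rintro y (rfl | rfl | rfl)
        · exact ⟨h2, h3⟩
        · simpa [hne] using ⟨h4, h5⟩
        · simpa using ⟨h6, h7⟩
    intro x hx v hv
    have hx' := hx
    rcases hx' with rfl | rfl | rfl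
    · by_cases h1 : v = 1
      · exact mk v 0 1 (by omega) (by omega) (by omega) (by omega) (by omega) (by omega)
          (by omega) _ hx v (fun _ => rfl) (by simp) (by simp)
      · by_cases h2 : hi (.b i (l - 1)) = 1
        · exact mk v 1 (lo (.b i u)) (by omega) (by omega) (by omega) (by omega) (by omega)
            (by omega) (by omega) _ hx v (fun _ => rfl) (by simp) (by simp)
        · exact mk v 0 0 (by omega) (by omega) (by omega) (by omega) (by omega) (by omega)
            (by omega) _ hx v (fun _ => rfl) (by simp) (by simp)
    · by_cases h1 : v = 1
      · exact mk 0 v (lo (.b i u)) (by omega) (by omega) (by omega) (by omega) (by omega)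
          (by omega) (by omega) _ hx v (by simp) (fun _ => rfl)
              (fun h => absurd (by simpa using h) hne)
      · by_cases h2 : hi (.a i l u) = 0 ∨ hi (.b i u) = 0
        · exact mk 0 v 0 (by omega) (by omega) (by omega) (by omega) (by omega)
            (by omega) (by omega) _ hx v (by simp) (fun _ => rfl)
                (fun h => absurd (by simpa using h) hne)
        · exact mk 1 v 1 (by omega) (by omega) (by omega) (by omega) (by omega)
            (by omega) (by omega) _ hx v (by simp) (fun _ => rfl)
                (fun h => absurd (by simpa using h) hne)
    · by_cases h1 : v = 0
      · exact mk 0 (hi (.b i (l - 1))) v (by omega) (by omega) (by omega) (by omega) (by omega)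
          (by omega) (by omega) _ hx v (by simp) (fun h => absurd (by simpa using h) hne.symm)
              (fun _ => rfl)
      · by_cases h2 : hi (.a i l u) = 0 ∨ lo (.b i (l - 1)) = 1
        · exact mk 0 1 v (by omega) (by omega) (by omega) (by omega) (by omega)
            (by omega) (by omega) _ hx v (by simp) (fun h => absurd (by simpa using h) hne.symm)
                (fun _ => rfl)
        · exact mk 1 0 v (by omega) (by omega) (by omega) (by omega) (by omega)
            (by omega) (by omega) _ hx v (by simp) (fun h => absurd (by simpa using h) hne.symm)
                (fun _ => rfl)

/-- As `a` has at most two values, moving it from its minimum to its maximum adds at most one to the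
sum. An `a` that is not fixed has no support for its maximum exactly when the minima already sum up
to the maximum of the counter; dually for its minimum. -/
theorem cCount_bcBounds_iff {d : ℕ} (I : OADInstance n d) (hle : ∀ x, lo x ≤ hi x) (k : CKind)
    (l u : ℕ) (hr : ∀ i, hi (.a i l u) ≤ lo (.a i l u) + 1) :
    (I.cCount k l u).BCBounds lo hi ↔
      ∑ i ∈ I.counted k, lo (.a i l u) ≤ lo (.C k l u) ∧
      hi (.C k l u) ≤ ∑ i ∈ I.counted k, hi (.a i l u) ∧
      (hi (.C k l u) ≤ ∑ i ∈ I.counted k, lo (.a i l u) →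
        ∀ i ∈ I.counted k, hi (.a i l u) = lo (.a i l u)) ∧
      (∑ i ∈ I.counted k, hi (.a i l u) ≤ lo (.C k l u) →
        ∀ i ∈ I.counted k, hi (.a i l u) = lo (.a i l u)) := by
  have hC := hle (.C k l u)
  have hmemC : DVar.C k l u ∈ (I.cCount k l u).scope := by simp [OADInstance.cCount]
  have hmema : ∀ i ∈ I.counted k, DVar.a i l u ∈ (I.cCount k l u).scope := fun i hi => by
    simp [OADInstance.cCount, hi]
  constructor
  · intro h
    have key : ∀ x ∈ (I.cCount k l u).scope, ∀ v, (v = lo x ∨ v = hi x) → ∃ (c : ℤ) (s : Fin n → ℤ),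
        c = ∑ i ∈ I.counted k, s i ∧ lo (.C k l u) ≤ c ∧ c ≤ hi (.C k l u) ∧
        (∀ i ∈ I.counted k, lo (.a i l u) ≤ s i) ∧ (∀ i ∈ I.counted k, s i ≤ hi (.a i l u)) ∧
        (x = .C k l u → c = v) ∧ (∀ i, x = .a i l u → s i = v) := by
      intro x hx v hv
      obtain ⟨σ, h2, h3, h4⟩ := h x hx v hv
      exact ⟨σ (.C k l u), fun i => σ (.a i l u), h3, (h4 _ hmemC).1, (h4 _ hmemC).2,
        fun i hi => (h4 _ (hmema i hi)).1, fun i hi => (h4 _ (hmema i hi)).2,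
        fun h => h ▸ h2, fun i h => by subst h; exact h2⟩
    refine ⟨?_, ?_, ?_, ?_⟩
    · obtain ⟨c, s, e1, e2, e3, e4, e5, e6, e7⟩ := key _ hmemC _ (Or.inl rfl)
      rw [← e6 rfl, e1]
      exact Finset.sum_le_sum e4
    · obtain ⟨c, s, e1, e2, e3, e4, e5, e6, e7⟩ := key _ hmemC _ (Or.inr rfl)
      rw [← e6 rfl, e1]
      exact Finset.sum_le_sum e5
    · intro h1 i hik
      obtain ⟨c, s, e1, e2, e3, e4, e5, e6, e7⟩ := key _ (hmema i hik) _ (Or.inr rfl)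
      by_contra hne
      have : ∑ i ∈ I.counted k, lo (.a i l u) < ∑ i ∈ I.counted k, s i :=
        Finset.sum_lt_sum e4 ⟨i, hik, by have := e7 i rfl; have := hle (.a i l u); omega⟩
      omega
    · intro h1 i hik
      obtain ⟨c, s, e1, e2, e3, e4, e5, e6, e7⟩ := key _ (hmema i hik) _ (Or.inl rfl)
      by_contra hne
      have : ∑ i ∈ I.counted k, s i < ∑ i ∈ I.counted k, hi (.a i l u) :=
        Finset.sum_lt_sum e5 ⟨i, hik, by have := e7 i rfl; have := hle (.a i l u); omega⟩
      omega
  · rintro ⟨h1, h2, h3, h4⟩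
    have mk : ∀ (c : ℤ) (s : Fin n → ℤ), c = ∑ i ∈ I.counted k, s i → lo (.C k l u) ≤ c →
        c ≤ hi (.C k l u) → (∀ i ∈ I.counted k, lo (.a i l u) ≤ s i ∧ s i ≤ hi (.a i l u)) →
        ∀ x ∈ (I.cCount k l u).scope, ∀ v,
        (x = .C k l u → c = v) → (∀ i ∈ I.counted k, x = .a i l u → s i = v) →
        ∃ σ : DVar n → ℤ, σ x = v ∧ (I.cCount k l u).holds σ ∧
          ∀ y ∈ (I.cCount k l u).scope, lo y ≤ σ y ∧ σ y ≤ hi y := by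
      intro c s e1 e2 e3 e4 x hx v e5 e6
      refine ⟨fun y => match y with | .C _ _ _ => c | .a i _ _ => s i | _ => 0, ?_, e1, ?_⟩
      · rcases hx with rfl | ⟨i, hi, rfl⟩
        exacts [e5 rfl, e6 i hi rfl]
      · rintro y (rfl | ⟨i, hi, rfl⟩)
        exacts [⟨e2, e3⟩, e4 i hi]
    intro x hx v hv
    have hx' := hx
    rcases hx' with rfl | ⟨i, hik, rfl⟩
    · obtain ⟨s, hs, hsum⟩ := exists_sum_eq_of_le (I.counted k) (fun i => lo (.a i l u))
        (fun i => hi (.a i l u)) (fun i _ => hle _) v (by omega) (by omega)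
      exact mk v s hsum.symm (by omega) (by omega) hs _ hx v (fun _ => rfl) (by simp)
    · have hi' := hr i
      have hai := hle (.a i l u)
      have hv1 : lo (.a i l u) ≤ v ∧ v ≤ hi (.a i l u) := by omega
      have upd : ∀ f : Fin n → ℤ, ∑ j ∈ I.counted k, Function.update f i v j =
          ∑ j ∈ I.counted k, f j - f i + v := by
        intro f
        rw [Finset.sum_update_of_mem hik, ← Finset.add_sum_erase _ f hik, Finset.erase_eq]
        ring
      have hupd := upd fun j => lo (.a j l u)
      have hupd' := upd fun j => hi (.a j l u)
      have hsum : ∑ j ∈ I.counted k, lo (.a j l u) ≤ ∑ j ∈ I.counted k, hi (.a j l u) :=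
        Finset.sum_le_sum fun j _ => hle _
      have h3' := fun h => h3 h i hik
      have h4' := fun h => h4 h i hik
      -- With `a i` fixed to `v`, the sum takes all values between the two updated sums. This range
      -- has to meet the range of the counter; the larger of the two lower ends is a common point.
      obtain ⟨c, c1, c2, c3, c4⟩ : ∃ c, lo (.C k l u) ≤ c ∧ c ≤ hi (.C k l u) ∧
          ∑ j ∈ I.counted k, Function.update (fun j => lo (.a j l u)) i v j ≤ c ∧
          c ≤ ∑ j ∈ I.counted k, Function.update (fun j => hi (.a j l u)) i v j := by
        rw [hupd, hupd']
        refine ⟨max (lo (.C k l u)) (∑ j ∈ I.counted k, lo (.a j l u) - lo (.a i l u) + v),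
          by omega, ?_, by omega, ?_⟩
        · by_cases h : hi (.C k l u) ≤ ∑ i ∈ I.counted k, lo (.a i l u)
          · have := h3' h; omega
          · omega
        · by_cases h : ∑ i ∈ I.counted k, hi (.a i l u) ≤ lo (.C k l u)
          · have := h4' h; omega
          · omega
      obtain ⟨s, hs, hsum⟩ := exists_sum_eq_of_le (I.counted k) _ _ (fun j _ => by
        by_cases hj : j = i
        · subst hj; simp
        · simp only [Function.update_of_ne hj]; exact hle _) c c3 c4
      refine mk c s hsum.symm c1 c2 (fun j hj => ?_) _ hx v (by simp) (fun j hj e => ?_)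
      · have := hs j hj
        by_cases hji : j = i
        · subst hji; simp only [Function.update_self] at this; omega
        · simpa only [Function.update_of_ne hji] using this
      · obtain rfl : i = j := by simpa using e
        have := hs i hj
        simp only [Function.update_self] at this
        omega

/-- Each bound of one variable must be attainable by the ranges of the two others, and these ranges
are intervals. The hypotheses `1 ≤ l < u` keep the three counters distinct. -/
theorem cPyramid_bcBounds_iff (hle : ∀ x, lo x ≤ hi x) (l u : ℕ) (hl : 1 ≤ l) (hlu : l < u) :
    (cPyramid l u).BCBounds lo hi ↔
      lo (.C .st 1 l) + lo (.C .st (l + 1) u) ≤ lo (.C .st 1 u) ∧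
      lo (.C .st 1 u) - hi (.C .st (l + 1) u) ≤ lo (.C .st 1 l) ∧
      lo (.C .st 1 u) - hi (.C .st 1 l) ≤ lo (.C .st (l + 1) u) ∧
      hi (.C .st 1 u) ≤ hi (.C .st 1 l) + hi (.C .st (l + 1) u) ∧
      hi (.C .st 1 l) ≤ hi (.C .st 1 u) - lo (.C .st (l + 1) u) ∧
      hi (.C .st (l + 1) u) ≤ hi (.C .st 1 u) - lo (.C .st 1 l) := by
  have hx := hle (.C .st 1 u)
  have hy := hle (.C .st 1 l)
  have hz := hle (.C .st (l + 1) u)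
  have hl0 : l ≠ 0 := by omega
  have hlu' : l ≠ u := by omega
  constructor
  · intro h
    have key : ∀ w ∈ (cPyramid l u : Constr (DVar n)).scope, ∀ v, (v = lo w ∨ v = hi w) →
        ∃ x y z : ℤ, x = y + z ∧
        lo (.C .st 1 u) ≤ x ∧ x ≤ hi (.C .st 1 u) ∧ lo (.C .st 1 l) ≤ y ∧ y ≤ hi (.C .st 1 l) ∧
        lo (.C .st (l + 1) u) ≤ z ∧ z ≤ hi (.C .st (l + 1) u) ∧
        (w = .C .st 1 u → x = v) ∧ (w = .C .st 1 l → y = v) ∧ (w = .C .st (l + 1) u → z = v) := by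
      intro w hw v hv
      obtain ⟨σ, h2, h3, h4⟩ := h w hw v hv
      have h5 := h4 (.C .st 1 u) (by simp [cPyramid])
      have h6 := h4 (.C .st 1 l) (by simp [cPyramid])
      have h7 := h4 (.C .st (l + 1) u) (by simp [cPyramid])
      exact ⟨_, _, _, h3, h5.1, h5.2, h6.1, h6.2, h7.1, h7.2,
        fun h => h ▸ h2, fun h => h ▸ h2, fun h => h ▸ h2⟩
    obtain ⟨x1, y1, z1, e1⟩ := key (.C .st 1 u) (by simp [cPyramid]) _ (Or.inl rfl)
    obtain ⟨x2, y2, z2, e2⟩ := key (.C .st 1 u) (by simp [cPyramid]) _ (Or.inr rfl)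
    obtain ⟨x3, y3, z3, e3⟩ := key (.C .st 1 l) (by simp [cPyramid]) _ (Or.inl rfl)
    obtain ⟨x4, y4, z4, e4⟩ := key (.C .st 1 l) (by simp [cPyramid]) _ (Or.inr rfl)
    obtain ⟨x5, y5, z5, e5⟩ := key (.C .st (l + 1) u) (by simp [cPyramid]) _ (Or.inl rfl)
    obtain ⟨x6, y6, z6, e6⟩ := key (.C .st (l + 1) u) (by simp [cPyramid]) _ (Or.inr rfl)
    have f1 := e1.2.2.2.2.2.2.2.1 rfl
    have f2 := e2.2.2.2.2.2.2.2.1 rfl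
    have f3 := e3.2.2.2.2.2.2.2.2.1 rfl
    have f4 := e4.2.2.2.2.2.2.2.2.1 rfl
    have f5 := e5.2.2.2.2.2.2.2.2.2 rfl
    have f6 := e6.2.2.2.2.2.2.2.2.2 rfl
    omega
  · intro h
    have mk : ∀ x y z : ℤ, x = y + z →
        lo (.C .st 1 u) ≤ x → x ≤ hi (.C .st 1 u) → lo (.C .st 1 l) ≤ y → y ≤ hi (.C .st 1 l) →
        lo (.C .st (l + 1) u) ≤ z → z ≤ hi (.C .st (l + 1) u) →
        ∀ w ∈ (cPyramid l u : Constr (DVar n)).scope, ∀ v,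
        (w = .C .st 1 u → x = v) → (w = .C .st 1 l → y = v) → (w = .C .st (l + 1) u → z = v) →
        ∃ σ : DVar n → ℤ, σ w = v ∧ (cPyramid l u).holds σ ∧
          ∀ y ∈ (cPyramid l u : Constr (DVar n)).scope, lo y ≤ σ y ∧ σ y ≤ hi y := by
      intro x y z h1 h2 h3 h4 h5 h6 h7 w hw v h8 h9 h10
      refine ⟨fun w => match w with
        | .C _ l' u' => if l' = l + 1 then z else if u' = u then x else y | _ => 0, ?_, ?_, ?_⟩
      · rcases hw with rfl | rfl | rfl
        · simpa [hl0] using h8 rfl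
        · simpa [hl0, hlu'] using h9 rfl
        · simpa using h10 rfl
      · simpa [cPyramid, hl0, hlu'] using h1
      · rintro y (rfl | rfl | rfl)
        · simpa [hl0] using ⟨h2, h3⟩
        · simpa [hl0, hlu'] using ⟨h4, h5⟩
        · simpa using ⟨h6, h7⟩
    intro w hw v hv
    have hw' := hw
    have hsu : ∀ b c : ℕ, DVar.C (n := n) .st (l + 1) b ≠ .C .st 1 c := by
      intro b c; simp [hl0]
    have hul : DVar.C (n := n) .st 1 u ≠ .C .st 1 l := by simp [hlu'.symm]
    rcases hw' with rfl | rfl | rfl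
    · obtain ⟨y, h1, h2, h3, h4⟩ : ∃ y, lo (.C .st 1 l) ≤ y ∧ y ≤ hi (.C .st 1 l) ∧
          lo (.C .st (l + 1) u) ≤ v - y ∧ v - y ≤ hi (.C .st (l + 1) u) :=
        ⟨max (lo (.C .st 1 l)) (v - hi (.C .st (l + 1) u)), by omega, by omega, by omega, by omega⟩
      exact mk v y (v - y) (by omega) (by omega) (by omega) h1 h2 h3 h4 _ hw v (fun _ => rfl)
        (fun h => absurd h hul) (fun h => absurd h.symm (hsu _ _))
    · obtain ⟨x, h1, h2, h3, h4⟩ : ∃ x, lo (.C .st 1 u) ≤ x ∧ x ≤ hi (.C .st 1 u) ∧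
          lo (.C .st (l + 1) u) ≤ x - v ∧ x - v ≤ hi (.C .st (l + 1) u) :=
        ⟨max (lo (.C .st 1 u)) (v + lo (.C .st (l + 1) u)), by omega, by omega, by omega, by omega⟩
      exact mk x v (x - v) (by omega) h1 h2 (by omega) (by omega) h3 h4 _ hw v
        (fun h => absurd h.symm hul) (fun _ => rfl) (fun h => absurd h.symm (hsu _ _))
    · obtain ⟨x, h1, h2, h3, h4⟩ : ∃ x, lo (.C .st 1 u) ≤ x ∧ x ≤ hi (.C .st 1 u) ∧
          lo (.C .st 1 l) ≤ x - v ∧ x - v ≤ hi (.C .st 1 l) :=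
        ⟨max (lo (.C .st 1 u)) (v + lo (.C .st 1 l)), by omega, by omega, by omega, by omega⟩
      exact mk x (x - v) v (by omega) h1 h2 h3 h4 (by omega) (by omega) _ hw v
        (fun h => absurd h (hsu _ _)) (fun h => absurd h (hsu _ _)) (fun _ => rfl)

/-- Lowering a variable never violates the constraint, so only the maxima matter, each tested
against the minimum of the other variable. -/
theorem cCapacity_bcBounds_iff (hle : ∀ x, lo x ≤ hi x) (k : CKind) (hk : k ≠ .st) (l u : ℕ) :
    (cCapacity k l u).BCBounds lo hi ↔
      hi (.C .st l u) + lo (.C k l u) ≤ (u : ℤ) - l + 1 ∧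
      lo (.C .st l u) + hi (.C k l u) ≤ (u : ℤ) - l + 1 := by
  have hx := hle (.C .st l u)
  have hy := hle (.C k l u)
  constructor
  · intro h
    obtain ⟨σ, h2, h3, h4⟩ := h (.C .st l u) (by simp [cCapacity]) _ (Or.inr rfl)
    obtain ⟨τ, k2, k3, k4⟩ := h (.C k l u) (by simp [cCapacity]) _ (Or.inr rfl)
    have h5 := h4 (.C k l u) (by simp [cCapacity])
    have k5 := k4 (.C .st l u) (by simp [cCapacity])
    simp only [cCapacity] at h3 k3
    omega
  · intro h w hw v hv
    have mk : ∀ x y : ℤ, x + y ≤ (u : ℤ) - l + 1 →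
        lo (.C .st l u) ≤ x → x ≤ hi (.C .st l u) → lo (.C k l u) ≤ y → y ≤ hi (.C k l u) →
        (w = .C .st l u → x = v) → (w = .C k l u → y = v) →
        ∃ σ : DVar n → ℤ, σ w = v ∧ (cCapacity k l u).holds σ ∧
          ∀ y ∈ (cCapacity k l u : Constr (DVar n)).scope, lo y ≤ σ y ∧ σ y ≤ hi y := by
      intro x y h1 h2 h3 h4 h5 h6 h7
      refine ⟨fun w => match w with | .C .st _ _ => x | .C _ _ _ => y | _ => 0, ?_⟩
      cases k with
      | st => exact absurd rfl hk
      | s | t =>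
        refine ⟨?_, h1, ?_⟩
        · rcases hw with rfl | rfl
          exacts [h6 rfl, h7 rfl]
        · rintro y (rfl | rfl)
          exacts [⟨h2, h3⟩, ⟨h4, h5⟩]
    rcases hw with rfl | rfl
    · exact mk v (lo (.C k l u)) (by omega) (by omega) (by omega) (by omega) (by omega)
        (fun _ => rfl) (fun h => absurd (by simpa using h.symm) hk)
    · exact mk (lo (.C .st l u)) v (by omega) (by omega) (by omega) (by omega) (by omega)
        (fun h => absurd (by simpa using h) hk) (fun _ => rfl)

end Local

/-! ## Bound consistency of the whole decomposition -/

/-- The inequalities between the bounds of the domains that express bound consistency of the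
decomposition. -/
structure OADInstance.Cons {n d : ℕ} (I : OADInstance n d) (lo hi : DVar n → ℤ) : Prop where
  bool : ∀ i l, l ≤ d → (lo (.b i l) = 1 ↔ hi (.X i) ≤ l) ∧ (hi (.b i l) = 0 ↔ (l : ℤ) < lo (.X i))
  interval : ∀ i l u, InWindow n d l u →
    (lo (.a i l u) = 1 ↔ (l : ℤ) ≤ lo (.X i) ∧ hi (.X i) ≤ u) ∧
    (hi (.a i l u) = 0 → ((l : ℤ) ≤ lo (.X i) → (u : ℤ) < lo (.X i)) ∧
      (hi (.X i) ≤ u → hi (.X i) < l)) ∧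
    (hi (.X i) < l → hi (.a i l u) = 0) ∧ ((u : ℤ) < lo (.X i) → hi (.a i l u) = 0)
  count : ∀ k l u, InWindow n d l u →
    ∑ i ∈ I.counted k, lo (.a i l u) ≤ lo (.C k l u) ∧
    hi (.C k l u) ≤ ∑ i ∈ I.counted k, hi (.a i l u) ∧
    (hi (.C k l u) ≤ ∑ i ∈ I.counted k, lo (.a i l u) →
      ∀ i ∈ I.counted k, hi (.a i l u) = lo (.a i l u)) ∧
    (∑ i ∈ I.counted k, hi (.a i l u) ≤ lo (.C k l u) →
      ∀ i ∈ I.counted k, hi (.a i l u) = lo (.a i l u))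
  pyramid : ∀ l u, InWindow n d l u → l < u →
    lo (.C .st 1 l) + lo (.C .st (l + 1) u) ≤ lo (.C .st 1 u) ∧
    lo (.C .st 1 u) - hi (.C .st (l + 1) u) ≤ lo (.C .st 1 l) ∧
    lo (.C .st 1 u) - hi (.C .st 1 l) ≤ lo (.C .st (l + 1) u) ∧
    hi (.C .st 1 u) ≤ hi (.C .st 1 l) + hi (.C .st (l + 1) u) ∧
    hi (.C .st 1 l) ≤ hi (.C .st 1 u) - lo (.C .st (l + 1) u) ∧
    hi (.C .st (l + 1) u) ≤ hi (.C .st 1 u) - lo (.C .st 1 l)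
  capacity : ∀ k, k ≠ CKind.st → ∀ l u, InWindow n d l u →
    hi (.C .st l u) + lo (.C k l u) ≤ (u : ℤ) - l + 1 ∧
    lo (.C .st l u) + hi (.C k l u) ≤ (u : ℤ) - l + 1

namespace OADInstance

variable {n d : ℕ} (I : OADInstance n d)

theorem initDom_finite (x : DVar n) : (I.initDom x).Finite := by
  cases x with
  | X i => exact (I.dom i).finite_toSet
  | b i l => exact Set.toFinite {0, 1}
  | a i l u => exact Set.toFinite {0, 1}
  | C k l u => exact Set.finite_Icc _ _

theorem forall_decomposition (P : Constr (DVar n) → Prop) :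
    (∀ c ∈ I.decomposition, P c) ↔
      (∀ i l, l ≤ d → P (cBool i l)) ∧ (∀ i l u, InWindow n d l u → P (cInterval i l u)) ∧
      (∀ k l u, InWindow n d l u → P (I.cCount k l u)) ∧
      (∀ l u, InWindow n d l u → l < u → P (cPyramid l u)) ∧
      (∀ k, k ≠ CKind.st → ∀ l u, InWindow n d l u → P (cCapacity k l u)) := by
  constructor
  · intro h
    refine ⟨fun i l hl => h _ ?_, fun i l u hw => h _ ?_, fun k l u hw => h _ ?_,
      fun l u hw hlu => h _ ?_, fun k hk l u hw => h _ ?_⟩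
    · exact Or.inl (Or.inl (Or.inl (Or.inl (Or.inl ⟨i, l, hl, rfl⟩))))
    · exact Or.inl (Or.inl (Or.inl (Or.inl (Or.inr ⟨i, l, u, hw, rfl⟩))))
    · exact Or.inl (Or.inl (Or.inl (Or.inr ⟨k, l, u, hw, rfl⟩)))
    · exact Or.inl (Or.inl (Or.inr ⟨l, u, hw, hlu, rfl⟩))
    · cases k with
      | st => exact absurd rfl hk
      | s => exact Or.inl (Or.inr ⟨l, u, hw, rfl⟩)
      | t => exact Or.inr ⟨l, u, hw, rfl⟩
  · rintro ⟨h1, h2, h3, h4, h5⟩ c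
      (((((⟨i, l, hl, rfl⟩ | ⟨i, l, u, hw, rfl⟩) | ⟨k, l, u, hw, rfl⟩) | ⟨l, u, hw, hlu, rfl⟩) |
      ⟨l, u, hw, rfl⟩) | ⟨l, u, hw, rfl⟩)
    exacts [h1 i l hl, h2 i l u hw, h3 k l u hw, h4 l u hw hlu, h5 .s (by simp) l u hw,
      h5 .t (by simp) l u hw]

variable {I}

/-- Consistency of the constraints on `b` makes the bounds of `b` functions of those of `X`;
substituting them removes `b` from the interval conditions. The inclusion in the initial domains
supplies the ranges `0, 1` of the Boolean variables. -/
theorem cons_iff {E : DVar n → Set ℤ} {lo hi : DVar n → ℤ} (hb : HasBounds E lo hi)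
    (hE : ∀ x, E x ⊆ I.initDom x) :
    (∀ c ∈ I.decomposition, c.BoundConsistent E) ↔ I.Cons lo hi := by
  have hle := hb.le
  have rb : ∀ i l, 0 ≤ lo (.b i l) ∧ hi (.b i l) ≤ 1 := fun i l => by
    have h1 := hE _ (hb (.b i l)).1.1
    have h2 := hE _ (hb (.b i l)).2.1
    simp only [initDom, Set.mem_insert_iff, Set.mem_singleton_iff] at h1 h2
    omega
  have ra : ∀ i l u, 0 ≤ lo (.a i l u) ∧ hi (.a i l u) ≤ 1 := fun i l u => by
    have h1 := hE _ (hb (.a i l u)).1.1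
    have h2 := hE _ (hb (.a i l u)).2.1
    simp only [initDom, Set.mem_insert_iff, Set.mem_singleton_iff] at h1 h2
    omega
  have hbool : ∀ (i : Fin n) l, l ≤ d → ((cBool i l).BCBounds lo hi ↔
      (lo (.b i l) = 1 ↔ hi (.X i) ≤ l) ∧ (hi (.b i l) = 0 ↔ (l : ℤ) < lo (.X i))) :=
    fun i l _ => cBool_bcBounds_iff hle i l (rb i l).1 (rb i l).2
  have hint : ∀ (i : Fin n) l u, InWindow n d l u → _ := fun i l u hw =>
    cInterval_bcBounds_iff hle i l u hw.1 hw.2.1 (by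
      rintro x (rfl | rfl | rfl)
      exacts [ra i l u, rb i _, rb i u])
  have hcnt : ∀ k l u, InWindow n d l u → _ := fun k l u _ =>
    cCount_bcBounds_iff I hle k l u fun i => by have := ra i l u; have := hle (.a i l u); omega
  have hint' : (∀ i l, l ≤ d → (lo (.b i l) = 1 ↔ hi (.X i) ≤ l) ∧
      (hi (.b i l) = 0 ↔ (l : ℤ) < lo (.X i))) → ∀ i l u, InWindow n d l u →
      ((cInterval i l u).BCBounds lo hi ↔
        (lo (.a i l u) = 1 ↔ (l : ℤ) ≤ lo (.X i) ∧ hi (.X i) ≤ u) ∧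
        (hi (.a i l u) = 0 → ((l : ℤ) ≤ lo (.X i) → (u : ℤ) < lo (.X i)) ∧
          (hi (.X i) ≤ u → hi (.X i) < l)) ∧
        (hi (.X i) < l → hi (.a i l u) = 0) ∧ ((u : ℤ) < lo (.X i) → hi (.a i l u) = 0)) := by
    intro h i l u hw
    obtain ⟨hw1, hw2, hw3, hw4⟩ := hw
    rw [hint i l u ⟨hw1, hw2, hw3, hw4⟩, (h i u hw3).1, (h i u hw3).2,
      (h i (l - 1) (by omega)).1, (h i (l - 1) (by omega)).2, Nat.cast_sub hw1]
    have e1 : ∀ z : ℤ, (l : ℤ) - (1 : ℕ) < z ↔ (l : ℤ) ≤ z := fun z => by push_cast; omega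
    have e2 : ∀ z : ℤ, z ≤ (l : ℤ) - (1 : ℕ) ↔ z < (l : ℤ) := fun z => by push_cast; omega
    rw [e1, e2]
  simp only [hb.boundConsistent_iff]
  rw [forall_decomposition]
  constructor
  · rintro ⟨h1, h2, h3, h4, h5⟩
    have hB := fun i l hl => (hbool i l hl).1 (h1 i l hl)
    exact ⟨hB, fun i l u hw => (hint' hB i l u hw).1 (h2 i l u hw),
      fun k l u hw => (hcnt k l u hw).1 (h3 k l u hw),
      fun l u hw hlu => (cPyramid_bcBounds_iff hle l u hw.1 hlu).1 (h4 l u hw hlu),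
      fun k hk l u hw => (cCapacity_bcBounds_iff hle k hk l u).1 (h5 k hk l u hw)⟩
  · rintro ⟨h1, h2, h3, h4, h5⟩
    exact ⟨fun i l hl => (hbool i l hl).2 (h1 i l hl),
      fun i l u hw => (hint' h1 i l u hw).2 (h2 i l u hw),
      fun k l u hw => (hcnt k l u hw).2 (h3 k l u hw),
      fun l u hw hlu => (cPyramid_bcBounds_iff hle l u hw.1 hlu).2 (h4 l u hw hlu),
      fun k hk l u hw => (cCapacity_bcBounds_iff hle k hk l u).2 (h5 k hk l u hw)⟩

theorem closure_subset (x : DVar n) : I.closure x ⊆ I.initDom x :=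
  bcClosure_subset _ _ x

/-- If enforcing bound consistency does not fail, the bounds of the result are consistent. -/
theorem exists_cons_of_not_fails (h : ¬ I.Fails) :
    ∃ lo hi, HasBounds I.closure lo hi ∧ I.Cons lo hi := by
  have hne : ∀ y, (I.closure y).Nonempty := fun y => by
    rw [Set.nonempty_iff_ne_empty]
    exact fun hy => h ⟨y, hy⟩
  obtain ⟨lo, hi, hb⟩ := exists_hasBounds closure_subset I.initDom_finite hne
  exact ⟨lo, hi, hb, (cons_iff hb closure_subset).1 (bcClosure_boundConsistent _ _)⟩

/-- Consistent bounds within the initial domains lie within the closure. -/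
theorem Cons.mem_closure {lo hi : DVar n → ℤ} (h : I.Cons lo hi)
    (hlo : ∀ x, lo x ∈ I.initDom x) (hhi : ∀ x, hi x ∈ I.initDom x) (hle : ∀ x, lo x ≤ hi x)
    (x : DVar n) : lo x ∈ I.closure x ∧ hi x ∈ I.closure x := by
  -- All initial values between the bounds are kept; only the two ends matter for consistency.
  have hb : HasBounds (fun x => I.initDom x ∩ Set.Icc (lo x) (hi x)) lo hi := fun x =>
    ⟨⟨⟨hlo x, le_refl _, hle x⟩, fun y hy => hy.2.1⟩, ⟨hhi x, hle x, le_refl _⟩, fun y hy => hy.2.2⟩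
  have hsub := subset_bcClosure (fun x => Set.inter_subset_left)
    ((cons_iff hb fun x => Set.inter_subset_left).2 h) x
  exact ⟨hsub (hb x).1.1, hsub (hb x).2.1⟩

theorem Cons.not_fails {lo hi : DVar n → ℤ} (h : I.Cons lo hi)
    (hlo : ∀ x, lo x ∈ I.initDom x) (hhi : ∀ x, hi x ∈ I.initDom x) (hle : ∀ x, lo x ≤ hi x) :
    ¬ I.Fails := by
  rintro ⟨x, hx⟩
  have := (h.mem_closure hlo hhi hle x).1
  unfold closure at this
  rw [hx] at this
  exact this

theorem disjoint_counted {k k' : CKind} (h : k ≠ k') : Disjoint (I.counted k) (I.counted k') := by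
  rw [Finset.disjoint_left]
  cases k <;> cases k' <;> simp_all [counted]

theorem sum_card_counted :
    (I.counted .st).card + (I.counted .s).card + (I.counted .t).card = n := by
  rw [← Finset.card_union_of_disjoint (disjoint_counted (by simp)),
    ← Finset.card_union_of_disjoint (by
      rw [Finset.disjoint_union_left]
      exact ⟨disjoint_counted (by simp), disjoint_counted (by simp)⟩)]
  have : I.counted .st ∪ I.counted .s ∪ I.counted .t = Finset.univ := by
    rw [← I.cover]
    ext i
    simp only [counted, Finset.mem_union, Finset.mem_inter, Finset.mem_sdiff]
    tauto
  rw [this, Finset.card_univ, Fintype.card_fin]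

theorem one_le_dom {i : Fin n} {v : ℤ} (h : v ∈ I.dom i) : 1 ≤ v ∧ v ≤ d :=
  Finset.mem_Icc.1 (I.dom_subset i h)

/-! ### A solution makes the decomposition consistent -/

open Classical in
/-- The values of the variables of the decomposition for given values of the variables. -/
noncomputable def extend (I : OADInstance n d) (x : Fin n → ℤ) : DVar n → ℤ
  | .X i => x i
  | .b i l => if x i ≤ l then 1 else 0
  | .a i l u => if l ≤ x i ∧ x i ≤ u then 1 else 0
  | .C k l u => ∑ i ∈ I.counted k, if l ≤ x i ∧ x i ≤ u then 1 else 0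

theorem extend_mem_initDom {x : Fin n → ℤ} (hx : ∀ i, x i ∈ I.dom i) (y : DVar n) :
    I.extend x y ∈ I.initDom y := by
  cases y with
  | X i => exact hx i
  | b i l => simp only [extend, initDom]; split_ifs <;> simp
  | a i l u => simp only [extend, initDom]; split_ifs <;> simp
  | C k l u =>
    simp only [extend, initDom, Set.mem_Icc, Finset.sum_boole]
    refine ⟨by positivity, ?_⟩
    exact_mod_cast (Finset.card_filter_le _ _).trans ((Finset.card_le_univ _).trans (by simp))

/-- With one value per domain, `Cons` amounts to the constraints themselves. Capacity holds because
an injective map sends the counted variables into an interval of `u - l + 1` values. -/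
theorem cons_extend {x : Fin n → ℤ}
    (hS : Set.InjOn x (I.S : Set (Fin n))) (hT : Set.InjOn x (I.T : Set (Fin n))) :
    I.Cons (I.extend x) (I.extend x) := by
  have hpyr : ∀ l u : ℕ, 1 ≤ l → l < u → I.extend x (.C .st 1 u) =
      I.extend x (.C .st 1 l) + I.extend x (.C .st (l + 1) u) := by
    intro l u hl hlu
    simp only [extend, ← Finset.sum_add_distrib]
    refine Finset.sum_congr rfl fun i _ => ?_
    push_cast
    split_ifs <;> omega
  have hcap : ∀ k, k ≠ CKind.st → ∀ l u : ℕ, l ≤ u →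
      I.extend x (.C .st l u) + I.extend x (.C k l u) ≤ (u : ℤ) - l + 1 := by
    intro k hk l u hlu
    simp only [extend]
    rw [← Finset.sum_union (disjoint_counted hk.symm), Finset.sum_boole]
    have hinj : Set.InjOn x (I.counted .st ∪ I.counted k : Finset (Fin n)) := by
      cases k with
      | st => exact absurd rfl hk
      | s => exact hS.mono fun i => by simp only [counted, Finset.coe_union]; aesop
      | t => exact hT.mono fun i => by simp only [counted, Finset.coe_union]; aesop
    have h1 : ((I.counted .st ∪ I.counted k).filter fun i => (l : ℤ) ≤ x i ∧ x i ≤ u).card ≤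
        (Finset.Icc (l : ℤ) u).card := by
      refine Finset.card_le_card_of_injOn x (fun i hi => ?_)
        (hinj.mono (Finset.coe_subset.2 (Finset.filter_subset _ _)))
      simpa using (Finset.mem_filter.1 hi).2
    rw [Int.card_Icc] at h1
    omega
  refine ⟨fun i l _ => ?_, fun i l u hw => ?_, fun k l u _ => ⟨le_refl _, le_refl _, ?_, ?_⟩,
    fun l u hw hlu => ?_, fun k hk l u hw => ⟨hcap k hk l u hw.2.1, hcap k hk l u hw.2.1⟩⟩
  · simp only [extend]; split_ifs <;> omega
  · obtain ⟨-, h, -, -⟩ := hw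
    simp only [extend]; split_ifs <;> omega
  · exact fun _ _ _ => rfl
  · exact fun _ _ _ => rfl
  · have := hpyr l u hw.1 hlu
    omega

theorem no_solution_of_fails (h : I.Fails) :
    ¬ ∃ x : Fin n → ℤ, (∀ i, x i ∈ I.dom i) ∧ I.overlappingAllDiff.holds x := by
  rintro ⟨x, hx, hS, hT⟩
  exact (cons_extend hS hT).not_fails (extend_mem_initDom hx) (extend_mem_initDom hx)
    (fun _ => le_refl _) h

end OADInstance

/-! ## Matching of variables with intervals as domains -/

section Matching

variable {ι : Type*}

/-- Hall's condition for interval domains has to be checked for intervals only. -/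
theorem card_le_card_biUnion_Icc_inter (K : Finset ι) (a b : ι → ℕ) (R : Finset ℕ)
    (h : ∀ i ∈ K, ∀ j ∈ K, a i ≤ b j →
      (K.filter fun m => a i ≤ a m ∧ b m ≤ b j).card ≤ (R ∩ Finset.Icc (a i) (b j)).card)
    (hab : ∀ i ∈ K, a i ≤ b i) :
    K.card ≤ (K.biUnion fun i => R ∩ Finset.Icc (a i) (b i)).card := by
  classical
  induction K using Finset.strongInduction with
  | H K ih =>
    rcases K.eq_empty_or_nonempty with rfl | hne
    · simp
    obtain ⟨i, hi, hmin⟩ := K.exists_min_image a hne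
    obtain ⟨j, hj, hmax⟩ := K.exists_max_image b hne
    have hij : a i ≤ b j := (hab i hi).trans (hmax i hi)
    -- If the intervals cover everything from the least left end to the greatest right end, the
    -- hypothesis for this range is the claim. Otherwise a gap `v` separates the family into two
    -- smaller ones, left and right of `v`, with disjoint unions.
    by_cases hcov : ∀ v ∈ Finset.Icc (a i) (b j), ∃ m ∈ K, v ∈ Finset.Icc (a m) (b m)
    · have h1 := h i hi j hj hij
      rw [Finset.filter_true_of_mem fun m hm => ⟨hmin m hm, hmax m hm⟩] at h1
      refine h1.trans (Finset.card_le_card fun v hv => ?_)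
      rw [Finset.mem_inter] at hv
      obtain ⟨m, hm, hvm⟩ := hcov v hv.2
      exact Finset.mem_biUnion.2 ⟨m, hm, Finset.mem_inter.2 ⟨hv.1, hvm⟩⟩
    · push Not at hcov
      obtain ⟨v, hv, hvK⟩ := hcov
      rw [Finset.mem_Icc] at hv
      have hsub : ∀ L ⊆ K, L ≠ K →
          L.card ≤ (L.biUnion fun i => R ∩ Finset.Icc (a i) (b i)).card := by
        intro L hL hLK
        refine ih L (hL.ssubset_of_ne hLK) (fun p hp q hq hpq => ?_) fun p hp => hab p (hL hp)
        exact (Finset.card_le_card (Finset.filter_subset_filter _ hL)).trans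
          (h p (hL hp) q (hL hq) hpq)
      have h1 := hsub (K.filter fun m => b m < v) (Finset.filter_subset _ _) fun he => by
        have := he.ge hj
        simp only [Finset.mem_filter] at this
        omega
      have h2 := hsub (K.filter fun m => ¬ b m < v) (Finset.filter_subset _ _) fun he => by
        have := he.ge hi
        have h3 := hvK i hi
        simp only [Finset.mem_filter, Finset.mem_Icc] at this h3
        omega
      rw [← Finset.card_filter_add_card_filter_not (s := K) (fun m => b m < v)]
      refine (Nat.add_le_add h1 h2).trans ?_
      rw [← Finset.card_union_of_disjoint]
      · refine Finset.card_le_card (Finset.union_subset ?_ ?_) <;>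
          exact Finset.biUnion_subset_biUnion_of_subset_left _ (Finset.filter_subset _ _)
      · rw [Finset.disjoint_left]
        intro w h3 h4
        simp only [Finset.mem_biUnion, Finset.mem_filter, Finset.mem_inter,
          Finset.mem_Icc] at h3 h4
        obtain ⟨p, ⟨hp, hpv⟩, -, hp1, hp2⟩ := h3
        obtain ⟨q, ⟨hq, hqv⟩, -, hq1, hq2⟩ := h4
        have h5 := hvK q hq
        rw [Finset.mem_Icc] at h5
        omega

/-- The preceding lemma verifies Hall's condition for each subfamily, which has no more members in
an interval than `K` has. Only intervals from an occurring left end to an occurring right end are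
needed, so their position within `[1, d]` comes for free in applications. -/
theorem exists_injOn_of_interval_hall (K : Finset ι) (a b : ι → ℕ) (R : Finset ℕ)
    (h : ∀ l u, l ≤ u → (∃ i ∈ K, a i = l) → (∃ j ∈ K, b j = u) →
      (K.filter fun m => l ≤ a m ∧ b m ≤ u).card ≤ (R ∩ Finset.Icc l u).card)
    (hab : ∀ i ∈ K, a i ≤ b i) :
    ∃ f : ι → ℕ, Set.InjOn f K ∧ ∀ i ∈ K, f i ∈ R ∧ a i ≤ f i ∧ f i ≤ b i := by
  classical
  have key := (Finset.all_card_le_biUnion_card_iff_exists_injective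
    (fun i : K => R ∩ Finset.Icc (a i) (b i))).1 (by
      intro s
      have h1 := card_le_card_biUnion_Icc_inter (s.map (Function.Embedding.subtype _)) a b R ?_ ?_
      · rw [Finset.card_map] at h1
        refine h1.trans (Finset.card_le_card fun v hv => ?_)
        simp only [Finset.mem_biUnion, Finset.mem_map, Function.Embedding.subtype_apply] at hv ⊢
        obtain ⟨_, ⟨i, hi, rfl⟩, hv⟩ := hv
        exact ⟨i, hi, hv⟩
      · intro i hi j hj hij
        simp only [Finset.mem_map, Function.Embedding.subtype_apply] at hi hj
        obtain ⟨⟨i, hiK⟩, hi, rfl⟩ := hi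
        obtain ⟨⟨j, hjK⟩, hj, rfl⟩ := hj
        refine (Finset.card_le_card (Finset.filter_subset_filter _ fun m hm => ?_)).trans
          (h _ _ hij ⟨i, hiK, rfl⟩ ⟨j, hjK, rfl⟩)
        simp only [Finset.mem_map, Function.Embedding.subtype_apply] at hm
        obtain ⟨⟨m, hmK⟩, hm, rfl⟩ := hm
        exact hmK
      · intro i hi
        simp only [Finset.mem_map, Function.Embedding.subtype_apply] at hi
        obtain ⟨⟨i, hiK⟩, hi, rfl⟩ := hi
        exact hab i hiK)
  obtain ⟨f, hf, hfR⟩ := key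
  refine ⟨fun i => if hi : i ∈ K then f ⟨i, hi⟩ else 0, fun i hi j hj hij => ?_, fun i hi => ?_⟩
  · simp only [Finset.mem_coe] at hi hj
    simp only [hi, hj, dif_pos] at hij
    exact congrArg Subtype.val (hf hij)
  · have := hfR ⟨i, hi⟩
    simp only [Finset.mem_inter, Finset.mem_Icc] at this
    simpa only [hi, dif_pos] using this

/-- The union of tight sets is tight. -/
theorem card_biUnion_tight (K : Finset ι) (a b : ι → ℕ) (hab : ∀ i ∈ K, a i ≤ b i)
    (R : Finset ℕ) (F : Finset (ℕ × ℕ))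
    (hF : ∀ p ∈ F, ∀ l u, p.1 ≤ l → u ≤ p.2 → l ≤ u →
      (K.filter fun m => l ≤ a m ∧ b m ≤ u).card ≤ (R ∩ Finset.Icc l u).card)
    (ht : ∀ p ∈ F, (R ∩ Finset.Icc p.1 p.2).card ≤
      (K.filter fun m => p.1 ≤ a m ∧ b m ≤ p.2).card) :
    (R ∩ F.biUnion fun p => Finset.Icc p.1 p.2).card ≤
      (K.filter fun m => Finset.Icc (a m) (b m) ⊆ F.biUnion fun p => Finset.Icc p.1 p.2).card := by
  classical
  induction F using Finset.induction_on with
  | empty => simp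
  | insert p F hp ih =>
    have ih := ih (fun q hq => hF q (Finset.mem_insert_of_mem hq))
      (fun q hq => ht q (Finset.mem_insert_of_mem hq))
    rw [Finset.biUnion_insert]
    set U := F.biUnion fun p => Finset.Icc p.1 p.2
    set J := Finset.Icc p.1 p.2 with hJ
    have hpt := ht p (Finset.mem_insert_self p F)
    have hpF := hF p (Finset.mem_insert_self p F)
    have h1 : (K.filter fun m => p.1 ≤ a m ∧ b m ≤ p.2) =
        K.filter fun m => Finset.Icc (a m) (b m) ⊆ J := by
      refine Finset.filter_congr fun m hm => ?_
      rw [hJ, Finset.Icc_subset_Icc_iff (hab m hm)]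
    rw [h1, ← hJ] at hpt
    -- The set `J ∩ U` need not be an interval, but the members inside it are also inside `J`, and
    -- all intervals between their ends are subintervals of `J`, where the hypothesis `hF` applies.
    have h2 : (K.filter fun m => Finset.Icc (a m) (b m) ⊆ J ∩ U).card ≤ (R ∩ (J ∩ U)).card := by
      refine (card_le_card_biUnion_Icc_inter (K.filter fun m => Finset.Icc (a m) (b m) ⊆ J ∩ U)
        a b R ?_ fun i hi => hab i (Finset.mem_filter.1 hi).1).trans (Finset.card_le_card ?_)
      · intro i hi j hj hij
        simp only [Finset.mem_filter, Finset.subset_inter_iff] at hi hj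
        have hi1 := (Finset.Icc_subset_Icc_iff (hab i hi.1)).1 hi.2.1
        have hj1 := (Finset.Icc_subset_Icc_iff (hab j hj.1)).1 hj.2.1
        exact (Finset.card_le_card (Finset.filter_subset_filter _ (Finset.filter_subset _ _))).trans
          (hpF _ _ hi1.1 hj1.2 hij)
      · intro v hv
        simp only [Finset.mem_biUnion, Finset.mem_filter, Finset.mem_inter] at hv
        obtain ⟨m, ⟨-, hm⟩, hvR, hv⟩ := hv
        exact Finset.mem_inter.2 ⟨hvR, hm hv⟩
    -- Counting values is modular and counting contained intervals is supermodular; so tightness of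
    -- `J` and `U`, with the inequality for `J ∩ U`, gives tightness of `J ∪ U`.
    have h3 : (R ∩ (J ∪ U)).card + (R ∩ (J ∩ U)).card = (R ∩ J).card + (R ∩ U).card := by
      rw [Finset.inter_union_distrib_left, Finset.inter_inter_distrib_left,
        Finset.card_union_add_card_inter]
    have h4 : (K.filter fun m => Finset.Icc (a m) (b m) ⊆ J).card +
        (K.filter fun m => Finset.Icc (a m) (b m) ⊆ U).card ≤
        (K.filter fun m => Finset.Icc (a m) (b m) ⊆ J ∪ U).card +
        (K.filter fun m => Finset.Icc (a m) (b m) ⊆ J ∩ U).card := by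
      rw [← Finset.card_union_add_card_inter]
      refine Nat.add_le_add (Finset.card_le_card ?_) (Finset.card_le_card ?_)
      · rw [← Finset.filter_or]
        refine Finset.monotone_filter_right _ fun m _ hm => ?_
        rcases hm with hm | hm
        exacts [hm.trans Finset.subset_union_left, hm.trans Finset.subset_union_right]
      · rw [← Finset.filter_and]
        exact Finset.monotone_filter_right _ fun m _ hm => Finset.subset_inter hm.1 hm.2
    omega

theorem card_Icc_sdiff_add (Q : Finset ℕ) (l u : ℕ) :
    (Finset.Icc l u \ Q).card + (Q ∩ Finset.Icc l u).card = u + 1 - l := by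
  rw [Finset.inter_comm, Finset.card_sdiff_add_card_inter, Nat.card_Icc]

/-- The set `Q` leaves room for the variables in `K` in intervals with less than `n` values. -/
def LeavesRoom (n d : ℕ) (K : Finset ι) (a b : ι → ℕ) (Q : Finset ℕ) : Prop :=
  ∀ l u, 1 ≤ l → l ≤ u → u ≤ d → u + 1 < l + n →
    (Q ∩ Finset.Icc l u).card + (K.filter fun m => l ≤ a m ∧ b m ≤ u).card ≤ u + 1 - l

/-- The set `Q` contains enough values for the variables in `K` in intervals with less than `n`
values. -/
def Suffices (n d : ℕ) (K : Finset ι) (a b : ι → ℕ) (Q : Finset ℕ) : Prop :=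
  ∀ l u, 1 ≤ l → l ≤ u → u ≤ d → u + 1 < l + n →
    (K.filter fun m => l ≤ a m ∧ b m ≤ u).card ≤ (Q ∩ Finset.Icc l u).card

/-- If no more elements can be added to `Q` without taking the room of `K`, then few
elements are missing. -/
theorem card_blocked_le {n d : ℕ} {K : Finset ι} {a b : ι → ℕ} {Q : Finset ℕ}
    (hab : ∀ i, 1 ≤ a i ∧ a i ≤ b i ∧ b i ≤ d)
    (hQ : LeavesRoom n d K a b Q) (M : Finset ℕ) (hM : ∀ v ∈ M, v ∉ Q)
    (hM' : ∀ v ∈ M, ¬ LeavesRoom n d K a b (insert v Q)) : M.card ≤ K.card := by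
  classical
  -- Since `Q` itself leaves room, adding `v` can only violate the condition on a short interval
  -- that contains `v` and has no room to spare: its values outside `Q` are no more than the
  -- variables confined to it.
  have h1 : ∀ v ∈ M, ∃ p : ℕ × ℕ, (1 ≤ p.1 ∧ p.1 ≤ p.2 ∧ p.2 ≤ d ∧ p.2 + 1 < p.1 + n) ∧
      v ∈ Finset.Icc p.1 p.2 ∧ (Finset.Icc p.1 p.2 \ Q).card ≤
        (K.filter fun m => p.1 ≤ a m ∧ b m ≤ p.2).card := by
    intro v hv
    have h2 := hM' v hv
    unfold LeavesRoom at h2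
    push Not at h2
    obtain ⟨l, u, h3, h4, h5, h6, h7⟩ := h2
    have h8 := hQ l u h3 h4 h5 h6
    have h9 := card_Icc_sdiff_add Q l u
    by_cases hvI : v ∈ Finset.Icc l u
    · rw [Finset.insert_inter_of_mem hvI, Finset.card_insert_of_notMem
        (fun h => hM v hv (Finset.mem_inter.1 h).1)] at h7
      exact ⟨(l, u), ⟨h3, h4, h5, h6⟩, hvI, by dsimp only; omega⟩
    · rw [Finset.insert_inter_of_notMem hvI] at h7
      omega
  choose! p hp using h1
  -- The tight intervals found above contain all of `M`; by tightness of their union, `M` has at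
  -- most as many elements as there are variables confined to this union.
  have h2 := card_biUnion_tight K a b (fun i _ => (hab i).2.1) (Finset.Icc 1 d \ Q) (M.image p)
    ?_ ?_
  · refine le_trans (Finset.card_le_card fun v hv => ?_) (h2.trans (Finset.card_filter_le _ _))
    have hv' := hp v hv
    rw [Finset.mem_inter, Finset.mem_sdiff, Finset.mem_biUnion]
    refine ⟨⟨?_, hM v hv⟩, p v, Finset.mem_image_of_mem p hv, hv'.2.1⟩
    have := Finset.mem_Icc.1 hv'.2.1
    rw [Finset.mem_Icc]
    omega
  · intro q hq l u h3 h4 h5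
    obtain ⟨v, hv, rfl⟩ := Finset.mem_image.1 hq
    have hv' := (hp v hv).1
    have h6 := hQ l u (by omega) h5 (by omega) (by omega)
    have h7 := card_Icc_sdiff_add Q l u
    have h8 : (Finset.Icc 1 d \ Q) ∩ Finset.Icc l u = Finset.Icc l u \ Q := by
      ext w
      simp only [Finset.mem_inter, Finset.mem_sdiff, Finset.mem_Icc]
      constructor
      · rintro ⟨⟨-, h⟩, h'⟩; exact ⟨h', h⟩
      · rintro ⟨h', h⟩; exact ⟨⟨by omega, h⟩, h'⟩
    rw [h8]
    omega
  · intro q hq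
    obtain ⟨v, hv, rfl⟩ := Finset.mem_image.1 hq
    have hv' := hp v hv
    refine (Finset.card_le_card ?_).trans hv'.2.2
    intro w hw
    simp only [Finset.mem_inter, Finset.mem_sdiff] at hw ⊢
    exact ⟨hw.2, hw.1.2⟩

/-- Values for `A`, `B` and `C` such that those of `A` and `B`, and those of `A` and `C`, are
different, if some set of values for `A` is feasible for all short intervals. -/
theorem exists_overlapping_matching [DecidableEq ι] {n d : ℕ} (A B C : Finset ι)
    (hcard : A.card + B.card + C.card ≤ n)
    (a b : ι → ℕ) (hab : ∀ i, 1 ≤ a i ∧ a i ≤ b i ∧ b i ≤ d) (Q₀ : Finset ℕ)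
    (hQ₀ : Q₀ ⊆ Finset.Icc 1 d) (hA : Suffices n d A a b Q₀) (hB : LeavesRoom n d B a b Q₀)
    (hC : LeavesRoom n d C a b Q₀) (hAB : Disjoint A B) (hAC : Disjoint A C)
    (hBC : Disjoint B C) :
    ∃ x : ι → ℕ, (∀ i ∈ A ∪ B ∪ C, a i ≤ x i ∧ x i ≤ b i) ∧
      Set.InjOn x (A ∪ B : Finset ι) ∧ Set.InjOn x (A ∪ C : Finset ι) := by
  classical
  have hab' : ∀ K : Finset ι, ∀ i ∈ K, a i ≤ b i := fun _ i _ => (hab i).2.1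
  -- A feasible set of maximal size. Enlarging it never harms `A`, so any further value is blocked
  -- by `B` or by `C`.
  obtain ⟨Q, hQ, hmax⟩ := ((Finset.Icc 1 d).powerset.filter fun Q => Suffices n d A a b Q ∧
    LeavesRoom n d B a b Q ∧ LeavesRoom n d C a b Q).exists_max_image Finset.card
    ⟨Q₀, Finset.mem_filter.2 ⟨Finset.mem_powerset.2 hQ₀, hA, hB, hC⟩⟩
  simp only [Finset.mem_filter, Finset.mem_powerset, and_imp] at hQ hmax
  obtain ⟨hQd, hQA, hQB, hQC⟩ := hQ
  -- If a long interval had fewer elements of `Q` than variables of `A` confined to it, it would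
  -- contain more than `n - A.card ≥ B.card + C.card` values outside `Q`. By maximality each is
  -- blocked by `B` or by `C`, and `card_blocked_le` bounds the two kinds by `B.card` and `C.card`.
  have hwide : ∀ l u, 1 ≤ l → l ≤ u → u ≤ d →
      (A.filter fun m => l ≤ a m ∧ b m ≤ u).card ≤ (Q ∩ Finset.Icc l u).card := by
    intro l u hl hlu hud
    by_cases hn : u + 1 < l + n
    · exact hQA l u hl hlu hud hn
    by_contra hlt
    push Not at hlt
    have h1 := Finset.card_filter_le A fun m => l ≤ a m ∧ b m ≤ u
    have h2 := card_Icc_sdiff_add Q l u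
    have h3 : ∀ v ∈ Finset.Icc l u \ Q, LeavesRoom n d B a b (insert v Q) →
        ¬ LeavesRoom n d C a b (insert v Q) := by
      intro v hv h4 h5
      rw [Finset.mem_sdiff, Finset.mem_Icc] at hv
      have h6 := hmax (insert v Q) (Finset.insert_subset (Finset.mem_Icc.2 (by omega)) hQd)
        (fun l u h7 h8 h9 h10 => (hQA l u h7 h8 h9 h10).trans (Finset.card_le_card
          (Finset.inter_subset_inter_right (Finset.subset_insert _ _)))) h4 h5
      rw [Finset.card_insert_of_notMem hv.2] at h6
      omega
    have h4 := card_blocked_le hab hQB ((Finset.Icc l u \ Q).filter fun v =>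
      ¬ LeavesRoom n d B a b (insert v Q)) (fun v hv => by
        simp only [Finset.mem_filter, Finset.mem_sdiff] at hv; exact hv.1.2)
      (fun v hv => (Finset.mem_filter.1 hv).2)
    have h5 := card_blocked_le hab hQC ((Finset.Icc l u \ Q).filter fun v =>
      LeavesRoom n d B a b (insert v Q)) (fun v hv => by
        simp only [Finset.mem_filter, Finset.mem_sdiff] at hv; exact hv.1.2)
      (fun v hv => h3 v (Finset.mem_filter.1 hv).1 (Finset.mem_filter.1 hv).2)
    have h6 := Finset.card_filter_add_card_filter_not (s := Finset.Icc l u \ Q)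
      (fun v => LeavesRoom n d B a b (insert v Q))
    omega
  obtain ⟨f, hfinj, hf⟩ := exists_injOn_of_interval_hall A a b Q (fun l u hlu hi hj => by
    obtain ⟨i, hi, rfl⟩ := hi
    obtain ⟨j, hj, rfl⟩ := hj
    exact hwide _ _ (hab i).1 hlu (hab j).2.2) (hab' A)
  -- `B` and `C` avoid the values used by `A`. Short intervals have room since these values lie in
  -- `Q`; in intervals with at least `n` values the inequality `A.card + K.card ≤ n` suffices.
  have hrest : ∀ K : Finset ι, A.card + K.card ≤ n → LeavesRoom n d K a b Q →
      ∃ g : ι → ℕ, Set.InjOn g K ∧ ∀ i ∈ K, g i ∈ Finset.Icc 1 d \ A.image f ∧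
        a i ≤ g i ∧ g i ≤ b i := by
    intro K hK hQK
    refine exists_injOn_of_interval_hall K a b _ (fun l u hlu hi hj => ?_) (hab' K)
    obtain ⟨i, hi, rfl⟩ := hi
    obtain ⟨j, hj, rfl⟩ := hj
    have hl := (hab i).1
    have hu := (hab j).2.2
    have h8 : (Finset.Icc 1 d \ A.image f) ∩ Finset.Icc (a i) (b j) =
        Finset.Icc (a i) (b j) \ A.image f := by
      ext w
      simp only [Finset.mem_inter, Finset.mem_sdiff, Finset.mem_Icc]
      constructor
      · rintro ⟨⟨-, h⟩, h'⟩; exact ⟨h', h⟩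
      · rintro ⟨h', h⟩; exact ⟨⟨by omega, h⟩, h'⟩
    rw [h8]
    have h9 := card_Icc_sdiff_add (A.image f) (a i) (b j)
    by_cases hn : b j + 1 < a i + n
    · have h10 := hQK _ _ hl hlu hu hn
      have h11 : (A.image f ∩ Finset.Icc (a i) (b j)).card ≤
          (Q ∩ Finset.Icc (a i) (b j)).card :=
        Finset.card_le_card (Finset.inter_subset_inter_right
          (Finset.image_subset_iff.2 fun m hm => (hf m hm).1))
      omega
    · have h10 : (A.image f ∩ Finset.Icc (a i) (b j)).card ≤ A.card :=
        (Finset.card_le_card Finset.inter_subset_left).trans Finset.card_image_le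
      have h11 := Finset.card_filter_le K fun m => a i ≤ a m ∧ b m ≤ b j
      omega
  obtain ⟨g, hginj, hg⟩ := hrest B (by omega) hQB
  obtain ⟨h, hhinj, hh⟩ := hrest C (by omega) hQC
  have hA' : ∀ i ∈ A, (if i ∈ A then f i else if i ∈ B then g i else h i) = f i :=
    fun i hi => if_pos hi
  have hB' : ∀ i ∈ B, (if i ∈ A then f i else if i ∈ B then g i else h i) = g i := fun i hi => by
    rw [if_neg (Finset.disjoint_right.1 hAB hi), if_pos hi]
  have hC' : ∀ i ∈ C, (if i ∈ A then f i else if i ∈ B then g i else h i) = h i := fun i hi => by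
    rw [if_neg (Finset.disjoint_right.1 hAC hi), if_neg (Finset.disjoint_right.1 hBC hi)]
  have hinj : ∀ (K : Finset ι) (g : ι → ℕ) (x : ι → ℕ), Set.InjOn g K →
      (∀ i ∈ K, g i ∈ Finset.Icc 1 d \ A.image f) → (∀ i ∈ A, x i = f i) →
      (∀ i ∈ K, x i = g i) → Set.InjOn x (A ∪ K : Finset ι) := by
    intro K g x hg1 hg2 hx1 hx2 i hi j hj hij
    have hne : ∀ i ∈ A, ∀ j ∈ K, f i ≠ g j := fun i hi j hj he =>
      (Finset.mem_sdiff.1 (hg2 j hj)).2 (he ▸ Finset.mem_image_of_mem f hi)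
    rw [Finset.mem_coe, Finset.mem_union] at hi hj
    rcases hi with hi | hi <;> rcases hj with hj | hj
    · rw [hx1 i hi, hx1 j hj] at hij; exact hfinj hi hj hij
    · rw [hx1 i hi, hx2 j hj] at hij; exact absurd hij (hne i hi j hj)
    · rw [hx2 i hi, hx1 j hj] at hij; exact absurd hij.symm (hne j hj i hi)
    · rw [hx2 i hi, hx2 j hj] at hij; exact hg1 hi hj hij
  refine ⟨fun i => if i ∈ A then f i else if i ∈ B then g i else h i, fun i hi => ?_,
    hinj B g _ hginj (fun i hi => (hg i hi).1) hA' hB',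
    hinj C h _ hhinj (fun i hi => (hh i hi).1) hA' hC'⟩
  rw [Finset.mem_union, Finset.mem_union] at hi
  dsimp only
  rcases hi with (hi | hi) | hi
  · rw [hA' i hi]; exact (hf i hi).2
  · rw [hB' i hi]; exact (hg i hi).2
  · rw [hC' i hi]; exact (hh i hi).2

end Matching

/-! ## Consistent bounds yield a bound support -/

namespace OADInstance

variable {n d : ℕ} {I : OADInstance n d}

/-- A function with increments `0` and `1` counts the elements of a set. -/
theorem card_filter_jump_Icc (p : ℕ → ℤ) (d : ℕ) (hp : ∀ v, 1 ≤ v → v ≤ d →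
    p (v - 1) ≤ p v ∧ p v ≤ p (v - 1) + 1) (l u : ℕ) (hl : 1 ≤ l) (hlu : l ≤ u + 1) (hu : u ≤ d) :
    ((((Finset.Icc 1 d).filter fun v => p v = p (v - 1) + 1) ∩ Finset.Icc l u).card : ℤ) =
      p u - p (l - 1) := by
  induction u with
  | zero =>
    obtain rfl : l = 1 := by omega
    simp
  | succ u ih =>
    rcases Nat.lt_or_ge u.succ l with h | h
    · obtain rfl : l = u + 2 := by omega
      simp
    · have ih := ih (by omega) (by omega)
      rw [← Finset.insert_Icc_right_eq_Icc_add_one (by omega)]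
      have hp' := hp (u + 1) (by omega) hu
      rw [Nat.add_sub_cancel] at hp'
      by_cases hj : p (u + 1) = p u + 1
      · rw [Finset.inter_insert_of_mem (by simp [hj]; omega),
            Finset.card_insert_of_notMem (by simp)]
        push_cast
        omega
      · rw [Finset.inter_insert_of_notMem (by simp [hj])]
        omega

/-- The minima of the prefix counters single out a set `Q` of values reserved for `S ∩ T` that is
feasible on all short intervals; the rest is the combinatorial matching above. -/
theorem exists_boundSupport_of_cons {lo hi : DVar n → ℤ} (h : I.Cons lo hi)
    (hlo : ∀ x, lo x ∈ I.initDom x) (hhi : ∀ x, hi x ∈ I.initDom x) (hle : ∀ x, lo x ≤ hi x) :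
    ¬ I.overlappingAllDiff.BoundDisentailed I.domains := by
  have hX : ∀ i, 1 ≤ lo (.X i) ∧ hi (.X i) ≤ d := fun i =>
    ⟨(one_le_dom (hlo (.X i))).1, (one_le_dom (hhi (.X i))).2⟩
  set a : Fin n → ℕ := fun i => (lo (.X i)).toNat with ha
  set b : Fin n → ℕ := fun i => (hi (.X i)).toNat with hb
  have ha' : ∀ i, (a i : ℤ) = lo (.X i) := fun i => Int.toNat_of_nonneg (by have := hX i; omega)
  have hb' : ∀ i, (b i : ℤ) = hi (.X i) := fun i =>
    Int.toNat_of_nonneg (by have := hX i; have := hle (.X i); omega)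
  have hab : ∀ i, 1 ≤ a i ∧ a i ≤ b i ∧ b i ≤ d := fun i => by
    have h1 := hX i; have h2 := hle (.X i); have h3 := ha' i; have h4 := hb' i; omega
  -- A variable whose domain lies in `[l, u]` has `a` fixed to `1`, hence contributes to the minimum
  -- of the counter.
  have hN : ∀ k l u, InWindow n d l u →
      (((I.counted k).filter fun m => l ≤ a m ∧ b m ≤ u).card : ℤ) ≤ lo (.C k l u) := by
    intro k l u hw
    refine le_trans ?_ (h.count k l u hw).1
    rw [← Finset.sum_boole]
    refine Finset.sum_le_sum fun i _ => ?_
    have h1 := hlo (.a i l u)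
    have h2 := (h.interval i l u hw).1
    have h3 := ha' i
    have h4 := hb' i
    simp only [initDom, Set.mem_insert_iff, Set.mem_singleton_iff] at h1
    split_ifs <;> omega
  obtain ⟨Q, hQd, hQ⟩ : ∃ Q ⊆ Finset.Icc 1 d, ∀ l u, 1 ≤ l → l ≤ u → u ≤ d → u + 1 < l + n →
      lo (.C .st l u) ≤ ((Q ∩ Finset.Icc l u).card : ℤ) ∧
      ((Q ∩ Finset.Icc l u).card : ℤ) ≤ hi (.C .st l u) := by
    -- The empty prefix has no counter, so `p 0` is set to `0`. For `l > 1` the difference `p u - p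
    -- (l - 1)` is controlled by the pyramid constraint split at `l - 1`, which is present because
    -- `[l, u]` has fewer than `n` values.
    set p : ℕ → ℤ := fun v => if v = 0 then 0 else lo (.C .st 1 v) with hp
    have hdiff : ∀ l u, 1 ≤ l → l ≤ u → u ≤ d → u + 1 < l + n →
        lo (.C .st l u) ≤ p u - p (l - 1) ∧ p u - p (l - 1) ≤ hi (.C .st l u) := by
      intro l u h1 h2 h3 h4
      rcases Nat.lt_or_ge 1 l with h5 | h5
      · have h6 := h.pyramid (l - 1) u ⟨by omega, by omega, h3, by omega⟩ (by omega)
        rw [Nat.sub_add_cancel h1] at h6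
        simp only [hp, show u ≠ 0 by omega, show l - 1 ≠ 0 by omega, if_false]
        omega
      · obtain rfl : l = 1 := by omega
        have := hle (.C .st 1 u)
        simp only [hp, show u ≠ 0 by omega, if_false, Nat.sub_self, if_true]
        omega
    -- For `n ≤ 1` no non-empty interval has fewer than `n` values, and any `Q` will do. Otherwise
    -- single values are short intervals, and capacity there bounds the increments of `p` by `1`.
    by_cases hn : n ≤ 1
    · exact ⟨∅, by simp, fun l u _ _ _ _ => by omega⟩
    have hp1 : ∀ v, 1 ≤ v → v ≤ d → p (v - 1) ≤ p v ∧ p v ≤ p (v - 1) + 1 := by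
      intro v h1 h2
      have h3 := hdiff v v h1 (le_refl _) h2 (by omega)
      have h4 := (h.capacity .s (by simp) v v ⟨h1, le_refl _, h2, by omega⟩).1
      have h5 := hlo (.C .s v v)
      have h6 := hlo (.C .st v v)
      simp only [initDom, Set.mem_Icc] at h5 h6
      omega
    refine ⟨(Finset.Icc 1 d).filter fun v => p v = p (v - 1) + 1, Finset.filter_subset _ _,
      fun l u h1 h2 h3 h4 => ?_⟩
    rw [card_filter_jump_Icc p d hp1 l u h1 (by omega) h3]
    exact hdiff l u h1 h2 h3 h4
  have hroom : ∀ k, k ≠ CKind.st → LeavesRoom n d (I.counted k) a b Q := by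
    intro k hk l u h1 h2 h3 h4
    have h5 := hN k l u ⟨h1, h2, h3, by omega⟩
    have h6 := (hQ l u h1 h2 h3 h4).2
    have h7 := (h.capacity k hk l u ⟨h1, h2, h3, by omega⟩).1
    omega
  obtain ⟨x, hx, hxS, hxT⟩ := exists_overlapping_matching (I.counted .st) (I.counted .s)
    (I.counted .t) sum_card_counted.le a b hab Q hQd
    (fun l u h1 h2 h3 h4 => by
      have h5 := hN .st l u ⟨h1, h2, h3, by omega⟩
      have h6 := (hQ l u h1 h2 h3 h4).1
      omega) (hroom .s (by simp)) (hroom .t (by simp))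
    (disjoint_counted (by simp)) (disjoint_counted (by simp)) (disjoint_counted (by simp))
  have hcast : ∀ {s : Set (Fin n)}, Set.InjOn x s → Set.InjOn (fun i => (x i : ℤ)) s :=
    fun hs i hi j hj hij => hs hi hj (by simpa using hij)
  rw [Constr.BoundDisentailed, not_not]
  refine ⟨fun i => x i, ⟨hcast (hxS.mono fun i hi => ?_), hcast (hxT.mono fun i hi => ?_)⟩,
    fun i _ => ?_⟩
  · rw [Finset.mem_coe] at hi ⊢
    simp only [counted, Finset.mem_union, Finset.mem_inter, Finset.mem_sdiff]
    tauto
  · rw [Finset.mem_coe] at hi ⊢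
    simp only [counted, Finset.mem_union, Finset.mem_inter, Finset.mem_sdiff]
    tauto
  · have hi' : i ∈ I.S ∪ I.T := I.cover ▸ Finset.mem_univ i
    have h1 := hx i (by
      simp only [counted, Finset.mem_union, Finset.mem_inter, Finset.mem_sdiff] at hi' ⊢
      tauto)
    have h2 := ha' i
    have h3 := hb' i
    refine ⟨lo (.X i), hlo (.X i), hi (.X i), hhi (.X i), ?_, ?_⟩ <;> dsimp only <;> omega

theorem fails_of_boundDisentailed (h : I.overlappingAllDiff.BoundDisentailed I.domains) :
    I.Fails := by
  by_contra hf
  obtain ⟨lo, hi, hb, hc⟩ := exists_cons_of_not_fails hf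
  exact exists_boundSupport_of_cons hc (fun x => closure_subset x (hb x).1.1)
    (fun x => closure_subset x (hb x).2.1) hb.le h

end OADInstance

/-! ## The example with four variables -/

namespace fourVarExample

/-- The minima of the given domains. -/
def lowerX : Fin 4 → ℤ := ![2, 2, 1, 1]

/-- The maxima of the given domains. -/
def upperX : Fin 4 → ℤ := ![3, 4, 3, 2]

/-- The minima of the domains after enforcing bound consistency in the example. -/
def lower : DVar 4 → ℤ
  | .X i => lowerX i
  | .b i l => if upperX i ≤ l then 1 else 0
  | .a i l u => if (l : ℤ) ≤ lowerX i ∧ upperX i ≤ u then 1 else 0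
  -- The exceptional minimum on `[3, 4]` comes from the pyramid: on `[1, 4]` the counter is `2`,
  -- while on `[1, 2]` it is at most `1`, because one of these two values is taken by `X₄`.
  | .C .st l u => if l = 3 ∧ u = 4 then 1 else
      (if l ≤ 2 ∧ 4 ≤ u then 1 else 0) + (if l ≤ 1 ∧ 3 ≤ u then 1 else 0)
  | .C .s l u => if l ≤ 2 ∧ 3 ≤ u then 1 else 0
  | .C .t l u => if l ≤ 1 ∧ 2 ≤ u then 1 else 0

/-- The maxima of the domains after enforcing bound consistency in the example. -/
def upper : DVar 4 → ℤ
  | .X i => upperX i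
  | .b i l => if (l : ℤ) < lowerX i then 0 else 1
  | .a i l u => if upperX i < l ∨ (u : ℤ) < lowerX i then 0 else 1
  | .C .st l u => if (u ≤ l + 1 ∧ l ≠ 3) ∨ (u ≤ l ∧ l = 3) then 1 else 2
  | .C .s l u => if 3 < l ∨ u < 2 then 0 else 1
  | .C .t l u => if 2 < l ∨ u < 1 then 0 else 1

theorem bounds_X : ∀ i : Fin 4, lowerX i ∈ fourVarExample.dom i ∧
    upperX i ∈ fourVarExample.dom i ∧ lowerX i ≤ upperX i := by
  decide

theorem lower_mem (x : DVar 4) : lower x ∈ fourVarExample.initDom x := by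
  cases x with
  | X i => exact (bounds_X i).1
  | b i l => simp only [lower, OADInstance.initDom]; split_ifs <;> simp
  | a i l u => simp only [lower, OADInstance.initDom]; split_ifs <;> simp
  | C k l u => cases k <;> simp only [lower, OADInstance.initDom] <;> split_ifs <;> simp

theorem upper_mem (x : DVar 4) : upper x ∈ fourVarExample.initDom x := by
  cases x with
  | X i => exact (bounds_X i).2.1
  | b i l => simp only [upper, OADInstance.initDom]; split_ifs <;> simp
  | a i l u => simp only [upper, OADInstance.initDom]; split_ifs <;> simp
  | C k l u => cases k <;> simp only [upper, OADInstance.initDom] <;> split_ifs <;> simp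

theorem lower_le_upper (x : DVar 4) : lower x ≤ upper x := by
  cases x with
  | X i => exact (bounds_X i).2.2
  | b i l => have := (bounds_X i).2.2; simp only [lower, upper]; split_ifs <;> omega
  | a i l u => have := (bounds_X i).2.2; simp only [lower, upper]; split_ifs <;> omega
  | C k l u => cases k <;> simp only [lower, upper] <;> split_ifs <;> omega

theorem counted_eq : fourVarExample.counted .st = {1, 2} ∧ fourVarExample.counted .s = {0} ∧
    fourVarExample.counted .t = {3} := by
  decide

/-- The conditions on `b` and `a` hold by the form of the bounds, whatever the bounds of `X`; those
on the counters are checked window by window. -/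
theorem cons : fourVarExample.Cons lower upper := by
  obtain ⟨h1, h2, h3⟩ := counted_eq
  refine ⟨fun i l _ => ?_, fun i l u hw => ?_, fun k l u hw => ?_, fun l u hw hlu => ?_,
    fun k hk l u hw => ?_⟩
  · simp only [lower, upper]; split_ifs <;> omega
  · have := (bounds_X i).2.2
    obtain ⟨-, h, -, -⟩ := hw
    simp only [lower, upper]; split_ifs <;> omega
  · obtain ⟨hl, hlu, hu, -⟩ := hw
    cases k
    · rw [h1]
      simp only [Finset.sum_pair (show (1 : Fin 4) ≠ 2 by decide), Finset.mem_insert,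
        Finset.mem_singleton, forall_eq_or_imp, forall_eq]
      interval_cases u <;> interval_cases l <;> decide
    · rw [h2]
      simp only [Finset.sum_singleton, Finset.mem_singleton, forall_eq]
      interval_cases u <;> interval_cases l <;> decide
    · rw [h3]
      simp only [Finset.sum_singleton, Finset.mem_singleton, forall_eq]
      interval_cases u <;> interval_cases l <;> decide
  · obtain ⟨hl, -, hu, -⟩ := hw
    interval_cases u <;> interval_cases l <;> decide
  · obtain ⟨hl, hlu, hu, -⟩ := hw
    cases k
    · exact absurd rfl hk
    all_goals interval_cases u <;> interval_cases l <;> decide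

/-- The value `2` for `X₂` forces `X₁ = 3` and `X₄ = 1`, so nothing in `[1, 3]` is left for `X₃`.
Indices in the code start at `0`. -/
theorem no_support : ¬ ∃ x : Fin 4 → ℤ, x 1 = 2 ∧
    fourVarExample.overlappingAllDiff.IsBoundSupport fourVarExample.domains x := by
  rintro ⟨x, hx, ⟨hS, hT⟩, hd⟩
  have hI : ∀ p q v : ℤ, v ∈ boundHull (Finset.Icc p q : Finset ℤ) → p ≤ v ∧ v ≤ q := by
    rintro p q v ⟨r, hr, s, hs, h1, h2⟩
    simp only [Finset.coe_Icc, Set.mem_Icc] at hr hs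
    omega
  have d0 := hI 2 3 _ (hd 0 trivial)
  have d2 := hI 1 3 _ (hd 2 trivial)
  have d3 := hI 1 2 _ (hd 3 trivial)
  have s : ∀ i ∈ fourVarExample.S, ∀ j ∈ fourVarExample.S, i ≠ j → x i ≠ x j :=
    fun i hi j hj hij h => hij (hS hi hj h)
  have t : ∀ i ∈ fourVarExample.T, ∀ j ∈ fourVarExample.T, i ≠ j → x i ≠ x j :=
    fun i hi j hj hij h => hij (hT hi hj h)
  have s01 := s 0 (by decide) 1 (by decide) (by decide)
  have s02 := s 0 (by decide) 2 (by decide) (by decide)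
  have s12 := s 1 (by decide) 2 (by decide) (by decide)
  have t13 := t 1 (by decide) 3 (by decide) (by decide)
  have t23 := t 2 (by decide) 3 (by decide) (by decide)
  omega

theorem isLeast_closure : IsLeast (fourVarExample.closure (.X 1)) 2 := by
  refine ⟨(cons.mem_closure lower_mem upper_mem lower_le_upper (.X 1)).1, fun v hv => ?_⟩
  have : v ∈ Finset.Icc (2 : ℤ) 4 := OADInstance.closure_subset _ hv
  exact (Finset.mem_Icc.1 this).1

theorem not_boundConsistent : ¬ fourVarExample.overlappingAllDiff.BoundConsistent
    (fun i => fourVarExample.closure (.X i)) := by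
  intro h
  obtain ⟨x, hx, h1, h2⟩ := h 1 trivial 2 (Or.inl isLeast_closure)
  exact no_support ⟨x, hx, h1, fun y hy =>
    boundHull_mono (OADInstance.closure_subset (.X y)) (h2 y hy)⟩

end fourVarExample

/-! ## Straight-line programs in nested loops -/

/-- The registers that hold the parameters of a nest of loops: the two dimensions of the input,
two numbers computed from these, and the three loop counters. -/
def paramRegs : List ℕ := [0, 1, 3, 4, 10, 11, 12]

/-- Expressions without subtraction, which may be used as indices. -/
def RExpr.isIdx (ri : List ℕ) : RExpr → Bool
  | .const k => decide (0 ≤ k ∧ k ≤ 100)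
  | .reg r => decide (r ∈ paramRegs)
  | .read A e => decide (A ∈ ri) && e.isIdx ri
  | .add e f => e.isIdx ri && f.isIdx ri
  | .sub _ _ => false
  | .mul e f => e.isIdx ri && f.isIdx ri

/-- Expressions in which all indices have no subtraction. -/
def RExpr.isVal (ri ra : List ℕ) : RExpr → Bool
  | .const k => decide (0 ≤ k ∧ k ≤ 100)
  | .reg r => decide (r ∈ paramRegs)
  | .read A e => decide (A ∈ ra) && e.isIdx ri
  | .add e f => e.isVal ri ra && f.isVal ri ra
  | .sub e f => e.isVal ri ra && f.isVal ri ra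
  | .mul e f => e.isVal ri ra && f.isVal ri ra

/-- The parameters and the arrays that may be read are bounded by `M`. -/
structure RState.Bounded (M : ℤ) (ri ra : List ℕ) (m : RState) : Prop where
  reg : ∀ r ∈ paramRegs, 0 ≤ m.reg r ∧ m.reg r ≤ M
  idx : ∀ A ∈ ri, ∀ j, 0 ≤ m.mem A j ∧ m.mem A j ≤ M
  val : ∀ A ∈ ra, ∀ j, |m.mem A j| ≤ M

/-- Values of expressions are measured by `M` to the power of the cost: the additional factor paid
for an operation absorbs the sum of two powers. -/
theorem pow_add_pow_le_pow {M : ℤ} (hM : 100 ≤ M) (a b : ℕ) : M ^ a + M ^ b ≤ M ^ (a + b + 1) := by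
  have h1 : (1 : ℤ) ≤ M ^ a := one_le_pow₀ (by omega)
  have h2 : (1 : ℤ) ≤ M ^ b := one_le_pow₀ (by omega)
  have h3 : (1 : ℤ) ≤ M ^ a * M ^ b := by nlinarith
  rw [pow_succ, pow_add]
  nlinarith

theorem pow_mul_pow_le_pow {M : ℤ} (hM : 100 ≤ M) (a b : ℕ) : M ^ a * M ^ b ≤ M ^ (a + b + 1) := by
  rw [← pow_add]
  exact pow_le_pow_right₀ (by omega) (by omega)

/-- Without subtraction all values are non-negative, as array indices have to be. The word bound `M
^ e.cost ≤ W` passes to subexpressions because these have smaller cost. -/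
theorem RExpr.isIdx_spec {M W : ℤ} (hM : 100 ≤ M) {ri ra : List ℕ} {m : RState}
    (hm : m.Bounded M ri ra) (e : RExpr) (he : e.isIdx ri = true) :
    0 ≤ e.eval m ∧ e.eval m ≤ M ^ e.cost ∧ (M ^ e.cost ≤ W → e.Fits W m) := by
  have hmono : ∀ {a b : ℕ}, a ≤ b → M ^ a ≤ M ^ b := fun h => pow_le_pow_right₀ (by omega) h
  have hself : ∀ c : ℕ, 1 ≤ c → M ≤ M ^ c := fun c hc => by
    simpa using hmono hc
  induction e with
  | const k =>
    simp only [RExpr.isIdx, decide_eq_true_eq] at he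
    simp only [RExpr.eval, RExpr.cost, pow_one, RExpr.Fits]
    exact ⟨he.1, by omega, fun h => by rw [abs_of_nonneg he.1]; omega⟩
  | reg r =>
    simp only [RExpr.isIdx, decide_eq_true_eq] at he
    simp only [RExpr.eval, RExpr.cost, pow_one, RExpr.Fits]
    exact ⟨(hm.reg r he).1, (hm.reg r he).2, fun _ => trivial⟩
  | read A e ih =>
    simp only [RExpr.isIdx, Bool.and_eq_true, decide_eq_true_eq] at he
    obtain ⟨h1, h2, h3⟩ := ih he.2
    have h4 := hm.idx A he.1 (e.eval m).toNat
    simp only [RExpr.eval, RExpr.cost, RExpr.Fits]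
    exact ⟨h4.1, h4.2.trans (hself _ (by omega)), fun h => ⟨h3 ((hmono (by omega)).trans h), h1⟩⟩
  | add e f ihe ihf =>
    simp only [RExpr.isIdx, Bool.and_eq_true] at he
    obtain ⟨h1, h2, h3⟩ := ihe he.1
    obtain ⟨k1, k2, k3⟩ := ihf he.2
    have := pow_add_pow_le_pow hM e.cost f.cost
    simp only [RExpr.eval, RExpr.cost, RExpr.Fits]
    exact ⟨by omega, by omega, fun h => ⟨h3 ((hmono (by omega)).trans h),
      k3 ((hmono (by omega)).trans h), by rw [abs_of_nonneg (by omega)]; omega⟩⟩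
  | sub e f => simp [RExpr.isIdx] at he
  | mul e f ihe ihf =>
    simp only [RExpr.isIdx, Bool.and_eq_true] at he
    obtain ⟨h1, h2, h3⟩ := ihe he.1
    obtain ⟨k1, k2, k3⟩ := ihf he.2
    have := pow_mul_pow_le_pow hM e.cost f.cost
    have h5 : e.eval m * f.eval m ≤ M ^ e.cost * M ^ f.cost :=
      mul_le_mul h2 k2 k1 (by positivity)
    have h6 := mul_nonneg h1 k1
    simp only [RExpr.eval, RExpr.cost, RExpr.Fits]
    exact ⟨h6, by omega, fun h => ⟨h3 ((hmono (by omega)).trans h),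
      k3 ((hmono (by omega)).trans h), by rw [abs_of_nonneg h6]; omega⟩⟩

/-- Here subtraction is allowed, since the values are only stored or compared; absolute values obey
the same estimate. -/
theorem RExpr.isVal_spec {M W : ℤ} (hM : 100 ≤ M) {ri ra : List ℕ} {m : RState}
    (hm : m.Bounded M ri ra) (e : RExpr) (he : e.isVal ri ra = true) :
    |e.eval m| ≤ M ^ e.cost ∧ (M ^ e.cost ≤ W → e.Fits W m) := by
  have hmono : ∀ {a b : ℕ}, a ≤ b → M ^ a ≤ M ^ b := fun h => pow_le_pow_right₀ (by omega) h
  have hself : ∀ c : ℕ, 1 ≤ c → M ≤ M ^ c := fun c hc => by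
    simpa using hmono hc
  induction e with
  | const k =>
    simp only [RExpr.isVal, decide_eq_true_eq] at he
    simp only [RExpr.eval, RExpr.cost, pow_one, RExpr.Fits, abs_of_nonneg he.1]
    exact ⟨by omega, fun h => by omega⟩
  | reg r =>
    simp only [RExpr.isVal, decide_eq_true_eq] at he
    simp only [RExpr.eval, RExpr.cost, pow_one, RExpr.Fits, abs_of_nonneg (hm.reg r he).1]
    exact ⟨(hm.reg r he).2, fun _ => trivial⟩
  | read A e =>
    simp only [RExpr.isVal, Bool.and_eq_true, decide_eq_true_eq] at he
    obtain ⟨h1, h2, h3⟩ := RExpr.isIdx_spec (W := W) hM hm e he.2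
    simp only [RExpr.eval, RExpr.cost, RExpr.Fits]
    exact ⟨(hm.val A he.1 _).trans (hself _ (by omega)),
      fun h => ⟨h3 ((hmono (by omega)).trans h), h1⟩⟩
  | add e f ihe ihf =>
    simp only [RExpr.isVal, Bool.and_eq_true] at he
    obtain ⟨h2, h3⟩ := ihe he.1
    obtain ⟨k2, k3⟩ := ihf he.2
    have h4 := (abs_add_le (e.eval m) (f.eval m)).trans ((add_le_add h2 k2).trans
      (pow_add_pow_le_pow hM e.cost f.cost))
    simp only [RExpr.eval, RExpr.cost, RExpr.Fits]
    exact ⟨h4, fun h => ⟨h3 ((hmono (by omega)).trans h), k3 ((hmono (by omega)).trans h),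
      h4.trans h⟩⟩
  | sub e f ihe ihf =>
    simp only [RExpr.isVal, Bool.and_eq_true] at he
    obtain ⟨h2, h3⟩ := ihe he.1
    obtain ⟨k2, k3⟩ := ihf he.2
    have h4 := (abs_sub (e.eval m) (f.eval m)).trans ((add_le_add h2 k2).trans
      (pow_add_pow_le_pow hM e.cost f.cost))
    simp only [RExpr.eval, RExpr.cost, RExpr.Fits]
    exact ⟨h4, fun h => ⟨h3 ((hmono (by omega)).trans h), k3 ((hmono (by omega)).trans h),
      h4.trans h⟩⟩
  | mul e f ihe ihf =>
    simp only [RExpr.isVal, Bool.and_eq_true] at he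
    obtain ⟨h2, h3⟩ := ihe he.1
    obtain ⟨k2, k3⟩ := ihf he.2
    have h4 : |e.eval m * f.eval m| ≤ M ^ (e.cost + f.cost + 1) := by
      rw [abs_mul]
      exact (mul_le_mul h2 k2 (abs_nonneg _) (by positivity)).trans
        (pow_mul_pow_le_pow hM e.cost f.cost)
    simp only [RExpr.eval, RExpr.cost, RExpr.Fits]
    exact ⟨h4, fun h => ⟨h3 ((hmono (by omega)).trans h), k3 ((hmono (by omega)).trans h),
      h4.trans h⟩⟩

/-- Two memories agree in the parameters and in the arrays that may be read. -/
structure RState.Agree (ri ra : List ℕ) (m m' : RState) : Prop where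
  reg : ∀ r ∈ paramRegs, m.reg r = m'.reg r
  idx : ∀ A ∈ ri, m.mem A = m'.mem A
  val : ∀ A ∈ ra, m.mem A = m'.mem A

theorem RState.Agree.bounded {M : ℤ} {ri ra : List ℕ} {m m' : RState} (h : m.Agree ri ra m')
    (hm : m'.Bounded M ri ra) : m.Bounded M ri ra :=
  ⟨fun r hr => h.reg r hr ▸ hm.reg r hr, fun A hA => h.idx A hA ▸ hm.idx A hA,
    fun A hA => h.val A hA ▸ hm.val A hA⟩

theorem RState.Agree.eval_idx {ri ra : List ℕ} {m m' : RState} (h : m.Agree ri ra m')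
    (e : RExpr) (he : e.isIdx ri = true) : e.eval m = e.eval m' := by
  induction e with
  | const k => rfl
  | reg r =>
    simp only [RExpr.isIdx, decide_eq_true_eq] at he
    exact h.reg r he
  | read A e ih =>
    simp only [RExpr.isIdx, Bool.and_eq_true, decide_eq_true_eq] at he
    simp only [RExpr.eval, ih he.2, h.idx A he.1]
  | add e f ihe ihf =>
    simp only [RExpr.isIdx, Bool.and_eq_true] at he
    simp only [RExpr.eval, ihe he.1, ihf he.2]
  | sub e f => simp [RExpr.isIdx] at he
  | mul e f ihe ihf =>
    simp only [RExpr.isIdx, Bool.and_eq_true] at he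
    simp only [RExpr.eval, ihe he.1, ihf he.2]

theorem RState.Agree.eval_val {ri ra : List ℕ} {m m' : RState} (h : m.Agree ri ra m')
    (e : RExpr) (he : e.isVal ri ra = true) : e.eval m = e.eval m' := by
  induction e with
  | const k => rfl
  | reg r =>
    simp only [RExpr.isVal, decide_eq_true_eq] at he
    exact h.reg r he
  | read A e =>
    simp only [RExpr.isVal, Bool.and_eq_true, decide_eq_true_eq] at he
    simp only [RExpr.eval, h.eval_idx e he.2, h.val A he.1]
  | add e f ihe ihf =>
    simp only [RExpr.isVal, Bool.and_eq_true] at he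
    simp only [RExpr.eval, ihe he.1, ihf he.2]
  | sub e f ihe ihf =>
    simp only [RExpr.isVal, Bool.and_eq_true] at he
    simp only [RExpr.eval, ihe he.1, ihf he.2]
  | mul e f ihe ihf =>
    simp only [RExpr.isVal, Bool.and_eq_true] at he
    simp only [RExpr.eval, ihe he.1, ihf he.2]

/-! ### Operations with arguments that do not depend on earlier operations -/

/-- Operations: add the edge from `x` to `g` to the linked lists of edges; set the data of the
gate `g`; write a value. -/
inductive Op
  | edge (x g : RExpr)
  | gate (g c ob inh : RExpr)
  | put (A : ℕ) (j v : RExpr)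

/-- The program of an operation: array `20` holds the heads of the lists of edges, `21` the next
edges, `22` the targets; register `5` is the number of edges. -/
def Op.prog : Op → RProg
  | .edge x g => .seq (.assign 5 (.add (.reg 5) (.const 1)))
      (.seq (.store 21 (.reg 5) (.read 20 x)) (.seq (.store 22 (.reg 5) g) (.store 20 x (.reg 5))))
  | .gate g c ob inh => .seq (.store 23 g c) (.seq (.store 24 g ob) (.store 25 g inh))
  | .put A j v => .store A j v

/-- Operations with evaluated arguments. -/
inductive EOp
  | edge (x g : ℕ)
  | gate (g : ℕ) (c ob inh : ℤ)
  | put (A j : ℕ) (v : ℤ)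

/-- Evaluation of the arguments of an operation. -/
def Op.eval (m : RState) : Op → EOp
  | .edge x g => .edge (x.eval m).toNat (g.eval m).toNat
  | .gate g c ob inh => .gate (g.eval m).toNat (c.eval m) (ob.eval m) (inh.eval m)
  | .put A j v => .put A (j.eval m).toNat (v.eval m)

/-- The effect of an operation. -/
def EOp.apply (m : RState) : EOp → RState
  | .edge x g => (((m.setReg 5 (m.reg 5 + 1)).setMem 21 (m.reg 5 + 1).toNat (m.mem 20 x)).setMem 22
      (m.reg 5 + 1).toNat g).setMem 20 x (m.reg 5 + 1)
  | .gate g c ob inh => ((m.setMem 23 g c).setMem 24 g ob).setMem 25 g inh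
  | .put A j v => m.setMem A j v

/-- The arrays to which an operation writes. -/
def Op.writes : Op → List ℕ
  | .edge _ _ => [20, 21, 22]
  | .gate _ _ _ _ => [23, 24, 25]
  | .put A _ _ => [A]

/-- The arguments of an operation. -/
def Op.idxArgs : Op → List RExpr
  | .edge x g => [x, g]
  | .gate g _ _ _ => [g]
  | .put _ j _ => [j]

/-- The arguments of an operation that are stored only. -/
def Op.valArgs : Op → List RExpr
  | .edge _ _ => []
  | .gate _ c ob inh => [c, ob, inh]
  | .put _ _ v => [v]

/-- A bounded expression. -/
abbrev RExpr.isSmall (e : RExpr) : Bool := decide (e.cost ≤ 64)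

/-- The operation is well-formed. -/
def Op.ok (ri ra : List ℕ) (o : Op) : Bool :=
  o.writes.all (fun A => decide (A ∉ ri ∧ A ∉ ra)) &&
  o.idxArgs.all (fun e => e.isIdx ri && e.isSmall) &&
  o.valArgs.all (fun e => e.isVal ri ra && e.isSmall)

theorem RState.Agree.setReg_five {ri ra : List ℕ} {m m' : RState} (h : m.Agree ri ra m') (v : ℤ) :
    (m.setReg 5 v).Agree ri ra m' := by
  refine ⟨fun r hr => ?_, h.idx, h.val⟩
  have : r ≠ 5 := by rintro rfl; simp [paramRegs] at hr
  simp only [RState.setReg, Function.update_of_ne this]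
  exact h.reg r hr

theorem RState.Agree.setMem {ri ra : List ℕ} {m m' : RState} (h : m.Agree ri ra m') {A : ℕ}
    (hA : A ∉ ri ∧ A ∉ ra) (j : ℕ) (v : ℤ) : (m.setMem A j v).Agree ri ra m' := by
  refine ⟨h.reg, fun B hB => ?_, fun B hB => ?_⟩
  · have : B ≠ A := by rintro rfl; exact hA.1 hB
    simp only [RState.setMem, Function.update_of_ne this]
    exact h.idx B hB
  · have : B ≠ A := by rintro rfl; exact hA.2 hB
    simp only [RState.setMem, Function.update_of_ne this]
    exact h.val B hB

/-- A well-formed operation writes only to arrays that no expression reads, and to register `5`,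
which is not a parameter. -/
theorem Op.apply_agree {ri ra : List ℕ} {m m' : RState} (h : m.Agree ri ra m') (o : Op)
    (ho : o.ok ri ra = true) (m₁ : RState) : ((o.eval m₁).apply m).Agree ri ra m' := by
  cases o <;>
    simp only [Op.ok, Op.writes, Bool.and_eq_true, List.all_cons, List.all_nil, and_true,
      decide_eq_true_eq] at ho
  · exact (((h.setReg_five _).setMem ho.1.1.2.1 _ _).setMem ho.1.1.2.2 _ _).setMem ho.1.1.1 _ _
  · exact ((h.setMem ho.1.1.1 _ _).setMem ho.1.1.2.1 _ _).setMem ho.1.1.2.2 _ _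
  · exact h.setMem ho.1.1 _ _

theorem RExec.assign_of_eval {W : ℤ} {r : ℕ} {e : RExpr} {m : RState} {v : ℤ}
    (he : e.Fits W m) (hv : e.eval m = v) :
    RExec W (.assign r e) m (e.cost + 1) (m.setReg r v) :=
  hv ▸ .assign r e m he

theorem RExec.store_of_eval {W : ℤ} {A : ℕ} {e f : RExpr} {m : RState} {j v : ℤ}
    (he : e.Fits W m) (hf : f.Fits W m) (hj : e.eval m = j) (hj' : 0 ≤ j) (hv : f.eval m = v) :
    RExec W (.store A e f) m (e.cost + f.cost + 1) (m.setMem A j.toNat v) := by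
  subst hj hv
  exact .store A e f m he hf hj'

/-- Agreement with `m₀` survives every single write, so each argument has its value in `m₀` whenever
it is evaluated. Arguments of cost at most `64` keep every operation below `400` steps. -/
theorem Op.exec {M W : ℤ} (hM : 100 ≤ M) (hW : M ^ 64 ≤ W) {ri ra : List ℕ} {m m₀ : RState}
    (h : m.Agree ri ra m₀) (hm : m₀.Bounded M ri ra) (o : Op) (ho : o.ok ri ra = true)
    (h5 : 0 ≤ m.reg 5) (h5' : m.reg 5 + 1 ≤ W) :
    ∃ t ≤ 400, RExec W o.prog m t ((o.eval m₀).apply m) := by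
  have hmono : ∀ {a b : ℕ}, a ≤ b → M ^ a ≤ M ^ b := fun h => pow_le_pow_right₀ (by omega) h
  have hM64 : M ≤ M ^ 64 := by simpa using hmono (show 1 ≤ 64 by norm_num)
  have hidx : ∀ {m : RState}, m.Agree ri ra m₀ → ∀ e : RExpr, e.isIdx ri = true → e.cost ≤ 64 →
      e.Fits W m ∧ e.eval m = e.eval m₀ ∧ 0 ≤ e.eval m₀ := fun h e he hc =>
    ⟨(RExpr.isIdx_spec hM (h.bounded hm) e he).2.2 ((hmono hc).trans hW), h.eval_idx e he,
      (RExpr.isIdx_spec (W := W) hM hm e he).1⟩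
  have hval : ∀ {m : RState}, m.Agree ri ra m₀ → ∀ e : RExpr, e.isVal ri ra = true → e.cost ≤ 64 →
      e.Fits W m ∧ e.eval m = e.eval m₀ := fun h e he hc =>
    ⟨(RExpr.isVal_spec hM (h.bounded hm) e he).2 ((hmono hc).trans hW), h.eval_val e he⟩
  cases o with
  | edge x g =>
    simp only [Op.ok, Op.writes, Op.idxArgs, Op.valArgs, Bool.and_eq_true, List.all_cons,
      List.all_nil, and_true, decide_eq_true_eq] at ho
    obtain ⟨⟨w20, w21, w22⟩, ⟨hx, hxc⟩, hg, hgc⟩ := ho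
    have a1 := h.setReg_five (m.reg 5 + 1)
    have x1 := hidx a1 x hx hxc
    have a2 := a1.setMem w21 (m.reg 5 + 1).toNat (m.mem 20 (x.eval m₀).toNat)
    have g2 := hidx a2 g hg hgc
    have a3 := a2.setMem w22 (m.reg 5 + 1).toNat (g.eval m₀)
    have x3 := hidx a3 x hx hxc
    have r0 : RExec W (.assign 5 (.add (.reg 5) (.const 1))) m 4 (m.setReg 5 (m.reg 5 + 1)) :=
      .assign_of_eval ⟨trivial, by simp only [RExpr.Fits, abs_one]; omega,
        by simp only [RExpr.eval]; rw [abs_of_nonneg (by omega)]; exact h5'⟩ rfl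
    have r1 := RExec.store_of_eval (W := W) (A := 21) (e := .reg 5) (f := .read 20 x)
      (m := m.setReg 5 (m.reg 5 + 1)) (j := m.reg 5 + 1) (v := m.mem 20 (x.eval m₀).toNat) trivial
      ⟨x1.1, by rw [x1.2.1]; exact x1.2.2⟩ (by simp [RExpr.eval, RState.setReg]) (by omega)
      (by simp only [RExpr.eval, x1.2.1]; rfl)
    have r2 := RExec.store_of_eval (W := W) (A := 22) (e := .reg 5) (f := g)
      (j := m.reg 5 + 1) trivial g2.1 (by simp [RExpr.eval, RState.setReg, RState.setMem])
      (by omega) g2.2.1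
    have r3 := RExec.store_of_eval (W := W) (A := 20) (e := x) (f := .reg 5)
      (v := m.reg 5 + 1) x3.1 trivial x3.2.1 x3.2.2
      (by simp [RExpr.eval, RState.setReg, RState.setMem])
    have r4 := RExec.seq _ _ _ _ _ _ _ r0 (.seq _ _ _ _ _ _ _ r1 (.seq _ _ _ _ _ _ _ r2 r3))
    refine ⟨_, ?_, Eq.mp (congrArg (RExec W _ m _) ?_) r4⟩
    · simp only [RExpr.cost]; omega
    · simp only [EOp.apply, Op.eval, Int.toNat_of_nonneg g2.2.2]
  | gate g c ob inh =>
    simp only [Op.ok, Op.writes, Op.idxArgs, Op.valArgs, Bool.and_eq_true, List.all_cons,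
      List.all_nil, and_true, decide_eq_true_eq] at ho
    obtain ⟨⟨⟨w23, w24, w25⟩, hg, hgc⟩, ⟨hc, hcc⟩, ⟨hob, hobc⟩, hinh, hinhc⟩ := ho
    have g1 := hidx h g hg hgc
    have c1 := hval h c hc hcc
    have a2 := h.setMem w23 (g.eval m₀).toNat (c.eval m₀)
    have g2 := hidx a2 g hg hgc
    have c2 := hval a2 ob hob hobc
    have a3 := a2.setMem w24 (g.eval m₀).toNat (ob.eval m₀)
    have g3 := hidx a3 g hg hgc
    have c3 := hval a3 inh hinh hinhc
    have r1 := RExec.store_of_eval (A := 23) g1.1 c1.1 g1.2.1 g1.2.2 c1.2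
    have r2 := RExec.store_of_eval (A := 24) g2.1 c2.1 g2.2.1 g2.2.2 c2.2
    have r3 := RExec.store_of_eval (A := 25) g3.1 c3.1 g3.2.1 g3.2.2 c3.2
    exact ⟨_, by omega, .seq _ _ _ _ _ _ _ r1 (.seq _ _ _ _ _ _ _ r2 r3)⟩
  | put A j v =>
    simp only [Op.ok, Op.writes, Op.idxArgs, Op.valArgs, Bool.and_eq_true, List.all_cons,
      List.all_nil, and_true, decide_eq_true_eq] at ho
    obtain ⟨⟨w, hj, hjc⟩, hv, hvc⟩ := ho
    have g1 := hidx h j hj hjc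
    have c1 := hval h v hv hvc
    exact ⟨_, by omega, .store_of_eval (A := A) g1.1 c1.1 g1.2.1 g1.2.2 c1.2⟩

/-! ### Guarded operations -/

/-- A guarded operation: it is performed if `e ≤ f` for all the guards `(e, f)`. -/
structure Item where
  guards : List (RExpr × RExpr)
  op : Op

/-- All the guards are satisfied. -/
def guardsHold (m : RState) (gs : List (RExpr × RExpr)) : Prop :=
  ∀ g ∈ gs, g.1.eval m ≤ g.2.eval m

/-- The program of a guarded operation. -/
def guardProg (p : RProg) : List (RExpr × RExpr) → RProg
  | [] => p
  | g :: gs => .ite g.1 g.2 (guardProg p gs) .skip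

/-- The program of a list of guarded operations. -/
def itemsProg : List Item → RProg
  | [] => .skip
  | i :: is => .seq (guardProg i.op.prog i.guards) (itemsProg is)

open Classical in
/-- The operations performed by a list of guarded operations. -/
noncomputable def itemsOps (m : RState) (is : List Item) : List EOp :=
  is.flatMap fun i => if guardsHold m i.guards then [i.op.eval m] else []

/-- Guards are well-formed. -/
def guardsOk (ri ra : List ℕ) (gs : List (RExpr × RExpr)) : Bool :=
  gs.all fun g => g.1.isVal ri ra && g.1.isSmall && g.2.isVal ri ra && g.2.isSmall

/-- The guarded operations are well-formed. -/
def itemsOk (ri ra : List ℕ) (is : List Item) : Bool :=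
  is.all fun i => guardsOk ri ra i.guards && i.op.ok ri ra

/-- The memory after a list of operations. -/
def runOps (m : RState) (os : List EOp) : RState :=
  os.foldl EOp.apply m

/-- The memory `m'` serves both outcomes: if a guard fails nothing happens, and `m' = m`. A test
takes at most `64 + 64 + 1 = 129` steps. -/
theorem guardProg_exec {M W : ℤ} (hM : 100 ≤ M) (hW : M ^ 64 ≤ W) {ri ra : List ℕ}
    {m m₀ : RState} (h : m.Agree ri ra m₀) (hm : m₀.Bounded M ri ra) (p : RProg) (m' : RState)
    (T : ℕ) (hT : 1 ≤ T) (gs : List (RExpr × RExpr)) (hgs : guardsOk ri ra gs = true)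
    (hp : guardsHold m₀ gs → ∃ t ≤ T, RExec W p m t m')
    (hp' : ¬ guardsHold m₀ gs → m' = m) :
    ∃ t ≤ T + 129 * gs.length, RExec W (guardProg p gs) m t m' := by
  have hmono : ∀ {a b : ℕ}, a ≤ b → M ^ a ≤ M ^ b := fun h => pow_le_pow_right₀ (by omega) h
  induction gs with
  | nil => exact hp (by simp [guardsHold])
  | cons g gs ih =>
    simp only [guardsOk, List.all_cons, Bool.and_eq_true, decide_eq_true_eq] at hgs
    obtain ⟨⟨⟨⟨h1, h2⟩, h3⟩, h4⟩, h5⟩ := hgs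
    have f1 := (RExpr.isVal_spec hM (h.bounded hm) g.1 h1).2 ((hmono h2).trans hW)
    have f2 := (RExpr.isVal_spec hM (h.bounded hm) g.2 h3).2 ((hmono h4).trans hW)
    have e1 := h.eval_val g.1 h1
    have e2 := h.eval_val g.2 h3
    simp only [guardsHold, List.forall_mem_cons] at hp hp'
    simp only [List.length_cons]
    by_cases hc : g.1.eval m ≤ g.2.eval m
    · obtain ⟨t, ht, hx⟩ := ih h5 (fun hg => hp ⟨by omega, hg⟩) (fun hg => hp' fun hh => hg hh.2)
      exact ⟨_, by omega, .ite_true _ _ _ _ _ _ _ f1 f2 hc hx⟩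
    · rw [hp' fun hh => hc (by rw [e1, e2]; exact hh.1)]
      exact ⟨_, by omega, .ite_false _ _ _ _ _ _ _ f1 f2 (by omega) (.skip m)⟩

theorem EOp.apply_reg (o : EOp) (m : RState) (r : ℕ) (hr : r ≠ 5) :
    (o.apply m).reg r = m.reg r := by
  cases o <;> simp [EOp.apply, RState.setReg, RState.setMem, hr]

theorem EOp.apply_reg_five (o : EOp) (m : RState) :
    m.reg 5 ≤ (o.apply m).reg 5 ∧ (o.apply m).reg 5 ≤ m.reg 5 + 1 := by
  cases o <;> simp [EOp.apply, RState.setReg, RState.setMem]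

/-- A bound for the number of steps of a list of guarded operations. -/
def itemsTime : List Item → ℕ
  | [] => 1
  | i :: is => 400 + 129 * i.guards.length + itemsTime is

/-- The operations can be read off from `m₀` in advance, because each of them preserves agreement
with `m₀`. Only register `5` changes, by at most one per item. -/
theorem itemsProg_exec {M W : ℤ} (hM : 100 ≤ M) (hW : M ^ 64 ≤ W) {ri ra : List ℕ}
    {m₀ : RState} (hm : m₀.Bounded M ri ra) (is : List Item) (his : itemsOk ri ra is = true)
    (m : RState) (h : m.Agree ri ra m₀) (h5 : 0 ≤ m.reg 5) (h5' : m.reg 5 + is.length ≤ W) :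
    (∃ t ≤ itemsTime is, RExec W (itemsProg is) m t (runOps m (itemsOps m₀ is))) ∧
    (runOps m (itemsOps m₀ is)).Agree ri ra m₀ ∧
    (∀ r ≠ 5, (runOps m (itemsOps m₀ is)).reg r = m.reg r) ∧
    m.reg 5 ≤ (runOps m (itemsOps m₀ is)).reg 5 ∧
    (runOps m (itemsOps m₀ is)).reg 5 ≤ m.reg 5 + is.length := by
  classical
  induction is generalizing m with
  | nil => exact ⟨⟨1, le_refl _, .skip m⟩, h, fun _ _ => rfl, le_refl _, by simp [runOps, itemsOps]⟩
  | cons i is ih =>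
    simp only [itemsOk, List.all_cons, Bool.and_eq_true] at his
    simp only [List.length_cons, Nat.cast_add, Nat.cast_one] at h5' ⊢
    by_cases hg : guardsHold m₀ i.guards
    · have e : itemsOps m₀ (i :: is) = i.op.eval m₀ :: itemsOps m₀ is := by
        simp [itemsOps, hg]
      have hr5 := (i.op.eval m₀).apply_reg_five m
      obtain ⟨⟨t, ht, hx⟩, h1, h2, h3, h4⟩ := ih his.2 _ (i.op.apply_agree h his.1.2 m₀)
        (by omega) (by omega)
      obtain ⟨t', ht', hx'⟩ := guardProg_exec hM hW h hm i.op.prog _ 400 (by omega) i.guards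
        his.1.1 (fun _ => i.op.exec hM hW h hm his.1.2 h5 (by omega)) (fun hh => absurd hg hh)
      rw [e]
      refine ⟨⟨t' + t, ?_, .seq _ _ _ _ _ _ _ hx' hx⟩, h1, fun r hr => ?_, h3.trans' hr5.1, ?_⟩
      · simp only [itemsTime]; omega
      · exact (h2 r hr).trans (EOp.apply_reg _ m r hr)
      · exact h4.trans (by omega)
    · have e : itemsOps m₀ (i :: is) = itemsOps m₀ is := by
        simp [itemsOps, hg]
      obtain ⟨⟨t, ht, hx⟩, h1, h2, h3, h4⟩ := ih his.2 m h h5 (by omega)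
      obtain ⟨t', ht', hx'⟩ := guardProg_exec hM hW h hm i.op.prog m 400 (by omega) i.guards
        his.1.1 (fun hh => absurd hh hg) (fun _ => rfl)
      rw [e]
      refine ⟨⟨t' + t, ?_, .seq _ _ _ _ _ _ _ hx' hx⟩, h1, h2, h3, by omega⟩
      simp only [itemsTime]; omega

/-! ### Loops -/

/-- `for r := 0, …, hi do p`. -/
def forProg (r : ℕ) (hi : RExpr) (p : RProg) : RProg :=
  .seq (.assign r (.const 0))
    (.loop (.reg r) hi (.seq p (.assign r (.add (.reg r) (.const 1)))))

/-- `Inv k` describes the memory when the test is reached with counter `k`. The limit `N` is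
inclusive, so there are `N + 1` rounds. A round adds at most `9` steps to the body (test and
increment), and initialisation and last test at most `7` in total. -/
theorem forProg_exec {W : ℤ} (r : ℕ) (hi : RExpr) (p : RProg) (N T : ℕ) (hc : hi.cost ≤ 3)
    (hW : (N : ℤ) + 1 ≤ W) (Inv : ℕ → RState → Prop)
    (hInv : ∀ k m, Inv k m → m.reg r = k ∧ hi.Fits W m ∧ hi.eval m = N)
    (hp : ∀ k ≤ N, ∀ m, Inv k m → ∃ t ≤ T, ∃ m', RExec W p m t m' ∧ m'.reg r = k ∧
      Inv (k + 1) (m'.setReg r (k + 1 : ℕ))) (m : RState) (h0 : Inv 0 (m.setReg r 0)) :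
    ∃ t ≤ (N + 1) * (T + 16), ∃ m', RExec W (forProg r hi p) m t m' ∧ Inv (N + 1) m' := by
  have key : ∀ j k, k + j = N + 1 → ∀ m, Inv k m → ∃ t ≤ j * (T + 9) + 5, ∃ m',
      RExec W (.loop (.reg r) hi (.seq p (.assign r (.add (.reg r) (.const 1))))) m t m' ∧
      Inv (N + 1) m' := by
    intro j
    induction j with
    | zero =>
      intro k hk m hm
      obtain ⟨h1, h2, h3⟩ := hInv k m hm
      obtain rfl : k = N + 1 := by omega
      exact ⟨_, by simp only [RExpr.cost]; omega, m, .loop_done _ _ _ _ trivial h2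
        (by simp only [RExpr.eval]; rw [h1, h3]; omega), hm⟩
    | succ j ih =>
      intro k hk m hm
      obtain ⟨h1, h2, h3⟩ := hInv k m hm
      obtain ⟨t, ht, m', hx, hr, hI⟩ := hp k (by omega) m hm
      obtain ⟨t', ht', m'', hx', hI'⟩ := ih (k + 1) (by omega) _ hI
      have hx2 : RExec W (.assign r (.add (.reg r) (.const 1))) m' 4 (m'.setReg r (k + 1 : ℕ)) :=
        .assign_of_eval ⟨trivial, by simp only [RExpr.Fits, abs_one]; omega,
          by simp only [RExpr.eval, hr]; rw [abs_of_nonneg (by omega)]; omega⟩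
          (by simp [RExpr.eval, hr])
      refine ⟨_, ?_, m'', .loop_step _ _ _ _ _ _ _ _ trivial h2
        (by simp only [RExpr.eval]; rw [h1, h3]; omega) (.seq _ _ _ _ _ _ _ hx hx2) hx', hI'⟩
      simp only [RExpr.cost]
      rw [Nat.succ_mul]
      omega
  obtain ⟨t, ht, m', hx, hI⟩ := key (N + 1) 0 (by omega) _ h0
  refine ⟨_, ?_, m', .seq _ _ _ _ _ _ _ (.assign r (.const 0) m ?_) hx, hI⟩
  · simp only [RExpr.cost]
    have : (N + 1) * (T + 16) = (N + 1) * (T + 9) + (N + 1) * 7 := by ring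
    omega
  · simp only [RExpr.Fits, abs_zero]; omega

/-- A list of guarded operations in a nest of three loops. -/
def boxProg (is : List Item) : RProg :=
  forProg 10 (.add (.reg 1) (.const 1)) (forProg 11 (.add (.reg 1) (.const 1))
    (forProg 12 (.add (.reg 0) (.const 1)) (itemsProg is)))

/-- The memory with given loop counters. -/
def RState.withCounters (m : RState) (l u j : ℕ) : RState :=
  ((m.setReg 10 l).setReg 11 u).setReg 12 j

/-- The operations in the nest of loops. -/
noncomputable def boxOps (m : RState) (n d : ℕ) (is : List Item) : List EOp :=
  (List.range (d + 2)).flatMap fun l => (List.range (d + 2)).flatMap fun u =>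
    (List.range (n + 2)).flatMap fun j => itemsOps (m.withCounters l u j) is

/-- The memory `m` is the result of the operations `os` in the memory `m₀`, up to the loop
counters. -/
structure LoopRel (ri ra : List ℕ) (m₀ : RState) (os : List EOp) (N : ℕ) (m : RState) : Prop where
  mem : m.mem = (runOps m₀ os).mem
  reg : ∀ r, r ≠ 10 → r ≠ 11 → r ≠ 12 → m.reg r = (runOps m₀ os).reg r
  reg' : ∀ r, r ≠ 5 → r ≠ 10 → r ≠ 11 → r ≠ 12 → m.reg r = m₀.reg r
  idx : ∀ A ∈ ri, m.mem A = m₀.mem A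
  val : ∀ A ∈ ra, m.mem A = m₀.mem A
  five : m₀.reg 5 ≤ m.reg 5 ∧ m.reg 5 ≤ m₀.reg 5 + N

/-- Operations with evaluated arguments consult no register except `5`, so the loop counters are
irrelevant to their effect. -/
theorem EOp.apply_congr (o : EOp) {m m' : RState} (h : m.mem = m'.mem)
    (h' : ∀ r, r ≠ 10 → r ≠ 11 → r ≠ 12 → m.reg r = m'.reg r) :
    (o.apply m).mem = (o.apply m').mem ∧
    ∀ r, r ≠ 10 → r ≠ 11 → r ≠ 12 → (o.apply m).reg r = (o.apply m').reg r := by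
  have h5 := h' 5 (by norm_num) (by norm_num) (by norm_num)
  cases o with
  | edge x g =>
    refine ⟨by simp [EOp.apply, RState.setReg, RState.setMem, h, h5], fun r h1 h2 h3 => ?_⟩
    simp only [EOp.apply, RState.setReg, RState.setMem, h5]
    by_cases hr : r = 5
    · subst hr; simp
    · simp only [Function.update_of_ne hr]; exact h' r h1 h2 h3
  | gate g c ob inh =>
    exact ⟨by simp [EOp.apply, RState.setMem, h], h'⟩
  | put A j v =>
    exact ⟨by simp [EOp.apply, RState.setMem, h], h'⟩

theorem runOps_congr (os : List EOp) {m m' : RState} (h : m.mem = m'.mem)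
    (h' : ∀ r, r ≠ 10 → r ≠ 11 → r ≠ 12 → m.reg r = m'.reg r) :
    (runOps m os).mem = (runOps m' os).mem ∧
    ∀ r, r ≠ 10 → r ≠ 11 → r ≠ 12 → (runOps m os).reg r = (runOps m' os).reg r := by
  induction os generalizing m m' with
  | nil => exact ⟨h, h'⟩
  | cons o os ih =>
    obtain ⟨h1, h2⟩ := o.apply_congr h h'
    exact ih h1 h2

theorem runOps_append (m : RState) (os os' : List EOp) :
    runOps m (os ++ os') = runOps (runOps m os) os' :=
  List.foldl_append

theorem LoopRel.setReg {ri ra : List ℕ} {m₀ : RState} {os : List EOp} {N : ℕ} {m : RState}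
    (h : LoopRel ri ra m₀ os N m) (r : ℕ) (hr : r = 10 ∨ r = 11 ∨ r = 12) (v : ℤ) :
    LoopRel ri ra m₀ os N (m.setReg r v) := by
  refine ⟨h.mem, fun q h1 h2 h3 => ?_, fun q h0 h1 h2 h3 => ?_, h.idx, h.val, ?_⟩
  · simp only [RState.setReg, Function.update_of_ne (show q ≠ r by omega)]
    exact h.reg q h1 h2 h3
  · simp only [RState.setReg, Function.update_of_ne (show q ≠ r by omega)]
    exact h.reg' q h0 h1 h2 h3
  · simp only [RState.setReg, Function.update_of_ne (show 5 ≠ r by omega)]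
    exact h.five

/-- One round of the innermost body. The guards and arguments see only the parameters, the readable
arrays and the counters, all as in the start memory with the present counters. -/
theorem LoopRel.items {M W : ℤ} (hM : 100 ≤ M) (hW : M ^ 64 ≤ W) {ri ra : List ℕ}
    {m₀ : RState} {os : List EOp} {N : ℕ} {m : RState} (is : List Item)
    (his : itemsOk ri ra is = true) (h : LoopRel ri ra m₀ os N m) {l u j : ℕ}
    (hb : (m₀.withCounters l u j).Bounded M ri ra) (h5 : 0 ≤ m₀.reg 5)
    (h5' : m₀.reg 5 + N + is.length ≤ W) (hl : m.reg 10 = l) (hu : m.reg 11 = u)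
    (hj : m.reg 12 = j) :
    ∃ t ≤ itemsTime is, ∃ m', RExec W (itemsProg is) m t m' ∧
      LoopRel ri ra m₀ (os ++ itemsOps (m₀.withCounters l u j) is) (N + is.length) m' ∧
      m'.reg 10 = l ∧ m'.reg 11 = u ∧ m'.reg 12 = j := by
  have hag : m.Agree ri ra (m₀.withCounters l u j) := by
    refine ⟨fun r hr => ?_, h.idx, h.val⟩
    simp only [paramRegs, List.mem_cons, List.not_mem_nil, or_false] at hr
    rcases hr with rfl | rfl | rfl | rfl | rfl | rfl | rfl
    · simpa [RState.withCounters, RState.setReg] using h.reg' 0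
    · simpa [RState.withCounters, RState.setReg] using h.reg' 1
    · simpa [RState.withCounters, RState.setReg] using h.reg' 3
    · simpa [RState.withCounters, RState.setReg] using h.reg' 4
    · simpa [RState.withCounters, RState.setReg] using hl
    · simpa [RState.withCounters, RState.setReg] using hu
    · simpa [RState.withCounters, RState.setReg] using hj
  have hf := h.five
  obtain ⟨⟨t, ht, hx⟩, h1, h2, h3, h4⟩ := itemsProg_exec hM hW hb is his m hag (by omega) (by omega)
  have hc := runOps_congr (itemsOps (m₀.withCounters l u j) is) h.mem h.reg
  refine ⟨t, ht, _, hx, ⟨?_, ?_, fun r h5 h6 h7 h8 => ?_, h1.idx, h1.val, ?_⟩, ?_, ?_, ?_⟩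
  · rw [runOps_append]; exact hc.1
  · rw [runOps_append]; exact hc.2
  · exact (h2 r h5).trans (h.reg' r h5 h6 h7 h8)
  · push_cast; omega
  · exact (h2 10 (by norm_num)).trans hl
  · exact (h2 11 (by norm_num)).trans hu
  · exact (h2 12 (by norm_num)).trans hj

/-- The loops are treated from the inside outwards. The invariant says that the memory is the result
of the operations of all completed rounds; the number `N` in it bounds the growth of register `5`,
which must fit into a word. -/
theorem boxProg_exec {M W : ℤ} (hM : 100 ≤ M) (hW : M ^ 64 ≤ W) {ri ra : List ℕ} {n d : ℕ}
    {m₀ : RState} (is : List Item) (his : itemsOk ri ra is = true) (h0 : m₀.reg 0 = n)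
    (h1 : m₀.reg 1 = d) (h5 : 0 ≤ m₀.reg 5)
    (h5' : m₀.reg 5 + (((d + 2) * ((d + 2) * ((n + 2) * is.length)) : ℕ) : ℤ) ≤ W)
    (hb : ∀ l ≤ d + 1, ∀ u ≤ d + 1, ∀ j ≤ n + 1, (m₀.withCounters l u j).Bounded M ri ra)
    (hn : (n : ℤ) + 2 ≤ M) (hd : (d : ℤ) + 2 ≤ M) :
    ∃ t ≤ (d + 2) * ((d + 2) * ((n + 2) * (itemsTime is + 16) + 16) + 16), ∃ m',
      RExec W (boxProg is) m₀ t m' ∧ m'.mem = (runOps m₀ (boxOps m₀ n d is)).mem ∧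
      ∀ r, r ≠ 10 → r ≠ 11 → r ≠ 12 → m'.reg r = (runOps m₀ (boxOps m₀ n d is)).reg r := by
  have hMW : M ≤ W := by
    refine le_trans ?_ hW
    simpa using pow_le_pow_right₀ (show (1 : ℤ) ≤ M by omega) (show 1 ≤ 64 by norm_num)
  have hfit : ∀ {m : RState} {r N : ℕ}, m.reg r = N → (N : ℤ) + 1 ≤ M →
      (RExpr.add (.reg r) (.const 1)).Fits W m ∧
      (RExpr.add (.reg r) (.const 1)).eval m = ((N + 1 : ℕ) : ℤ) := by
    intro m r N h h'
    simp only [RExpr.Fits, RExpr.eval, h]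
    refine ⟨⟨trivial, by rw [abs_one]; omega, by rw [abs_of_nonneg (by omega)]; omega⟩, by simp⟩
  set s := is.length with hs
  set oj : ℕ → ℕ → ℕ → List EOp := fun l u j => itemsOps (m₀.withCounters l u j) is
  set ou : ℕ → ℕ → List EOp := fun l u => (List.range (n + 2)).flatMap (oj l u)
  set ol : ℕ → List EOp := fun l => (List.range (d + 2)).flatMap (ou l)
  have hflat : ∀ (f : ℕ → List EOp) k, (List.range (k + 1)).flatMap f =
      (List.range k).flatMap f ++ f k := by
    intro f k; simp [List.range_succ]
  set P1 : List EOp → ℕ → RState → Prop := fun os N m => LoopRel ri ra m₀ os N m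
  have hP1 : ∀ {os N m}, P1 os N m → m.reg 0 = n ∧ m.reg 1 = d := fun h =>
    ⟨(h.reg' 0 (by norm_num) (by norm_num) (by norm_num) (by norm_num)).trans h0,
      (h.reg' 1 (by norm_num) (by norm_num) (by norm_num) (by norm_num)).trans h1⟩
  have inner : ∀ (l : ℕ), l ≤ d + 1 → ∀ (u : ℕ), u ≤ d + 1 → ∀ os N m, P1 os N m →
      m.reg 10 = l → m.reg 11 = u → m₀.reg 5 + N + ((n + 2) * s : ℕ) ≤ W →
      ∃ t ≤ (n + 2) * (itemsTime is + 16), ∃ m',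
        RExec W (forProg 12 (.add (.reg 0) (.const 1)) (itemsProg is)) m t m' ∧
        P1 (os ++ ou l u) (N + (n + 2) * s) m' ∧ m'.reg 10 = l ∧ m'.reg 11 = u := by
    intro l hl u hu os N m hm h10 h11 hN
    obtain ⟨t, ht, m', hx, hI⟩ := forProg_exec (W := W) 12 (.add (.reg 0) (.const 1))
      (itemsProg is) (n + 1) (itemsTime is) (le_refl _) (by push_cast; omega)
      (fun k m => P1 (os ++ (List.range k).flatMap (oj l u)) (N + k * s) m ∧
        m.reg 10 = l ∧ m.reg 11 = u ∧ m.reg 12 = k)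
      (fun k m hk => ⟨hk.2.2.2, hfit (hP1 hk.1).1 (by omega)⟩)
      (fun k hk m hkm => by
        have hks : (k + 1) * s ≤ (n + 2) * s := Nat.mul_le_mul_right _ (by omega)
        rw [Nat.succ_mul] at hks
        obtain ⟨t, ht, m', hx, hr, e10, e11, e12⟩ := LoopRel.items hM hW is his hkm.1
          (hb l hl u hu k hk) h5 (by zify at hks; rw [← hs]; push_cast at hN hks ⊢; linarith)
          hkm.2.1 hkm.2.2.1 hkm.2.2.2
        refine ⟨t, ht, m', hx, e12, ?_, ?_, ?_, ?_⟩
        · rw [hflat, ← List.append_assoc, Nat.succ_mul, ← Nat.add_assoc]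
          exact hr.setReg 12 (by norm_num) _
        · simpa [RState.setReg] using e10
        · simpa [RState.setReg] using e11
        · simp [RState.setReg])
      m (by
        refine ⟨by simpa using hm.setReg 12 (by norm_num) 0, ?_, ?_, ?_⟩ <;>
          simp [RState.setReg, h10, h11])
    exact ⟨t, ht, m', hx, hI.1, hI.2.1, hI.2.2.1⟩
  have middle : ∀ (l : ℕ), l ≤ d + 1 → ∀ os N m, P1 os N m →
      m.reg 10 = l → m₀.reg 5 + N + ((d + 2) * ((n + 2) * s) : ℕ) ≤ W →
      ∃ t ≤ (d + 2) * ((n + 2) * (itemsTime is + 16) + 16), ∃ m',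
        RExec W (forProg 11 (.add (.reg 1) (.const 1)) (forProg 12 (.add (.reg 0) (.const 1))
          (itemsProg is))) m t m' ∧
        P1 (os ++ ol l) (N + (d + 2) * ((n + 2) * s)) m' ∧ m'.reg 10 = l := by
    intro l hl os N m hm h10 hN
    obtain ⟨t, ht, m', hx, hI⟩ := forProg_exec (W := W) 11 (.add (.reg 1) (.const 1))
      (forProg 12 (.add (.reg 0) (.const 1)) (itemsProg is)) (d + 1)
      ((n + 2) * (itemsTime is + 16)) (le_refl _) (by push_cast; omega)
      (fun k m => P1 (os ++ (List.range k).flatMap (ou l)) (N + k * ((n + 2) * s)) m ∧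
        m.reg 10 = l ∧ m.reg 11 = k)
      (fun k m hk => ⟨hk.2.2, hfit (hP1 hk.1).2 (by omega)⟩)
      (fun k hk m hkm => by
        have hks : (k + 1) * ((n + 2) * s) ≤ (d + 2) * ((n + 2) * s) :=
          Nat.mul_le_mul_right _ (by omega)
        rw [Nat.succ_mul] at hks
        obtain ⟨t, ht, m', hx, hr, e10, e11⟩ := inner l hl k hk _ _ m hkm.1 hkm.2.1 hkm.2.2
          (by zify at hks; push_cast at hN hks ⊢; linarith)
        refine ⟨t, ht, m', hx, e11, ?_, ?_, ?_⟩
        · rw [hflat, ← List.append_assoc, Nat.succ_mul, ← Nat.add_assoc]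
          exact hr.setReg 11 (by norm_num) _
        · simpa [RState.setReg] using e10
        · simp [RState.setReg])
      m (by
        refine ⟨by simpa using hm.setReg 11 (by norm_num) 0, ?_, ?_⟩ <;>
          simp [RState.setReg, h10])
    exact ⟨t, ht, m', hx, hI.1, hI.2.1⟩
  obtain ⟨t, ht, m', hx, hI⟩ := forProg_exec (W := W) 10 (.add (.reg 1) (.const 1))
    (forProg 11 (.add (.reg 1) (.const 1)) (forProg 12 (.add (.reg 0) (.const 1)) (itemsProg is)))
    (d + 1) ((d + 2) * ((n + 2) * (itemsTime is + 16) + 16)) (le_refl _) (by push_cast; omega)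
    (fun k m => P1 ((List.range k).flatMap ol) (k * ((d + 2) * ((n + 2) * s))) m ∧ m.reg 10 = k)
    (fun k m hk => ⟨hk.2, hfit (hP1 hk.1).2 (by omega)⟩)
    (fun k hk m hkm => by
      have hks : (k + 1) * ((d + 2) * ((n + 2) * s)) ≤ (d + 2) * ((d + 2) * ((n + 2) * s)) :=
        Nat.mul_le_mul_right _ (by omega)
      rw [Nat.succ_mul] at hks
      obtain ⟨t, ht, m', hx, hr, e10⟩ := middle k hk _ _ m hkm.1 hkm.2
        (by zify at hks; push_cast at h5' hks ⊢; linarith)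
      refine ⟨t, ht, m', hx, e10, ?_, ?_⟩
      · rw [hflat, Nat.succ_mul]
        exact hr.setReg 10 (by norm_num) _
      · simp [RState.setReg])
    m₀ (by
      refine ⟨LoopRel.setReg ⟨?_, ?_, ?_, ?_, ?_, ?_⟩ 10 (by norm_num) 0, ?_⟩ <;>
        simp [RState.setReg, runOps])
  exact ⟨t, ht, m', hx, hI.1.mem, hI.1.reg⟩

/-! ## Propagation in networks of counters -/

/-- A network of gates. Edges lead from literals to gates. A gate counts its true inputs, starting
from `c0`. When the count reaches `s ≥ 1`, the literal `ob + s` becomes true, unless the literal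
`inh` is true. -/
structure Net where
  adj : ℕ → List ℕ
  c0 : ℕ → ℤ
  ob : ℕ → ℤ
  inh : ℕ → ℤ

namespace Net

variable (N : Net)

/-- The number of inputs of `g` from the literals in `T`. -/
def count (T : Finset ℕ) (g : ℕ) : ℕ := ∑ x ∈ T, (N.adj x).count g

/-- The count of the gate `g` is at least `s ≥ 1`. -/
def Active (T : Finset ℕ) (g : ℕ) (s : ℤ) : Prop := 1 ≤ s ∧ s ≤ N.c0 g + N.count T g

/-- The output of the gate `g` for the count `s`. -/
def out (g : ℕ) (s : ℤ) : ℕ := (N.ob g + s).toNat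

/-- All the literals, except for the first one, are outputs of gates. -/
def Supported (T : Finset ℕ) : Prop :=
  ∀ x ∈ T, x = 0 ∨ ∃ g s, N.Active T g s ∧ x = N.out g s

/-- The set `H` is preserved by propagation. -/
def Preserved (H : Set ℕ) : Prop :=
  0 ∈ H ∧ ∀ T : Finset ℕ, (∀ x ∈ T, x ∈ H) → N.Supported T → ∀ g s, N.Active T g s →
    (N.inh g).toNat ∉ T → N.out g s ∈ H

/-- Propagation in `T` is complete. -/
def Closed (T : Finset ℕ) : Prop :=
  ∀ g s, N.Active T g s → N.out g s ∈ T ∨ (N.inh g).toNat ∈ T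

theorem count_mono {T T' : Finset ℕ} (h : T ⊆ T') (g : ℕ) : N.count T g ≤ N.count T' g :=
  Finset.sum_le_sum_of_subset h

theorem Active.mono {N : Net} {T T' : Finset ℕ} (h : T ⊆ T') {g : ℕ} {s : ℤ}
    (ha : N.Active T g s) : N.Active T' g s :=
  ⟨ha.1, ha.2.trans (by have := N.count_mono h g; omega)⟩

/-- Activity of gates is monotone in the set of true literals, so earlier supports persist. -/
theorem Supported.insert {N : Net} {T : Finset ℕ} (h : N.Supported T) {g : ℕ} {s : ℤ}
    (ha : N.Active T g s) : N.Supported (insert (N.out g s) T) := by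
  intro x hx
  rcases Finset.mem_insert.1 hx with rfl | hx
  · exact Or.inr ⟨g, s, ha.mono (Finset.subset_insert _ _), rfl⟩
  · rcases h x hx with h | ⟨g', s', h1, h2⟩
    · exact Or.inl h
    · exact Or.inr ⟨g', s', h1.mono (Finset.subset_insert _ _), h2⟩

end Net

/-- The list of targets of the edges in a linked list. -/
def Chain (nxt tgt : ℕ → ℤ) : ℤ → List ℕ → Prop
  | e, [] => e = 0
  | e, g :: gs => 1 ≤ e ∧ tgt e.toNat = g ∧ Chain nxt tgt (nxt e.toNat) gs

/-- Put the literal in register `13` on the stack (array `27`, with the height in register `6`),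
if it was not true before (array `26`). -/
def pushProg : RProg :=
  .ite (.read 26 (.reg 13)) (.const 0)
    (.seq (.store 26 (.reg 13) (.const 1))
      (.seq (.store 27 (.reg 6) (.reg 13)) (.assign 6 (.add (.reg 6) (.const 1))))) .skip

/-- Process the edge in register `8`. -/
def edgeProg : RProg :=
  .seq (.assign 9 (.read 22 (.reg 8)))
    (.seq (.store 23 (.reg 9) (.add (.read 23 (.reg 9)) (.const 1)))
      (.seq (.ite (.const 1) (.read 23 (.reg 9))
        (.ite (.read 26 (.read 25 (.reg 9))) (.const 0)
          (.seq (.assign 13 (.add (.read 24 (.reg 9)) (.read 23 (.reg 9)))) pushProg) .skip) .skip)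
        (.assign 8 (.read 21 (.reg 8)))))

/-- Process the stack. -/
def stackProg : RProg :=
  .loop (.const 1) (.reg 6)
    (.seq (.assign 6 (.sub (.reg 6) (.const 1)))
      (.seq (.assign 7 (.read 27 (.reg 6)))
        (.seq (.assign 8 (.read 20 (.reg 7))) (.loop (.const 1) (.reg 8) edgeProg))))

/-- Propagation, starting from the literal `0`. -/
def engineProg : RProg :=
  .seq (.assign 6 (.const 0)) (.seq (.assign 13 (.const 0)) (.seq pushProg stackProg))

/-! ### Correctness and running time of propagation -/

/-- The memory stores the network `N`, and all numbers are small. -/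
structure Stores (W : ℤ) (N : Net) (Ne : ℕ) (m : RState) : Prop where
  chain : ∀ x, Chain (m.mem 21) (m.mem 22) (m.mem 20 x) (N.adj x)
  c0 : ∀ g, m.mem 23 g = N.c0 g
  ob : ∀ g, m.mem 24 g = N.ob g
  inh : ∀ g, m.mem 25 g = N.inh g
  c0_le : ∀ g, N.c0 g ≤ 0
  le_c0 : ∀ g, -W ≤ N.c0 g
  le_ob : ∀ g, -1 ≤ N.ob g
  ob_le : ∀ g, N.ob g + Ne ≤ W
  inh_nonneg : ∀ g, 0 ≤ N.inh g
  sum_le : ∀ F : Finset ℕ, ∑ x ∈ F, (N.adj x).length ≤ Ne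
  le_W : (Ne : ℤ) + 3 ≤ W

theorem Stores.count_le {W : ℤ} {N : Net} {Ne : ℕ} {m : RState} (h : Stores W N Ne m)
    (T : Finset ℕ) (g : ℕ) : N.count T g ≤ Ne :=
  (Finset.sum_le_sum fun _ _ => List.count_le_length).trans (h.sum_le T)

/-- The state of propagation: the literals in `T` are true, those in `stk` have not been
processed, and `c` counts the processed edges of the gates. -/
structure EngineInv (N : Net) (m₀ m : RState) (T : Finset ℕ) (stk : List ℕ) (c : ℕ → ℕ) :
    Prop where
  reg : ∀ r, r ≠ 6 → r ≠ 7 → r ≠ 8 → r ≠ 9 → r ≠ 13 → m.reg r = m₀.reg r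
  mem : ∀ A, A ≠ 23 → A ≠ 26 → A ≠ 27 → m.mem A = m₀.mem A
  truth : ∀ x, m.mem 26 x = if x ∈ T then 1 else 0
  cnt : ∀ g, m.mem 23 g = N.c0 g + c g
  height : m.reg 6 = stk.length
  stack : ∀ (i : ℕ) (hi : i < stk.length), m.mem 27 i = stk[i]
  nodup : stk.Nodup
  subset : ∀ x ∈ stk, x ∈ T
  le_count : ∀ g, c g ≤ N.count T g
  closed : ∀ g (s : ℤ), 1 ≤ s → s ≤ N.c0 g + c g → N.out g s ∈ T ∨ (N.inh g).toNat ∈ T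
  supported : N.Supported T
  sound : ∀ H, N.Preserved H → ∀ x ∈ T, x ∈ H

/-- Registers other than those used for the stack do not matter. -/
theorem EngineInv.setReg {N : Net} {m₀ m : RState} {T : Finset ℕ} {stk : List ℕ} {c : ℕ → ℕ}
    (h : EngineInv N m₀ m T stk c) {r : ℕ} (hr : r = 7 ∨ r = 8 ∨ r = 9 ∨ r = 13) (v : ℤ) :
    EngineInv N m₀ (m.setReg r v) T stk c := by
  refine { h with reg := fun q h1 h2 h3 h4 h5 => ?_, height := ?_ }
  · simp only [RState.setReg, Function.update_of_ne (show q ≠ r by omega)]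
    exact h.reg q h1 h2 h3 h4 h5
  · simp only [RState.setReg, Function.update_of_ne (show 6 ≠ r by omega)]
    exact h.height

theorem EngineInv.length_le {N : Net} {m₀ m : RState} {T : Finset ℕ} {stk : List ℕ} {c : ℕ → ℕ}
    (h : EngineInv N m₀ m T stk c) : stk.length ≤ T.card := by
  rw [← List.toFinset_card_of_nodup h.nodup]
  exact Finset.card_le_card fun x hx => h.subset x (List.mem_toFinset.1 hx)

theorem fits_add_one {W : ℤ} {m : RState} {e : RExpr} (he : e.Fits W m) (h1 : -W ≤ e.eval m)
    (h2 : e.eval m + 1 ≤ W) : (RExpr.add e (.const 1)).Fits W m := by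
  refine ⟨he, ?_, ?_⟩
  · simp only [RExpr.Fits, abs_one]; omega
  · simp only [RExpr.eval]; rw [abs_le]; omega

/-- Adding a literal to the stack. -/
theorem pushProg_exec {W : ℤ} {m : RState} {y : ℕ} (hy : m.reg 13 = y) (h6 : 0 ≤ m.reg 6)
    (h6' : m.reg 6 + 1 ≤ W) :
    (m.mem 26 y ≤ 0 → ∃ t ≤ 15, RExec W pushProg m t (((m.setMem 26 y 1).setMem 27
      (m.reg 6).toNat y).setReg 6 (m.reg 6 + 1))) ∧
    (0 < m.mem 26 y → ∃ t ≤ 15, RExec W pushProg m t m) := by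
  have f1 : (RExpr.read 26 (.reg 13)).Fits W m := ⟨trivial, by simp only [RExpr.eval]; omega⟩
  have f2 : (RExpr.const 0).Fits W m := by simp only [RExpr.Fits, abs_zero]; omega
  have f3 : (RExpr.const 1).Fits W m := by simp only [RExpr.Fits, abs_one]; omega
  have e1 : (RExpr.read 26 (.reg 13)).eval m = m.mem 26 y := by simp [RExpr.eval, hy]
  have e2 : (RExpr.const 0).eval m = 0 := rfl
  constructor
  · intro h
    have r1 := RExec.store_of_eval (W := W) (A := 26) (e := .reg 13) (m := m) (j := y) trivial f3
      hy (by omega) rfl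
    have r2 := RExec.store_of_eval (W := W) (A := 27) (e := .reg 6) (f := .reg 13)
      (m := m.setMem 26 (y : ℤ).toNat 1) (j := m.reg 6) (v := y) trivial trivial rfl h6 hy
    have r3 := RExec.assign_of_eval (W := W) (r := 6) (e := .add (.reg 6) (.const 1))
      (m := (m.setMem 26 (y : ℤ).toNat 1).setMem 27 (m.reg 6).toNat y) (v := m.reg 6 + 1)
      (fits_add_one trivial (by simp only [RExpr.eval, RState.setMem]; omega) h6') rfl
    exact ⟨_, by simp [RExpr.cost], .ite_true _ _ _ _ _ _ _ f1 f2 (by rw [e1, e2]; exact h)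
      (.seq _ _ _ _ _ _ _ r1 (.seq _ _ _ _ _ _ _ r2 r3))⟩
  · intro h
    exact ⟨_, by simp [RExpr.cost], .ite_false _ _ _ _ _ _ _ f1 f2 (by rw [e1, e2]; exact h)
      (.skip m)⟩

/-- Pushing preserves the invariant. -/
theorem EngineInv.push {N : Net} {m₀ m : RState} {T : Finset ℕ} {stk : List ℕ} {c : ℕ → ℕ}
    (h : EngineInv N m₀ m T stk c) {y : ℕ} (hy : y ∉ T)
    (hsup : N.Supported (insert y T)) (hsound : ∀ H, N.Preserved H → y ∈ H) :
    EngineInv N m₀ (((m.setMem 26 y 1).setMem 27 (m.reg 6).toNat y).setReg 6 (m.reg 6 + 1))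
      (insert y T) (stk ++ [y]) c := by
  have hh := h.height
  refine ⟨fun q h1 h2 h3 h4 h5 => ?_, fun A h1 h2 h3 => ?_, fun x => ?_, fun g => ?_, ?_,
    fun i hi => ?_, ?_, fun x hx => ?_, fun g => ?_, fun g s h1 h2 => ?_, hsup, fun H hH x hx => ?_⟩
  · simpa [RState.setReg, RState.setMem, h1] using h.reg q h1 h2 h3 h4 h5
  · simpa [RState.setReg, RState.setMem, h2, h3] using h.mem A h1 h2 h3
  · by_cases hxy : x = y
    · subst hxy; simp [RState.setReg, RState.setMem]
    · simpa [RState.setReg, RState.setMem, hxy] using h.truth x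
  · simpa [RState.setReg, RState.setMem] using h.cnt g
  · simp [RState.setReg, RState.setMem, hh]
  · simp only [RState.setReg, RState.setMem, Function.update_self, hh, Int.toNat_natCast]
    rcases Nat.lt_or_ge i stk.length with h1 | h1
    · rw [Function.update_of_ne (by omega), List.getElem_append_left h1]
      simpa using h.stack i h1
    · simp only [List.length_append, List.length_singleton] at hi
      obtain rfl : i = stk.length := by omega
      simp
  · rw [List.nodup_append]
    refine ⟨h.nodup, by simp, fun a ha b hb => ?_⟩
    rw [List.mem_singleton] at hb
    rintro rfl
    exact hy (hb ▸ h.subset a ha)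
  · rcases List.mem_append.1 hx with hx | hx
    · exact Finset.mem_insert_of_mem (h.subset x hx)
    · rw [List.mem_singleton] at hx; exact hx ▸ Finset.mem_insert_self _ _
  · exact (h.le_count g).trans (N.count_mono (Finset.subset_insert _ _) g)
  · exact (h.closed g s h1 h2).imp (Finset.mem_insert_of_mem) (Finset.mem_insert_of_mem)
  · rcases Finset.mem_insert.1 hx with rfl | hx
    exacts [hsound H hH, h.sound H hH x hx]

/-- Processing one edge. -/
theorem edgeProg_exec {W : ℤ} {N : Net} {Ne : ℕ} {m₀ m : RState} (hN : Stores W N Ne m₀)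
    {T : Finset ℕ} {stk : List ℕ} {c : ℕ → ℕ} (h : EngineInv N m₀ m T stk c) {g : ℕ}
    (h8 : 1 ≤ m.reg 8) (hg : m₀.mem 22 (m.reg 8).toNat = g) (hT : T.card ≤ Ne)
    (hc : c g + 1 ≤ N.count T g) :
    ∃ t ≤ 60, ∃ m' l, RExec W edgeProg m t m' ∧
      EngineInv N m₀ m' (T ∪ l.toFinset) (stk ++ l) (Function.update c g (c g + 1)) ∧
      m'.reg 8 = m₀.mem 21 (m.reg 8).toNat ∧ l.length ≤ 1 ∧ Disjoint T l.toFinset := by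
  have hW := hN.le_W
  have hcT := hN.count_le T g
  have hl := h.length_le
  have hh := h.height
  have hc0 := hN.c0_le g
  have hc0' := hN.le_c0 g
  have hob := hN.le_ob g
  have hob' := hN.ob_le g
  have hinh := hN.inh_nonneg g
  -- The new count of the gate. By `hc` it does not exceed the count of all edges from `T`, so the
  -- gate is active in `T` for `s ≥ 1`, even if some literals of `T` are still on the stack.
  set s : ℤ := N.c0 g + c g + 1 with hs
  have r1 : RExec W (.assign 9 (.read 22 (.reg 8))) m 3 (m.setReg 9 g) :=
    .assign_of_eval ⟨trivial, by simp only [RExpr.eval]; omega⟩ (by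
      simp only [RExpr.eval, h.mem 22 (by norm_num) (by norm_num) (by norm_num), hg])
  have hcnt := h.cnt g
  have r2 : RExec W (.store 23 (.reg 9) (.add (.read 23 (.reg 9)) (.const 1))) (m.setReg 9 g) 6
      ((m.setReg 9 g).setMem 23 g s) := by
    have := RExec.store_of_eval (W := W) (A := 23) (e := .reg 9)
      (f := .add (.read 23 (.reg 9)) (.const 1)) (m := m.setReg 9 g) (j := g) (v := s) trivial
      (fits_add_one ⟨trivial, by simp [RExpr.eval, RState.setReg]⟩
        (by simp only [RExpr.eval, RState.setReg, Function.update_self, Int.toNat_natCast]; omega)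
        (by simp only [RExpr.eval, RState.setReg, Function.update_self, Int.toNat_natCast]; omega))
      (by simp [RExpr.eval, RState.setReg]) (by omega)
      (by simp only [RExpr.eval, RState.setReg, Function.update_self, Int.toNat_natCast]; omega)
    exact this
  set m2 := (m.setReg 9 g).setMem 23 g s with hm2
  have hinv9 := h.setReg (r := 9) (by norm_num) (g : ℤ)
  -- Smaller counts were dealt with when they were reached; only the count `s` is new.
  have hinv2 : (1 ≤ s → N.out g s ∈ T ∨ (N.inh g).toNat ∈ T) →
      EngineInv N m₀ m2 T stk (Function.update c g (c g + 1)) := by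
    intro hcl
    refine ⟨fun q h1 h2 h3 h4 h5 => hinv9.reg q h1 h2 h3 h4 h5, fun A h1 h2 h3 => ?_, fun x => ?_,
      fun g' => ?_, hinv9.height, fun i hi => ?_, h.nodup, h.subset, fun g' => ?_,
      fun g' s' h1 h2 => ?_, h.supported, h.sound⟩
    · simpa [hm2, RState.setMem, h1] using hinv9.mem A h1 h2 h3
    · simpa [hm2, RState.setMem] using hinv9.truth x
    · by_cases hg' : g' = g
      · subst hg'; simp [hm2, RState.setMem, hs]; ring
      · simpa [hm2, RState.setMem, hg'] using hinv9.cnt g'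
    · simpa [hm2, RState.setMem] using hinv9.stack i hi
    · by_cases hg' : g' = g
      · subst hg'; simpa using hc
      · simpa [hg'] using h.le_count g'
    · by_cases hg' : g' = g
      · subst hg'
        rw [Function.update_self] at h2
        push_cast at h2
        rcases lt_or_ge (N.c0 g' + c g') s' with h3 | h3
        · obtain rfl : s' = s := by omega
          exact hcl h1
        · exact h.closed g' s' h1 h3
      · rw [Function.update_of_ne hg'] at h2
        exact h.closed g' s' h1 h2
  have hm29 : m2.reg 9 = g := by simp [hm2, RState.setMem, RState.setReg]
  have hm28 : m2.reg 8 = m.reg 8 := by simp [hm2, RState.setMem, RState.setReg]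
  have hm26 : m2.reg 6 = stk.length := by simp [hm2, RState.setMem, RState.setReg, hh]
  have hm2A : ∀ A, A ≠ 23 → m2.mem A = m.mem A := fun A hA => by
    simp [hm2, RState.setMem, RState.setReg, hA]
  have hm23 : m2.mem 23 g = s := by simp [hm2, RState.setMem, RState.setReg]
  have mid : ∃ t ≤ 45, ∃ m3 l, RExec W (.ite (.const 1) (.read 23 (.reg 9))
        (.ite (.read 26 (.read 25 (.reg 9))) (.const 0)
          (.seq (.assign 13 (.add (.read 24 (.reg 9)) (.read 23 (.reg 9)))) pushProg) .skip) .skip)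
        m2 t m3 ∧
      EngineInv N m₀ m3 (T ∪ l.toFinset) (stk ++ l) (Function.update c g (c g + 1)) ∧
      m3.reg 8 = m.reg 8 ∧ l.length ≤ 1 ∧ Disjoint T l.toFinset := by
    have f1 : (RExpr.const 1).Fits W m2 := by simp only [RExpr.Fits, abs_one]; omega
    have f0 : (RExpr.const 0).Fits W m2 := by simp only [RExpr.Fits, abs_zero]; omega
    have f2 : (RExpr.read 23 (.reg 9)).Fits W m2 := ⟨trivial, by simp only [RExpr.eval]; omega⟩
    have e2 : (RExpr.read 23 (.reg 9)).eval m2 = s := by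
      simp only [RExpr.eval, hm29, Int.toNat_natCast, hm23]
    have e3 : (RExpr.read 25 (.reg 9)).eval m2 = N.inh g := by
      simp only [RExpr.eval, hm29, Int.toNat_natCast, hm2A 25 (by norm_num),
        h.mem 25 (by norm_num) (by norm_num) (by norm_num), hN.inh]
    have f3 : (RExpr.read 26 (.read 25 (.reg 9))).Fits W m2 :=
      ⟨⟨trivial, by simp only [RExpr.eval]; omega⟩, by rw [e3]; exact hinh⟩
    have e4 : (RExpr.read 26 (.read 25 (.reg 9))).eval m2 =
        if (N.inh g).toNat ∈ T then 1 else 0 := by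
      change m2.mem 26 ((RExpr.read 25 (.reg 9)).eval m2).toNat = _
      rw [e3, hm2A 26 (by norm_num), h.truth]
    have e5 : (RExpr.read 24 (.reg 9)).eval m2 = N.ob g := by
      simp only [RExpr.eval, hm29, Int.toNat_natCast, hm2A 24 (by norm_num),
        h.mem 24 (by norm_num) (by norm_num) (by norm_num), hN.ob]
    by_cases hs1 : 1 ≤ s
    · by_cases hi : (N.inh g).toNat ∈ T
      · rw [if_pos hi] at e4
        refine ⟨_, ?_, m2, [], .ite_true _ _ _ _ _ _ _ f1 f2 (by rw [e2]; exact hs1)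
          (.ite_false _ _ _ _ _ _ _ f3 f0 (by rw [e4]; simp [RExpr.eval]) (.skip _)), ?_, hm28,
          by simp, by simp⟩
        · simp [RExpr.cost]
        · simpa using hinv2 fun _ => Or.inr hi
      · rw [if_neg hi] at e4
        have r4 : RExec W (.assign 13 (.add (.read 24 (.reg 9)) (.read 23 (.reg 9)))) m2 6
            (m2.setReg 13 (N.out g s)) := by
          refine .assign_of_eval ⟨⟨trivial, by simp only [RExpr.eval]; omega⟩, f2, ?_⟩ ?_
          · rw [e2, e5, abs_of_nonneg (by omega)]; omega
          · change (RExpr.read 24 (.reg 9)).eval m2 + (RExpr.read 23 (.reg 9)).eval m2 = _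
            rw [e2, e5, Net.out, Int.toNat_of_nonneg (by omega)]
        have hp := pushProg_exec (W := W) (m := m2.setReg 13 (N.out g s)) (y := N.out g s)
          (by simp [RState.setReg]) (by simp [RState.setReg, hm26])
          (by
            have : (m2.setReg 13 (N.out g s)).reg 6 = stk.length := by simp [RState.setReg, hm26]
            omega)
        have htr : (m2.setReg 13 (N.out g s)).mem 26 (N.out g s) =
            if N.out g s ∈ T then 1 else 0 := by
          change m2.mem 26 _ = _
          rw [hm2A 26 (by norm_num), h.truth]
        by_cases ho : N.out g s ∈ T
        · rw [if_pos ho] at htr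
          obtain ⟨t, ht, hx⟩ := hp.2 (by omega)
          refine ⟨_, ?_, _, [], .ite_true _ _ _ _ _ _ _ f1 f2 (by rw [e2]; exact hs1)
            (.ite_true _ _ _ _ _ _ _ f3 f0 (by rw [e4]; simp [RExpr.eval])
              (.seq _ _ _ _ _ _ _ r4 hx)), ?_, ?_, by simp, by simp⟩
          · simp only [RExpr.cost]; omega
          · simpa using (hinv2 fun _ => Or.inl ho).setReg (r := 13) (by norm_num) _
          · simpa [RState.setReg] using hm28
        · rw [if_neg ho] at htr
          obtain ⟨t, ht, hx⟩ := hp.1 (by omega)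
          have hact : N.Active T g s := ⟨hs1, by omega⟩
          refine ⟨_, ?_, _, [N.out g s], .ite_true _ _ _ _ _ _ _ f1 f2 (by rw [e2]; exact hs1)
            (.ite_true _ _ _ _ _ _ _ f3 f0 (by rw [e4]; simp [RExpr.eval])
              (.seq _ _ _ _ _ _ _ r4 hx)), ?_, ?_, by simp, by simpa using ho⟩
          · simp only [RExpr.cost]; omega
          -- The inhibitor is false at this moment and `T` is supported, as `Net.Preserved`
          -- requires.
          · have hsnd : ∀ H, N.Preserved H → N.out g s ∈ H := fun H hH =>
              hH.2 T (h.sound H hH) h.supported g s hact hi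
            have hpsh := (hinv9.push ho (h.supported.insert hact) hsnd).setReg (r := 13)
              (by norm_num) (N.out g s)
            rw [Finset.union_comm, List.toFinset_cons, List.toFinset_nil, insert_empty_eq,
              Finset.singleton_union]
            refine ⟨fun q h1 h2 h3 h4 h5 => ?_, fun A h1 h2 h3 => ?_, fun x => ?_,
              fun g' => ?_, ?_, fun i hi => ?_, hpsh.nodup, hpsh.subset, fun g' => ?_,
              fun g' s' h1 h2 => ?_, hpsh.supported, hpsh.sound⟩
            · have := h.reg q h1 h2 h3 h4 h5
              simpa [hm2, RState.setReg, RState.setMem, h1, h4, h5] using this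
            · have := h.mem A h1 h2 h3
              simpa [hm2, RState.setReg, RState.setMem, h1, h2, h3] using this
            · have := hpsh.truth x
              simpa [hm2, RState.setReg, RState.setMem] using this
            · by_cases hg' : g' = g
              · subst hg'; simp [hm2, RState.setReg, RState.setMem, hs]; ring
              · simpa [hm2, RState.setReg, RState.setMem, hg'] using h.cnt g'
            · simp [RState.setReg, RState.setMem, hm26]
            · have := hpsh.stack i hi
              simpa [hm2, RState.setReg, RState.setMem] using this
            · refine le_trans ?_ (N.count_mono (Finset.subset_insert _ _) g')
              by_cases hg' : g' = g
              · subst hg'; simpa using hc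
              · simpa [hg'] using h.le_count g'
            · by_cases hg' : g' = g
              · subst hg'
                rw [Function.update_self] at h2
                push_cast at h2
                rcases lt_or_ge (N.c0 g' + c g') s' with h3 | h3
                · obtain rfl : s' = s := by omega
                  exact Or.inl (Finset.mem_insert_self _ _)
                · exact hpsh.closed g' s' h1 h3
              · rw [Function.update_of_ne hg'] at h2
                exact hpsh.closed g' s' h1 h2
          · simpa [RState.setReg, RState.setMem] using hm28
    · refine ⟨_, ?_, m2, [], .ite_false _ _ _ _ _ _ _ f1 f2
        (by rw [e2]; simp only [RExpr.eval]; omega) (.skip _), ?_, hm28, by simp, by simp⟩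
      · simp [RExpr.cost]
      · simpa using hinv2 fun h => absurd h hs1
  obtain ⟨t, ht, m3, l, hx, hinv, h38, hl1, hdis⟩ := mid
  have r5 : RExec W (.assign 8 (.read 21 (.reg 8))) m3 3
      (m3.setReg 8 (m₀.mem 21 (m.reg 8).toNat)) :=
    .assign_of_eval ⟨trivial, by simp only [RExpr.eval]; omega⟩ (by
      simp only [RExpr.eval, hinv.mem 21 (by norm_num) (by norm_num) (by norm_num), h38])
  exact ⟨_, by omega, _, l, .seq _ _ _ _ _ _ _ r1 (.seq _ _ _ _ _ _ _ r2
    (.seq _ _ _ _ _ _ _ hx r5)), hinv.setReg (by norm_num) _, by simp [RState.setReg], hl1, hdis⟩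

/-- Processing a list of edges. -/
theorem edgeLoop_exec {W : ℤ} {N : Net} {Ne : ℕ} {m₀ : RState} (hN : Stores W N Ne m₀)
    (gs : List ℕ) : ∀ (m : RState) (T : Finset ℕ) (stk : List ℕ) (c : ℕ → ℕ),
    EngineInv N m₀ m T stk c → Chain (m₀.mem 21) (m₀.mem 22) (m.reg 8) gs →
    T.card + gs.length ≤ Ne + 1 → (∀ g, c g + gs.count g ≤ N.count T g) →
    ∃ t ≤ 63 * gs.length + 3, ∃ m' l, RExec W (.loop (.const 1) (.reg 8) edgeProg) m t m' ∧
      EngineInv N m₀ m' (T ∪ l.toFinset) (stk ++ l) (fun g => c g + gs.count g) ∧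
      l.length ≤ gs.length ∧ Disjoint T l.toFinset := by
  have hW := hN.le_W
  induction gs with
  | nil =>
    intro m T stk c h hch _ _
    change m.reg 8 = 0 at hch
    refine ⟨_, ?_, m, [], .loop_done _ _ _ _ (by simp only [RExpr.Fits, abs_one]; omega) trivial
      (by simp only [RExpr.eval]; omega), by simpa using h, by simp, by simp⟩
    simp [RExpr.cost]
  | cons g gs ih =>
    intro m T stk c h hch hT hc
    obtain ⟨h8, hg, hch'⟩ := hch
    simp only [List.length_cons] at hT
    have hcg := hc g
    rw [List.count_cons_self] at hcg
    obtain ⟨t, ht, m', l, hx, hinv, h8', hl, hdis⟩ := edgeProg_exec hN h h8 hg (by omega)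
      (by omega)
    have hcard : (T ∪ l.toFinset).card ≤ T.card + 1 :=
      (Finset.card_union_le _ _).trans
        (Nat.add_le_add_left ((List.toFinset_card_le _).trans hl) _)
    obtain ⟨t', ht', m'', l', hx', hinv', hl', hdis'⟩ := ih m' _ _ _ hinv (by rw [h8']; exact hch')
      (by omega) (fun g' => by
        refine le_trans ?_ ((hc g').trans (N.count_mono Finset.subset_union_left g'))
        by_cases hg' : g' = g
        · subst hg'; rw [Function.update_self, List.count_cons_self]; omega
        · rw [Function.update_of_ne hg', List.count_cons_of_ne (fun h => hg' h.symm)])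
    refine ⟨_, ?_, m'', l ++ l', .loop_step _ _ _ _ _ _ _ _
      (by simp only [RExpr.Fits, abs_one]; omega) trivial (by simpa [RExpr.eval] using h8) hx hx',
      ?_, ?_, ?_⟩
    · simp only [RExpr.cost, List.length_cons]; omega
    · convert hinv' using 1
      · simp [Finset.union_assoc]
      · simp
      · funext g'
        by_cases hg' : g' = g
        · subst hg'; rw [Function.update_self, List.count_cons_self]; omega
        · rw [Function.update_of_ne hg', List.count_cons_of_ne (fun h => hg' h.symm)]
    · simp only [List.length_append, List.length_cons]; omega
    · rw [List.toFinset_append, Finset.disjoint_union_right]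
      exact ⟨hdis, hdis'.mono_left Finset.subset_union_left⟩

/-- Processing the stack. -/
theorem stackProg_exec {W : ℤ} {N : Net} {Ne : ℕ} {m₀ : RState} (hN : Stores W N Ne m₀)
    (k : ℕ) : ∀ (m : RState) (D : Finset ℕ) (stk : List ℕ), k + D.card = Ne + 1 →
    EngineInv N m₀ m (D ∪ stk.toFinset) stk (N.count D) → Disjoint D stk.toFinset →
    (D ∪ stk.toFinset).card ≤ 1 + ∑ x ∈ D, (N.adj x).length →
    ∃ t ≤ 20 * k + 63 * (Ne - ∑ x ∈ D, (N.adj x).length) + 3, ∃ m' T, RExec W stackProg m t m' ∧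
      EngineInv N m₀ m' T [] (N.count T) ∧ D ∪ stk.toFinset ⊆ T := by
  have hW := hN.le_W
  -- `D` consists of the processed literals. Every true literal except the first one was pushed by
  -- an edge of its own from `D`, so there are at most `Ne + 1` true literals, and `k` bounds those
  -- yet to be processed. The time allows `20` steps per literal and `63` per remaining edge. For `k
  -- = 0` the counting leaves nothing on the stack.
  induction k with
  | zero =>
    intro m D stk hk h hdis hcard
    have h1 := hN.sum_le D
    have h2 : stk.toFinset = ∅ := by
      rw [Finset.card_union_of_disjoint hdis] at hcard
      rw [← Finset.card_eq_zero]
      omega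
    obtain rfl : stk = [] := List.toFinset_eq_empty_iff _ |>.1 h2
    have hh := h.height
    refine ⟨_, ?_, m, D, .loop_done _ _ _ _ (by simp only [RExpr.Fits, abs_one]; omega) trivial
      (by simp [RExpr.eval, hh]), by simpa using h, by simp⟩
    simp [RExpr.cost]
  | succ k ih =>
    intro m D stk hk h hdis hcard
    have hh := h.height
    rcases stk.eq_nil_or_concat with rfl | ⟨st, x, rfl⟩
    · refine ⟨_, ?_, m, D, .loop_done _ _ _ _ (by simp only [RExpr.Fits, abs_one]; omega) trivial
        (by simp [RExpr.eval, hh]), by simpa using h, by simp⟩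
      simp [RExpr.cost]
    · rw [List.concat_eq_append] at h hdis hcard hh
      simp only [List.length_append, List.length_singleton, Nat.cast_add, Nat.cast_one] at hh
      have hxD : x ∉ D := fun hx => Finset.disjoint_left.1 hdis hx (by simp)
      have hnd := h.nodup
      rw [List.nodup_append] at hnd
      have hxst : x ∉ st := fun hx => hnd.2.2 x hx x (by simp) rfl
      have hT : D ∪ (st ++ [x]).toFinset = insert x D ∪ st.toFinset := by
        ext y; simp only [Finset.mem_union, List.mem_toFinset, List.mem_append, List.mem_singleton,
          Finset.mem_insert]; tauto
      rw [hT] at h hcard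
      have hsum : ∑ y ∈ insert x D, (N.adj y).length =
          (N.adj x).length + ∑ y ∈ D, (N.adj y).length := Finset.sum_insert hxD
      have hsumle := hN.sum_le (insert x D)
      have hcnt : ∀ g, N.count (insert x D) g = (N.adj x).count g + N.count D g := fun g =>
        Finset.sum_insert hxD
      have hlen := h.length_le
      simp only [List.length_append, List.length_singleton] at hlen
      have r1 : RExec W (.assign 6 (.sub (.reg 6) (.const 1))) m 4 (m.setReg 6 st.length) :=
        .assign_of_eval ⟨trivial, by simp only [RExpr.Fits, abs_one]; omega, by
          simp only [RExpr.eval]; rw [abs_of_nonneg (by omega)]; omega⟩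
          (by simp only [RExpr.eval]; omega)
      have hst := h.stack st.length (by simp)
      rw [List.getElem_append_right (le_refl _)] at hst
      simp only [Nat.sub_self, List.getElem_cons_zero] at hst
      have r2 : RExec W (.assign 7 (.read 27 (.reg 6))) (m.setReg 6 st.length) 3
          ((m.setReg 6 st.length).setReg 7 x) :=
        .assign_of_eval ⟨trivial, by simp [RExpr.eval, RState.setReg]⟩
          (by simpa [RExpr.eval, RState.setReg] using hst)
      have r3 : RExec W (.assign 8 (.read 20 (.reg 7))) ((m.setReg 6 st.length).setReg 7 x) 3
          (((m.setReg 6 st.length).setReg 7 x).setReg 8 (m₀.mem 20 x)) :=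
        .assign_of_eval ⟨trivial, by simp [RExpr.eval, RState.setReg]⟩
          (by simp [RExpr.eval, RState.setReg, h.mem 20])
      have hinv6 : EngineInv N m₀ (m.setReg 6 st.length) (insert x D ∪ st.toFinset) st
          (N.count D) := by
        refine { h with reg := fun q h1 h2 h3 h4 h5 => ?_, height := ?_, stack := fun i hi => ?_,
                        nodup := hnd.1, subset := fun y hy => h.subset y (by simp [hy]) }
        · simpa [RState.setReg, h1] using h.reg q h1 h2 h3 h4 h5
        · simp [RState.setReg]
        · have := h.stack i (by simp; omega)
          rw [List.getElem_append_left hi] at this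
          exact this
      obtain ⟨t, ht, m', l, hx, hinv, hl, hdis'⟩ := edgeLoop_exec hN (N.adj x) _ _ _ _
        ((hinv6.setReg (r := 7) (by norm_num) x).setReg (r := 8) (by norm_num) (m₀.mem 20 x))
        (by simpa [RState.setReg] using hN.chain x) (by omega) (fun g => by
          rw [Nat.add_comm, ← hcnt]
          exact N.count_mono Finset.subset_union_left g)
      have hT' : insert x D ∪ st.toFinset ∪ l.toFinset = insert x D ∪ (st ++ l).toFinset := by
        rw [List.toFinset_append, Finset.union_assoc]
      have hc' : (fun g => N.count D g + (N.adj x).count g) = N.count (insert x D) := by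
        funext g; rw [hcnt, Nat.add_comm]
      rw [hT', hc'] at hinv
      have hcardD : (insert x D).card = D.card + 1 := Finset.card_insert_of_notMem hxD
      have hll : (insert x D ∪ (st ++ l).toFinset).card ≤
          (insert x D ∪ st.toFinset).card + l.length := by
        rw [← hT']
        exact (Finset.card_union_le _ _).trans
          (Nat.add_le_add_left (List.toFinset_card_le _) _)
      obtain ⟨t', ht', m'', T, hx', hinv', hsub⟩ := ih m' (insert x D) (st ++ l) (by omega) hinv (by
        rw [List.toFinset_append, Finset.disjoint_union_right]
        refine ⟨?_, hdis'.mono_left Finset.subset_union_left⟩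
        rw [Finset.disjoint_insert_left]
        refine ⟨by simpa using hxst, hdis.mono_right fun y hy => ?_⟩
        rw [List.mem_toFinset] at hy ⊢
        exact List.mem_append_left _ hy) (by omega)
      refine ⟨_, ?_, m'', T, .loop_step _ _ _ _ _ _ _ _ (by simp only [RExpr.Fits, abs_one]; omega)
        trivial (by simp only [RExpr.eval]; omega) (.seq _ _ _ _ _ _ _ r1 (.seq _ _ _ _ _ _ _ r2
          (.seq _ _ _ _ _ _ _ r3 hx))) hx', hinv', ?_⟩
      · simp only [RExpr.cost]
        omega
      · rw [List.concat_eq_append, hT]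
        exact (Finset.subset_union_left.trans hT'.subset).trans hsub

/-- Propagation computes a set of literals that is closed, supported, and contained in all
preserved sets. -/
theorem engineProg_exec {W : ℤ} {N : Net} {Ne : ℕ} {m : RState} (hN : Stores W N Ne m)
    (h26 : ∀ x, m.mem 26 x = 0) :
    ∃ t ≤ 83 * Ne + 50, ∃ (m' : RState) (T : Finset ℕ), RExec W engineProg m t m' ∧
      (∀ r, r ≠ 6 → r ≠ 7 → r ≠ 8 → r ≠ 9 → r ≠ 13 → m'.reg r = m.reg r) ∧
      (∀ A, A ≠ 23 → A ≠ 26 → A ≠ 27 → m'.mem A = m.mem A) ∧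
      (∀ x, m'.mem 26 x = if x ∈ T then 1 else 0) ∧
      (∀ g, m'.mem 23 g = N.c0 g + N.count T g) ∧
      0 ∈ T ∧ N.Closed T ∧ (∀ H, N.Preserved H → ∀ x ∈ T, x ∈ H) := by
  have hW := hN.le_W
  have f0 : ∀ m, (RExpr.const 0).Fits W m := fun m => by simp only [RExpr.Fits, abs_zero]; omega
  have r1 : RExec W (.assign 6 (.const 0)) m 2 (m.setReg 6 0) := .assign_of_eval (f0 _) rfl
  have r2 : RExec W (.assign 13 (.const 0)) (m.setReg 6 0) 2 ((m.setReg 6 0).setReg 13 0) :=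
    .assign_of_eval (f0 _) rfl
  obtain ⟨t3, ht3, r3⟩ := (pushProg_exec (W := W) (m := (m.setReg 6 0).setReg 13 0) (y := 0)
    (by simp [RState.setReg]) (by simp [RState.setReg]) (by simp [RState.setReg]; omega)).1
    (by simp [RState.setReg, h26])
  -- The empty set satisfies the invariant because `c0 ≤ 0`: no gate is active without inputs.
  have hinv0 : EngineInv N m ((m.setReg 6 0).setReg 13 0) ∅ [] (N.count ∅) := by
    refine ⟨fun q h1 h2 h3 h4 h5 => ?_, fun A _ _ _ => rfl, fun x => ?_, fun g => ?_, ?_,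
      fun i hi => ?_, by simp, by simp, fun g => le_refl _, fun g s h1 h2 => ?_, ?_, by simp⟩
    · simp [RState.setReg, h1, h5]
    · simp [RState.setReg, h26]
    · simp [RState.setReg, Net.count, hN.c0]
    · simp [RState.setReg]
    · simp at hi
    · have := hN.c0_le g
      simp only [Net.count, Finset.sum_empty, Nat.cast_zero] at h2
      omega
    · intro x hx; simp at hx
  have hinv1 := hinv0.push (y := 0) (by simp) (fun x hx => Or.inl (by simpa using hx))
    (fun H hH => hH.1)
  obtain ⟨t, ht, m', T, hx, hinv, hsub⟩ := stackProg_exec hN (Ne + 1) _ ∅ [0] (by simp)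
    (by simpa using hinv1) (by simp) (by simp)
  refine ⟨_, ?_, m', T, .seq _ _ _ _ _ _ _ r1 (.seq _ _ _ _ _ _ _ r2 (.seq _ _ _ _ _ _ _ r3 hx)),
    hinv.reg, hinv.mem, hinv.truth, hinv.cnt, hsub (by simp),
        fun g s hs => hinv.closed g s hs.1 hs.2, hinv.sound⟩
  simp only [Finset.sum_empty] at ht
  omega

/-! ## Building a network -/

/-- The edges added by a list of operations. -/
def edgesOf (os : List EOp) : List (ℕ × ℕ) :=
  os.flatMap fun o => match o with
    | .edge x g => [(x, g)]
    | _ => []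

/-- The targets of the edges from `x`, the last edge first. -/
def targets (es : List (ℕ × ℕ)) (x : ℕ) : List ℕ :=
  ((es.filter fun e => e.1 = x).map Prod.snd).reverse

theorem edgesOf_append (os os' : List EOp) : edgesOf (os ++ os') = edgesOf os ++ edgesOf os' :=
  List.flatMap_append

theorem mem_edgesOf {os : List EOp} {x g : ℕ} : (x, g) ∈ edgesOf os ↔ EOp.edge x g ∈ os := by
  simp only [edgesOf, List.mem_flatMap]
  constructor
  · rintro ⟨o, ho, h⟩
    cases o <;> simp_all
  · exact fun h => ⟨_, h, by simp⟩

theorem length_edgesOf (os : List EOp) : (edgesOf os).length ≤ os.length := by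
  induction os with
  | nil => simp [edgesOf]
  | cons o os ih =>
    have : edgesOf (o :: os) = edgesOf [o] ++ edgesOf os := edgesOf_append [o] os
    rw [this, List.length_append, List.length_cons]
    cases o <;> simp [edgesOf] at ih ⊢ <;> omega

theorem targets_concat (es : List (ℕ × ℕ)) (x g y : ℕ) :
    targets (es ++ [(x, g)]) y = if x = y then g :: targets es y else targets es y := by
  simp only [targets, List.filter_append, List.map_append, List.reverse_append]
  split_ifs with h <;> simp [h]

theorem sum_length_targets (es : List (ℕ × ℕ)) (F : Finset ℕ) :
    ∑ x ∈ F, (targets es x).length ≤ es.length := by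
  induction es using List.reverseRecOn with
  | nil => simp [targets]
  | append_singleton es e ih =>
    obtain ⟨x, g⟩ := e
    have : ∀ y, (targets (es ++ [(x, g)]) y).length =
        (targets es y).length + if x = y then 1 else 0 := fun y => by
      rw [targets_concat]; split_ifs <;> simp
    simp only [this, Finset.sum_add_distrib, Finset.sum_ite_eq, List.length_append,
      List.length_singleton]
    split_ifs <;> omega

theorem sum_count_targets (es : List (ℕ × ℕ)) (F : Finset ℕ) (g : ℕ) :
    ∑ x ∈ F, (targets es x).count g = es.countP fun e => e.1 ∈ F ∧ e.2 = g := by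
  induction es using List.reverseRecOn with
  | nil => simp [targets]
  | append_singleton es e ih =>
    obtain ⟨x, h⟩ := e
    have : ∀ y, (targets (es ++ [(x, h)]) y).count g =
        (targets es y).count g + if x = y then (if h = g then 1 else 0) else 0 := fun y => by
      rw [targets_concat]; split_ifs with h1 h2 <;> simp [*]
    simp only [this, Finset.sum_add_distrib, Finset.sum_ite_eq, List.countP_append, ih,
      List.countP_singleton, decide_eq_true_eq]
    congr 1
    by_cases h1 : x ∈ F <;> by_cases h2 : h = g <;> simp [h1, h2]

/-- Entries up to `N` are unchanged and their links do not lead beyond `N`, so a list that starts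
below `N` never meets a changed entry. -/
theorem Chain.congr {nxt tgt nxt' tgt' : ℕ → ℤ} {N : ℤ} (h : ∀ e : ℤ, 1 ≤ e → e ≤ N →
    nxt' e.toNat = nxt e.toNat ∧ tgt' e.toNat = tgt e.toNat ∧ nxt e.toNat ≤ N) :
    ∀ (gs : List ℕ) (e : ℤ), e ≤ N → Chain nxt tgt e gs → Chain nxt' tgt' e gs
  | [], _, _, hc => hc
  | g :: gs, e, he, ⟨h1, h2, h3⟩ =>
    have h4 := h e h1 he
    ⟨h1, h4.2.1.trans h2, by rw [h4.1]; exact Chain.congr h gs _ h4.2.2 h3⟩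

/-- The linked lists of the edges added by a list of operations. -/
theorem chain_runOps {m : RState} (h5 : m.reg 5 = 0) (h20 : ∀ x, m.mem 20 x = 0)
    (h21 : ∀ x, m.mem 21 x = 0) (os : List EOp) (hos : ∀ o ∈ os, ∀ A j v, o ≠ .put A j v) :
    0 ≤ (runOps m os).reg 5 ∧ (∀ x, (runOps m os).mem 20 x ≤ (runOps m os).reg 5) ∧
    (∀ e, (runOps m os).mem 21 e ≤ (runOps m os).reg 5) ∧
    ∀ x, Chain ((runOps m os).mem 21) ((runOps m os).mem 22) ((runOps m os).mem 20 x)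
      (targets (edgesOf os) x) := by
  induction os using List.reverseRecOn with
  | nil => simp [runOps, h5, h20, h21, targets, edgesOf, Chain]
  | append_singleton os o ih =>
    obtain ⟨i1, i2, i3, i4⟩ := ih fun o ho => hos o (List.mem_append_left _ ho)
    rw [runOps_append, edgesOf_append]
    set m' := runOps m os
    change 0 ≤ (o.apply m').reg 5 ∧ (∀ x, (o.apply m').mem 20 x ≤ (o.apply m').reg 5) ∧
      (∀ e, (o.apply m').mem 21 e ≤ (o.apply m').reg 5) ∧ ∀ x, Chain ((o.apply m').mem 21)
      ((o.apply m').mem 22) ((o.apply m').mem 20 x) _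
    cases o with
    | put A j v => exact absurd rfl (hos _ (by simp) A j v)
    | gate g c ob inh =>
      have : edgesOf [EOp.gate g c ob inh] = [] := by simp [edgesOf]
      rw [this, List.append_nil]
      simpa [EOp.apply, RState.setMem] using ⟨i1, i2, i3, i4⟩
    | edge x g =>
      have he : edgesOf [EOp.edge x g] = [(x, g)] := by simp [edgesOf]
      have e5 : ((EOp.edge x g).apply m').reg 5 = m'.reg 5 + 1 := by
        simp [EOp.apply, RState.setMem, RState.setReg]
      have e20 : ((EOp.edge x g).apply m').mem 20 =
          Function.update (m'.mem 20) x (m'.reg 5 + 1) := by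
        simp [EOp.apply, RState.setMem, RState.setReg]
      have e21 : ((EOp.edge x g).apply m').mem 21 =
          Function.update (m'.mem 21) (m'.reg 5 + 1).toNat (m'.mem 20 x) := by
        simp [EOp.apply, RState.setMem, RState.setReg]
      have e22 : ((EOp.edge x g).apply m').mem 22 =
          Function.update (m'.mem 22) (m'.reg 5 + 1).toNat g := by
        simp [EOp.apply, RState.setMem, RState.setReg]
      rw [he, e5, e20, e21, e22]
      -- The new edge gets the fresh number `reg 5 + 1`, beyond all existing lists.
      have hcong : ∀ y, Chain (Function.update (m'.mem 21) (m'.reg 5 + 1).toNat (m'.mem 20 x))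
          (Function.update (m'.mem 22) (m'.reg 5 + 1).toNat g) (m'.mem 20 y)
          (targets (edgesOf os) y) := fun y => by
        refine Chain.congr (N := m'.reg 5) (fun e h1 h2 => ?_) _ _ (i2 y) (i4 y)
        rw [Function.update_of_ne (by omega), Function.update_of_ne (by omega)]
        exact ⟨rfl, rfl, i3 _⟩
      refine ⟨by omega, fun y => ?_, fun e => ?_, fun y => ?_⟩
      · by_cases hy : y = x
        · subst hy; simp
        · rw [Function.update_of_ne hy]; exact (i2 y).trans (by omega)
      · by_cases hy : e = (m'.reg 5 + 1).toNat
        · subst hy; rw [Function.update_self]; exact (i2 x).trans (by omega)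
        · rw [Function.update_of_ne hy]; exact (i3 e).trans (by omega)
      · rw [targets_concat]
        by_cases hy : y = x
        · subst hy
          rw [Function.update_self, if_pos rfl]
          refine ⟨by omega, by rw [Function.update_self], ?_⟩
          rw [Function.update_self]
          exact hcong y
        · rw [Function.update_of_ne hy, if_neg fun h => hy h.symm]
          exact hcong y

/-- The data of the gates all satisfy a property that the operations guarantee. -/
theorem gate_runOps {m : RState} (P : ℤ → ℤ → ℤ → Prop) (g : ℕ) (os : List EOp)
    (hos : ∀ o ∈ os, ∀ A j v, o ≠ .put A j v)
    (h0 : P (m.mem 23 g) (m.mem 24 g) (m.mem 25 g))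
    (h : ∀ c ob inh, .gate g c ob inh ∈ os → P c ob inh) :
    P ((runOps m os).mem 23 g) ((runOps m os).mem 24 g) ((runOps m os).mem 25 g) := by
  induction os generalizing m with
  | nil => exact h0
  | cons o os ih =>
    refine ih (m := o.apply m) (fun o ho => hos o (List.mem_cons_of_mem _ ho)) ?_
      (fun c ob inh hg => h c ob inh (List.mem_cons_of_mem _ hg))
    cases o with
    | put A j v => exact absurd rfl (hos _ (by simp) A j v)
    | edge x g' => simpa [EOp.apply, RState.setMem, RState.setReg] using h0
    | gate g' c ob inh =>
      by_cases hg : g = g'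
      · subst hg
        simpa [EOp.apply, RState.setMem] using h c ob inh (by simp)
      · simpa [EOp.apply, RState.setMem, hg] using h0

/-- The data of a gate that is set to unique values. -/
theorem gate_runOps_eq {m : RState} {g : ℕ} {c ob inh : ℤ} (os : List EOp)
    (hos : ∀ o ∈ os, ∀ A j v, o ≠ .put A j v) (hg : .gate g c ob inh ∈ os)
    (h : ∀ c' ob' inh', .gate g c' ob' inh' ∈ os → c' = c ∧ ob' = ob ∧ inh' = inh) :
    (runOps m os).mem 23 g = c ∧ (runOps m os).mem 24 g = ob ∧ (runOps m os).mem 25 g = inh := by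
  obtain ⟨os₁, os₂, rfl⟩ := List.append_of_mem hg
  rw [runOps_append]
  refine gate_runOps (m := (EOp.gate g c ob inh).apply (runOps m os₁))
    (fun c' ob' inh' => c' = c ∧ ob' = ob ∧ inh' = inh) g os₂
    (fun o ho => hos o (by simp [ho])) ?_ (fun c' ob' inh' hg' => h _ _ _ (by simp [hg']))
  simp [EOp.apply, RState.setMem]

/-- An entry of an array that is set to a unique value. -/
theorem put_runOps_eq {m : RState} {A j : ℕ} {v : ℤ} (os : List EOp)
    (hos : ∀ o ∈ os, ∃ A j v, o = .put A j v) (hp : .put A j v ∈ os)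
    (h : ∀ v', .put A j v' ∈ os → v' = v) : (runOps m os).mem A j = v := by
  obtain ⟨os₁, os₂, rfl⟩ := List.append_of_mem hp
  rw [runOps_append]
  have key : ∀ (os : List EOp) (m : RState), m.mem A j = v → (∀ o ∈ os, ∃ A j v, o = .put A j v) →
      (∀ v', .put A j v' ∈ os → v' = v) → (runOps m os).mem A j = v := by
    intro os
    induction os with
    | nil => exact fun m h _ _ => h
    | cons o os ih =>
      intro m h1 h2 h3
      refine ih (o.apply m) ?_ (fun o ho => h2 o (List.mem_cons_of_mem _ ho))
        (fun v' h => h3 v' (List.mem_cons_of_mem _ h))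
      obtain ⟨A', j', v', rfl⟩ := h2 o (by simp)
      by_cases hA : A' = A
      · subst hA
        by_cases hj : j' = j
        · subst hj
          simpa [EOp.apply, RState.setMem] using h3 v' (by simp)
        · simpa [EOp.apply, RState.setMem, Ne.symm hj] using h1
      · simpa [EOp.apply, RState.setMem, Ne.symm hA] using h1
  exact key os₂ _ (by simp [EOp.apply, RState.setMem]) (fun o ho => hos o (by simp [ho]))
    (fun v' hv => h v' (by simp [hv]))

/-! ## Propagation rules -/

/-- A point in the nest of loops. -/
structure Pt where
  l : ℕ
  u : ℕ
  j : ℕ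

/-- Expressions in rules: `kind` stands for the set of variables to which the variable `j` belongs,
and `dom` tells if `l` is in the domain of the variable `j`. -/
inductive NE
  | k (c : ℕ)
  | n
  | d
  | l
  | u
  | j
  | kind
  | dom
  | add (e f : NE)

instance : Zero NE := ⟨.k 0⟩

/-- The program expression. -/
def NE.toR : NE → RExpr
  | .k c => .const c
  | .n => .reg 0
  | .d => .reg 1
  | .l => .reg 10
  | .u => .reg 11
  | .j => .reg 12
  | .kind => .add (.read 1 (.reg 12)) (.add (.read 2 (.reg 12)) (.read 2 (.reg 12)))
  | .dom => .read 0 (.add (.mul (.reg 12) (.add (.reg 1) (.const 1))) (.reg 10))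
  | .add e f => .add e.toR f.toR

/-- The value of an expression. -/
noncomputable def NE.eval {n d : ℕ} (I : OADInstance n d) (p : Pt) : NE → ℕ
  | .k c => c
  | .n => n
  | .d => d
  | .l => p.l
  | .u => p.u
  | .j => p.j
  | .kind => (I.input.mem 1 p.j).toNat + ((I.input.mem 2 p.j).toNat + (I.input.mem 2 p.j).toNat)
  | .dom => (I.input.mem 0 (p.j * (d + 1) + p.l)).toNat
  | .add e f => e.eval I p + f.eval I p

/-- Literals: a tag and three numbers. -/
structure Lit (α : Type) where
  t : ℕ
  a : α
  b : α
  c : α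

/-- The memory holds the input and the sizes that are used for numbering literals. -/
structure RState.IsEnv {n d : ℕ} (I : OADInstance n d) (m : RState) : Prop where
  zero : m.reg 0 = n
  one : m.reg 1 = d
  three : m.reg 3 = (d + 3 : ℕ)
  four : m.reg 4 = (6 * n + 20 : ℕ)
  mem : ∀ A ≤ 2, m.mem A = I.input.mem A

section

variable {n d : ℕ} {I : OADInstance n d}

theorem OADInstance.input_mem_nonneg (A j : ℕ) : 0 ≤ I.input.mem A j ∧ I.input.mem A j ≤ 1 := by
  simp only [OADInstance.input]
  split_ifs <;> omega

theorem NE.eval_toR {m : RState} (hm : m.IsEnv I) (p : Pt) (e : NE) :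
    e.toR.eval (m.withCounters p.l p.u p.j) = e.eval I p := by
  have h0 := fun A j => (I.input_mem_nonneg A j).1
  have hA : ∀ A ≤ 2, (m.withCounters p.l p.u p.j).mem A = I.input.mem A := hm.mem
  induction e with
  | k c => rfl
  | n => simpa [RExpr.eval, NE.toR, NE.eval, RState.withCounters, RState.setReg] using hm.zero
  | d => simpa [RExpr.eval, NE.toR, NE.eval, RState.withCounters, RState.setReg] using hm.one
  | l => simp [RExpr.eval, NE.toR, NE.eval, RState.withCounters, RState.setReg]
  | u => simp [RExpr.eval, NE.toR, NE.eval, RState.withCounters, RState.setReg]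
  | j => simp [RExpr.eval, NE.toR, NE.eval, RState.withCounters, RState.setReg]
  | kind =>
    simp only [RExpr.eval, NE.toR, NE.eval, hA 1 (by norm_num), hA 2 (by norm_num)]
    have : (m.withCounters p.l p.u p.j).reg 12 = p.j := by
      simp [RState.withCounters, RState.setReg]
    rw [this, Int.toNat_natCast]
    push_cast [Int.toNat_of_nonneg (h0 _ _)]
    rfl
  | dom =>
    have h1 : (m.withCounters p.l p.u p.j).reg 12 = p.j := by
      simp [RState.withCounters, RState.setReg]
    have h2 : (m.withCounters p.l p.u p.j).reg 10 = p.l := by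
      simp [RState.withCounters, RState.setReg]
    have h3 : (m.withCounters p.l p.u p.j).reg 1 = d := by
      simpa [RState.withCounters, RState.setReg] using hm.one
    simp only [RExpr.eval, NE.toR, NE.eval, hA 0 (by norm_num), h1, h2, h3]
    rw [Int.toNat_of_nonneg (h0 _ _)]
    norm_cast
  | add e f ihe ihf => simp [RExpr.eval, NE.toR, NE.eval, ihe, ihf]

end

theorem add_mul_inj {q p s r B : ℕ} (hq : q < B) (hs : s < B) (h : p * B + q = r * B + s) :
    p = r ∧ q = s := by
  have h1 : (p * B + q) / B = p := by
    rw [Nat.add_comm, Nat.add_mul_div_right _ _ (by omega), Nat.div_eq_of_lt hq, Nat.zero_add]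
  have h2 : (r * B + s) / B = r := by
    rw [Nat.add_comm, Nat.add_mul_div_right _ _ (by omega), Nat.div_eq_of_lt hs, Nat.zero_add]
  have : p = r := by rw [← h1, ← h2, h]
  subst this
  exact ⟨rfl, by omega⟩

/-! ### Literals and their numbers -/

namespace Lit

variable {n d : ℕ} (I : OADInstance n d)

/-- Evaluation of the numbers in a literal. -/
noncomputable def eval (p : Pt) (x : Lit NE) : Lit ℕ :=
    ⟨x.t, x.a.eval I p, x.b.eval I p, x.c.eval I p⟩

/-- The number of a literal. -/
def code (n d : ℕ) (x : Lit ℕ) : ℕ := ((x.t * (d + 3) + x.a) * (d + 3) + x.b) * (6 * n + 20) + x.c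

/-- The program expression for the number of a literal. -/
def toR (x : Lit NE) : RExpr :=
  .add (.mul (.add (.mul (.add (.mul (.const x.t) (.reg 3)) x.a.toR) (.reg 3)) x.b.toR) (.reg 4))
    x.c.toR

/-- The numbers in the literal are in the range in which numbering is injective. -/
def InBox (n d : ℕ) (x : Lit ℕ) : Prop := x.a < d + 3 ∧ x.b < d + 3 ∧ x.c < 6 * n + 20

/-- The literal with the last number increased. -/
def shift (x : Lit ℕ) (s : ℕ) : Lit ℕ := ⟨x.t, x.a, x.b, x.c + s⟩

variable {I}

/-- Numbers in mixed radix; the tag is the leading digit and needs no bound. -/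
theorem code_injective {x y : Lit ℕ} (hx : x.InBox n d) (hy : y.InBox n d)
    (h : x.code n d = y.code n d) : x = y := by
  obtain ⟨t, a, b, c⟩ := x
  obtain ⟨t', a', b', c'⟩ := y
  obtain ⟨h1, h2, h3⟩ := hx
  obtain ⟨h4, h5, h6⟩ := hy
  simp only [code] at h
  obtain ⟨k1, rfl⟩ := add_mul_inj (q := c) (s := c') h3 h6 h
  obtain ⟨k2, rfl⟩ := add_mul_inj (q := b) (s := b') h2 h5 k1
  obtain ⟨rfl, rfl⟩ := add_mul_inj (q := a) (s := a') h1 h4 k2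
  rfl

/-- The last digit is the counter value, so a gate reaches `C ≥ 1`, `C ≥ 2`, … by adding its count
to a single offset. -/
theorem code_shift (x : Lit ℕ) (s : ℕ) : (x.shift s).code n d = x.code n d + s := by
  simp only [code, shift]; omega

theorem eval_toR {m : RState} (hm : m.IsEnv I) (p : Pt) (x : Lit NE) :
    x.toR.eval (m.withCounters p.l p.u p.j) = (x.eval I p).code n d := by
  have h3 : (m.withCounters p.l p.u p.j).reg 3 = (d + 3 : ℕ) := by
    simpa [RState.withCounters, RState.setReg] using hm.three
  have h4 : (m.withCounters p.l p.u p.j).reg 4 = (6 * n + 20 : ℕ) := by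
    simpa [RState.withCounters, RState.setReg] using hm.four
  simp only [toR, RExpr.eval, NE.eval_toR hm, h3, h4, code, eval]
  push_cast
  rfl

section

variable {α : Type} [Zero α]

/-- The literal that is always true. -/
def tru : Lit α := ⟨0, 0, 0, 0⟩
/-- A contradiction. -/
def fls : Lit α := ⟨1, 0, 0, 0⟩
/-- `X i ≥ v`. -/
def ge (i v : α) : Lit α := ⟨2, v, 0, i⟩
/-- `X i < v`. -/
def lt (i v : α) : Lit α := ⟨3, v, 0, i⟩
/-- `a i l u = 1`. -/
def one (i l u : α) : Lit α := ⟨4, l, u, i⟩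
/-- `a i l u = 0`. -/
def zero (i l u : α) : Lit α := ⟨5, l, u, i⟩

end

end Lit

/-- Encoding of the sets of variables: `1` for elements of `S` plus `2` for elements of `T`. -/
def CKind.code : CKind → ℕ
  | .st => 3
  | .s => 1
  | .t => 2

namespace Lit

variable {α : Type}

/-- `C k l u ≥ y`. -/
def cge (k : CKind) (l u y : α) : Lit α := ⟨6 + k.code, l, u, y⟩
/-- `C k l u ≤ n - y`. -/
def cle (k : CKind) (l u y : α) : Lit α := ⟨9 + k.code, l, u, y⟩
/-- The variables `a i l u` counted by `C k l u` are `0` unless they must be `1`. -/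
def low (k : CKind) (l u y : α) : Lit α := ⟨12 + k.code, l, u, y⟩
/-- The variables `a i l u` counted by `C k l u` are `1` unless they must be `0`. -/
def high (k : CKind) (l u y : α) : Lit α := ⟨15 + k.code, l, u, y⟩
/-- A literal without meaning. -/
def junk (l u y : α) : Lit α := ⟨19, l, u, y⟩

end Lit

/-- Conditions `e ≤ f`. -/
abbrev Cond := List (NE × NE)

/-- All the conditions are satisfied. -/
def Cond.Holds {n d : ℕ} (I : OADInstance n d) (gs : Cond) (p : Pt) : Prop :=
  ∀ g ∈ gs, g.1.eval I p ≤ g.2.eval I p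

/-- A rule: if the number of true inputs is at least `thr + s`, where `1 ≤ s`, then `out`, shifted
by `s - 1`, is true unless `inh` is. If `sum` is set, the inputs for all values of `j` are
counted. -/
structure Rule where
  guards : Cond := []
  ins : List (Cond × Lit NE)
  sum : Bool
  thr : NE := .k 0
  out : Lit NE
  inh : Lit NE := .fls

namespace Rule

variable {n d : ℕ} (I : OADInstance n d)

open Classical in
/-- The number of true inputs for a fixed value of `j`. -/
noncomputable def cntAt (R : Rule) (τ : Lit ℕ → Prop) (p : Pt) : ℕ :=
  R.ins.countP fun i => Cond.Holds I R.guards p ∧ Cond.Holds I i.1 p ∧ τ (i.2.eval I p)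

/-- The number of true inputs. -/
noncomputable def cnt (R : Rule) (τ : Lit ℕ → Prop) (p : Pt) : ℕ :=
  if R.sum then ∑ j ∈ Finset.range (n + 2), R.cntAt I τ ⟨p.l, p.u, j⟩ else R.cntAt I τ p

/-- The rule fires with excess `s`. -/
def Fires (R : Rule) (τ : Lit ℕ → Prop) (p : Pt) (s : ℕ) : Prop :=
  p.l ≤ d + 1 ∧ p.u ≤ d + 1 ∧ p.j ≤ n + 1 ∧ (R.sum = true → p.j = 0) ∧ 1 ≤ s ∧
    R.thr.eval I p + s ≤ R.cnt I τ p

/-- The number of the gate for a rule. -/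
def gateR (r : ℕ) (R : Rule) : RExpr :=
  (Lit.mk r .l .u (if R.sum then .k 0 else .j)).toR

/-- The operations that add a rule to the network. -/
def items (r : ℕ) (R : Rule) : List Item :=
  (R.ins.map fun i => ⟨(R.guards ++ i.1).map fun g => (g.1.toR, g.2.toR),
    .edge i.2.toR (R.gateR r)⟩) ++
  [⟨if R.sum then [(.reg 12, .const 0)] else [],
    .gate (R.gateR r) (.sub (.const 0) R.thr.toR) (.sub R.out.toR (.const 1)) R.inh.toR⟩]

end Rule

/-- Expressions with values up to `d + 2`. -/
def NE.isPos : NE → Bool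
  | .k c => decide (c ≤ 1)
  | .l => true
  | .u => true
  | .add .l (.k c) => decide (c ≤ 1)
  | .add .u (.k c) => decide (c ≤ 1)
  | .add .d (.k c) => decide (c ≤ 1)
  | _ => false

/-- Expressions with values up to `n + 1`. -/
def NE.isCnt : NE → Bool
  | .k c => decide (c ≤ 1)
  | .j => true
  | _ => false

theorem NE.isPos_spec {n d : ℕ} {I : OADInstance n d} {p : Pt} (hl : p.l ≤ d + 1)
    (hu : p.u ≤ d + 1) {e : NE} (he : e.isPos = true) : e.eval I p < d + 3 := by
  unfold NE.isPos at he
  split at he <;> simp_all [NE.eval] <;> omega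

theorem NE.isCnt_spec {n d : ℕ} {I : OADInstance n d} {p : Pt} (hj : p.j ≤ n + 1)
    {e : NE} (he : e.isCnt = true) : e.eval I p ≤ n + 1 := by
  unfold NE.isCnt at he
  split at he <;> simp_all [NE.eval]; omega

/-- The numbers in the literal are small. -/
def Lit.ok (x : Lit NE) : Bool := x.a.isPos && x.b.isPos && x.c.isCnt

/-- The literals in the rule have small numbers. -/
def Rule.ok (R : Rule) : Bool :=
  R.ins.all (fun i => i.2.ok) && R.out.ok && R.inh.ok && decide (R.ins.length ≤ 5)

/-! ## The network of a list of rules -/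

instance : Inhabited Rule := ⟨⟨[], [], false, .k 0, .fls, .fls⟩⟩

/-- The guarded operations that add all the rules to the network. -/
def netItems (Rs : List Rule) : List Item :=
  (List.range Rs.length).flatMap fun r => (Rs.getD r default).items r

/-- The number of the gate for the rule `R` with index `r`. -/
def Rule.gate (n d : ℕ) (r : ℕ) (R : Rule) (p : Pt) : ℕ :=
  (Lit.mk r p.l p.u (if R.sum then 0 else p.j)).code n d

/-- The point in the nest of loops is within the range. -/
def Pt.InBox (n d : ℕ) (p : Pt) : Prop := p.l ≤ d + 1 ∧ p.u ≤ d + 1 ∧ p.j ≤ n + 1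

/-- The network built by the rules in the memory `m`. -/
noncomputable def netOf (n d : ℕ) (m : RState) (Rs : List Rule) : Net where
  adj := targets (edgesOf (boxOps m n d (netItems Rs)))
  c0 := (runOps m (boxOps m n d (netItems Rs))).mem 23
  ob := (runOps m (boxOps m n d (netItems Rs))).mem 24
  inh := (runOps m (boxOps m n d (netItems Rs))).mem 25

theorem countP_flatMap_range {α : Type} (p : α → Bool) (f : ℕ → List α) (k : ℕ) :
    ((List.range k).flatMap f).countP p = ∑ i ∈ Finset.range k, (f i).countP p := by
  induction k with
  | zero => simp
  | succ k ih => simp [List.range_succ, Finset.sum_range_succ, ih]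

theorem edgesOf_flatMap {α : Type} (l : List α) (f : α → List EOp) :
    edgesOf (l.flatMap f) = l.flatMap fun a => edgesOf (f a) :=
  List.flatMap_assoc

theorem mem_boxOps {m : RState} {n d : ℕ} {is : List Item} {o : EOp} :
    o ∈ boxOps m n d is ↔ ∃ p : Pt, p.InBox n d ∧ ∃ i ∈ is,
      guardsHold (m.withCounters p.l p.u p.j) i.guards ∧
      o = i.op.eval (m.withCounters p.l p.u p.j) := by
  classical
  simp only [boxOps, itemsOps, List.mem_flatMap, List.mem_range]
  constructor
  · rintro ⟨l, hl, u, hu, j, hj, i, hi, ho⟩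
    refine ⟨⟨l, u, j⟩, ⟨by simp only; omega, by simp only; omega, by simp only; omega⟩, i, hi, ?_⟩
    split_ifs at ho with h
    · exact ⟨h, by simpa using ho⟩
    · simp at ho
  · rintro ⟨⟨l, u, j⟩, ⟨hl, hu, hj⟩, i, hi, h, ho⟩
    exact ⟨l, by simp only at hl; omega, u, by simp only at hu; omega, j,
      by simp only at hj; omega, i, hi, by rw [if_pos h]; simp [ho]⟩

section

variable {n d : ℕ} {I : OADInstance n d} {m : RState} {Rs : List Rule}

theorem Rule.eval_gateR (hm : m.IsEnv I) (p : Pt) (r : ℕ) (R : Rule) :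
    (R.gateR r).eval (m.withCounters p.l p.u p.j) = R.gate n d r p := by
  rw [Rule.gateR, Lit.eval_toR hm]
  simp only [Lit.eval, Rule.gate, NE.eval]
  split_ifs <;> rfl

theorem guardsHold_map (hm : m.IsEnv I) (p : Pt) (gs : Cond) :
    guardsHold (m.withCounters p.l p.u p.j) (gs.map fun g => (g.1.toR, g.2.toR)) ↔
      gs.Holds I p := by
  simp only [guardsHold, List.mem_map, forall_exists_index, and_imp, forall_apply_eq_imp_iff₂,
    NE.eval_toR hm, Cond.Holds, Nat.cast_le]

theorem Cond.holds_append (gs gs' : Cond) (p : Pt) :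
    Cond.Holds I (gs ++ gs') p ↔ gs.Holds I p ∧ gs'.Holds I p :=
  List.forall_mem_append

theorem mem_netItems {i : Item} : i ∈ netItems Rs ↔ ∃ (r : ℕ) (R : Rule), Rs[r]? = some R ∧
    i ∈ R.items r := by
  simp only [netItems, List.mem_flatMap, List.mem_range]
  constructor
  · rintro ⟨r, hr, hi⟩
    refine ⟨r, Rs[r], by simp [hr], ?_⟩
    rwa [List.getD_eq_getElem _ _ hr] at hi
  · rintro ⟨r, R, hr, hi⟩
    obtain ⟨hr', rfl⟩ := List.getElem?_eq_some_iff.1 hr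
    exact ⟨r, hr', by rwa [List.getD_eq_getElem _ _ hr']⟩

/-- The edges of the network. -/
theorem edge_mem_boxOps (hm : m.IsEnv I) {x g : ℕ} :
    EOp.edge x g ∈ boxOps m n d (netItems Rs) → ∃ (r : ℕ) (R : Rule) (p : Pt), Rs[r]? = some R ∧
        p.InBox n d ∧
      g = R.gate n d r p := by
  rw [mem_boxOps]
  rintro ⟨p, hp, i, hi, hg, ho⟩
  obtain ⟨r, R, hr, hi⟩ := mem_netItems.1 hi
  rw [Rule.items, List.mem_append, List.mem_map, List.mem_singleton] at hi
  rcases hi with ⟨i, -, rfl⟩ | rfl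
  · simp only [Op.eval, Rule.eval_gateR hm, Int.toNat_natCast, EOp.edge.injEq] at ho
    exact ⟨r, R, p, hr, hp, ho.2⟩
  · simp [Op.eval] at ho

/-- The gates of the network. -/
theorem gate_mem_boxOps (hm : m.IsEnv I) {g : ℕ} {c ob inh : ℤ} :
    EOp.gate g c ob inh ∈ boxOps m n d (netItems Rs) ↔ ∃ (r : ℕ) (R : Rule) (p : Pt), Rs[r]? =
        some R ∧ p.InBox n d ∧
      (R.sum = true → p.j = 0) ∧ g = R.gate n d r p ∧ c = -(R.thr.eval I p : ℤ) ∧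
      ob = (R.out.eval I p).code n d - 1 ∧ inh = (R.inh.eval I p).code n d := by
  have h12 : ∀ p : Pt, (m.withCounters p.l p.u p.j).reg 12 = p.j := fun p => by
    simp [RState.withCounters, RState.setReg]
  have hgu : ∀ (R : Rule) (p : Pt), guardsHold (m.withCounters p.l p.u p.j)
      (if R.sum = true then [(RExpr.reg 12, RExpr.const 0)] else []) ↔
      (R.sum = true → p.j = 0) := fun R p => by
    split_ifs with h <;> simp [guardsHold, RExpr.eval, h12, h]
  rw [mem_boxOps]
  constructor
  · rintro ⟨p, hp, i, hi, hg, ho⟩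
    obtain ⟨r, R, hr, hi⟩ := mem_netItems.1 hi
    rw [Rule.items, List.mem_append, List.mem_map, List.mem_singleton] at hi
    rcases hi with ⟨i, -, rfl⟩ | rfl
    · simp [Op.eval] at ho
    · simp only [Op.eval, Rule.eval_gateR hm, Int.toNat_natCast, EOp.gate.injEq, RExpr.eval,
        NE.eval_toR hm, Lit.eval_toR hm] at ho
      exact ⟨r, R, p, hr, hp, (hgu R p).1 hg, ho.1, by rw [ho.2.1]; ring, ho.2.2.1, ho.2.2.2⟩
  · rintro ⟨r, R, p, hr, hp, hs, rfl, rfl, rfl, rfl⟩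
    refine ⟨p, hp, _, mem_netItems.2 ⟨r, R, hr, List.mem_append_right _ (List.mem_singleton.2 rfl)⟩,
      (hgu R p).2 hs, ?_⟩
    simp only [Op.eval, Rule.eval_gateR hm, Int.toNat_natCast, RExpr.eval, NE.eval_toR hm,
      Lit.eval_toR hm, zero_sub]

theorem not_put_mem_boxOps : ∀ o ∈ boxOps m n d (netItems Rs), ∀ A j v, o ≠ .put A j v := by
  intro o ho A j v
  rw [mem_boxOps] at ho
  obtain ⟨p, hp, i, hi, hg, rfl⟩ := ho
  obtain ⟨r, R, hr, hi⟩ := mem_netItems.1 hi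
  rw [Rule.items, List.mem_append, List.mem_map, List.mem_singleton] at hi
  rcases hi with ⟨i, -, rfl⟩ | rfl <;> simp [Op.eval]

/-- Gates are numbered like literals, with the index of the rule as tag. A summing rule ignores `j`,
so that all `j` feed the same gate. -/
theorem Rule.gate_injective {r r' : ℕ} {R R' : Rule} {p p' : Pt} (hp : p.InBox n d)
    (hp' : p'.InBox n d) (hr : Rs[r]? = some R) (hr' : Rs[r']? = some R')
    (h : R.gate n d r p = R'.gate n d r' p') :
    r = r' ∧ R = R' ∧ p.l = p'.l ∧ p.u = p'.u ∧ (R.sum = false → p.j = p'.j) := by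
  obtain ⟨h1, h2, h3⟩ := hp
  obtain ⟨h4, h5, h6⟩ := hp'
  have := Lit.code_injective (x := Lit.mk r p.l p.u (if R.sum then 0 else p.j))
    (y := Lit.mk r' p'.l p'.u (if R'.sum then 0 else p'.j))
    ⟨by simp only; omega, by simp only; omega, by simp only; split_ifs <;> omega⟩
    ⟨by simp only; omega, by simp only; omega, by simp only; split_ifs <;> omega⟩ h
  simp only [Lit.mk.injEq] at this
  obtain ⟨rfl, k2, k3, k4⟩ := this
  obtain rfl : R = R' := by rw [hr] at hr'; exact Option.some.inj hr'
  exact ⟨rfl, rfl, k2, k3, fun hs => by simpa [hs] using k4⟩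

open Classical in
/-- The number of edges into a gate, from literals in a given set, that are added at one point. -/
theorem countP_items (hm : m.IsEnv I) (p : Pt) (T : Finset ℕ) (g r : ℕ) (R : Rule) :
    (edgesOf (itemsOps (m.withCounters p.l p.u p.j) (R.items r))).countP
        (fun e => e.1 ∈ T ∧ e.2 = g) =
      if R.gate n d r p = g then R.cntAt I (fun x => x.code n d ∈ T) p else 0 := by
  have key : ∀ ins : List (Cond × Lit NE), (edgesOf (itemsOps (m.withCounters p.l p.u p.j)
      (ins.map fun i => ⟨(R.guards ++ i.1).map fun g => (g.1.toR, g.2.toR),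
        .edge i.2.toR (R.gateR r)⟩))).countP (fun e => e.1 ∈ T ∧ e.2 = g) =
      if R.gate n d r p = g then ins.countP fun i => Cond.Holds I R.guards p ∧ Cond.Holds I i.1 p ∧
        (i.2.eval I p).code n d ∈ T else 0 := by
    intro ins
    induction ins with
    | nil => simp [itemsOps, edgesOf]
    | cons i ins ih =>
      rw [List.map_cons, itemsOps, List.flatMap_cons, edgesOf_append, List.countP_append]
      rw [itemsOps] at ih
      rw [ih, guardsHold_map hm, Cond.holds_append, List.countP_cons]
      by_cases h1 : Cond.Holds I R.guards p ∧ Cond.Holds I i.1 p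
      · rw [if_pos h1]
        by_cases h2 : R.gate n d r p = g <;> by_cases h3 : (i.2.eval I p).code n d ∈ T <;>
          simp [h1.1, h1.2, h2, h3, edgesOf, Op.eval, Rule.eval_gateR hm, Lit.eval_toR hm,
            Nat.add_comm]
      · rw [if_neg h1]
        have : ¬ (Cond.Holds I R.guards p ∧ Cond.Holds I i.1 p ∧ (i.2.eval I p).code n d ∈ T) :=
          fun h => h1 ⟨h.1, h.2.1⟩
        simp [this, edgesOf]
  rw [Rule.items, itemsOps, List.flatMap_append, edgesOf_append, List.countP_append]
  have h2 : (edgesOf (List.flatMap (fun i : Item => if guardsHold (m.withCounters p.l p.u p.j)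
      i.guards then [i.op.eval (m.withCounters p.l p.u p.j)] else [])
      [⟨if R.sum then [(.reg 12, .const 0)] else [],
    .gate (R.gateR r) (.sub (.const 0) R.thr.toR) (.sub R.out.toR (.const 1)) R.inh.toR⟩])) =
        [] := by
    simp only [List.flatMap_cons, List.flatMap_nil, List.append_nil]
    split_ifs <;> simp [edgesOf, Op.eval]
  rw [h2, List.countP_nil, Nat.add_zero]
  have hk := key R.ins
  rw [itemsOps] at hk
  rw [Rule.cntAt]
  convert hk

/-- By injectivity of gate numbers, the edges into the gate come from one rule and one pair `(l,
u)`, and from one `j` or, for a summing rule, from all `j`. The sums over the other points and rules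
vanish. -/
theorem netOf_count (hm : m.IsEnv I) (T : Finset ℕ) {r : ℕ} {R : Rule} (hr : Rs[r]? = some R)
    {p : Pt} (hp : p.InBox n d) :
    (netOf n d m Rs).count T (R.gate n d r p) = R.cnt I (fun x => x.code n d ∈ T) p := by
  classical
  rw [Net.count]
  simp only [netOf]
  rw [sum_count_targets, boxOps, edgesOf_flatMap, countP_flatMap_range]
  simp only [edgesOf_flatMap, countP_flatMap_range]
  have hitems : ∀ l u j, (edgesOf (itemsOps (m.withCounters l u j) (netItems Rs))).countP
      (fun e => e.1 ∈ T ∧ e.2 = R.gate n d r p) = ∑ r' ∈ Finset.range Rs.length,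
        if (Rs.getD r' default).gate n d r' ⟨l, u, j⟩ = R.gate n d r p then
          (Rs.getD r' default).cntAt I (fun x => x.code n d ∈ T) ⟨l, u, j⟩ else 0 := by
    intro l u j
    rw [netItems, itemsOps, List.flatMap_assoc, edgesOf_flatMap, countP_flatMap_range]
    exact Finset.sum_congr rfl fun r' _ => countP_items hm ⟨l, u, j⟩ T _ r' _
  simp only [hitems]
  obtain ⟨hp1, hp2, hp3⟩ := hp
  have hr' : r < Rs.length := (List.getElem?_eq_some_iff.1 hr).1
  have hgetD : Rs.getD r default = R := by
    rw [List.getD_eq_getElem?_getD, hr]; rfl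
  have hinj : ∀ l < d + 2, ∀ u < d + 2, ∀ j < n + 2, ∀ r' < Rs.length,
      (Rs.getD r' default).gate n d r' ⟨l, u, j⟩ = R.gate n d r p →
      r' = r ∧ l = p.l ∧ u = p.u ∧ (R.sum = false → j = p.j) := by
    intro l hl u hu j hj r' hr'' h
    have h1 : Rs[r']? = some (Rs.getD r' default) := by
      rw [List.getD_eq_getElem _ _ hr'', List.getElem?_eq_getElem hr'']
    obtain ⟨rfl, h2, h3, h4, h5⟩ := Rule.gate_injective (p := ⟨l, u, j⟩)
      ⟨by simp only; omega, by simp only; omega, by simp only; omega⟩ ⟨hp1, hp2, hp3⟩ h1 hr h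
    rw [h2] at h5
    exact ⟨rfl, h3, h4, h5⟩
  rw [Finset.sum_eq_single p.l, Finset.sum_eq_single p.u]
  · rw [Finset.sum_comm, Finset.sum_eq_single r]
    · rw [hgetD]
      simp only [Rule.cnt]
      by_cases hs : R.sum = true
      · rw [if_pos hs]
        refine Finset.sum_congr rfl fun j _ => if_pos ?_
        simp [Rule.gate, hs]
      · rw [if_neg hs, Finset.sum_eq_single p.j, if_pos rfl]
        · intro j hj hj'
          refine if_neg fun h => hj' ?_
          refine (hinj p.l (by omega) p.u (by omega) j (by simpa using hj) r hr' ?_).2.2.2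
            (by simpa using hs)
          rw [hgetD]; exact h
        · intro h; simp at h; omega
    · intro r' hr'' hne
      refine Finset.sum_eq_zero fun j hj => if_neg fun h => hne ?_
      exact (hinj p.l (by omega) p.u (by omega) j (by simpa using hj) r'
        (by simpa using hr'') h).1
    · intro h; simp at h; omega
  · intro u hu hne
    refine Finset.sum_eq_zero fun j hj => Finset.sum_eq_zero fun r' hr'' => if_neg fun h => hne ?_
    exact (hinj p.l (by omega) u (by simpa using hu) j (by simpa using hj) r'
        (by simpa using hr'') h).2.2.1
  · intro h; simp at h; omega
  · intro l hl hne
    refine Finset.sum_eq_zero fun u hu => Finset.sum_eq_zero fun j hj =>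
      Finset.sum_eq_zero fun r' hr'' => if_neg fun h => hne ?_
    exact (hinj l (by simpa using hl) u (by simpa using hu) j (by simpa using hj) r'
        (by simpa using hr'') h).2.1
  · intro h; simp at h; omega

/-- Only one point writes the data of a gate: for a summing rule the guard admits only `j = 0`. The
offset is one less than the number of the output, since counts start at `1`. -/
theorem netOf_gate (hm : m.IsEnv I) {r : ℕ} {R : Rule} (hr : Rs[r]? = some R) {p : Pt}
    (hp : p.InBox n d) (hs : R.sum = true → p.j = 0) :
    (netOf n d m Rs).c0 (R.gate n d r p) = -(R.thr.eval I p : ℤ) ∧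
    (netOf n d m Rs).ob (R.gate n d r p) = (R.out.eval I p).code n d - 1 ∧
    (netOf n d m Rs).inh (R.gate n d r p) = (R.inh.eval I p).code n d := by
  refine gate_runOps_eq _ not_put_mem_boxOps
    ((gate_mem_boxOps hm).2 ⟨r, R, p, hr, hp, hs, rfl, rfl, rfl, rfl⟩) ?_
  intro c' ob' inh' h
  obtain ⟨r', R', p', hr', hp', hs', h1, rfl, rfl, rfl⟩ := (gate_mem_boxOps hm).1 h
  obtain ⟨rfl, rfl, h2, h3, h4⟩ := Rule.gate_injective hp hp' hr hr' h1
  have : p = p' := by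
    obtain ⟨l, u, j⟩ := p
    obtain ⟨l', u', j'⟩ := p'
    simp only at h2 h3 h4 hs hs'
    subst h2 h3
    congr 1
    by_cases h : R.sum = true
    · rw [hs h, hs' h]
    · exact h4 (by simpa using h)
  subst this
  exact ⟨rfl, rfl, rfl⟩

end

/-! ### Propagation with a list of rules -/

/-- The truth of literals is preserved by the rules. -/
def RulesPreserve {n d : ℕ} (I : OADInstance n d) (Rs : List Rule) (P : Lit ℕ → Prop) : Prop :=
  P .tru ∧ ∀ τ : Lit ℕ → Prop, (∀ x, x.InBox n d → τ x → P x) →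
    (∀ x, x.InBox n d → τ x → x = .tru ∨
      ∃ R ∈ Rs, ∃ p k, R.Fires I τ p k ∧ x = (R.out.eval I p).shift (k - 1)) →
    ∀ R ∈ Rs, ∀ p k, R.Fires I τ p k → ¬ τ (R.inh.eval I p) → P ((R.out.eval I p).shift (k - 1))

/-- Propagation with the rules is complete. -/
def RulesClosed {n d : ℕ} (I : OADInstance n d) (Rs : List Rule) (τ : Lit ℕ → Prop) : Prop :=
  ∀ R ∈ Rs, ∀ p k, R.Fires I τ p k → τ ((R.out.eval I p).shift (k - 1)) ∨ τ (R.inh.eval I p)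

section

variable {n d : ℕ} {I : OADInstance n d} {m : RState} {Rs : List Rule}

theorem Rule.Fires.inBox {R : Rule} {τ : Lit ℕ → Prop} {p : Pt} {k : ℕ} (h : R.Fires I τ p k) :
    p.InBox n d := ⟨h.1, h.2.1, h.2.2.1⟩

theorem Rule.cnt_le (R : Rule) (τ : Lit ℕ → Prop) (p : Pt) :
    R.cnt I τ p ≤ R.ins.length * (n + 2) := by
  have h : ∀ p, R.cntAt I τ p ≤ R.ins.length := fun p => List.countP_le_length
  rw [Rule.cnt]
  split_ifs
  · refine (Finset.sum_le_card_nsmul _ _ R.ins.length fun j _ => h _).trans ?_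
    simp [Nat.mul_comm]
  · exact (h p).trans (Nat.le_mul_of_pos_right _ (by omega))

/-- At most five inputs for each of `n + 2` values of `j` give a count of at most `5 * (n + 2)`; the
last digit then stays below the radix `6 * n + 20`, which is chosen for this purpose. -/
theorem Rule.Fires.inBox_out {R : Rule} {τ : Lit ℕ → Prop} {p : Pt} {k : ℕ}
    (h : R.Fires I τ p k) (hR : R.ok = true) :
    ((R.out.eval I p).shift (k - 1)).InBox n d := by
  simp only [Rule.ok, Lit.ok, Bool.and_eq_true, decide_eq_true_eq] at hR
  obtain ⟨h1, h2, h3, h4, h5, h6⟩ := h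
  have hc := R.cnt_le (I := I) τ p
  have hl : R.ins.length * (n + 2) ≤ 5 * (n + 2) := Nat.mul_le_mul_right _ hR.2
  have ho : (R.out.eval I p).c ≤ n + 1 := NE.isCnt_spec h3 hR.1.1.2.2
  refine ⟨NE.isPos_spec h1 h2 hR.1.1.2.1.1, NE.isPos_spec h1 h2 hR.1.1.2.1.2, ?_⟩
  simp only [Lit.shift]
  omega

theorem netOf_c0_nonpos (hm : m.IsEnv I) (h23 : ∀ g, m.mem 23 g = 0) (g : ℕ) :
    (netOf n d m Rs).c0 g ≤ 0 := by
  refine gate_runOps (fun c _ _ => c ≤ 0) g _ not_put_mem_boxOps (h23 g).le fun c ob inh h => ?_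
  obtain ⟨r, R, p, -, -, -, -, rfl, -, -⟩ := (gate_mem_boxOps hm).1 h
  omega

theorem netOf_active_iff (hm : m.IsEnv I) {T : Finset ℕ} {r : ℕ} {R : Rule} {p : Pt} {k : ℕ}
    (hr : Rs[r]? = some R) (hp : p.InBox n d) (hs : R.sum = true → p.j = 0) :
    (netOf n d m Rs).Active T (R.gate n d r p) k ↔
      R.Fires I (fun x => x.code n d ∈ T) p k := by
  rw [Net.Active, netOf_count hm T hr hp, (netOf_gate hm hr hp hs).1, Rule.Fires]
  obtain ⟨h1, h2, h3⟩ := hp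
  constructor
  · rintro ⟨h4, h5⟩
    exact ⟨h1, h2, h3, hs, by omega, by omega⟩
  · rintro ⟨-, -, -, -, h4, h5⟩
    exact ⟨by omega, by omega⟩

theorem netOf_out (hm : m.IsEnv I) {r : ℕ} {R : Rule} {p : Pt} {k : ℕ}
    (hr : Rs[r]? = some R) (hp : p.InBox n d) (hs : R.sum = true → p.j = 0) (hk : 1 ≤ k) :
    (netOf n d m Rs).out (R.gate n d r p) k = ((R.out.eval I p).shift (k - 1)).code n d := by
  rw [Net.out, (netOf_gate hm hr hp hs).2.1, Lit.code_shift]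
  omega

/-- Initial counts are not positive, so an active gate has an incoming edge, and edges lead only to
gates of rules. For a summing rule the point is moved to `j = 0`, where the data of the gate are
set. -/
theorem exists_of_active (hm : m.IsEnv I) (h23 : ∀ g, m.mem 23 g = 0) {T : Finset ℕ} {g : ℕ}
    {s : ℤ} (h : (netOf n d m Rs).Active T g s) :
    ∃ (r : ℕ) (R : Rule) (p : Pt) (k : ℕ), Rs[r]? = some R ∧ g = R.gate n d r p ∧ s = k ∧
      R.Fires I (fun x => x.code n d ∈ T) p k := by
  have h1 := netOf_c0_nonpos (Rs := Rs) hm h23 g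
  obtain ⟨h2, h3⟩ := h
  have h4 : 0 < (netOf n d m Rs).count T g := by omega
  rw [Net.count] at h4
  simp only [netOf] at h4
  rw [sum_count_targets, List.countP_pos_iff] at h4
  obtain ⟨⟨x, g'⟩, he, h5⟩ := h4
  simp only [decide_eq_true_eq] at h5
  obtain ⟨-, rfl⟩ := h5
  obtain ⟨r, R, p, hr, hp, rfl⟩ := edge_mem_boxOps hm (mem_edgesOf.1 he)
  obtain ⟨p', hp', hs, e⟩ : ∃ p' : Pt, p'.InBox n d ∧ (R.sum = true → p'.j = 0) ∧
      R.gate n d r p = R.gate n d r p' := by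
    by_cases hs : R.sum = true
    · exact ⟨⟨p.l, p.u, 0⟩, ⟨hp.1, hp.2.1, Nat.zero_le _⟩, fun _ => rfl, by simp [Rule.gate, hs]⟩
    · exact ⟨p, hp, fun h => absurd h hs, rfl⟩
  lift s to ℕ using by omega
  refine ⟨r, R, p', s, hr, e, rfl, ?_⟩
  rw [← netOf_active_iff hm hr hp' hs, ← e]
  exact ⟨h2, h3⟩

theorem netOf_closed (hm : m.IsEnv I) {T : Finset ℕ} (h : (netOf n d m Rs).Closed T) :
    RulesClosed I Rs fun x => x.code n d ∈ T := by
  intro R hR p k hf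
  obtain ⟨r, hr⟩ := List.getElem?_of_mem hR
  have := h _ _ ((netOf_active_iff hm hr hf.inBox hf.2.2.2.1).2 hf)
  rw [netOf_out hm hr hf.inBox hf.2.2.2.1 hf.2.2.2.2.1,
    (netOf_gate hm hr hf.inBox hf.2.2.2.1).2.2, Int.toNat_natCast] at this
  exact this

/-- Numbers of literals in the box determine these literals, so support, inhibition and the property
`P` translate from the network to the rules. -/
theorem netOf_preserved (hm : m.IsEnv I) (h23 : ∀ g, m.mem 23 g = 0)
    (hok : ∀ R ∈ Rs, R.ok = true) {P : Lit ℕ → Prop} (hP : RulesPreserve I Rs P) :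
    (netOf n d m Rs).Preserved {x | ∃ y : Lit ℕ, y.InBox n d ∧ y.code n d = x ∧ P y} := by
  have htru : (Lit.tru : Lit ℕ).InBox n d :=
    ⟨Nat.succ_pos _, Nat.succ_pos _, Nat.succ_pos _⟩
  have hcode : (Lit.tru : Lit ℕ).code n d = 0 := by
    change ((0 * (d + 3) + 0) * (d + 3) + 0) * (6 * n + 20) + 0 = 0
    simp
  refine ⟨⟨.tru, htru, hcode, hP.1⟩, ?_⟩
  intro T hT hsup g s hact hinh
  obtain ⟨r, R, p, k, hr, rfl, rfl, hf⟩ := exists_of_active hm h23 hact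
  rw [(netOf_gate hm hr hf.inBox hf.2.2.2.1).2.2, Int.toNat_natCast] at hinh
  refine ⟨_, hf.inBox_out (hok R (List.mem_of_getElem? hr)),
    (netOf_out hm hr hf.inBox hf.2.2.2.1 hf.2.2.2.2.1).symm, hP.2 _ ?_ ?_ R
    (List.mem_of_getElem? hr) p k hf hinh⟩
  · intro x hx hxT
    obtain ⟨y, hy, hxy, hPy⟩ := hT _ hxT
    rwa [Lit.code_injective hx hy hxy.symm]
  · intro x hx hxT
    rcases hsup _ hxT with h | ⟨g', s', h1, h2⟩
    · exact Or.inl (Lit.code_injective hx htru (h.trans hcode.symm))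
    · obtain ⟨r', R', p', k', hr', rfl, rfl, hf'⟩ := exists_of_active hm h23 h1
      rw [netOf_out hm hr' hf'.inBox hf'.2.2.2.1 hf'.2.2.2.2.1] at h2
      exact Or.inr ⟨R', List.mem_of_getElem? hr', p', k', hf',
        Lit.code_injective hx (hf'.inBox_out (hok R' (List.mem_of_getElem? hr'))) h2⟩

theorem runOps_mem (os : List EOp) (hos : ∀ o ∈ os, ∀ A j v, o ≠ .put A j v) (m : RState) {A : ℕ}
    (hA : A < 20 ∨ 25 < A) : (runOps m os).mem A = m.mem A := by
  induction os generalizing m with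
  | nil => rfl
  | cons o os ih =>
    refine (ih (fun o ho => hos o (List.mem_cons_of_mem _ ho)) (o.apply m)).trans ?_
    cases o with
    | put A j v => exact absurd rfl (hos _ (by simp) A j v)
    | edge x g =>
      simp [EOp.apply, RState.setMem, RState.setReg, show A ≠ 20 by omega, show A ≠ 21 by omega,
        show A ≠ 22 by omega]
    | gate g c ob inh =>
      simp [EOp.apply, RState.setMem, show A ≠ 23 by omega, show A ≠ 24 by omega,
        show A ≠ 25 by omega]

theorem runOps_reg (os : List EOp) (m : RState) {r : ℕ} (hr : r ≠ 5) :
    (runOps m os).reg r = m.reg r := by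
  induction os generalizing m with
  | nil => rfl
  | cons o os ih => exact (ih (o.apply m)).trans (o.apply_reg m r hr)

theorem length_itemsOps (m : RState) (is : List Item) : (itemsOps m is).length ≤ is.length := by
  induction is with
  | nil => simp [itemsOps]
  | cons i is ih =>
    rw [itemsOps, List.flatMap_cons, List.length_append, List.length_cons]
    rw [itemsOps] at ih
    split_ifs <;> simp at ih ⊢ <;> omega

theorem length_boxOps (m : RState) (n d : ℕ) (is : List Item) :
    (boxOps m n d is).length ≤ (d + 2) * ((d + 2) * ((n + 2) * is.length)) := by
  have key : ∀ {f : ℕ → List EOp} {k N : ℕ}, (∀ i, (f i).length ≤ N) →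
      ((List.range k).flatMap f).length ≤ k * N := by
    intro f k N h
    rw [List.length_flatMap]
    refine (List.sum_le_card_nsmul _ N fun x hx => ?_).trans (by simp)
    obtain ⟨i, -, rfl⟩ := List.mem_map.1 hx
    exact h i
  exact key fun l => key fun u => key fun j => length_itemsOps _ _

/-- Propagation with a list of rules, on the machine. -/
theorem propagation_exec {M W : ℤ} (hM : 100 ≤ M) (hok : ∀ R ∈ Rs, R.ok = true)
    (hitems : itemsOk [0, 1, 2] [0, 1, 2] (netItems Rs) = true) (hm : m.IsEnv I)
    (h5 : m.reg 5 = 0) (h0 : ∀ A, 15 ≤ A → ∀ j, m.mem A j = 0)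
    (hW : M ^ 64 + (((d + 2) * ((d + 2) * ((n + 2) * (netItems Rs).length)) : ℕ) : ℤ) ≤ W)
    (hn : 6 * (n : ℤ) + 20 ≤ M) (hd : (d : ℤ) + 3 ≤ M) :
    ∃ t ≤ (d + 2) * ((d + 2) * ((n + 2) * (itemsTime (netItems Rs) + 16) + 16) + 16) +
        83 * ((d + 2) * ((d + 2) * ((n + 2) * (netItems Rs).length))) + 50,
      ∃ (m' : RState) (τ : Lit ℕ → Prop),
        RExec W (.seq (boxProg (netItems Rs)) engineProg) m t m' ∧ m'.IsEnv I ∧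
        m'.reg 2 = m.reg 2 ∧
        (∀ x : Lit ℕ, (τ x → m'.mem 26 (x.code n d) = 1) ∧ (¬ τ x → m'.mem 26 (x.code n d) = 0)) ∧
        (∀ x, 0 ≤ m'.mem 26 x ∧ m'.mem 26 x ≤ 1) ∧
        (∀ g, |m'.mem 23 g| ≤ M ^ 64 +
          (((d + 2) * ((d + 2) * ((n + 2) * (netItems Rs).length)) : ℕ) : ℤ)) ∧
        (∀ (r : ℕ) (R : Rule) (p : Pt), Rs[r]? = some R → p.InBox n d →
          (R.sum = true → p.j = 0) →
          m'.mem 23 (R.gate n d r p) = R.cnt I τ p - R.thr.eval I p) ∧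
        τ .tru ∧ RulesClosed I Rs τ ∧
        ∀ P, RulesPreserve I Rs P → ∀ x : Lit ℕ, x.InBox n d → τ x → P x := by
  set Ne := (d + 2) * ((d + 2) * ((n + 2) * (netItems Rs).length)) with hNe
  have hM1 : 1 ≤ M ^ 64 := one_le_pow₀ (by omega)
  have hM3 : M ≤ M ^ 64 := by
    simpa using pow_le_pow_right₀ (show (1 : ℤ) ≤ M by omega) (show 1 ≤ 64 by norm_num)
  have hb : ∀ l ≤ d + 1, ∀ u ≤ d + 1, ∀ j ≤ n + 1,
      (m.withCounters l u j).Bounded M [0, 1, 2] [0, 1, 2] := by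
    intro l hl u hu j hj
    have hmem : ∀ A ∈ [0, 1, 2], ∀ i, 0 ≤ m.mem A i ∧ m.mem A i ≤ 1 := by
      intro A hA i
      rw [hm.mem A (by simp at hA; omega)]
      exact I.input_mem_nonneg A i
    refine ⟨fun r hr => ?_, fun A hA i => ?_, fun A hA i => ?_⟩
    · have e1 := hm.zero
      have e2 := hm.one
      have e3 := hm.three
      have e4 := hm.four
      simp only [paramRegs, List.mem_cons, List.not_mem_nil, or_false] at hr
      rcases hr with rfl | rfl | rfl | rfl | rfl | rfl | rfl <;>
        simp [RState.withCounters, RState.setReg, e1, e2, e3, e4] <;> omega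
    · have := hmem A hA i
      change 0 ≤ m.mem A i ∧ m.mem A i ≤ M
      omega
    · have := hmem A hA i
      change |m.mem A i| ≤ M
      rw [abs_le]; omega
  obtain ⟨t₁, ht₁, m₁, hx₁, hmem₁, hreg₁⟩ := boxProg_exec hM (show M ^ 64 ≤ W by omega)
    (netItems Rs) hitems hm.zero hm.one h5.ge (by rw [h5, ← hNe]; omega) hb (by omega) (by omega)
  set os := boxOps m n d (netItems Rs) with hos
  have hput := not_put_mem_boxOps (n := n) (d := d) (m := m) (Rs := Rs)
  have hch := chain_runOps h5 (h0 20 (by norm_num)) (h0 21 (by norm_num)) os hput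
  have h23 : ∀ g, m.mem 23 g = 0 := h0 23 (by norm_num)
  have hval : ∀ (p : Pt), p.InBox n d → ∀ e : RExpr, e.isVal [0, 1, 2] [0, 1, 2] = true →
      e.cost ≤ 64 → |e.eval (m.withCounters p.l p.u p.j)| ≤ M ^ 64 := fun p hp e he hc =>
    (RExpr.isVal_spec (W := W) hM (hb p.l hp.1 p.u hp.2.1 p.j hp.2.2) e he).1.trans
      (pow_le_pow_right₀ (by omega) hc)
  -- Gates that are never set have data `0`. The others hold values of expressions of cost at most
  -- `64`; `ob` is the number of a literal minus one, hence at least `-1`.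
  have hgate : ∀ g, (netOf n d m Rs).c0 g ≤ 0 ∧ -M ^ 64 ≤ (netOf n d m Rs).c0 g ∧
      -1 ≤ (netOf n d m Rs).ob g ∧ (netOf n d m Rs).ob g + Ne ≤ W ∧
      0 ≤ (netOf n d m Rs).inh g := by
    intro g
    refine gate_runOps (fun c ob inh => c ≤ 0 ∧ -M ^ 64 ≤ c ∧ -1 ≤ ob ∧ ob + Ne ≤ W ∧ 0 ≤ inh)
        g _ hput
      ?_ fun c ob inh h => ?_
    · rw [h23, h0 24 (by norm_num), h0 25 (by norm_num)]; omega
    · have h' := (gate_mem_boxOps hm).1 h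
      rw [mem_boxOps] at h
      obtain ⟨p, hp, i, hi, -, ho⟩ := h
      have hi' := List.all_eq_true.1 hitems i hi
      obtain ⟨g', op⟩ := i
      cases op with
      | edge _ _ => simp [Op.eval] at ho
      | put _ _ _ => simp [Op.eval] at ho
      | gate g c' ob' inh' =>
        simp only [Op.eval, EOp.gate.injEq] at ho
        simp only [Op.ok, Op.valArgs, Bool.and_eq_true, List.all_cons, List.all_nil, and_true,
          decide_eq_true_eq] at hi'
        obtain ⟨-, -, ⟨hc1, hc2⟩, ⟨ho1, ho2⟩, -⟩ := hi'
        have b1 := hval p hp c' hc1 hc2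
        have b2 := hval p hp ob' ho1 ho2
        rw [← ho.2.1, abs_le] at b1
        rw [← ho.2.2.1, abs_le] at b2
        obtain ⟨r, R, p, -, -, -, -, e1, e2, e3⟩ := h'
        omega
  have hstores : Stores W (netOf n d m Rs) Ne m₁ := by
    refine ⟨fun x => ?_, fun g => by rw [hmem₁]; rfl, fun g => by rw [hmem₁]; rfl,
      fun g => by rw [hmem₁]; rfl, fun g => (hgate g).1, fun g => by have := (hgate g).2.1; omega,
      fun g => (hgate g).2.2.1, fun g => (hgate g).2.2.2.1, fun g => (hgate g).2.2.2.2,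
      fun F => ?_, by omega⟩
    · rw [hmem₁]; exact hch.2.2.2 x
    · exact (sum_length_targets _ F).trans ((length_edgesOf _).trans (length_boxOps _ _ _ _))
  obtain ⟨t₂, ht₂, m₂, T, hx₂, hreg₂, hmem₂, htr, hcnt, hT0, hcl, hsound⟩ := engineProg_exec hstores
    (fun x => by rw [hmem₁, runOps_mem os hput m (by norm_num), h0 26 (by norm_num)])
  have hreg : ∀ r, r < 5 → m₂.reg r = m.reg r := fun r hr => by
    rw [hreg₂ r (by omega) (by omega) (by omega) (by omega) (by omega),
      hreg₁ r (by omega) (by omega) (by omega), runOps_reg os m (by omega)]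
  refine ⟨t₁ + t₂, by omega, m₂, fun x => x.code n d ∈ T, .seq _ _ _ _ _ _ _ hx₁ hx₂,
    ⟨(hreg 0 (by norm_num)).trans hm.zero, (hreg 1 (by norm_num)).trans hm.one,
      (hreg 3 (by norm_num)).trans hm.three, (hreg 4 (by norm_num)).trans hm.four,
      fun A hA => ?_⟩, hreg 2 (by norm_num), fun x => ⟨fun h => ?_, fun h => ?_⟩, fun x => ?_,
    fun g => ?_, fun r R p hr hp hs => ?_, by simpa [Lit.code, Lit.tru] using hT0,
        netOf_closed hm hcl, fun P hP x hx hxT => ?_⟩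
  · rw [hmem₂ A (by omega) (by omega) (by omega), hmem₁, runOps_mem os hput m (by omega),
        hm.mem A hA]
  · rw [htr, if_pos h]
  · rw [htr, if_neg h]
  · rw [htr]; split_ifs <;> omega
  · have h1 := hstores.count_le T g
    have h2 := hgate g
    rw [hcnt, abs_le]
    omega
  · rw [hcnt, netOf_count hm T hr hp, (netOf_gate hm hr hp hs).1]; ring
  · obtain ⟨y, hy, hxy, hPy⟩ := hsound _ (netOf_preserved hm h23 hok hP) _ hxT
    rwa [Lit.code_injective hx hy hxy.symm]

end

/-! ## The rules for bound consistency of the decomposition -/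

namespace Rule

/-- The rule `x → o`. -/
def imp (G : Cond) (x o : Lit NE) (inh : Lit NE := .fls) : Rule where
  guards := G
  ins := [([], x)]
  sum := false
  out := o
  inh := inh

/-- The rule `x ∧ y → o`. -/
def imp₂ (G : Cond) (x y o : Lit NE) : Rule where
  guards := G
  ins := [([], x), ([], y)]
  sum := false
  thr := .k 1
  out := o

/-- A rule that counts the inputs for all `j`. -/
def total (G : Cond) (ins : List (Cond × Lit NE)) (thr : NE) (o : Lit NE) : Rule where
  guards := G
  ins := ins
  sum := true
  thr := thr
  out := o

end Rule

/-- `X j` is a variable. -/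
def condVar : Cond := [(.add .j (.k 1), .n)]

/-- `[l, u]` is an interval considered in the decomposition. -/
def condWindow : Cond :=
  [(.k 1, .l), (.l, .u), (.u, .d), (.add .u (.k 1), .add .l .n)]

/-- `l < u`, and `[l, u]` is an interval considered in the decomposition. -/
def condPyramid : Cond := condWindow ++ [(.add .l (.k 1), .u)]

/-- `X j` is counted by `C k`. -/
def condKind (k : CKind) : Cond := condVar ++ [(.kind, .k k.code), (.k k.code, .kind)]

/-- The variables `a` that are `1`. -/
def insOne (k : CKind) : List (Cond × Lit NE) := [(condKind k, .one .j .l .u)]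

/-- The variables `a` that are `0`, or not counted by `C k`. -/
def insZero (k : CKind) : List (Cond × Lit NE) :=
  [(condKind k, .zero .j .l .u), (condVar ++ [(.add .kind (.k 1), .k k.code)], .tru),
    (condVar ++ [(.add (.k k.code) (.k 1), .kind)], .tru)]

/-- The lower bound of `C k l u`. -/
def insLower (k : CKind) (e f : NE) : List (Cond × Lit NE) := [([(.k 1, .j)], .cge k e f .j)]

/-- The number `n` minus the upper bound of `C k l u`. -/
def insUpper (k : CKind) (e f : NE) : List (Cond × Lit NE) := [([(.k 1, .j)], .cle k e f .j)]

/-- A single true input. -/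
def insUnit : List (Cond × Lit NE) := [([(.j, .k 0)], .tru)]

/-- As many true inputs as the difference between `n` and the length of `[l, u]`. -/
def insSlack : List (Cond × Lit NE) :=
  [([(.k 1, .j), (.add .j (.add .u (.k 1)), .add .n .l)], .tru)]

/-- Counting the bounds of `C k l u`. -/
def counterRules (k : CKind) : List Rule :=
  [.total [] (insLower k .l .u) (.k 0) (.junk 0 0 0),
    .total [] (insUpper k .l .u) (.k 0) (.junk 0 0 0)]

/-- The bounds of `X j`. -/
def varRules : List Rule :=
  [.imp (condVar ++ [(.l, .d)]) (.ge .j (.add .l (.k 1))) (.ge .j .l),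
    .imp (condVar ++ [(.l, .d)]) (.lt .j .l) (.lt .j (.add .l (.k 1))),
    .imp (condVar ++ [(.l, .d), (.dom, .k 0)]) (.ge .j .l) (.ge .j (.add .l (.k 1))),
    .imp (condVar ++ [(.l, .d), (.dom, .k 0)]) (.lt .j (.add .l (.k 1))) (.lt .j .l),
    .imp₂ condVar (.ge .j .l) (.lt .j .l) .fls,
    .imp condVar .tru (.ge .j 0),
    .imp condVar .tru (.lt .j (.add .d (.k 1)))]

/-- `a j l u = 1 ↔ X j ≥ l ∧ X j < u + 1`. -/
def intervalRules : List Rule :=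
  [.imp₂ (condVar ++ condWindow) (.ge .j .l) (.lt .j (.add .u (.k 1))) (.one .j .l .u),
    .imp (condVar ++ condWindow) (.one .j .l .u) (.ge .j .l),
    .imp (condVar ++ condWindow) (.one .j .l .u) (.lt .j (.add .u (.k 1))),
    .imp (condVar ++ condWindow) (.lt .j .l) (.zero .j .l .u),
    .imp (condVar ++ condWindow) (.ge .j (.add .u (.k 1))) (.zero .j .l .u),
    .imp₂ (condVar ++ condWindow) (.zero .j .l .u) (.ge .j .l) (.ge .j (.add .u (.k 1))),
    .imp₂ (condVar ++ condWindow) (.zero .j .l .u) (.lt .j (.add .u (.k 1))) (.lt .j .l),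
    .imp₂ (condVar ++ condWindow) (.one .j .l .u) (.zero .j .l .u) .fls]

/-- `C k l u` is the sum of the variables `a j l u` that it counts. -/
def countRules (k : CKind) : List Rule :=
  [.imp (condKind k ++ condWindow) (.low k .l .u 0) (.zero .j .l .u) (.one .j .l .u),
    .imp (condKind k ++ condWindow) (.high k .l .u 0) (.one .j .l .u) (.zero .j .l .u),
    .total condWindow (insOne k) (.k 0) (.cge k .l .u (.k 1)),
    .total condWindow (insZero k) (.k 0) (.cle k .l .u (.k 1)),
    .total condWindow (insOne k ++ insUpper k .l .u ++ insUnit) .n (.low k .l .u 0),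
    .total condWindow (insZero k ++ insLower k .l .u ++ insUnit) .n (.high k .l .u 0),
    .total [] (insLower k .l .u ++ insUpper k .l .u) .n .fls]

/-- `C 1 u = C 1 l + C (l + 1) u`. -/
def pyramidRules : List Rule :=
  [.total condPyramid (insLower .st (.k 1) .l ++ insLower .st (.add .l (.k 1)) .u) (.k 0)
      (.cge .st (.k 1) .u (.k 1)),
    .total condPyramid (insUpper .st (.k 1) .l ++ insUpper .st (.add .l (.k 1)) .u) .n
      (.cle .st (.k 1) .u (.k 1)),
    .total condPyramid (insLower .st (.k 1) .u ++ insUpper .st (.add .l (.k 1)) .u) .n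
      (.cge .st (.k 1) .l (.k 1)),
    .total condPyramid (insUpper .st (.k 1) .u ++ insLower .st (.add .l (.k 1)) .u) (.k 0)
      (.cle .st (.k 1) .l (.k 1)),
    .total condPyramid (insLower .st (.k 1) .u ++ insUpper .st (.k 1) .l) .n
      (.cge .st (.add .l (.k 1)) .u (.k 1)),
    .total condPyramid (insUpper .st (.k 1) .u ++ insLower .st (.k 1) .l) (.k 0)
      (.cle .st (.add .l (.k 1)) .u (.k 1))]

/-- `C k l u + C k' l u ≤ u - l + 1`. -/
def capacityRule (k k' : CKind) : Rule :=
  .total condWindow (insLower k .l .u ++ insSlack) (.k 0) (.cle k' .l .u (.k 1))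

/-- All the rules. -/
def oadRules : List Rule :=
  counterRules .st ++ counterRules .s ++ counterRules .t ++ varRules ++ intervalRules ++
  countRules .st ++ countRules .s ++ countRules .t ++ pyramidRules ++
  [capacityRule .st .s, capacityRule .s .st, capacityRule .st .t, capacityRule .t .st]

theorem oadRules_ok : ∀ R ∈ oadRules, R.ok = true := by
  have : oadRules.all Rule.ok = true := by decide
  exact List.all_eq_true.1 this

theorem oadRules_itemsOk : itemsOk [0, 1, 2] [0, 1, 2] (netItems oadRules) = true := by
  decide +kernel

/-- `C k` is one of the counters, so its rules are present. -/
theorem countRules_subset (k : CKind) : ∀ R ∈ countRules k, R ∈ oadRules := by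
  intro R hR
  cases k <;> simp only [oadRules, List.mem_append] <;> tauto

section

variable {n d : ℕ} {I : OADInstance n d}

theorem Cond.holds_condWindow (p : Pt) : condWindow.Holds I p ↔ InWindow n d p.l p.u := by
  simp [Cond.Holds, condWindow, InWindow, NE.eval]

theorem Cond.holds_condPyramid (p : Pt) :
    condPyramid.Holds I p ↔ InWindow n d p.l p.u ∧ p.l < p.u := by
  rw [condPyramid, Cond.holds_append, Cond.holds_condWindow]
  simp [Cond.Holds, NE.eval]

theorem Cond.holds_condVar (p : Pt) : condVar.Holds I p ↔ p.j < n := by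
  simp [Cond.Holds, condVar, NE.eval]

theorem eval_kind (p : Pt) (i : Fin n) (hp : p.j = i) (k : CKind) :
    NE.kind.eval I p = k.code ↔ i ∈ I.counted k := by
  classical
  have h1 : I.input.mem 1 p.j = if i ∈ I.S then 1 else 0 := by
    simp only [OADInstance.input, hp, one_ne_zero, if_false, if_true]
    congr 1
    simp [Fin.val_inj]
  have h2 : I.input.mem 2 p.j = if i ∈ I.T then 1 else 0 := by
    simp only [OADInstance.input, hp, OfNat.ofNat_ne_zero, OfNat.ofNat_ne_one, if_false, if_true]
    congr 1
    simp [Fin.val_inj]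
  have hc : i ∈ I.S ∪ I.T := by rw [I.cover]; exact Finset.mem_univ i
  rw [Finset.mem_union] at hc
  simp only [NE.eval, h1, h2]
  cases k <;> by_cases hS : i ∈ I.S <;> by_cases hT : i ∈ I.T <;>
    simp [CKind.code, OADInstance.counted, hS, hT] at hc ⊢

theorem Cond.holds_condKind (k : CKind) (p : Pt) :
    (condKind k).Holds I p ↔ ∃ i : Fin n, p.j = i ∧ i ∈ I.counted k := by
  have : Cond.Holds I [(.kind, .k k.code), (.k k.code, .kind)] p ↔
      NE.kind.eval I p = k.code := by
    simp [Cond.Holds, NE.eval, le_antisymm_iff]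
  rw [condKind, Cond.holds_append, Cond.holds_condVar, this]
  constructor
  · rintro ⟨h1, h2⟩
    exact ⟨⟨p.j, h1⟩, rfl, (eval_kind p ⟨p.j, h1⟩ rfl k).1 h2⟩
  · rintro ⟨i, h1, h2⟩
    exact ⟨h1 ▸ i.2, (eval_kind p i h1 k).2 h2⟩

theorem Rule.fires_imp {G : Cond} {x o inh : Lit NE} {τ : Lit ℕ → Prop} {p : Pt} {k : ℕ} :
    (imp G x o inh).Fires I τ p k ↔ p.InBox n d ∧ k = 1 ∧ G.Holds I p ∧ τ (x.eval I p) := by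
  have h0 : Cond.Holds I [] p := by simp [Cond.Holds]
  by_cases hG : G.Holds I p <;> by_cases hx : τ (x.eval I p) <;>
    simp [Fires, imp, cnt, cntAt, NE.eval, Pt.InBox, h0, hG, hx] <;> omega

theorem Rule.fires_imp₂ {G : Cond} {x y o : Lit NE} {τ : Lit ℕ → Prop} {p : Pt} {k : ℕ} :
    (imp₂ G x y o).Fires I τ p k ↔
      p.InBox n d ∧ k = 1 ∧ G.Holds I p ∧ τ (x.eval I p) ∧ τ (y.eval I p) := by
  have h0 : Cond.Holds I [] p := by simp [Cond.Holds]
  by_cases hG : G.Holds I p <;> by_cases hx : τ (x.eval I p) <;> by_cases hy : τ (y.eval I p) <;>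
    simp [Fires, imp₂, cnt, cntAt, NE.eval, Pt.InBox, h0, hG, hx, hy] <;> omega

open Classical in
/-- The number of true inputs of a rule that counts the inputs for all `j`. -/
noncomputable def insCount (I : OADInstance n d) (ins : List (Cond × Lit NE)) (τ : Lit ℕ → Prop)
    (p : Pt) : ℕ :=
  ∑ j ∈ Finset.range (n + 2), ins.countP fun i =>
    Cond.Holds I i.1 ⟨p.l, p.u, j⟩ ∧ τ (i.2.eval I ⟨p.l, p.u, j⟩)

theorem insCount_append (ins ins' : List (Cond × Lit NE)) (τ : Lit ℕ → Prop) (p : Pt) :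
    insCount I (ins ++ ins') τ p = insCount I ins τ p + insCount I ins' τ p := by
  simp only [insCount, List.countP_append, Finset.sum_add_distrib]

open Classical in
theorem Rule.fires_total {G : Cond} {ins : List (Cond × Lit NE)} {thr : NE} {o : Lit NE}
    {τ : Lit ℕ → Prop} {p : Pt} {k : ℕ}
    (hG : ∀ j, G.Holds I ⟨p.l, p.u, j⟩ ↔ G.Holds I p) :
    (total G ins thr o).Fires I τ p k ↔ p.InBox n d ∧ p.j = 0 ∧ 1 ≤ k ∧ G.Holds I p ∧
      thr.eval I p + k ≤ insCount I ins τ p := by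
  have hc : (total G ins thr o).cnt I τ p = if G.Holds I p then insCount I ins τ p else 0 := by
    simp only [cnt, total, if_true, cntAt, hG]
    split_ifs with h
    · simp only [h, true_and, insCount]
    · simp [h]
  rw [Fires, hc]
  simp only [total, Pt.InBox, forall_const]
  split_ifs with h
  · simp only [h, true_and]; tauto
  · constructor
    · rintro ⟨-, -, -, -, h1, h2⟩; omega
    · rintro ⟨-, -, -, h', -⟩; exact absurd h' h

/-! ### Counting the true inputs of summing rules -/

open Classical in
/-- The number of `y` from `1` to `n + 1` that have a property. -/
noncomputable def slots (n : ℕ) (f : ℕ → Prop) : ℕ :=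
  ((Finset.range (n + 2)).filter fun y => 1 ≤ y ∧ f y).card

theorem slots_le {f : ℕ → Prop} {q : ℕ} (h : ∀ y, 1 ≤ y → y ≤ n + 1 → f y → y ≤ q) :
    slots n f ≤ q := by
  classical
  refine (Finset.card_le_card (t := Finset.Icc 1 q) fun y hy => ?_).trans (by simp)
  simp only [Finset.mem_filter, Finset.mem_range] at hy
  exact Finset.mem_Icc.2 ⟨hy.2.1, h y hy.2.1 (by omega) hy.2.2⟩

/-- There are `n + 1` slots, one more than a counter can use. Since at most `n` of them are filled,
`q` cannot have been cut off at `n + 1`. -/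
theorem le_slots {f : ℕ → Prop} {q : ℕ} (h : ∀ y, 1 ≤ y → y ≤ q → f y) (hn : slots n f ≤ n) :
    q ≤ slots n f := by
  classical
  have key : min q (n + 1) ≤ slots n f := by
    refine le_trans (by simp) (Finset.card_le_card (s := Finset.Icc 1 (min q (n + 1)))
      fun y hy => ?_)
    rw [Finset.mem_Icc] at hy
    simp only [Finset.mem_filter, Finset.mem_range]
    exact ⟨by omega, hy.1, h y hy.1 (by omega)⟩
  omega

open Classical in
/-- The number of the variables counted by `C k` that have a property. -/
noncomputable def OADInstance.numCounted (I : OADInstance n d) (k : CKind) (f : ℕ → Prop) : ℕ :=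
  ((I.counted k).filter fun i : Fin n => f i).card

theorem sum_range_kind (k : CKind) (f : ℕ → Prop) (l u : ℕ) [∀ j, Decidable
    (Cond.Holds I (condKind k) ⟨l, u, j⟩ ∧ f j)] :
    (∑ j ∈ Finset.range (n + 2), if Cond.Holds I (condKind k) ⟨l, u, j⟩ ∧ f j then 1 else 0) =
      I.numCounted k f := by
  classical
  rw [OADInstance.numCounted, ← Finset.card_filter]
  refine (Finset.card_bij (fun (i : Fin n) _ => (i : ℕ)) (fun i hi => ?_)
    (fun i _ j _ h => Fin.val_injective h)
    fun j hj => ?_).symm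
  · rw [Finset.mem_filter] at hi ⊢
    exact ⟨Finset.mem_range.2 (by omega), (Cond.holds_condKind k _).2 ⟨i, rfl, hi.1⟩, hi.2⟩
  · rw [Finset.mem_filter, Cond.holds_condKind] at hj
    obtain ⟨-, ⟨i, hi, hik⟩, hf⟩ := hj
    simp only at hi
    subst hi
    exact ⟨i, Finset.mem_filter.2 ⟨hik, hf⟩, rfl⟩

theorem insCount_insOne (k : CKind) (τ : Lit ℕ → Prop) (p : Pt) :
    insCount I (insOne k) τ p = I.numCounted k fun i => τ (.one i p.l p.u) := by
  classical
  rw [← sum_range_kind k _ p.l p.u]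
  simp only [insCount, insOne, List.countP_singleton, decide_eq_true_eq]
  rfl

theorem insCount_insLower (k : CKind) (e f : NE) (τ : Lit ℕ → Prop) (p : Pt) (l' u' : ℕ)
    (hl : ∀ j, e.eval I ⟨p.l, p.u, j⟩ = l') (hu : ∀ j, f.eval I ⟨p.l, p.u, j⟩ = u') :
    insCount I (insLower k e f) τ p = slots n fun y => τ (.cge k l' u' y) := by
  classical
  simp only [insCount, insLower, List.countP_singleton, decide_eq_true_eq, slots,
    Finset.card_filter]
  refine Finset.sum_congr rfl fun j _ => ?_
  have : (Lit.cge k e f NE.j).eval I ⟨p.l, p.u, j⟩ = Lit.cge k l' u' j := by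
    simp only [Lit.eval, Lit.cge, hl, hu, NE.eval]
  rw [this]
  simp [Cond.Holds, NE.eval]

theorem insCount_insUpper (k : CKind) (e f : NE) (τ : Lit ℕ → Prop) (p : Pt) (l' u' : ℕ)
    (hl : ∀ j, e.eval I ⟨p.l, p.u, j⟩ = l') (hu : ∀ j, f.eval I ⟨p.l, p.u, j⟩ = u') :
    insCount I (insUpper k e f) τ p = slots n fun y => τ (.cle k l' u' y) := by
  classical
  simp only [insCount, insUpper, List.countP_singleton, decide_eq_true_eq, slots,
    Finset.card_filter]
  refine Finset.sum_congr rfl fun j _ => ?_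
  have : (Lit.cle k e f NE.j).eval I ⟨p.l, p.u, j⟩ = Lit.cle k l' u' j := by
    simp only [Lit.eval, Lit.cle, hl, hu, NE.eval]
  rw [this]
  simp [Cond.Holds, NE.eval]

theorem Lit.eval_tru (p : Pt) : (Lit.tru : Lit NE).eval I p = Lit.tru := rfl

theorem insCount_insUnit {τ : Lit ℕ → Prop} (hτ : τ .tru) (p : Pt) :
    insCount I insUnit τ p = 1 := by
  classical
  simp only [insCount, insUnit, List.countP_singleton, decide_eq_true_eq, Lit.eval_tru, hτ,
    and_true]
  rw [Finset.sum_eq_single 0]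
  · simp [Cond.Holds, NE.eval]
  · intro j _ hj
    simp [Cond.Holds, NE.eval, hj]
  · simp

theorem insCount_insSlack {τ : Lit ℕ → Prop} (hτ : τ .tru) (p : Pt)
    (hp : InWindow n d p.l p.u) : insCount I insSlack τ p = n + p.l - (p.u + 1) := by
  classical
  obtain ⟨h1, h2, h3, h4⟩ := hp
  simp only [insCount, insSlack, List.countP_singleton, decide_eq_true_eq, Lit.eval_tru, hτ,
    and_true, ← Finset.card_filter]
  have : (Finset.range (n + 2)).filter (fun j => Cond.Holds I [(.k 1, .j),
      (.add .j (.add .u (.k 1)), .add .n .l)] ⟨p.l, p.u, j⟩) =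
      Finset.Icc 1 (n + p.l - (p.u + 1)) := by
    ext j
    simp only [Finset.mem_filter, Finset.mem_range, Cond.Holds, NE.eval, Finset.mem_Icc,
      List.forall_mem_cons, List.not_mem_nil, false_implies, implies_true, and_true]
    omega
  rw [this]
  simp

/-- For `j < n` exactly one of the three guards holds, and the input is true if `j` is not counted,
or if it is counted and `a = 0` has been derived. For derived maxima the count is `n` minus their
sum; the additive form avoids truncated subtraction. -/
theorem insCount_insZero (k : CKind) {τ : Lit ℕ → Prop} (hτ : τ .tru) (p : Pt) :
    insCount I (insZero k) τ p + (I.counted k).card =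
      (I.numCounted k fun i => τ (.zero i p.l p.u)) + n := by
  classical
  have hnum : (I.counted k).card = I.numCounted k fun _ => True := by
    simp [OADInstance.numCounted]
  rw [hnum, ← sum_range_kind k _ p.l p.u, ← sum_range_kind k _ p.l p.u, insCount,
    ← Finset.sum_add_distrib]
  have hn : n = ∑ j ∈ Finset.range (n + 2), if j < n then 1 else 0 := by
    rw [← Finset.card_filter]
    have : (Finset.range (n + 2)).filter (· < n) = Finset.range n := by
      ext j; simp; omega
    rw [this, Finset.card_range]
  refine Eq.trans ?_ (congrArg _ hn.symm)
  rw [← Finset.sum_add_distrib]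
  refine Finset.sum_congr rfl fun j _ => ?_
  simp only [insZero, List.countP_cons, List.countP_nil, decide_eq_true_eq, Lit.eval_tru, hτ,
    and_true, Cond.holds_append, Cond.holds_condVar, condKind]
  have h1 : Cond.Holds I [(.add .kind (.k 1), .k k.code)] ⟨p.l, p.u, j⟩ ↔
      NE.kind.eval I ⟨p.l, p.u, j⟩ < k.code := by
    simp [Cond.Holds, NE.eval]
  have h2 : Cond.Holds I [(.add (.k k.code) (.k 1), .kind)] ⟨p.l, p.u, j⟩ ↔
      k.code < NE.kind.eval I ⟨p.l, p.u, j⟩ := by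
    simp [Cond.Holds, NE.eval]
  have h3 : Cond.Holds I [(.kind, .k k.code), (.k k.code, .kind)] ⟨p.l, p.u, j⟩ ↔
      NE.kind.eval I ⟨p.l, p.u, j⟩ = k.code := by
    simp [Cond.Holds, NE.eval, le_antisymm_iff]
  rw [h1, h2, h3]
  have h4 : (Lit.zero NE.j NE.l NE.u).eval I ⟨p.l, p.u, j⟩ = Lit.zero j p.l p.u := rfl
  rw [h4]
  by_cases hj : j < n
  · rcases lt_trichotomy (NE.kind.eval I ⟨p.l, p.u, j⟩) k.code with h | h | h
    · simp [hj, h, h.ne, h.not_gt]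
    · by_cases hz : τ (Lit.zero j p.l p.u) <;> simp [hj, h, hz]
    · simp [hj, h, h.ne', h.not_gt]
  · simp [hj]

end

/-! ## Soundness of the rules -/

theorem CKind.forall {p : CKind → Prop} : (∀ k, p k) ↔ p .st ∧ p .s ∧ p .t :=
  ⟨fun h => ⟨h _, h _, h _⟩, fun h k => by cases k <;> simp [h]⟩

/-- A literal is correct for given bounds of the domains. -/
def Lit.Correct {n d : ℕ} (I : OADInstance n d) (lo hi : DVar n → ℤ) (x : Lit ℕ) : Prop :=
  x.t ≠ 1 ∧
  (x.t = 2 → ∀ i : Fin n, x.c = i → (x.a : ℤ) ≤ lo (.X i)) ∧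
  (x.t = 3 → ∀ i : Fin n, x.c = i → hi (.X i) < x.a) ∧
  (x.t = 4 → ∀ i : Fin n, x.c = i → lo (.a i x.a x.b) = 1) ∧
  (x.t = 5 → ∀ i : Fin n, x.c = i → hi (.a i x.a x.b) = 0) ∧
  ∀ k : CKind,
    (x.t = 6 + k.code → (x.c : ℤ) ≤ lo (.C k x.a x.b)) ∧
    (x.t = 9 + k.code → (x.c : ℤ) ≤ n - hi (.C k x.a x.b)) ∧
    (x.t = 12 + k.code → hi (.C k x.a x.b) ≤ ∑ i ∈ I.counted k, lo (.a i x.a x.b)) ∧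
    (x.t = 15 + k.code → ∑ i ∈ I.counted k, hi (.a i x.a x.b) ≤ lo (.C k x.a x.b))

namespace Lit

variable {n d : ℕ} {I : OADInstance n d} {lo hi : DVar n → ℤ}

theorem correct_tru : (tru : Lit ℕ).Correct I lo hi := by
  simp [Correct, tru, CKind.forall, CKind.code]

theorem not_correct_fls : ¬ (fls : Lit ℕ).Correct I lo hi := by
  simp [Correct, fls]

theorem correct_ge {i v : ℕ} :
    (ge i v).Correct I lo hi ↔ ∀ i' : Fin n, i = i' → (v : ℤ) ≤ lo (.X i') := by
  simp [Correct, ge, CKind.forall, CKind.code]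

theorem correct_lt {i v : ℕ} :
    (lt i v).Correct I lo hi ↔ ∀ i' : Fin n, i = i' → hi (.X i') < v := by
  simp [Correct, lt, CKind.forall, CKind.code]

theorem correct_one {i l u : ℕ} :
    (one i l u).Correct I lo hi ↔ ∀ i' : Fin n, i = i' → lo (.a i' l u) = 1 := by
  simp [Correct, one, CKind.forall, CKind.code]

theorem correct_zero {i l u : ℕ} :
    (zero i l u).Correct I lo hi ↔ ∀ i' : Fin n, i = i' → hi (.a i' l u) = 0 := by
  simp [Correct, zero, CKind.forall, CKind.code]

theorem correct_cge {k : CKind} {l u y : ℕ} :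
    (cge k l u y).Correct I lo hi ↔ (y : ℤ) ≤ lo (.C k l u) := by
  cases k <;> simp [Correct, cge, CKind.forall, CKind.code]

theorem correct_cle {k : CKind} {l u y : ℕ} :
    (cle k l u y).Correct I lo hi ↔ (y : ℤ) ≤ n - hi (.C k l u) := by
  cases k <;> simp [Correct, cle, CKind.forall, CKind.code]

theorem correct_low {k : CKind} {l u y : ℕ} :
    (low k l u y).Correct I lo hi ↔ hi (.C k l u) ≤ ∑ i ∈ I.counted k, lo (.a i l u) := by
  cases k <;> simp [Correct, low, CKind.forall, CKind.code]

theorem correct_high {k : CKind} {l u y : ℕ} :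
    (high k l u y).Correct I lo hi ↔ ∑ i ∈ I.counted k, hi (.a i l u) ≤ lo (.C k l u) := by
  cases k <;> simp [Correct, high, CKind.forall, CKind.code]

theorem correct_junk {l u y : ℕ} : (junk l u y).Correct I lo hi := by
  simp [Correct, junk, CKind.forall, CKind.code]

theorem inBox_mk {t a b c : ℕ} (ha : a ≤ d + 2) (hb : b ≤ d + 2) (hc : c ≤ n + 2) :
    (Lit.mk t a b c).InBox n d := ⟨by simp only; omega, by simp only; omega, by simp only; omega⟩

end Lit

section

variable {n d : ℕ} {I : OADInstance n d} {lo hi : DVar n → ℤ} {τ : Lit ℕ → Prop}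

theorem eval_dom {p : Pt} {i : Fin n} (hp : p.j = i) (hl : p.l ≤ d) :
    NE.dom.eval I p ≤ 0 ↔ (p.l : ℤ) ∉ I.dom i := by
  classical
  have h : (∃ (i' : Fin n) (v : ℕ), v ≤ d ∧ (v : ℤ) ∈ I.dom i' ∧
      p.j * (d + 1) + p.l = i' * (d + 1) + v) ↔ (p.l : ℤ) ∈ I.dom i := by
    constructor
    · rintro ⟨i', v, hv, hvi, h⟩
      have h1 : (p.j * (d + 1) + p.l) / (d + 1) = p.j := by
        rw [Nat.add_comm, Nat.add_mul_div_right _ _ (by omega), Nat.div_eq_of_lt (by omega),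
          Nat.zero_add]
      have h2 : ((i' : ℕ) * (d + 1) + v) / (d + 1) = i' := by
        rw [Nat.add_comm, Nat.add_mul_div_right _ _ (by omega), Nat.div_eq_of_lt (by omega),
          Nat.zero_add]
      have h3 : p.j = i' := by rw [← h1, ← h2, h]
      obtain rfl : i = i' := Fin.ext (hp ▸ h3)
      rw [h3] at h
      have : p.l = v := by omega
      rwa [this]
    · exact fun h => ⟨i, p.l, hl, h, by rw [hp]⟩
  simp only [NE.eval, OADInstance.input, if_true]
  rw [← h]
  split_ifs with hc
  · simp [hc]
  · simp [hc]

theorem Cond.holds_noIndex {G : Cond} (h : G = [] ∨ G = condWindow ∨ G = condPyramid) (p : Pt)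
    (j : ℕ) : G.Holds I ⟨p.l, p.u, j⟩ ↔ G.Holds I p := by
  rcases h with rfl | rfl | rfl
  · simp [Cond.Holds]
  · simp only [Cond.holds_condWindow]
  · simp only [Cond.holds_condPyramid]

/-- The bounds `lo` and `hi` lie in the initial domains, and are consistent. -/
structure OADInstance.IsBounds (I : OADInstance n d) (lo hi : DVar n → ℤ) : Prop where
  cons : I.Cons lo hi
  lo_mem : ∀ x, lo x ∈ I.initDom x
  hi_mem : ∀ x, hi x ∈ I.initDom x
  le : ∀ x, lo x ≤ hi x

namespace OADInstance.IsBounds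

theorem bool_a (h : I.IsBounds lo hi) (i : Fin n) (l u : ℕ) :
    (lo (.a i l u) = 0 ∨ lo (.a i l u) = 1) ∧ (hi (.a i l u) = 0 ∨ hi (.a i l u) = 1) :=
  ⟨h.lo_mem (.a i l u), h.hi_mem (.a i l u)⟩

theorem counter (h : I.IsBounds lo hi) (k : CKind) (l u : ℕ) :
    0 ≤ lo (.C k l u) ∧ lo (.C k l u) ≤ hi (.C k l u) ∧ hi (.C k l u) ≤ n :=
  ⟨(h.lo_mem (.C k l u)).1, h.le _, (h.hi_mem (.C k l u)).2⟩

/-- A correct literal `C ≥ y` has `y` at most the minimum of the counter, so all filled slots lie in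
an initial segment of that length, whether or not they are contiguous. -/
theorem slots_cge (h : I.IsBounds lo hi)
    (hτ : ∀ x : Lit ℕ, x.InBox n d → τ x → x.Correct I lo hi) {k : CKind} {l u : ℕ}
    (hl : l ≤ d + 2) (hu : u ≤ d + 2) :
    (slots n (fun y => τ (.cge k l u y)) : ℤ) ≤ lo (.C k l u) := by
  have hC := h.counter k l u
  have : slots n (fun y => τ (.cge k l u y)) ≤ (lo (.C k l u)).toNat :=
    slots_le fun y _ hy hyτ => by
      have := Lit.correct_cge.1 (hτ _ (Lit.inBox_mk hl hu (by omega)) hyτ)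
      omega
  omega

theorem slots_cle (h : I.IsBounds lo hi)
    (hτ : ∀ x : Lit ℕ, x.InBox n d → τ x → x.Correct I lo hi) {k : CKind} {l u : ℕ}
    (hl : l ≤ d + 2) (hu : u ≤ d + 2) :
    (slots n (fun y => τ (.cle k l u y)) : ℤ) ≤ n - hi (.C k l u) := by
  have hC := h.counter k l u
  have : slots n (fun y => τ (.cle k l u y)) ≤ (n - hi (.C k l u)).toNat :=
    slots_le fun y _ hy hyτ => by
      have := Lit.correct_cle.1 (hτ _ (Lit.inBox_mk hl hu (by omega)) hyτ)
      omega
  omega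

/-- The strict second part concerns a variable that must be `1` although this has not been derived
yet; it refutes premature firing of inhibited rules. -/
theorem num_one (h : I.IsBounds lo hi)
    (hτ : ∀ x : Lit ℕ, x.InBox n d → τ x → x.Correct I lo hi) {k : CKind} {l u : ℕ}
    (hl : l ≤ d + 2) (hu : u ≤ d + 2) :
    (I.numCounted k (fun i => τ (.one i l u)) : ℤ) ≤ ∑ i ∈ I.counted k, lo (.a i l u) ∧
    ∀ i ∈ I.counted k, ¬ τ (.one i l u) → lo (.a i l u) = 1 →
      (I.numCounted k (fun i => τ (.one i l u)) : ℤ) + 1 ≤ ∑ i ∈ I.counted k, lo (.a i l u) := by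
  classical
  have key : ∀ i : Fin n, (if τ (.one i l u) then (1 : ℤ) else 0) ≤ lo (.a i l u) := by
    intro i
    have := (h.bool_a i l u).1
    split_ifs with hi
    · exact (Lit.correct_one.1 (hτ _ (Lit.inBox_mk hl hu (by omega)) hi) i rfl).ge
    · omega
  rw [OADInstance.numCounted, Finset.natCast_card_filter]
  refine ⟨Finset.sum_le_sum fun i _ => key i, fun i hi h1 h2 => ?_⟩
  refine Int.add_one_le_iff.2 (Finset.sum_lt_sum (fun i _ => key i) ⟨i, hi, ?_⟩)
  rw [if_neg h1, h2]
  norm_num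

theorem num_zero (h : I.IsBounds lo hi)
    (hτ : ∀ x : Lit ℕ, x.InBox n d → τ x → x.Correct I lo hi) {k : CKind} {l u : ℕ}
    (hl : l ≤ d + 2) (hu : u ≤ d + 2) :
    (I.numCounted k (fun i => τ (.zero i l u)) : ℤ) + ∑ i ∈ I.counted k, hi (.a i l u) ≤
      (I.counted k).card ∧
    ∀ i ∈ I.counted k, ¬ τ (.zero i l u) → hi (.a i l u) = 0 →
      (I.numCounted k (fun i => τ (.zero i l u)) : ℤ) + ∑ i ∈ I.counted k, hi (.a i l u) + 1 ≤
        (I.counted k).card := by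
  classical
  have key : ∀ i : Fin n, (if τ (.zero i l u) then (1 : ℤ) else 0) + hi (.a i l u) ≤ 1 := by
    intro i
    have := (h.bool_a i l u).2
    split_ifs with hi
    · rw [Lit.correct_zero.1 (hτ _ (Lit.inBox_mk hl hu (by omega)) hi) i rfl]; norm_num
    · omega
  rw [OADInstance.numCounted, Finset.natCast_card_filter, ← Finset.sum_add_distrib,
    Finset.cast_card]
  refine ⟨Finset.sum_le_sum fun i _ => key i, fun i hi h1 h2 => ?_⟩
  refine Int.add_one_le_iff.2 (Finset.sum_lt_sum (fun i _ => key i) ⟨i, hi, ?_⟩)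
  rw [if_neg h1, h2]
  norm_num

/-- Rules may step over a value that is missing from the domain because the bounds are themselves
elements of the domain. -/
theorem correct_varRules (h : I.IsBounds lo hi)
    (hτ : ∀ x : Lit ℕ, x.InBox n d → τ x → x.Correct I lo hi) {R : Rule} (hR : R ∈ varRules)
    {p : Pt} {k : ℕ} (hf : R.Fires I τ p k) :
    ((R.out.eval I p).shift (k - 1)).Correct I lo hi := by
  have hdom : ∀ i, lo (.X i) ∈ I.dom i ∧ hi (.X i) ∈ I.dom i := fun i =>
    ⟨h.lo_mem (.X i), h.hi_mem (.X i)⟩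
  have hbd : ∀ i, 1 ≤ lo (.X i) ∧ hi (.X i) ≤ d := fun i =>
    ⟨(one_le_dom (hdom i).1).1, (one_le_dom (hdom i).2).2⟩
  simp only [varRules, List.mem_cons, List.not_mem_nil, or_false] at hR
  rcases hR with rfl | rfl | rfl | rfl | rfl | rfl | rfl
  · obtain ⟨⟨hl, hu, hj⟩, rfl, hG, hx⟩ := Rule.fires_imp.1 hf
    have h1 : (Lit.ge p.j (p.l + 1)).Correct I lo hi :=
      hτ _ (Lit.inBox_mk (by omega) (Nat.zero_le _) (by omega)) hx
    refine Lit.correct_ge.2 fun i hi => ?_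
    have := Lit.correct_ge.1 h1 i hi
    push_cast at this
    change (p.l : ℤ) ≤ _
    omega
  · obtain ⟨⟨hl, hu, hj⟩, rfl, hG, hx⟩ := Rule.fires_imp.1 hf
    have h1 : (Lit.lt p.j p.l).Correct I lo hi :=
      hτ _ (Lit.inBox_mk (by omega) (Nat.zero_le _) (by omega)) hx
    refine Lit.correct_lt.2 fun i hi => ?_
    have := Lit.correct_lt.1 h1 i hi
    change _ < ((p.l + 1 : ℕ) : ℤ)
    omega
  · obtain ⟨⟨hl, hu, hj⟩, rfl, hG, hx⟩ := Rule.fires_imp.1 hf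
    have h1 : (Lit.ge p.j p.l).Correct I lo hi :=
      hτ _ (Lit.inBox_mk (by omega) (Nat.zero_le _) (by omega)) hx
    refine Lit.correct_ge.2 fun i hi => ?_
    have h2 := Lit.correct_ge.1 h1 i hi
    rw [Cond.holds_append] at hG
    have h3 : p.l ≤ d := hG.2 (.l, .d) (by simp)
    have h4 := (eval_dom hi h3).1 (hG.2 (.dom, .k 0) (by simp))
    have h5 : lo (.X i) ≠ p.l := fun h => h4 (h ▸ (hdom i).1)
    change ((p.l + 1 : ℕ) : ℤ) ≤ _
    omega
  · obtain ⟨⟨hl, hu, hj⟩, rfl, hG, hx⟩ := Rule.fires_imp.1 hf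
    have h1 : (Lit.lt p.j (p.l + 1)).Correct I lo hi :=
      hτ _ (Lit.inBox_mk (by omega) (Nat.zero_le _) (by omega)) hx
    refine Lit.correct_lt.2 fun i hi' => ?_
    have h2 := Lit.correct_lt.1 h1 i hi'
    rw [Cond.holds_append] at hG
    have h3 : p.l ≤ d := hG.2 (.l, .d) (by simp)
    have h4 := (eval_dom hi' h3).1 (hG.2 (.dom, .k 0) (by simp))
    have h5 : hi (.X i) ≠ p.l := fun h => h4 (h ▸ (hdom i).2)
    change _ < (p.l : ℤ)
    push_cast at h2
    omega
  · obtain ⟨⟨hl, hu, hj⟩, rfl, hG, hx, hy⟩ := Rule.fires_imp₂.1 hf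
    rw [Cond.holds_condVar] at hG
    have h1 : (Lit.ge p.j p.l).Correct I lo hi :=
      hτ _ (Lit.inBox_mk (by omega) (Nat.zero_le _) (by omega)) hx
    have h2 : (Lit.lt p.j p.l).Correct I lo hi :=
      hτ _ (Lit.inBox_mk (by omega) (Nat.zero_le _) (by omega)) hy
    have h3 := Lit.correct_ge.1 h1 ⟨p.j, hG⟩ rfl
    have h4 := Lit.correct_lt.1 h2 ⟨p.j, hG⟩ rfl
    have h5 := h.le (.X ⟨p.j, hG⟩)
    omega
  · obtain ⟨⟨hl, hu, hj⟩, rfl, hG, hx⟩ := Rule.fires_imp.1 hf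
    refine Lit.correct_ge.2 fun i hi => ?_
    change ((0 : ℕ) : ℤ) ≤ _
    have := hbd i
    omega
  · obtain ⟨⟨hl, hu, hj⟩, rfl, hG, hx⟩ := Rule.fires_imp.1 hf
    refine Lit.correct_lt.2 fun i hi => ?_
    change _ < ((d + 1 : ℕ) : ℤ)
    have := hbd i
    omega

theorem correct_intervalRules (h : I.IsBounds lo hi)
    (hτ : ∀ x : Lit ℕ, x.InBox n d → τ x → x.Correct I lo hi) {R : Rule}
    (hR : R ∈ intervalRules) {p : Pt} {k : ℕ} (hf : R.Fires I τ p k) :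
    ((R.out.eval I p).shift (k - 1)).Correct I lo hi := by
  have hG' : Cond.Holds I (condVar ++ condWindow) p ↔ p.j < n ∧ InWindow n d p.l p.u := by
    rw [Cond.holds_append, Cond.holds_condVar, Cond.holds_condWindow]
  have hge : ∀ {v}, p.InBox n d → v ≤ d + 2 → τ (.ge p.j v) → ∀ i : Fin n, p.j = i →
      (v : ℤ) ≤ lo (.X i) := fun hp hv hx =>
    Lit.correct_ge.1 (hτ _ (Lit.inBox_mk hv (Nat.zero_le _) (by have := hp.2.2; omega)) hx)
  have hlt : ∀ {v}, p.InBox n d → v ≤ d + 2 → τ (.lt p.j v) → ∀ i : Fin n, p.j = i →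
      hi (.X i) < v := fun hp hv hx =>
    Lit.correct_lt.1 (hτ _ (Lit.inBox_mk hv (Nat.zero_le _) (by have := hp.2.2; omega)) hx)
  have hone : p.InBox n d → τ (.one p.j p.l p.u) → ∀ i : Fin n, p.j = i →
      lo (.a i p.l p.u) = 1 := fun hp hx => Lit.correct_one.1 (hτ _ (Lit.inBox_mk
        (hp.1.trans (by omega)) (hp.2.1.trans (by omega)) (hp.2.2.trans (by omega))) hx)
  have hzero : p.InBox n d → τ (.zero p.j p.l p.u) → ∀ i : Fin n, p.j = i →
      hi (.a i p.l p.u) = 0 := fun hp hx => Lit.correct_zero.1 (hτ _ (Lit.inBox_mk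
        (hp.1.trans (by omega)) (hp.2.1.trans (by omega)) (hp.2.2.trans (by omega))) hx)
  simp only [intervalRules, List.mem_cons, List.not_mem_nil, or_false] at hR
  rcases hR with rfl | rfl | rfl | rfl | rfl | rfl | rfl | rfl
  · obtain ⟨hp, rfl, hG, hx, hy⟩ := Rule.fires_imp₂.1 hf
    obtain ⟨hj, hw⟩ := hG'.1 hG
    refine Lit.correct_one.2 fun i hi => ?_
    have h1 := hge (v := p.l) hp (by have := hw.2.2.1; have := hw.2.1; omega) hx i hi
    have h2 := hlt (v := p.u + 1) hp (by have := hw.2.2.1; omega) hy i hi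
    push_cast at h2
    exact (h.cons.interval i p.l p.u hw).1.2 ⟨h1, by omega⟩
  · obtain ⟨hp, rfl, hG, hx⟩ := Rule.fires_imp.1 hf
    obtain ⟨hj, hw⟩ := hG'.1 hG
    refine Lit.correct_ge.2 fun i hi => ?_
    exact ((h.cons.interval i p.l p.u hw).1.1 (hone hp hx i hi)).1
  · obtain ⟨hp, rfl, hG, hx⟩ := Rule.fires_imp.1 hf
    obtain ⟨hj, hw⟩ := hG'.1 hG
    refine Lit.correct_lt.2 fun i hi => ?_
    have := ((h.cons.interval i p.l p.u hw).1.1 (hone hp hx i hi)).2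
    change _ < ((p.u + 1 : ℕ) : ℤ)
    omega
  · obtain ⟨hp, rfl, hG, hx⟩ := Rule.fires_imp.1 hf
    obtain ⟨hj, hw⟩ := hG'.1 hG
    refine Lit.correct_zero.2 fun i hi => ?_
    have h1 := hlt (v := p.l) hp (by have := hw.2.2.1; have := hw.2.1; omega) hx i hi
    exact (h.cons.interval i p.l p.u hw).2.2.1 h1
  · obtain ⟨hp, rfl, hG, hx⟩ := Rule.fires_imp.1 hf
    obtain ⟨hj, hw⟩ := hG'.1 hG
    refine Lit.correct_zero.2 fun i hi => ?_
    have h1 := hge (v := p.u + 1) hp (by have := hw.2.2.1; omega) hx i hi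
    push_cast at h1
    exact (h.cons.interval i p.l p.u hw).2.2.2 (by omega)
  · obtain ⟨hp, rfl, hG, hx, hy⟩ := Rule.fires_imp₂.1 hf
    obtain ⟨hj, hw⟩ := hG'.1 hG
    refine Lit.correct_ge.2 fun i hi => ?_
    have h1 := hge (v := p.l) hp (by have := hw.2.2.1; have := hw.2.1; omega) hy i hi
    have := ((h.cons.interval i p.l p.u hw).2.1 (hzero hp hx i hi)).1 h1
    change ((p.u + 1 : ℕ) : ℤ) ≤ _
    omega
  · obtain ⟨hp, rfl, hG, hx, hy⟩ := Rule.fires_imp₂.1 hf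
    obtain ⟨hj, hw⟩ := hG'.1 hG
    refine Lit.correct_lt.2 fun i hi => ?_
    have h1 := hlt (v := p.u + 1) hp (by have := hw.2.2.1; omega) hy i hi
    push_cast at h1
    exact ((h.cons.interval i p.l p.u hw).2.1 (hzero hp hx i hi)).2 (by omega)
  · obtain ⟨hp, rfl, hG, hx, hy⟩ := Rule.fires_imp₂.1 hf
    obtain ⟨hj, hw⟩ := hG'.1 hG
    have h1 := hone hp hx ⟨p.j, hj⟩ rfl
    have h2 := hzero hp hy ⟨p.j, hj⟩ rfl
    have h3 := h.le (.a ⟨p.j, hj⟩ p.l p.u)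
    omega

end OADInstance.IsBounds

end

/-! ### Soundness of the rules for counters -/

section

variable {n d : ℕ} {I : OADInstance n d} {lo hi : DVar n → ℤ} {τ : Lit ℕ → Prop}

/-- A true literal `low` reveals the rule that produced it, since for each `k` only one rule has an
output with this tag. -/
theorem rule_of_out_low (k : CKind) : ∀ R ∈ oadRules, R.out.t = 12 + k.code →
    R = .total condWindow (insOne k ++ insUpper k .l .u ++ insUnit) .n (.low k .l .u 0) := by
  cases k <;> simp [oadRules, counterRules, varRules, intervalRules, countRules, pyramidRules,
    capacityRule, Rule.total, Rule.imp, Rule.imp₂, Lit.junk, Lit.ge, Lit.lt, Lit.one, Lit.zero,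
    Lit.cge, Lit.cle, Lit.low, Lit.high, Lit.fls, CKind.code]

theorem rule_of_out_high (k : CKind) : ∀ R ∈ oadRules, R.out.t = 15 + k.code →
    R = .total condWindow (insZero k ++ insLower k .l .u ++ insUnit) .n (.high k .l .u 0) := by
  cases k <;> simp [oadRules, counterRules, varRules, intervalRules, countRules, pyramidRules,
    capacityRule, Rule.total, Rule.imp, Rule.imp₂, Lit.junk, Lit.ge, Lit.lt, Lit.one, Lit.zero,
    Lit.cge, Lit.cle, Lit.low, Lit.high, Lit.fls, CKind.code]

theorem Rule.fires_window {ins : List (Cond × Lit NE)} {thr : NE} {o : Lit NE} {p : Pt} {k : ℕ} :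
    (total condWindow ins thr o).Fires I τ p k ↔ p.InBox n d ∧ p.j = 0 ∧ 1 ≤ k ∧
      InWindow n d p.l p.u ∧ thr.eval I p + k ≤ insCount I ins τ p := by
  rw [fires_total (Cond.holds_noIndex (Or.inr (Or.inl rfl)) p), Cond.holds_condWindow]

theorem Rule.fires_pyramid {ins : List (Cond × Lit NE)} {thr : NE} {o : Lit NE} {p : Pt} {k : ℕ} :
    (total condPyramid ins thr o).Fires I τ p k ↔ p.InBox n d ∧ p.j = 0 ∧ 1 ≤ k ∧
      (InWindow n d p.l p.u ∧ p.l < p.u) ∧ thr.eval I p + k ≤ insCount I ins τ p := by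
  rw [fires_total (Cond.holds_noIndex (Or.inr (Or.inr rfl)) p), Cond.holds_condPyramid]

theorem Rule.fires_total_nil {ins : List (Cond × Lit NE)} {thr : NE} {o : Lit NE} {p : Pt}
    {k : ℕ} : (total [] ins thr o).Fires I τ p k ↔ p.InBox n d ∧ p.j = 0 ∧ 1 ≤ k ∧
      thr.eval I p + k ≤ insCount I ins τ p := by
  rw [fires_total (Cond.holds_noIndex (Or.inl rfl) p)]
  simp [Cond.Holds]

namespace OADInstance.IsBounds

/-- Support of `τ` yields more than correctness of `low`: the exhaustion of the maximum is witnessed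
by the literals that are presently true. The unit input cancels the strictness of the threshold. -/
theorem supported_low (hsup : ∀ x : Lit ℕ, x.InBox n d → τ x → x = .tru ∨
      ∃ R ∈ oadRules, ∃ p k, R.Fires I τ p k ∧ x = (R.out.eval I p).shift (k - 1))
    (htru : τ .tru) {k : CKind} {l u : ℕ} (hl : l ≤ d + 2) (hu : u ≤ d + 2)
    (h : τ (.low k l u 0)) :
    n ≤ I.numCounted k (fun i => τ (.one i l u)) + slots n (fun y => τ (.cle k l u y)) := by
  rcases hsup _ (Lit.inBox_mk hl hu (Nat.zero_le _)) h with h | ⟨R, hR, p, s, hf, hx⟩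
  · simp [Lit.tru] at h
  · obtain rfl := rule_of_out_low k R hR (congrArg Lit.t hx).symm
    obtain ⟨hp, -, hs, hw, hc⟩ := Rule.fires_window.1 hf
    obtain rfl : l = p.l := congrArg Lit.a hx
    obtain rfl : u = p.u := congrArg Lit.b hx
    rw [insCount_append, insCount_append, insCount_insOne, insCount_insUpper k _ _ τ p p.l p.u
      (fun _ => rfl) (fun _ => rfl), insCount_insUnit htru] at hc
    simp only [NE.eval] at hc
    omega

theorem supported_high (hsup : ∀ x : Lit ℕ, x.InBox n d → τ x → x = .tru ∨
      ∃ R ∈ oadRules, ∃ p k, R.Fires I τ p k ∧ x = (R.out.eval I p).shift (k - 1))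
    (htru : τ .tru) {k : CKind} {l u : ℕ} (hl : l ≤ d + 2) (hu : u ≤ d + 2)
    (h : τ (.high k l u 0)) :
    (I.counted k).card ≤
      I.numCounted k (fun i => τ (.zero i l u)) + slots n (fun y => τ (.cge k l u y)) := by
  rcases hsup _ (Lit.inBox_mk hl hu (Nat.zero_le _)) h with h | ⟨R, hR, p, s, hf, hx⟩
  · simp [Lit.tru] at h
  · obtain rfl := rule_of_out_high k R hR (congrArg Lit.t hx).symm
    obtain ⟨hp, -, hs, hw, hc⟩ := Rule.fires_window.1 hf
    obtain rfl : l = p.l := congrArg Lit.a hx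
    obtain rfl : u = p.u := congrArg Lit.b hx
    have hz := insCount_insZero (I := I) k htru p
    rw [insCount_append, insCount_append, insCount_insLower k _ _ τ p p.l p.u
      (fun _ => rfl) (fun _ => rfl), insCount_insUnit htru] at hc
    simp only [NE.eval] at hc
    omega

/-- The first two rules have inhibitors. Suppose that `low` is true and `a i = 1` is not derived. If
nevertheless `lo (a i) = 1`, the derived ones would be fewer than `∑ lo`; but by `supported_low`
they are at least `hi C`, so `hi C < ∑ lo ≤ lo C`, which is impossible. So `lo (a i) = 0`, and as
the maximum is exhausted, `hi (a i) = 0` too. The rule for `high` is dual. The other rules compare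
counts. -/
theorem correct_countRules (h : I.IsBounds lo hi) (htru : τ .tru)
    (hτ : ∀ x : Lit ℕ, x.InBox n d → τ x → x.Correct I lo hi)
    (hsup : ∀ x : Lit ℕ, x.InBox n d → τ x → x = .tru ∨
      ∃ R ∈ oadRules, ∃ p k, R.Fires I τ p k ∧ x = (R.out.eval I p).shift (k - 1))
    {c : CKind} {R : Rule} (hR : R ∈ countRules c) {p : Pt} {k : ℕ} (hf : R.Fires I τ p k)
    (hinh : ¬ τ (R.inh.eval I p)) :
    ((R.out.eval I p).shift (k - 1)).Correct I lo hi := by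
  have hG' : Cond.Holds I (condKind c ++ condWindow) p ↔
      (∃ i : Fin n, p.j = i ∧ i ∈ I.counted c) ∧ InWindow n d p.l p.u := by
    rw [Cond.holds_append, Cond.holds_condKind, Cond.holds_condWindow]
  have hpl : p.l ≤ d + 2 := hf.1.trans (by omega)
  have hpu : p.u ≤ d + 2 := hf.2.1.trans (by omega)
  have b1 := h.slots_cge hτ (k := c) hpl hpu
  have b2 := h.slots_cle hτ (k := c) hpl hpu
  have b3 := h.num_one hτ (k := c) hpl hpu
  have b4 := h.num_zero hτ (k := c) hpl hpu
  have bC := h.counter c p.l p.u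
  have hz := insCount_insZero (I := I) c htru p
  have eL := insCount_insLower (I := I) c .l .u τ p p.l p.u (fun _ => rfl) (fun _ => rfl)
  have eU := insCount_insUpper (I := I) c .l .u τ p p.l p.u (fun _ => rfl) (fun _ => rfl)
  have eO := insCount_insOne (I := I) c τ p
  simp only [countRules, List.mem_cons, List.not_mem_nil, or_false] at hR
  rcases hR with rfl | rfl | rfl | rfl | rfl | rfl | rfl
  · obtain ⟨hp, rfl, hG, hx⟩ := Rule.fires_imp.1 hf
    obtain ⟨⟨i, hpi, hic⟩, hw⟩ := hG'.1 hG
    have hlow : (Lit.low c p.l p.u 0).Correct I lo hi :=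
      hτ _ (Lit.inBox_mk hpl hpu (Nat.zero_le _)) hx
    rw [Lit.correct_low] at hlow
    have hsupp := supported_low hsup htru hpl hpu hx
    obtain ⟨h1, h2, h3, h4⟩ := h.cons.count c p.l p.u hw
    have heq := h3 hlow i hic
    refine Lit.correct_zero.2 fun i' hi' => ?_
    obtain rfl : i = i' := Fin.ext (hpi ▸ hi')
    have hinh' : ¬ τ (.one i p.l p.u) := by rw [← hpi]; exact hinh
    change hi (.a i p.l p.u) = 0
    rcases (h.bool_a i p.l p.u).1 with h5 | h5
    · omega
    · have := b3.2 i hic hinh' h5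
      omega
  · obtain ⟨hp, rfl, hG, hx⟩ := Rule.fires_imp.1 hf
    obtain ⟨⟨i, hpi, hic⟩, hw⟩ := hG'.1 hG
    have hhigh : (Lit.high c p.l p.u 0).Correct I lo hi :=
      hτ _ (Lit.inBox_mk hpl hpu (Nat.zero_le _)) hx
    rw [Lit.correct_high] at hhigh
    have hsupp := supported_high hsup htru hpl hpu hx
    obtain ⟨h1, h2, h3, h4⟩ := h.cons.count c p.l p.u hw
    have heq := h4 hhigh i hic
    refine Lit.correct_one.2 fun i' hi' => ?_
    obtain rfl : i = i' := Fin.ext (hpi ▸ hi')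
    have hinh' : ¬ τ (.zero i p.l p.u) := by rw [← hpi]; exact hinh
    change lo (.a i p.l p.u) = 1
    rcases (h.bool_a i p.l p.u).2 with h5 | h5
    · have := b4.2 i hic hinh' h5
      omega
    · omega
  · obtain ⟨hp, -, hk, hw, hc⟩ := Rule.fires_window.1 hf
    have hcount := h.cons.count c p.l p.u hw
    refine Lit.correct_cge.2 ?_
    change ((1 + (k - 1) : ℕ) : ℤ) ≤ lo (.C c p.l p.u)
    simp only [NE.eval] at hc
    omega
  · obtain ⟨hp, -, hk, hw, hc⟩ := Rule.fires_window.1 hf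
    have hcount := h.cons.count c p.l p.u hw
    refine Lit.correct_cle.2 ?_
    change ((1 + (k - 1) : ℕ) : ℤ) ≤ n - hi (.C c p.l p.u)
    simp only [NE.eval] at hc
    omega
  · obtain ⟨hp, -, hk, hw, hc⟩ := Rule.fires_window.1 hf
    refine Lit.correct_low.2 ?_
    change hi (.C c p.l p.u) ≤ ∑ i ∈ I.counted c, lo (.a i p.l p.u)
    rw [insCount_append, insCount_append, insCount_insUnit htru] at hc
    simp only [NE.eval] at hc
    omega
  · obtain ⟨hp, -, hk, hw, hc⟩ := Rule.fires_window.1 hf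
    refine Lit.correct_high.2 ?_
    change ∑ i ∈ I.counted c, hi (.a i p.l p.u) ≤ lo (.C c p.l p.u)
    rw [insCount_append, insCount_append, insCount_insUnit htru] at hc
    simp only [NE.eval] at hc
    omega
  -- The contradiction cannot be derived: correct slots fill at most `lo` and `n - hi`, together at
  -- most `n`.
  · obtain ⟨hp, -, hk, hc⟩ := Rule.fires_total_nil.1 hf
    rw [insCount_append] at hc
    simp only [NE.eval] at hc
    omega

/-- Maxima enter as complements `n - hi`. The threshold is `n` in the three rules where the
complements leave a surplus of `n`, and `0` in the others. -/
theorem correct_pyramidRules (h : I.IsBounds lo hi)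
    (hτ : ∀ x : Lit ℕ, x.InBox n d → τ x → x.Correct I lo hi)
    {R : Rule} (hR : R ∈ pyramidRules) {p : Pt} {k : ℕ} (hf : R.Fires I τ p k) :
    ((R.out.eval I p).shift (k - 1)).Correct I lo hi := by
  have hpl : p.l + 1 ≤ d + 2 := by have := hf.1; omega
  have hpu : p.u ≤ d + 2 := hf.2.1.trans (by omega)
  have lx := h.slots_cge hτ (k := .st) (l := 1) (u := p.u) (by omega) hpu
  have ly := h.slots_cge hτ (k := .st) (l := 1) (u := p.l) (by omega) (by omega)
  have lz := h.slots_cge hτ (k := .st) (l := p.l + 1) (u := p.u) hpl hpu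
  have ux := h.slots_cle hτ (k := .st) (l := 1) (u := p.u) (by omega) hpu
  have uy := h.slots_cle hτ (k := .st) (l := 1) (u := p.l) (by omega) (by omega)
  have uz := h.slots_cle hτ (k := .st) (l := p.l + 1) (u := p.u) hpl hpu
  have elx := insCount_insLower (I := I) .st (.k 1) .u τ p 1 p.u (fun _ => rfl) (fun _ => rfl)
  have ely := insCount_insLower (I := I) .st (.k 1) .l τ p 1 p.l (fun _ => rfl) (fun _ => rfl)
  have elz := insCount_insLower (I := I) .st (.add .l (.k 1)) .u τ p (p.l + 1) p.u
    (fun _ => rfl) (fun _ => rfl)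
  have eux := insCount_insUpper (I := I) .st (.k 1) .u τ p 1 p.u (fun _ => rfl) (fun _ => rfl)
  have euy := insCount_insUpper (I := I) .st (.k 1) .l τ p 1 p.l (fun _ => rfl) (fun _ => rfl)
  have euz := insCount_insUpper (I := I) .st (.add .l (.k 1)) .u τ p (p.l + 1) p.u
    (fun _ => rfl) (fun _ => rfl)
  simp only [pyramidRules, List.mem_cons, List.not_mem_nil, or_false] at hR
  rcases hR with rfl | rfl | rfl | rfl | rfl | rfl <;>
    obtain ⟨hp, -, hk, ⟨hw, hlu⟩, hc⟩ := Rule.fires_pyramid.1 hf <;>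
    have hpyr := h.cons.pyramid p.l p.u hw hlu <;>
    rw [insCount_append] at hc <;>
    simp only [NE.eval] at hc
  · refine Lit.correct_cge.2 ?_
    change ((1 + (k - 1) : ℕ) : ℤ) ≤ lo (.C .st 1 p.u)
    omega
  · refine Lit.correct_cle.2 ?_
    change ((1 + (k - 1) : ℕ) : ℤ) ≤ n - hi (.C .st 1 p.u)
    omega
  · refine Lit.correct_cge.2 ?_
    change ((1 + (k - 1) : ℕ) : ℤ) ≤ lo (.C .st 1 p.l)
    omega
  · refine Lit.correct_cle.2 ?_
    change ((1 + (k - 1) : ℕ) : ℤ) ≤ n - hi (.C .st 1 p.l)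
    omega
  · refine Lit.correct_cge.2 ?_
    change ((1 + (k - 1) : ℕ) : ℤ) ≤ lo (.C .st (p.l + 1) p.u)
    omega
  · refine Lit.correct_cle.2 ?_
    change ((1 + (k - 1) : ℕ) : ℤ) ≤ n - hi (.C .st (p.l + 1) p.u)
    omega

theorem correct_capacityRule (h : I.IsBounds lo hi) (htru : τ .tru)
    (hτ : ∀ x : Lit ℕ, x.InBox n d → τ x → x.Correct I lo hi) {c c' : CKind}
    (hcc : c = .st ∧ c' ≠ .st ∨ c ≠ .st ∧ c' = .st) {p : Pt} {k : ℕ}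
    (hf : (capacityRule c c').Fires I τ p k) :
    (((capacityRule c c').out.eval I p).shift (k - 1)).Correct I lo hi := by
  have hpl : p.l ≤ d + 2 := hf.1.trans (by omega)
  have hpu : p.u ≤ d + 2 := hf.2.1.trans (by omega)
  obtain ⟨hp, -, hk, hw, hc⟩ := Rule.fires_window.1 hf
  have b1 := h.slots_cge hτ (k := c) hpl hpu
  rw [insCount_append, insCount_insSlack htru p hw, insCount_insLower (I := I) c .l .u τ p p.l p.u
    (fun _ => rfl) (fun _ => rfl)] at hc
  simp only [NE.eval] at hc
  refine Lit.correct_cle.2 ?_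
  change ((1 + (k - 1) : ℕ) : ℤ) ≤ n - hi (.C c' p.l p.u)
  have h1 := hw.2.1
  have h2 := hw.2.2.2
  rcases hcc with ⟨rfl, h3⟩ | ⟨h3, rfl⟩
  · have := h.cons.capacity c' h3 p.l p.u hw
    omega
  · have := h.cons.capacity c h3 p.l p.u hw
    omega

end OADInstance.IsBounds

theorem Rule.Fires.mono {R : Rule} {τ' : Lit ℕ → Prop} (hτ : ∀ x, τ x → τ' x) {p : Pt} {k : ℕ}
    (h : R.Fires I τ p k) : R.Fires I τ' p k := by
  classical
  obtain ⟨h1, h2, h3, h4, h5, h6⟩ := h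
  have key : ∀ p, R.cntAt I τ p ≤ R.cntAt I τ' p := fun p =>
    List.countP_mono_left fun i _ hi => by
      simp only [decide_eq_true_eq] at hi ⊢
      exact ⟨hi.1, hi.2.1, hτ _ hi.2.2⟩
  refine ⟨h1, h2, h3, h4, h5, h6.trans ?_⟩
  rw [Rule.cnt, Rule.cnt]
  split_ifs
  · exact Finset.sum_le_sum fun j _ => key _
  · exact key p

theorem oadRules_inh : ∀ R ∈ oadRules, R.inh.t ≠ 0 := by
  have : oadRules.all (fun R => decide (R.inh.t ≠ 0)) = true := by decide
  simpa using List.all_eq_true.1 this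

/-- The rules derive only correct literals. -/
theorem OADInstance.IsBounds.rulesPreserve (h : I.IsBounds lo hi) :
    RulesPreserve I oadRules fun x => x.Correct I lo hi := by
  refine ⟨Lit.correct_tru, fun τ₀ hτ₀ hsup₀ R hR p k hf₀ hinh₀ => ?_⟩
  set τ : Lit ℕ → Prop := fun x => τ₀ x ∨ x = .tru
  have hmono : ∀ x, τ₀ x → τ x := fun x => Or.inl
  have htru : τ .tru := Or.inr rfl
  have hτ : ∀ x : Lit ℕ, x.InBox n d → τ x → x.Correct I lo hi := by
    rintro x hx (h | rfl)
    exacts [hτ₀ x hx h, Lit.correct_tru]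
  have hsup : ∀ x : Lit ℕ, x.InBox n d → τ x → x = .tru ∨
      ∃ R ∈ oadRules, ∃ p k, R.Fires I τ p k ∧ x = (R.out.eval I p).shift (k - 1) := by
    rintro x hx (h | rfl)
    · exact (hsup₀ x hx h).imp id fun ⟨R, hR, p, k, hf, e⟩ => ⟨R, hR, p, k, hf.mono hmono, e⟩
    · exact Or.inl rfl
  have hinh : ¬ τ (R.inh.eval I p) := by
    rintro (h | h)
    · exact hinh₀ h
    · exact oadRules_inh R hR (congrArg Lit.t h)
  have hf := hf₀.mono hmono
  have hcounter : ∀ c, R ∈ counterRules c → ((R.out.eval I p).shift (k - 1)).Correct I lo hi := by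
    intro c hR
    simp only [counterRules, List.mem_cons, List.not_mem_nil, or_false] at hR
    rcases hR with rfl | rfl <;> exact Lit.correct_junk
  simp only [oadRules, List.mem_append, List.mem_cons, List.not_mem_nil, or_false] at hR
  rcases hR with ((((((((hR | hR) | hR) | hR) | hR) | hR) | hR) | hR) | hR) |
    (rfl | rfl | rfl | rfl)
  · exact hcounter _ hR
  · exact hcounter _ hR
  · exact hcounter _ hR
  · exact h.correct_varRules hτ hR hf
  · exact h.correct_intervalRules hτ hR hf
  · exact h.correct_countRules htru hτ hsup hR hf hinh
  · exact h.correct_countRules htru hτ hsup hR hf hinh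
  · exact h.correct_countRules htru hτ hsup hR hf hinh
  · exact h.correct_pyramidRules hτ hR hf
  · exact h.correct_capacityRule htru hτ (by simp) hf
  · exact h.correct_capacityRule htru hτ (by simp) hf
  · exact h.correct_capacityRule htru hτ (by simp) hf
  · exact h.correct_capacityRule htru hτ (by simp) hf

end

/-! ## Completeness of the rules -/

namespace RulesClosed

variable {n d : ℕ} {I : OADInstance n d} {τ : Lit ℕ → Prop}

theorem imp {Rs : List Rule} (h : RulesClosed I Rs τ) {G : Cond} {x o inh : Lit NE}
    (hR : Rule.imp G x o inh ∈ Rs) {p : Pt} (hp : p.InBox n d) (hG : G.Holds I p)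
    (hx : τ (x.eval I p)) : τ (o.eval I p) ∨ τ (inh.eval I p) :=
  h _ hR p 1 (Rule.fires_imp.2 ⟨hp, rfl, hG, hx⟩)

theorem imp₂ {Rs : List Rule} (h : RulesClosed I Rs τ) (hf : ¬ τ .fls) {G : Cond} {x y o : Lit NE}
    (hR : Rule.imp₂ G x y o ∈ Rs) {p : Pt} (hp : p.InBox n d) (hG : G.Holds I p)
    (hx : τ (x.eval I p)) (hy : τ (y.eval I p)) : τ (o.eval I p) :=
  (h _ hR p 1 (Rule.fires_imp₂.2 ⟨hp, rfl, hG, hx, hy⟩)).resolve_right hf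

theorem total {Rs : List Rule} (h : RulesClosed I Rs τ) (hf : ¬ τ .fls) {G : Cond}
    {ins : List (Cond × Lit NE)} {thr : NE} {o : Lit NE} (hR : Rule.total G ins thr o ∈ Rs)
    (hG : G = [] ∨ G = condWindow ∨ G = condPyramid) {l u s : ℕ} (hl : l ≤ d + 1) (hu : u ≤ d + 1)
    (hG' : G.Holds I ⟨l, u, 0⟩) (hs : 1 ≤ s)
    (hc : thr.eval I ⟨l, u, 0⟩ + s ≤ insCount I ins τ ⟨l, u, 0⟩) :
    τ ((o.eval I ⟨l, u, 0⟩).shift (s - 1)) :=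
  (h _ hR ⟨l, u, 0⟩ s ((Rule.fires_total fun j => Cond.holds_noIndex hG ⟨l, u, 0⟩ j).2
    ⟨⟨hl, hu, Nat.zero_le _⟩, rfl, hs, hG', hc⟩)).resolve_right hf

/-- The bounds of a variable. -/
theorem exists_var_bounds (h : RulesClosed I oadRules τ) (hf : ¬ τ .fls) (ht : τ .tru)
    (i : Fin n) : ∃ x y : ℕ, (x : ℤ) ∈ I.dom i ∧ (y : ℤ) ∈ I.dom i ∧ x ≤ y ∧ ∀ v ≤ d + 1,
      (τ (.ge i v) ↔ v ≤ x) ∧ (τ (.lt i v) ↔ y < v) := by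
  classical
  have hR : ∀ R ∈ varRules, R ∈ oadRules := by
    intro R hR
    simp only [oadRules, List.mem_append]
    tauto
  have hi := i.2
  have hbox : ∀ v ≤ d + 1, (Pt.mk v 0 i).InBox n d := fun v hv =>
    ⟨hv, Nat.zero_le _, by simp only; omega⟩
  have hvar : ∀ v, condVar.Holds I ⟨v, 0, i⟩ := fun v => (Cond.holds_condVar _).2 hi
  have hcond : ∀ v ≤ d, Cond.Holds I (condVar ++ [(.l, .d)]) ⟨v, 0, i⟩ := fun v hv =>
    (Cond.holds_append _ _ _).2 ⟨hvar v, by simpa [Cond.Holds, NE.eval] using hv⟩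
  have hcond' : ∀ v ≤ d, (v : ℤ) ∉ I.dom i →
      Cond.Holds I (condVar ++ [(.l, .d), (.dom, .k 0)]) ⟨v, 0, i⟩ := fun v hv hv' =>
    (Cond.holds_append _ _ _).2 ⟨hvar v, by
      have := (eval_dom (I := I) (p := ⟨v, 0, i⟩) rfl hv).2 hv'
      intro g hg
      simp only [List.mem_cons, List.not_mem_nil, or_false] at hg
      rcases hg with rfl | rfl
      exacts [hv, this]⟩
  have ge_pred : ∀ v ≤ d, τ (.ge i (v + 1)) → τ (.ge i v) := fun v hv hx =>
    (h.imp (x := .ge .j (.add .l (.k 1))) (o := .ge .j .l) (inh := .fls) (hR _ (by simp [varRules]))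
        (hbox v (by omega))
      (hcond v hv) hx).resolve_right hf
  have lt_succ : ∀ v ≤ d, τ (.lt i v) → τ (.lt i (v + 1)) := fun v hv hx =>
    (h.imp (x := .lt .j .l) (o := .lt .j (.add .l (.k 1))) (inh := .fls) (hR _ (by simp [varRules]))
        (hbox v (by omega))
      (hcond v hv) hx).resolve_right hf
  have ge_succ : ∀ v ≤ d, (v : ℤ) ∉ I.dom i → τ (.ge i v) → τ (.ge i (v + 1)) := fun v hv hv' hx =>
    (h.imp (x := .ge .j .l) (o := .ge .j (.add .l (.k 1))) (inh := .fls) (hR _ (by simp [varRules]))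
        (hbox v (by omega))
      (hcond' v hv hv') hx).resolve_right hf
  have lt_pred : ∀ v ≤ d, (v : ℤ) ∉ I.dom i → τ (.lt i (v + 1)) → τ (.lt i v) := fun v hv hv' hx =>
    (h.imp (x := .lt .j (.add .l (.k 1))) (o := .lt .j .l) (inh := .fls) (hR _ (by simp [varRules]))
        (hbox v (by omega))
      (hcond' v hv hv') hx).resolve_right hf
  have conflict : ∀ v ≤ d + 1, τ (.ge i v) → τ (.lt i v) → False := fun v hv hx hy =>
    hf (h.imp₂ hf (x := .ge .j .l) (y := .lt .j .l) (o := .fls) (hR _ (by simp [varRules]))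
        (hbox v hv) (hvar v) hx hy)
  have ge_zero : τ (.ge i 0) :=
    (h.imp (x := .tru) (o := .ge .j 0) (inh := .fls) (hR _ (by simp [varRules])) (hbox 0 (by omega))
        (hvar 0)
      ht).resolve_right hf
  have lt_top : τ (.lt i (d + 1)) :=
    (h.imp (x := .tru) (o := .lt .j (.add .d (.k 1))) (inh := .fls) (hR _ (by simp [varRules]))
        (hbox 0 (by omega)) (hvar 0)
      ht).resolve_right hf
  have not_ge_top : ¬ τ (.ge i (d + 1)) := fun hx => conflict _ (le_refl _) hx lt_top
  set x := Nat.findGreatest (fun v => τ (.ge i v)) (d + 1) with hxdef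
  have hx : τ (.ge i x) := Nat.findGreatest_spec (P := fun v => τ (.ge i v)) (Nat.zero_le _) ge_zero
  have hxd : x ≤ d := by
    have h1 : x ≤ d + 1 := Nat.findGreatest_le _
    have h2 : x ≠ d + 1 := fun h => not_ge_top (h ▸ hx)
    omega
  have hge_le : ∀ k v, v + k = x → τ (.ge i v) := by
    intro k
    induction k with
    | zero => rintro v rfl; exact hx
    | succ k ih => exact fun v hv => ge_pred v (by omega) (ih (v + 1) (by omega))
  have hex : ∃ v, τ (.lt i v) := ⟨_, lt_top⟩
  obtain ⟨y, hy⟩ : ∃ y, Nat.find hex = y + 1 := by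
    refine Nat.exists_eq_succ_of_ne_zero fun h0 => conflict 0 (by omega) ge_zero ?_
    have := Nat.find_spec hex
    rwa [h0] at this
  have hlt : τ (.lt i (y + 1)) := hy ▸ Nat.find_spec hex
  have hyd : y ≤ d := by have := Nat.find_le (h := hex) lt_top; omega
  have hlt_min : ∀ v, τ (.lt i v) → y < v := fun v hv => by
    have := Nat.find_le (h := hex) hv; omega
  have hlt_ge : ∀ k, y + 1 + k ≤ d + 1 → τ (.lt i (y + 1 + k)) := by
    intro k
    induction k with
    | zero => exact fun _ => hlt
    | succ k ih => exact fun hk => lt_succ (y + 1 + k) (by omega) (ih (by omega))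
  have hlt_iff : ∀ v ≤ d + 1, (τ (.lt i v) ↔ y < v) := fun v hv => ⟨hlt_min v, fun hyv => by
    obtain ⟨k, rfl⟩ : ∃ k, v = y + 1 + k := ⟨v - (y + 1), by omega⟩
    exact hlt_ge k hv⟩
  refine ⟨x, y, ?_, ?_, ?_, fun v hv => ⟨⟨fun hv' => Nat.le_findGreatest hv hv',
    fun hv' => hge_le (x - v) v (by omega)⟩, hlt_iff v hv⟩⟩
  · by_contra hxdom
    have := Nat.le_findGreatest (P := fun v => τ (.ge i v)) (n := d + 1) (by omega)
      (ge_succ x hxd hxdom hx)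
    omega
  · by_contra hydom
    exact absurd (hlt_min y (lt_pred y hyd hydom hlt)) (lt_irrefl y)
  · by_contra hxy
    exact conflict x (by omega) hx ((hlt_iff x (by omega)).2 (by omega))

end RulesClosed

section

variable {n d : ℕ}

open Classical in
/-- The lower bounds given by a set of literals. -/
noncomputable def lowerOf (d : ℕ) (τ : Lit ℕ → Prop) (x : Fin n → ℕ) : DVar n → ℤ
  | .X i => x i
  | .b i l => if l ≤ d ∧ τ (.lt i (l + 1)) then 1 else 0
  | .a i l u => if InWindow n d l u ∧ τ (.one i l u) then 1 else 0
  | .C k l u => if (DVar.C k l u : DVar n).Occurs d then slots n fun s => τ (.cge k l u s) else 0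

open Classical in
/-- The upper bounds given by a set of literals. -/
noncomputable def upperOf (d : ℕ) (τ : Lit ℕ → Prop) (y : Fin n → ℕ) : DVar n → ℤ
  | .X i => y i
  | .b i l => if l ≤ d ∧ τ (.ge i (l + 1)) then 0 else 1
  | .a i l u => if InWindow n d l u ∧ τ (.zero i l u) then 0 else 1
  | .C k l u =>
    if (DVar.C k l u : DVar n).Occurs d then n - slots n fun s => τ (.cle k l u s) else n

variable {I : OADInstance n d} {τ : Lit ℕ → Prop}

theorem occurs_of_inWindow (k : CKind) {l u : ℕ} (hw : InWindow n d l u) :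
    (DVar.C k l u : DVar n).Occurs d := by
  cases k
  exacts [Or.inl hw, hw, hw]

theorem le_of_occurs {k : CKind} {l u : ℕ} (h : (DVar.C k l u : DVar n).Occurs d) :
    l ≤ d ∧ u ≤ d := by
  have hw : InWindow n d l u → l ≤ d ∧ u ≤ d := fun h => ⟨h.2.1.trans h.2.2.1, h.2.2.1⟩
  cases k with
  | st =>
    rcases h with h | ⟨h1, h2, h3⟩
    · exact hw h
    · omega
  | s => exact hw h
  | t => exact hw h

set_option maxHeartbeats 800000 in
/-- Bounds given by a closed set of literals are consistent. -/
theorem RulesClosed.isBounds (h : RulesClosed I oadRules τ) (hf : ¬ τ .fls) (ht : τ .tru)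
    {x y : Fin n → ℕ} (hx : ∀ i, (x i : ℤ) ∈ I.dom i) (hy : ∀ i, (y i : ℤ) ∈ I.dom i)
    (hxy : ∀ i, x i ≤ y i)
    (hv : ∀ i : Fin n, ∀ v ≤ d + 1, (τ (.ge i v) ↔ v ≤ x i) ∧ (τ (.lt i v) ↔ y i < v)) :
    I.IsBounds (lowerOf d τ x) (upperOf d τ y) := by
  classical
  have hbox : ∀ {l u}, InWindow n d l u → ∀ i : Fin n, (Pt.mk l u i).InBox n d :=
    fun {l u} hw i => ⟨by have := hw.2.1; have := hw.2.2.1; simp only; omega,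
      by have := hw.2.2.1; simp only; omega, by have := i.2; simp only; omega⟩
  have hle : ∀ {l u}, InWindow n d l u → l ≤ d ∧ u ≤ d := fun hw =>
    ⟨hw.2.1.trans hw.2.2.1, hw.2.2.1⟩
  -- the variables `a`
  have hRi : ∀ R ∈ intervalRules, R ∈ oadRules := by
    intro R hR
    simp only [oadRules, List.mem_append]
    tauto
  have hGi : ∀ {l u}, InWindow n d l u → ∀ i : Fin n,
      Cond.Holds I (condVar ++ condWindow) ⟨l, u, i⟩ := fun hw i => by
    rw [Cond.holds_append, Cond.holds_condVar, Cond.holds_condWindow]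
    exact ⟨i.2, hw⟩
  have hone : ∀ {l u}, InWindow n d l u → ∀ i : Fin n, (τ (.one i l u) ↔ l ≤ x i ∧ y i ≤ u) := by
    intro l u hw i
    have hlu := hle hw
    have e1 := (hv i l (by omega)).1
    have e2 := (hv i (u + 1) (by omega)).2
    rw [Nat.lt_succ_iff] at e2
    rw [← e1, ← e2]
    exact ⟨fun hx => ⟨(h.imp (x := .one .j .l .u) (o := .ge .j .l) (inh := .fls)
        (hRi _ (by simp [intervalRules])) (hbox hw i) (hGi hw i)
        hx).resolve_right hf, (h.imp (x := .one .j .l .u) (o := .lt .j (.add .u (.k 1)))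
            (inh := .fls)
        (hRi _ (by simp [intervalRules])) (hbox hw i) (hGi hw i) hx).resolve_right hf⟩,
      fun hx => h.imp₂ hf (x := .ge .j .l) (y := .lt .j (.add .u (.k 1))) (o := .one .j .l .u)
          (hRi _ (by simp [intervalRules])) (hbox hw i)
        (hGi hw i) hx.1 hx.2⟩
  have hzero : ∀ {l u}, InWindow n d l u → ∀ i : Fin n,
      (y i < l → τ (.zero i l u)) ∧ (u < x i → τ (.zero i l u)) ∧
      (τ (.zero i l u) → (l ≤ x i → u < x i) ∧ (y i ≤ u → y i < l)) := by
    intro l u hw i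
    have hlu := hle hw
    have e1 := hv i l (by omega)
    have e2 := hv i (u + 1) (by omega)
    rw [Nat.lt_succ_iff, Nat.succ_le_iff] at e2
    rw [← e1.1, ← e1.2, ← e2.1, ← e2.2]
    exact ⟨fun hx => (h.imp (x := .lt .j .l) (o := .zero .j .l .u) (inh := .fls)
        (hRi _ (by simp [intervalRules])) (hbox hw i)
        (hGi hw i) hx).resolve_right hf,
      fun hx => (h.imp (x := .ge .j (.add .u (.k 1))) (o := .zero .j .l .u) (inh := .fls)
          (hRi _ (by simp [intervalRules])) (hbox hw i)
        (hGi hw i) hx).resolve_right hf,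
      fun hz => ⟨fun hx => h.imp₂ hf (x := .zero .j .l .u) (y := .ge .j .l)
          (o := .ge .j (.add .u (.k 1)))
        (hRi _ (by simp [intervalRules])) (hbox hw i) (hGi hw i) hz hx,
      fun hx => h.imp₂ hf (x := .zero .j .l .u) (y := .lt .j (.add .u (.k 1))) (o := .lt .j .l)
          (hRi _ (by simp [intervalRules])) (hbox hw i)
        (hGi hw i) hz hx⟩⟩
  have hnot : ∀ {l u}, InWindow n d l u → ∀ i : Fin n, τ (.one i l u) → τ (.zero i l u) → False :=
    fun hw i h1 h2 => hf (h.imp₂ hf (x := .one .j .l .u) (y := .zero .j .l .u) (o := .fls)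
        (hRi _ (by simp [intervalRules])) (hbox hw i)
      (hGi hw i) h1 h2)
  -- the counters
  have hconf : ∀ k {l u}, l ≤ d + 1 → u ≤ d + 1 →
      slots n (fun s => τ (.cge k l u s)) + slots n (fun s => τ (.cle k l u s)) ≤ n := by
    intro k l u hl hu
    by_contra hc
    refine hf (h.total hf (s := 1) (l := l) (u := u) (countRules_subset k
      (.total [] (insLower k .l .u ++ insUpper k .l .u) .n .fls) (by simp [countRules]))
      (Or.inl rfl) hl hu (by simp [Cond.Holds]) (le_refl _) ?_)
    rw [insCount_append, insCount_insLower k .l .u τ ⟨l, u, 0⟩ l u (fun _ => rfl) (fun _ => rfl),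
      insCount_insUpper k .l .u τ ⟨l, u, 0⟩ l u (fun _ => rfl) (fun _ => rfl)]
    simp only [NE.eval]
    omega
  have hGw : ∀ {l u}, InWindow n d l u → condWindow.Holds I ⟨l, u, 0⟩ := fun hw =>
    (Cond.holds_condWindow _).2 hw
  have lower_of : ∀ {k l u q}, l ≤ d + 1 → u ≤ d + 1 →
      (∀ s, 1 ≤ s → s ≤ q → τ (.cge k l u (1 + (s - 1)))) →
      q ≤ slots n (fun s => τ (.cge k l u s)) := fun {k l u q} hl hu hs =>
    le_slots (fun s h1 h2 => by have := hs s h1 h2; rwa [Nat.add_sub_cancel' h1] at this)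
      (by have := hconf k hl hu; omega)
  have upper_of : ∀ {k l u q}, l ≤ d + 1 → u ≤ d + 1 →
      (∀ s, 1 ≤ s → s ≤ q → τ (.cle k l u (1 + (s - 1)))) →
      q ≤ slots n (fun s => τ (.cle k l u s)) := fun {k l u q} hl hu hs =>
    le_slots (fun s h1 h2 => by have := hs s h1 h2; rwa [Nat.add_sub_cancel' h1] at this)
      (by have := hconf k hl hu; omega)
  have hcnt : ∀ k {l u}, InWindow n d l u →
      I.numCounted k (fun i => τ (.one i l u)) ≤ slots n (fun s => τ (.cge k l u s)) ∧
      I.numCounted k (fun i => τ (.zero i l u)) + n ≤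
        slots n (fun s => τ (.cle k l u s)) + (I.counted k).card ∧
      (n ≤ I.numCounted k (fun i => τ (.one i l u)) + slots n (fun s => τ (.cle k l u s)) →
        ∀ i ∈ I.counted k, τ (.zero i l u) ∨ τ (.one i l u)) ∧
      ((I.counted k).card ≤ I.numCounted k (fun i => τ (.zero i l u)) +
        slots n (fun s => τ (.cge k l u s)) →
        ∀ i ∈ I.counted k, τ (.one i l u) ∨ τ (.zero i l u)) := by
    intro k l u hw
    have hlu := hle hw
    have hR := countRules_subset k
    have eO := insCount_insOne (I := I) k τ ⟨l, u, 0⟩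
    have eZ := insCount_insZero (I := I) k ht ⟨l, u, 0⟩
    have eL := insCount_insLower (I := I) k .l .u τ ⟨l, u, 0⟩ l u (fun _ => rfl) (fun _ => rfl)
    have eU := insCount_insUpper (I := I) k .l .u τ ⟨l, u, 0⟩ l u (fun _ => rfl) (fun _ => rfl)
    simp only at eO eZ
    have hGk : ∀ i ∈ I.counted k, Cond.Holds I (condKind k ++ condWindow) ⟨l, u, i⟩ :=
      fun i hi => (Cond.holds_append _ _ _).2 ⟨(Cond.holds_condKind _ _).2 ⟨i, rfl, hi⟩,
        (Cond.holds_condWindow _).2 hw⟩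
    refine ⟨lower_of (by omega) (by omega) fun s h1 h2 => ?_, ?_, fun hc i hi => ?_,
      fun hc i hi => ?_⟩
    · refine h.total hf (ins := insOne k) (thr := .k 0) (o := .cge k .l .u (.k 1))
          (hR _ (by simp [countRules])) (Or.inr (Or.inl rfl))
        (by omega) (by omega) (hGw hw) h1 ?_
      simp only [NE.eval]
      omega
    · have := upper_of (k := k) (l := l) (u := u) (q := insCount I (insZero k) τ ⟨l, u, 0⟩)
        (by omega) (by omega) fun s h1 h2 => by
          refine h.total hf (ins := insZero k) (thr := .k 0) (o := .cle k .l .u (.k 1))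
              (hR _ (by simp [countRules]))
            (Or.inr (Or.inl rfl)) (by omega) (by omega) (hGw hw) h1 ?_
          simp only [NE.eval]
          omega
      omega
    · refine h.imp (x := .low k .l .u 0) (o := .zero .j .l .u) (inh := .one .j .l .u)
          (hR _ (by simp [countRules]))
        (hbox hw i) (hGk i hi) ?_
      refine h.total hf (s := 1) (l := l) (u := u) (o := .low k .l .u 0)
        (ins := insOne k ++ insUpper k .l .u ++ insUnit) (thr := .n)
        (hR _ (by simp [countRules])) (Or.inr (Or.inl rfl)) (by omega) (by omega) (hGw hw)
        (le_refl _) ?_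
      rw [insCount_append, insCount_append, insCount_insUnit ht]
      simp only [NE.eval]
      omega
    · refine h.imp (x := .high k .l .u 0) (o := .one .j .l .u) (inh := .zero .j .l .u)
          (hR _ (by simp [countRules]))
        (hbox hw i) (hGk i hi) ?_
      refine h.total hf (s := 1) (l := l) (u := u) (o := .high k .l .u 0)
        (ins := insZero k ++ insLower k .l .u ++ insUnit) (thr := .n)
        (hR _ (by simp [countRules])) (Or.inr (Or.inl rfl)) (by omega) (by omega) (hGw hw)
        (le_refl _) ?_
      rw [insCount_append, insCount_append, insCount_insUnit ht]
      simp only [NE.eval]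
      omega
  have hRp : ∀ R ∈ pyramidRules, R ∈ oadRules := by
    intro R hR
    simp only [oadRules, List.mem_append]
    tauto
  set L : CKind → ℕ → ℕ → ℕ := fun k l u => slots n (fun s => τ (.cge k l u s)) with hL
  set U : CKind → ℕ → ℕ → ℕ := fun k l u => slots n (fun s => τ (.cle k l u s)) with hU
  have eL : ∀ (k : CKind) (e f : NE) (l u l' u' : ℕ), (∀ j, e.eval I ⟨l, u, j⟩ = l') →
      (∀ j, f.eval I ⟨l, u, j⟩ = u') → insCount I (insLower k e f) τ ⟨l, u, 0⟩ = L k l' u' :=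
    fun k e f l u l' u' => insCount_insLower k e f τ ⟨l, u, 0⟩ l' u'
  have eU : ∀ (k : CKind) (e f : NE) (l u l' u' : ℕ), (∀ j, e.eval I ⟨l, u, j⟩ = l') →
      (∀ j, f.eval I ⟨l, u, j⟩ = u') → insCount I (insUpper k e f) τ ⟨l, u, 0⟩ = U k l' u' :=
    fun k e f l u l' u' => insCount_insUpper k e f τ ⟨l, u, 0⟩ l' u'
  have hpyr : ∀ {l u}, InWindow n d l u → l < u →
      L .st 1 l + L .st (l + 1) u ≤ L .st 1 u ∧ U .st 1 l + U .st (l + 1) u ≤ n + U .st 1 u ∧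
      L .st 1 u + U .st (l + 1) u ≤ n + L .st 1 l ∧ U .st 1 u + L .st (l + 1) u ≤ U .st 1 l ∧
      L .st 1 u + U .st 1 l ≤ n + L .st (l + 1) u ∧ U .st 1 u + L .st 1 l ≤ U .st (l + 1) u := by
    intro l u hw hlu
    have hlu' := hle hw
    have hGp : condPyramid.Holds I ⟨l, u, 0⟩ := (Cond.holds_condPyramid _).2 ⟨hw, hlu⟩
    have a1 := eL .st (.k 1) .l l u 1 l (fun _ => rfl) fun _ => rfl
    have a2 := eL .st (.add .l (.k 1)) .u l u (l + 1) u (fun _ => rfl) fun _ => rfl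
    have a3 := eL .st (.k 1) .u l u 1 u (fun _ => rfl) fun _ => rfl
    have b1 := eU .st (.k 1) .l l u 1 l (fun _ => rfl) fun _ => rfl
    have b2 := eU .st (.add .l (.k 1)) .u l u (l + 1) u (fun _ => rfl) fun _ => rfl
    have b3 := eU .st (.k 1) .u l u 1 u (fun _ => rfl) fun _ => rfl
    have key : ∀ {ins : List (Cond × Lit NE)} {thr : NE} {o : Lit NE},
        Rule.total condPyramid ins thr o ∈ pyramidRules → ∀ s, 1 ≤ s →
        s ≤ insCount I ins τ ⟨l, u, 0⟩ - thr.eval I ⟨l, u, 0⟩ →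
        τ ((o.eval I ⟨l, u, 0⟩).shift (s - 1)) := fun hR s h1 h2 =>
      h.total hf (hRp _ hR) (Or.inr (Or.inr rfl)) (by omega) (by omega) hGp h1 (by omega)
    have c1 := lower_of (k := .st) (l := 1) (u := u) (by omega) (by omega)
      (key (ins := insLower .st (.k 1) .l ++ insLower .st (.add .l (.k 1)) .u) (thr := .k 0)
        (o := .cge .st (.k 1) .u (.k 1)) (by simp [pyramidRules]))
    have c2 := upper_of (k := .st) (l := 1) (u := u) (by omega) (by omega)
      (key (ins := insUpper .st (.k 1) .l ++ insUpper .st (.add .l (.k 1)) .u) (thr := .n)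
        (o := .cle .st (.k 1) .u (.k 1)) (by simp [pyramidRules]))
    have c3 := lower_of (k := .st) (l := 1) (u := l) (by omega) (by omega)
      (key (ins := insLower .st (.k 1) .u ++ insUpper .st (.add .l (.k 1)) .u) (thr := .n)
        (o := .cge .st (.k 1) .l (.k 1)) (by simp [pyramidRules]))
    have c4 := upper_of (k := .st) (l := 1) (u := l) (by omega) (by omega)
      (key (ins := insUpper .st (.k 1) .u ++ insLower .st (.add .l (.k 1)) .u) (thr := .k 0)
        (o := .cle .st (.k 1) .l (.k 1)) (by simp [pyramidRules]))
    have c5 := lower_of (k := .st) (l := l + 1) (u := u) (by omega) (by omega)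
      (key (ins := insLower .st (.k 1) .u ++ insUpper .st (.k 1) .l) (thr := .n)
        (o := .cge .st (.add .l (.k 1)) .u (.k 1)) (by simp [pyramidRules]))
    have c6 := upper_of (k := .st) (l := l + 1) (u := u) (by omega) (by omega)
      (key (ins := insUpper .st (.k 1) .u ++ insLower .st (.k 1) .l) (thr := .k 0)
        (o := .cle .st (.add .l (.k 1)) .u (.k 1)) (by simp [pyramidRules]))
    simp only [insCount_append, a1, a2, a3, b1, b2, b3, NE.eval] at c1 c2 c3 c4 c5 c6
    change _ ≤ L .st 1 u at c1
    change _ ≤ U .st 1 u at c2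
    change _ ≤ L .st 1 l at c3
    change _ ≤ U .st 1 l at c4
    change _ ≤ L .st (l + 1) u at c5
    change _ ≤ U .st (l + 1) u at c6
    refine ⟨?_, ?_, ?_, ?_, ?_, ?_⟩ <;> omega
  have hcap : ∀ {k k' : CKind}, capacityRule k k' ∈ oadRules → ∀ {l u}, InWindow n d l u →
      L k l u + (n + l) ≤ U k' l u + (u + 1) := by
    intro k k' hR l u hw
    have hlu := hle hw
    have := hw.2.2.2
    have c := upper_of (k := k') (l := l) (u := u)
      (q := insCount I (insLower k .l .u ++ insSlack) τ ⟨l, u, 0⟩) (by omega) (by omega)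
      fun s h1 h2 => h.total hf (ins := insLower k .l .u ++ insSlack) (thr := .k 0)
        (o := .cle k' .l .u (.k 1)) hR (Or.inr (Or.inl rfl)) (by omega) (by omega) (hGw hw) h1
        (by simp only [NE.eval]; omega)
    rw [insCount_append, insCount_insSlack ht _ hw,
      eL k .l .u l u l u (fun _ => rfl) fun _ => rfl] at c
    simp only at c
    change _ ≤ U k' l u at c
    omega
  have hLU : ∀ k {l u}, (DVar.C k l u : DVar n).Occurs d → L k l u + U k l u ≤ n :=
    fun k l u ho => hconf k (by have := le_of_occurs ho; omega) (by have := le_of_occurs ho; omega)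
  have loC : ∀ k {l u}, (DVar.C k l u : DVar n).Occurs d →
      lowerOf d τ x (.C k l u) = L k l u := fun k l u ho => if_pos ho
  have hiC : ∀ k {l u}, (DVar.C k l u : DVar n).Occurs d →
      upperOf d τ y (.C k l u) = n - U k l u := fun k l u ho => if_pos ho
  have loA : ∀ (i : Fin n) {l u}, InWindow n d l u →
      lowerOf d τ x (.a i l u) = if τ (.one i l u) then 1 else 0 := fun i l u hw => by
    simp [lowerOf, hw]
  have hiA : ∀ (i : Fin n) {l u}, InWindow n d l u →
      upperOf d τ y (.a i l u) = if τ (.zero i l u) then 0 else 1 := fun i l u hw => by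
    simp [upperOf, hw]
  have loB : ∀ (i : Fin n) {l}, l ≤ d →
      lowerOf d τ x (.b i l) = if y i ≤ l then 1 else 0 := fun i l hl => by
    simp only [lowerOf, hl, true_and, (hv i (l + 1) (by omega)).2, Nat.lt_succ_iff]
  have hiB : ∀ (i : Fin n) {l}, l ≤ d →
      upperOf d τ y (.b i l) = if l < x i then 0 else 1 := fun i l hl => by
    simp only [upperOf, hl, true_and, (hv i (l + 1) (by omega)).1, Nat.succ_le_iff]
  refine ⟨⟨fun i l hl => ?_, fun i l u hw => ?_, fun k l u hw => ?_, fun l u hw hlu => ?_,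
    fun k hk l u hw => ?_⟩, fun v => ?_, fun v => ?_, fun v => ?_⟩
  · rw [loB i hl, hiB i hl]
    simp only [lowerOf, upperOf]
    constructor <;> split_ifs <;> omega
  · have h1 := hone hw i
    have h2 := hzero hw i
    rw [loA i hw, hiA i hw]
    simp only [lowerOf, upperOf, Nat.cast_le, Nat.cast_lt]
    refine ⟨by split_ifs <;> simp_all, ?_, ?_⟩
    · split_ifs with hz
      · exact fun _ => h2.2.2 hz
      · intro h; omega
    · split_ifs with hz
      · simp
      · exact ⟨fun h => absurd (h2.1 h) hz, fun h => absurd (h2.2.1 h) hz⟩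
  · obtain ⟨h1, h2, h3, h4⟩ := hcnt k hw
    have e1 : ∑ i ∈ I.counted k, lowerOf d τ x (.a i l u) =
        (I.numCounted k fun i => τ (.one i l u) : ℕ) := by
      rw [OADInstance.numCounted, Finset.natCast_card_filter]
      exact Finset.sum_congr rfl fun i _ => loA i hw
    have e2 : ∑ i ∈ I.counted k, upperOf d τ y (.a i l u) +
        (I.numCounted k fun i => τ (.zero i l u) : ℕ) = (I.counted k).card := by
      rw [OADInstance.numCounted, Finset.natCast_card_filter, ← Finset.sum_add_distrib,
        Finset.cast_card]
      refine Finset.sum_congr rfl fun i _ => ?_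
      rw [hiA i hw]
      split_ifs <;> rfl
    have e3 : ∀ i ∈ I.counted k, τ (.zero i l u) ∨ τ (.one i l u) →
        upperOf d τ y (.a i l u) = lowerOf d τ x (.a i l u) := fun i _ hi => by
      have := hnot hw i
      rw [loA i hw, hiA i hw]
      split_ifs <;> simp_all
    have ho := occurs_of_inWindow (n := n) k hw
    rw [e1, loC k ho, hiC k ho]
    change _ ≤ L k l u at h1
    change _ ≤ U k l u + _ at h2
    refine ⟨by omega, by omega, fun hc i hi => e3 i hi (h3 ?_ i hi),
      fun hc i hi => e3 i hi (h4 ?_ i hi).symm⟩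
    · change _ ≤ _ + U k l u
      omega
    · change _ ≤ _ + L k l u
      omega
  · obtain ⟨h1, h2, h3, h4, h5, h6⟩ := hpyr hw hlu
    obtain ⟨w1, w2, w3, w4⟩ := hw
    have o1 : (DVar.C .st 1 l : DVar n).Occurs d := Or.inr ⟨rfl, w1, by omega⟩
    have o2 : (DVar.C .st 1 u : DVar n).Occurs d := Or.inr ⟨rfl, by omega, w3⟩
    have o3 : (DVar.C .st (l + 1) u : DVar n).Occurs d := Or.inl ⟨by omega, hlu, w3, by omega⟩
    rw [loC _ o1, loC _ o2, loC _ o3, hiC _ o1, hiC _ o2, hiC _ o3]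
    refine ⟨?_, ?_, ?_, ?_, ?_, ?_⟩ <;> omega
  · have o1 := occurs_of_inWindow (n := n) .st hw
    have o2 := occurs_of_inWindow (n := n) k hw
    rw [loC _ o1, loC _ o2, hiC _ o1, hiC _ o2]
    have c1 : L .st l u + (n + l) ≤ U k l u + (u + 1) := hcap
      (by cases k with
        | st => exact absurd rfl hk
        | s => simp [oadRules]
        | t => simp [oadRules]) hw
    have c2 : L k l u + (n + l) ≤ U .st l u + (u + 1) := hcap
      (by cases k with
        | st => exact absurd rfl hk
        | s => simp [oadRules]
        | t => simp [oadRules]) hw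
    constructor <;> omega
  · cases v with
    | X i => exact hx i
    | b i l => simp only [lowerOf, OADInstance.initDom]; split_ifs <;> simp
    | a i l u => simp only [lowerOf, OADInstance.initDom]; split_ifs <;> simp
    | C k l u =>
      by_cases ho : (DVar.C k l u : DVar n).Occurs d
      · have := hLU k ho
        rw [loC k ho]
        exact ⟨by omega, by omega⟩
      · simp [lowerOf, OADInstance.initDom, ho]
  · cases v with
    | X i => exact hy i
    | b i l => simp only [upperOf, OADInstance.initDom]; split_ifs <;> simp
    | a i l u => simp only [upperOf, OADInstance.initDom]; split_ifs <;> simp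
    | C k l u =>
      by_cases ho : (DVar.C k l u : DVar n).Occurs d
      · have := hLU k ho
        rw [hiC k ho]
        exact ⟨by omega, by omega⟩
      · simp [upperOf, OADInstance.initDom, ho]
  · cases v with
    | X i => exact Nat.cast_le.2 (hxy i)
    | b i l =>
      by_cases hl : l ≤ d
      · rw [loB i hl, hiB i hl]
        have := hxy i
        split_ifs <;> omega
      · simp [lowerOf, upperOf, hl]
    | a i l u =>
      by_cases hw : InWindow n d l u
      · have := hnot hw i
        rw [loA i hw, hiA i hw]
        split_ifs <;> simp_all
      · simp [lowerOf, upperOf, hw]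
    | C k l u =>
      by_cases ho : (DVar.C k l u : DVar n).Occurs d
      · have := hLU k ho
        rw [loC k ho, hiC k ho]
        omega
      · simp [lowerOf, upperOf, ho]

end

/-! ## The result of the propagation -/

section

variable {n d : ℕ} {I : OADInstance n d} {τ : Lit ℕ → Prop}

theorem OADInstance.exists_isBounds_of_not_fails (h : ¬ I.Fails) :
    ∃ lo hi, HasBounds I.closure lo hi ∧ I.IsBounds lo hi := by
  obtain ⟨lo, hi, hb, hc⟩ := exists_cons_of_not_fails h
  exact ⟨lo, hi, hb, hc, fun x => closure_subset x (hb x).1.1,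
    fun x => closure_subset x (hb x).2.1, hb.le⟩

theorem RulesClosed.fails_iff (h : RulesClosed I oadRules τ) (ht : τ .tru)
    (hs : ∀ P, RulesPreserve I oadRules P → ∀ x : Lit ℕ, x.InBox n d → τ x → P x) :
    I.Fails ↔ τ .fls := by
  constructor
  · intro hF
    by_contra hf
    choose x y hx hy hxy hv using h.exists_var_bounds hf ht
    have hB := h.isBounds hf ht hx hy hxy hv
    exact hB.cons.not_fails hB.lo_mem hB.hi_mem hB.le hF
  · intro hf
    by_contra hF
    obtain ⟨lo, hi, -, hB⟩ := I.exists_isBounds_of_not_fails hF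
    exact Lit.not_correct_fls (hs _ hB.rulesPreserve _
      (Lit.inBox_mk (Nat.zero_le _) (Nat.zero_le _) (Nat.zero_le _)) hf)

/-- The literals that are derived determine the domains that enforcing bound consistency
yields. -/
theorem RulesClosed.bounds (h : RulesClosed I oadRules τ) (ht : τ .tru)
    (hs : ∀ P, RulesPreserve I oadRules P → ∀ x : Lit ℕ, x.InBox n d → τ x → P x)
    (hf : ¬ τ .fls) : ∃ x y : Fin n → ℕ, (∀ i, x i ≤ d ∧ y i ≤ d) ∧
      (∀ i : Fin n, ∀ v ≤ d + 1, (τ (.ge i v) ↔ v ≤ x i) ∧ (τ (.lt i v) ↔ y i < v)) ∧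
      ∀ v : DVar n, v.Occurs d → IsLeast (I.closure v) (lowerOf d τ x v) ∧
        IsGreatest (I.closure v) (upperOf d τ y v) := by
  choose x y hx hy hxy hv using h.exists_var_bounds hf ht
  have hB := h.isBounds hf ht hx hy hxy hv
  obtain ⟨lo, hi, hb, hL⟩ := I.exists_isBounds_of_not_fails
    (mt (h.fails_iff ht hs).1 hf)
  have hτ := hs _ hL.rulesPreserve
  have hmem := hB.cons.mem_closure hB.lo_mem hB.hi_mem hB.le
  have hd : ∀ i, x i ≤ d ∧ y i ≤ d := fun i =>
    ⟨by exact_mod_cast (OADInstance.one_le_dom (hx i)).2,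
        by exact_mod_cast (OADInstance.one_le_dom (hy i)).2⟩
  have hbox : ∀ {l u}, InWindow n d l u → ∀ (i : Fin n) (t : ℕ), (Lit.mk t l u i).InBox n d :=
    fun hw i t => Lit.inBox_mk (by have := hw.2.1; have := hw.2.2.1; omega)
      (by have := hw.2.2.1; omega) (by have := i.2; omega)
  have hlo : ∀ v : DVar n, v.Occurs d → lowerOf d τ x v ≤ lo v := by
    intro v ho
    cases v with
    | X i =>
      have := hd i
      exact Lit.correct_ge.1 (hτ _ (Lit.inBox_mk (by omega) (Nat.zero_le _)
        (by have := i.2; omega)) ((hv i (x i) (by omega)).1.2 le_rfl)) i rfl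
    | b i l =>
      have h1 := hL.lo_mem (.b i l)
      have h2 : hi (.X i) ≤ l → lo (.b i l) = 1 := (hL.cons.bool i l ho).1.2
      have ho' : l ≤ d := ho
      simp only [lowerOf]
      split_ifs with hc
      · have := Lit.correct_lt.1 (hτ _ (Lit.inBox_mk (by omega) (Nat.zero_le _)
          (by have := i.2; omega)) hc.2) i rfl
        rw [h2 (by push_cast at this; omega)]
      · rcases h1 with h1 | h1
        · rw [h1]
        · rw [h1]; norm_num
    | a i l u =>
      have h1 := hL.lo_mem (.a i l u)
      simp only [lowerOf]
      split_ifs with hc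
      · exact (Lit.correct_one.1 (hτ _ (hbox hc.1 i 4) hc.2) i rfl).ge
      · rcases h1 with h1 | h1
        · rw [h1]
        · rw [h1]; norm_num
    | C k l u =>
      have := le_of_occurs ho
      simp only [lowerOf, if_pos ho]
      exact hL.slots_cge hτ (by omega) (by omega)
  have hhi : ∀ v : DVar n, v.Occurs d → hi v ≤ upperOf d τ y v := by
    intro v ho
    cases v with
    | X i =>
      have := Lit.correct_lt.1 (hτ _ (Lit.inBox_mk (by have := hd i; omega)
        (Nat.zero_le _) (by have := i.2; omega))
        ((hv i (y i + 1) (by have := hd i; omega)).2.2 (Nat.lt_succ_self _))) i rfl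
      push_cast at this
      exact Int.lt_add_one_iff.1 this
    | b i l =>
      have h1 := hL.hi_mem (.b i l)
      have h2 : (l : ℤ) < lo (.X i) → hi (.b i l) = 0 := (hL.cons.bool i l ho).2.2
      have ho' : l ≤ d := ho
      simp only [upperOf]
      split_ifs with hc
      · have := Lit.correct_ge.1 (hτ _ (Lit.inBox_mk (by omega) (Nat.zero_le _)
          (by have := i.2; omega)) hc.2) i rfl
        rw [h2 (by push_cast at this; omega)]
      · rcases h1 with h1 | h1
        · rw [h1]; norm_num
        · rw [h1]
    | a i l u =>
      have h1 := hL.hi_mem (.a i l u)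
      simp only [upperOf]
      split_ifs with hc
      · exact (Lit.correct_zero.1 (hτ _ (hbox hc.1 i 5) hc.2) i rfl).le
      · rcases h1 with h1 | h1
        · rw [h1]; norm_num
        · rw [h1]
    | C k l u =>
      have := le_of_occurs ho
      have := hL.slots_cle hτ (k := k) (l := l) (u := u) (by omega) (by omega)
      simp only [upperOf, if_pos ho]
      omega
  refine ⟨x, y, hd, hv, fun v ho => ⟨⟨(hmem v).1, ?_⟩, ⟨(hmem v).2, ?_⟩⟩⟩
  · exact fun w hw => (hlo v ho).trans ((hb v).1.2 hw)
  · exact fun w hw => ((hb v).2.2 hw).trans (hhi v ho)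

end

/-! ## Writing the result -/

/-- The truth value of a literal. -/
def Lit.truth (x : Lit NE) : RExpr := .read 26 x.toR

/-- The number of true inputs of the rule with index `r`. -/
def gateCount (r : ℕ) : RExpr := .read 23 (Lit.mk r .l .u 0).toR

/-- The program expressions for conditions. -/
def Cond.toProg (gs : Cond) : List (RExpr × RExpr) := gs.map fun g => (g.1.toR, g.2.toR)

theorem RExpr.eval_sub (m : RState) (e f : RExpr) : (RExpr.sub e f).eval m = e.eval m - f.eval m :=
  rfl

theorem RExpr.eval_const (m : RState) (k : ℤ) : (RExpr.const k).eval m = k := rfl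

/-- The conditions for writing to an output array. -/
def outGuards : ℕ → List (RExpr × RExpr)
  | 3 => Cond.toProg (condVar ++ [(.l, .d)]) ++
    [(.const 1, (Lit.ge .j .l).truth), ((Lit.ge .j (.add .l (.k 1))).truth, .const 0)]
  | 4 => Cond.toProg (condVar ++ [(.l, .d)]) ++
    [(.const 1, (Lit.lt .j (.add .l (.k 1))).truth), ((Lit.lt .j .l).truth, .const 0)]
  | 5 => Cond.toProg (condVar ++ [(.l, .d)])
  | 6 => Cond.toProg (condVar ++ [(.l, .d)])
  | 7 => Cond.toProg (condVar ++ condWindow)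
  | 8 => Cond.toProg (condVar ++ condWindow)
  | _ => Cond.toProg [(.l, .d), (.u, .d), (.j, .k 0)]

/-- The index at which to write in an output array. -/
def outIdx : ℕ → RExpr
  | 3 => .reg 12
  | 4 => .reg 12
  | 5 => .add (.mul (.reg 12) (.add (.reg 1) (.const 1))) (.reg 10)
  | 6 => .add (.mul (.reg 12) (.add (.reg 1) (.const 1))) (.reg 10)
  | 7 => .add (.mul (.add (.mul (.reg 12) (.add (.reg 1) (.const 1))) (.reg 10))
    (.add (.reg 1) (.const 1))) (.reg 11)
  | 8 => .add (.mul (.add (.mul (.reg 12) (.add (.reg 1) (.const 1))) (.reg 10))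
    (.add (.reg 1) (.const 1))) (.reg 11)
  | _ => .add (.mul (.reg 10) (.add (.reg 1) (.const 1))) (.reg 11)

/-- The value to write in an output array. -/
def outVal : ℕ → RExpr
  | 3 => .reg 10
  | 4 => .reg 10
  | 5 => (Lit.lt .j (.add .l (.k 1))).truth
  | 6 => .sub (.const 1) (Lit.ge .j (.add .l (.k 1))).truth
  | 7 => (Lit.one .j .l .u).truth
  | 8 => .sub (.const 1) (Lit.zero .j .l .u).truth
  | 9 => gateCount 0
  | 10 => .sub (.reg 0) (gateCount 1)
  | 11 => gateCount 2
  | 12 => .sub (.reg 0) (gateCount 3)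
  | 13 => gateCount 4
  | _ => .sub (.reg 0) (gateCount 5)

/-- The operations that write the result. -/
def outItems : List Item :=
  ((List.range 12).map (· + 3)).map fun A => ⟨outGuards A, .put A (outIdx A) (outVal A)⟩

theorem outItems_ok : itemsOk [0, 1, 2] [0, 1, 2, 23, 26] outItems = true := by
  decide +kernel

section

variable {n d : ℕ} {I : OADInstance n d} {m : RState}

theorem put_of_mem_outItems : ∀ o ∈ boxOps m n d outItems, ∃ A j v, o = .put A j v := by
  intro o ho
  obtain ⟨p, -, i, hi, -, rfl⟩ := mem_boxOps.1 ho
  obtain ⟨A, -, rfl⟩ := List.mem_map.1 hi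
  exact ⟨_, _, _, rfl⟩

theorem outItems_mem {A : ℕ} (hA : 3 ≤ A ∧ A ≤ 14) (f : Pt → ℕ)
    (hf : ∀ p : Pt, (outIdx A).eval (m.withCounters p.l p.u p.j) = f p) {v : ℤ} {p₀ : Pt}
    (hp₀ : p₀.InBox n d) (hg₀ : guardsHold (m.withCounters p₀.l p₀.u p₀.j) (outGuards A))
    (hv : ∀ p : Pt, guardsHold (m.withCounters p.l p.u p.j) (outGuards A) → f p = f p₀ →
      (outVal A).eval (m.withCounters p.l p.u p.j) = v) :
    (runOps m (boxOps m n d outItems)).mem A (f p₀) = v := by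
  refine put_runOps_eq _ put_of_mem_outItems (mem_boxOps.2 ⟨p₀, hp₀, _,
    List.mem_map.2 ⟨A, List.mem_map.2 ⟨A - 3, List.mem_range.2 (by omega), by omega⟩, rfl⟩, hg₀,
    ?_⟩) fun v' hv' => ?_
  · simp only [Op.eval, hf, Int.toNat_natCast, hv p₀ hg₀ rfl]
  · obtain ⟨p, hp, i, hi, hg, ho⟩ := mem_boxOps.1 hv'
    obtain ⟨B, -, rfl⟩ := List.mem_map.1 hi
    simp only [Op.eval, EOp.put.injEq] at ho
    obtain ⟨rfl, h2, rfl⟩ := ho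
    rw [hf, Int.toNat_natCast] at h2
    exact hv p hg h2.symm

theorem runOps_outItems_reg (r : ℕ) :
    (runOps m (boxOps m n d outItems)).reg r = m.reg r := by
  have key : ∀ (os : List EOp) (m : RState), (∀ o ∈ os, ∃ A j v, o = .put A j v) →
      (runOps m os).reg r = m.reg r := by
    intro os
    induction os with
    | nil => exact fun _ _ => rfl
    | cons o os ih =>
      intro m h
      obtain ⟨A, j, v, rfl⟩ := h o (by simp)
      exact ih _ fun o ho => h o (List.mem_cons_of_mem _ ho)
  exact key _ m put_of_mem_outItems

/-- The output arrays hold the bounds given by the literals. -/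
theorem outItems_correct (hm : m.IsEnv I) {τ : Lit ℕ → Prop}
    (htr : ∀ x : Lit ℕ, (τ x → m.mem 26 (x.code n d) = 1) ∧ (¬ τ x → m.mem 26 (x.code n d) = 0))
    (hcnt : ∀ (r : ℕ) (ins : List (Cond × Lit NE)) (o : Lit NE),
      oadRules[r]? = some (.total [] ins (.k 0) o) → ∀ l ≤ d, ∀ u ≤ d,
      m.mem 23 ((Lit.mk r l u 0).code n d) = insCount I ins τ ⟨l, u, 0⟩)
    {x y : Fin n → ℕ} (hxy : ∀ i, x i ≤ d ∧ y i ≤ d)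
    (hv : ∀ i : Fin n, ∀ v ≤ d + 1, (τ (.ge i v) ↔ v ≤ x i) ∧ (τ (.lt i v) ↔ y i < v))
    (z : DVar n) (hz : z.Occurs d) :
    (runOps m (boxOps m n d outItems)).mem z.outArray (z.outIndex d) = lowerOf d τ x z ∧
    (runOps m (boxOps m n d outItems)).mem (z.outArray + 1) (z.outIndex d) = upperOf d τ y z := by
  classical
  have r0 : ∀ p : Pt, (m.withCounters p.l p.u p.j).reg 0 = n := fun p => by
    simpa [RState.withCounters, RState.setReg] using hm.zero
  have r1 : ∀ p : Pt, (m.withCounters p.l p.u p.j).reg 1 = d := fun p => by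
    simpa [RState.withCounters, RState.setReg] using hm.one
  have r10 : ∀ p : Pt, (m.withCounters p.l p.u p.j).reg 10 = p.l := fun p => by
    simp [RState.withCounters, RState.setReg]
  have r11 : ∀ p : Pt, (m.withCounters p.l p.u p.j).reg 11 = p.u := fun p => by
    simp [RState.withCounters, RState.setReg]
  have r12 : ∀ p : Pt, (m.withCounters p.l p.u p.j).reg 12 = p.j := fun p => by
    simp [RState.withCounters, RState.setReg]
  have hT : ∀ (X : Lit NE) (p : Pt), X.truth.eval (m.withCounters p.l p.u p.j) =
      if τ (X.eval I p) then 1 else 0 := fun X p => by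
    have : X.truth.eval (m.withCounters p.l p.u p.j) = m.mem 26 ((X.eval I p).code n d) := by
      simp only [Lit.truth, RExpr.eval, Lit.eval_toR hm, Int.toNat_natCast]
      rfl
    rw [this]
    split_ifs with h
    exacts [(htr _).1 h, (htr _).2 h]
  have hcond : ∀ (p : Pt) (gs : Cond), guardsHold (m.withCounters p.l p.u p.j) gs.toProg ↔
      gs.Holds I p := guardsHold_map hm
  have happ : ∀ (m : RState) (gs gs' : List (RExpr × RExpr)), guardsHold m (gs ++ gs') ↔
      guardsHold m gs ∧ guardsHold m gs' := fun m gs gs' => List.forall_mem_append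
  have hvar : ∀ p : Pt, guardsHold (m.withCounters p.l p.u p.j)
      (Cond.toProg (condVar ++ [(.l, .d)])) ↔
      p.j < n ∧ p.l ≤ d := fun p => by
    rw [hcond, Cond.holds_append, Cond.holds_condVar]
    simp [Cond.Holds, NE.eval]
  have hwin : ∀ p : Pt, guardsHold (m.withCounters p.l p.u p.j)
      (Cond.toProg (condVar ++ condWindow)) ↔
      p.j < n ∧ InWindow n d p.l p.u := fun p => by
    rw [hcond, Cond.holds_append, Cond.holds_condVar, Cond.holds_condWindow]
  have hsq : ∀ p : Pt, guardsHold (m.withCounters p.l p.u p.j)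
      (Cond.toProg [(.l, .d), (.u, .d), (.j, .k 0)]) ↔ p.l ≤ d ∧ p.u ≤ d ∧ p.j = 0 := fun p => by
    rw [hcond]
    simp [Cond.Holds, NE.eval]
  have hge : ∀ p : Pt, p.j < n → p.l ≤ d → ∀ i : Fin n, p.j = i →
      ((τ ((Lit.ge .j .l : Lit NE).eval I p) ↔ p.l ≤ x i) ∧
      (τ ((Lit.ge .j (.add .l (.k 1)) : Lit NE).eval I p) ↔ p.l < x i)) := fun p hj hl i hi => by
    have e1 : (Lit.ge .j .l : Lit NE).eval I p = Lit.ge (i : ℕ) p.l := by rw [← hi]; rfl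
    have e2 : (Lit.ge .j (.add .l (.k 1)) : Lit NE).eval I p = Lit.ge (i : ℕ) (p.l + 1) := by
      rw [← hi]; rfl
    rw [e1, e2, (hv i p.l (by omega)).1, (hv i (p.l + 1) (by omega)).1]
    exact ⟨Iff.rfl, Iff.rfl⟩
  have hlt : ∀ p : Pt, p.j < n → p.l ≤ d → ∀ i : Fin n, p.j = i →
      ((τ ((Lit.lt .j .l : Lit NE).eval I p) ↔ y i < p.l) ∧
      (τ ((Lit.lt .j (.add .l (.k 1)) : Lit NE).eval I p) ↔ y i ≤ p.l)) := fun p hj hl i hi => by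
    have e1 : (Lit.lt .j .l : Lit NE).eval I p = Lit.lt (i : ℕ) p.l := by rw [← hi]; rfl
    have e2 : (Lit.lt .j (.add .l (.k 1)) : Lit NE).eval I p = Lit.lt (i : ℕ) (p.l + 1) := by
      rw [← hi]; rfl
    rw [e1, e2, (hv i p.l (by omega)).2, (hv i (p.l + 1) (by omega)).2]
    exact ⟨Iff.rfl, Nat.lt_succ_iff⟩
  cases z with
  | X i =>
    have g3 : ∀ p : Pt, guardsHold (m.withCounters p.l p.u p.j) (outGuards 3) ↔
        (p.j < n ∧ p.l ≤ d) ∧ τ ((Lit.ge .j .l : Lit NE).eval I p) ∧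
        ¬ τ ((Lit.ge .j (.add .l (.k 1)) : Lit NE).eval I p) := fun p => by
      rw [outGuards, happ, hvar]
      refine and_congr_right fun _ => ?_
      simp only [guardsHold, List.forall_mem_cons, List.not_mem_nil, false_implies, implies_true,
        and_true, hT, RExpr.eval_const]
      split_ifs <;> simp_all
    have g4 : ∀ p : Pt, guardsHold (m.withCounters p.l p.u p.j) (outGuards 4) ↔
        (p.j < n ∧ p.l ≤ d) ∧ τ ((Lit.lt .j (.add .l (.k 1)) : Lit NE).eval I p) ∧
        ¬ τ ((Lit.lt .j .l : Lit NE).eval I p) := fun p => by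
      rw [outGuards, happ, hvar]
      refine and_congr_right fun _ => ?_
      simp only [guardsHold, List.forall_mem_cons, List.not_mem_nil, false_implies, implies_true,
        and_true, hT, RExpr.eval_const]
      split_ifs <;> simp_all
    have hd := hxy i
    constructor
    · refine outItems_mem (A := 3) (by norm_num) (fun p => p.j) r12 (p₀ := ⟨x i, 0, i⟩)
        ⟨by simp only; omega, Nat.zero_le _, by have := i.2; simp only; omega⟩ ((g3 _).2 ?_)
        fun p hp hpi => ?_
      · obtain ⟨h1, h2⟩ := hge ⟨x i, 0, i⟩ i.2 hd.1 i rfl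
        rw [h1, h2]
        exact ⟨⟨i.2, hd.1⟩, le_rfl, lt_irrefl _⟩
      · obtain ⟨⟨hj, hl⟩, h1, h2⟩ := (g3 p).1 hp
        obtain ⟨e1, e2⟩ := hge p hj hl i hpi
        rw [e1] at h1
        rw [e2] at h2
        exact (r10 p).trans (by rw [lowerOf]; omega)
    · refine outItems_mem (A := 4) (by norm_num) (fun p => p.j) r12 (p₀ := ⟨y i, 0, i⟩)
        ⟨by simp only; omega, Nat.zero_le _, by have := i.2; simp only; omega⟩ ((g4 _).2 ?_)
        fun p hp hpi => ?_
      · obtain ⟨h1, h2⟩ := hlt ⟨y i, 0, i⟩ i.2 hd.2 i rfl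
        rw [h1, h2]
        exact ⟨⟨i.2, hd.2⟩, le_rfl, lt_irrefl _⟩
      · obtain ⟨⟨hj, hl⟩, h1, h2⟩ := (g4 p).1 hp
        obtain ⟨e1, e2⟩ := hlt p hj hl i hpi
        rw [e1] at h2
        rw [e2] at h1
        exact (r10 p).trans (by rw [upperOf]; omega)
  | b i l =>
    have hl : l ≤ d := hz
    have hidx : ∀ p : Pt, (outIdx 5).eval (m.withCounters p.l p.u p.j) =
        ((fun p : Pt => p.j * (d + 1) + p.l) p : ℕ) := fun p => by
      simp only [outIdx, RExpr.eval, r1, r10, r12]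
      push_cast
      rfl
    have hbox : (Pt.mk l 0 i).InBox n d :=
      ⟨by simp only; omega, Nat.zero_le _, by have := i.2; simp only; omega⟩
    have hdec : ∀ p : Pt, p.j < n ∧ p.l ≤ d → p.j * (d + 1) + p.l = i * (d + 1) + l →
        p.j = i ∧ p.l = l := fun p hp h => add_mul_inj (by omega) (by omega) h
    constructor
    · refine outItems_mem (A := 5) (by norm_num) (fun p => p.j * (d + 1) + p.l) hidx
        (p₀ := ⟨l, 0, i⟩) hbox ((hvar _).2 ⟨i.2, hl⟩) fun p hp hpi => ?_
      obtain ⟨h1, h2⟩ := hdec p ((hvar p).1 hp) hpi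
      refine (hT _ p).trans ?_
      have : (Lit.lt .j (.add .l (.k 1)) : Lit NE).eval I p = Lit.lt (i : ℕ) (l + 1) := by
        rw [← h1, ← h2]; rfl
      simp only [this, lowerOf, hl, true_and]
    · refine outItems_mem (A := 6) (by norm_num) (fun p => p.j * (d + 1) + p.l) hidx
        (p₀ := ⟨l, 0, i⟩) hbox ((hvar _).2 ⟨i.2, hl⟩) fun p hp hpi => ?_
      obtain ⟨h1, h2⟩ := hdec p ((hvar p).1 hp) hpi
      have : (Lit.ge .j (.add .l (.k 1)) : Lit NE).eval I p = Lit.ge (i : ℕ) (l + 1) := by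
        rw [← h1, ← h2]; rfl
      simp only [outVal, RExpr.eval_sub, hT, this, upperOf, hl, true_and]
      split_ifs <;> rfl
  | a i l u =>
    have hw : InWindow n d l u := hz
    have hu := hw.2.2.1
    have hl := hw.2.1.trans hu
    have hidx : ∀ p : Pt, (outIdx 7).eval (m.withCounters p.l p.u p.j) =
        ((fun p : Pt => (p.j * (d + 1) + p.l) * (d + 1) + p.u) p : ℕ) := fun p => by
      simp only [outIdx, RExpr.eval, r1, r10, r11, r12]
      push_cast
      rfl
    have hbox : (Pt.mk l u i).InBox n d :=
      ⟨by simp only; omega, by simp only; omega, by have := i.2; simp only; omega⟩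
    have hdec : ∀ p : Pt, p.j < n ∧ InWindow n d p.l p.u →
        (p.j * (d + 1) + p.l) * (d + 1) + p.u = (i * (d + 1) + l) * (d + 1) + u →
        p.j = i ∧ p.l = l ∧ p.u = u := fun p hp h => by
      have h1 := hp.2.2.2.1
      have h2 := hp.2.2.1
      obtain ⟨k1, k2⟩ := add_mul_inj (by omega) (by omega) h
      obtain ⟨k3, k4⟩ := add_mul_inj (by omega) (by omega) k1
      exact ⟨k3, k4, k2⟩
    constructor
    · refine outItems_mem (A := 7) (by norm_num) (fun p => (p.j * (d + 1) + p.l) * (d + 1) + p.u)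
        hidx (p₀ := ⟨l, u, i⟩) hbox ((hwin _).2 ⟨i.2, hw⟩) fun p hp hpi => ?_
      obtain ⟨h1, h2, h3⟩ := hdec p ((hwin p).1 hp) hpi
      refine (hT _ p).trans ?_
      have : (Lit.one .j .l .u : Lit NE).eval I p = Lit.one (i : ℕ) l u := by
        rw [← h1, ← h2, ← h3]; rfl
      simp only [this, lowerOf, hw, true_and]
    · refine outItems_mem (A := 8) (by norm_num) (fun p => (p.j * (d + 1) + p.l) * (d + 1) + p.u)
        hidx (p₀ := ⟨l, u, i⟩) hbox ((hwin _).2 ⟨i.2, hw⟩) fun p hp hpi => ?_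
      obtain ⟨h1, h2, h3⟩ := hdec p ((hwin p).1 hp) hpi
      have : (Lit.zero .j .l .u : Lit NE).eval I p = Lit.zero (i : ℕ) l u := by
        rw [← h1, ← h2, ← h3]; rfl
      simp only [outVal, RExpr.eval_sub, hT, this, upperOf, hw, true_and]
      split_ifs <;> rfl
  | C k l u =>
    obtain ⟨hl, hu⟩ := le_of_occurs hz
    have hidx : ∀ A, 9 ≤ A → ∀ p : Pt, (outIdx A).eval (m.withCounters p.l p.u p.j) =
        ((fun p : Pt => p.l * (d + 1) + p.u) p : ℕ) := fun A hA p => by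
      have : outIdx A = .add (.mul (.reg 10) (.add (.reg 1) (.const 1))) (.reg 11) := by
        unfold outIdx
        split <;> first | omega | rfl
      simp only [this, RExpr.eval, r1, r10, r11]
      push_cast
      rfl
    have hgu : ∀ A, 9 ≤ A → ∀ p : Pt, guardsHold (m.withCounters p.l p.u p.j) (outGuards A) ↔
        p.l ≤ d ∧ p.u ≤ d ∧ p.j = 0 := fun A hA p => by
      have : outGuards A = Cond.toProg [(.l, .d), (.u, .d), (.j, .k 0)] := by
        unfold outGuards
        split <;> first | omega | rfl
      rw [this, hsq]
    have hbox : (Pt.mk l u 0).InBox n d :=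
      ⟨by simp only; omega, by simp only; omega, Nat.zero_le _⟩
    have hG : ∀ (r : ℕ) (p : Pt), (gateCount r).eval (m.withCounters p.l p.u p.j) =
        m.mem 23 ((Lit.mk r p.l p.u 0).code n d) := fun r p => by
      simp only [gateCount, RExpr.eval, Lit.eval_toR hm, Int.toNat_natCast]
      rfl
    have key : ∀ A, 9 ≤ A → A ≤ 14 → ∀ v : ℤ,
        (outVal A).eval (m.withCounters l u 0) = v →
        (runOps m (boxOps m n d outItems)).mem A (l * (d + 1) + u) = v := fun A hA hA' v hv => by
      refine outItems_mem (A := A) ⟨by omega, hA'⟩ (fun p => p.l * (d + 1) + p.u) (hidx A hA)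
        (p₀ := ⟨l, u, 0⟩) hbox ((hgu A hA _).2 ⟨hl, hu, rfl⟩) fun p hp hpi => ?_
      obtain ⟨h1, h2, h3⟩ := (hgu A hA p).1 hp
      obtain ⟨rfl, rfl⟩ := add_mul_inj (q := p.u) (s := u) (by omega) (by omega) hpi
      rw [h3]
      exact hv
    have hlow : ∀ (r : ℕ) (o : Lit NE), oadRules[r]? =
        some (.total [] (insLower k .l .u) (.k 0) o) →
        (gateCount r).eval (m.withCounters l u 0) = lowerOf d τ x (.C k l u) := fun r o h => by
      rw [hG r ⟨l, u, 0⟩, hcnt r _ o h l hl u hu, lowerOf, if_pos hz]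
      exact congrArg _ (insCount_insLower k .l .u τ ⟨l, u, 0⟩ l u (fun _ => rfl) fun _ => rfl)
    have hupp : ∀ (r : ℕ) (o : Lit NE), oadRules[r]? =
        some (.total [] (insUpper k .l .u) (.k 0) o) →
        (RExpr.sub (.reg 0) (gateCount r)).eval (m.withCounters l u 0) = upperOf d τ y (.C k l u) :=
      fun r o h => by
      rw [RExpr.eval_sub, hG r ⟨l, u, 0⟩, hcnt r _ o h l hl u hu, upperOf, if_pos hz]
      refine congrArg₂ _ (r0 ⟨l, u, 0⟩) (congrArg _ ?_)
      exact insCount_insUpper k .l .u τ ⟨l, u, 0⟩ l u (fun _ => rfl) fun _ => rfl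
    cases k with
    | st =>
      exact ⟨key 9 (by norm_num) (by norm_num) _ (hlow 0 _ rfl),
        key 10 (by norm_num) (by norm_num) _ (hupp 1 _ rfl)⟩
    | s =>
      exact ⟨key 11 (by norm_num) (by norm_num) _ (hlow 2 _ rfl),
        key 12 (by norm_num) (by norm_num) _ (hupp 3 _ rfl)⟩
    | t =>
      exact ⟨key 13 (by norm_num) (by norm_num) _ (hlow 4 _ rfl),
        key 14 (by norm_num) (by norm_num) _ (hupp 5 _ rfl)⟩

end

/-! ## The program -/

/-- The program that enforces bound consistency. -/
def bcProg : RProg :=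
  .seq (.assign 3 (.add (.reg 1) (.const 3)))
    (.seq (.assign 4 (.add (.mul (.const 6) (.reg 0)) (.const 20)))
      (.seq (.seq (boxProg (netItems oadRules)) engineProg)
        (.seq (.assign 5 (.const 0))
          (.seq (.assign 2 (.read 26 (.mul (.mul (.reg 3) (.reg 3)) (.reg 4))))
            (boxProg outItems)))))

theorem Rule.cnt_total_nil {n d : ℕ} {I : OADInstance n d} (ins : List (Cond × Lit NE)) (thr : NE)
    (o : Lit NE) (τ : Lit ℕ → Prop) (p : Pt) :
    Rule.cnt I (.total [] ins thr o) τ p = insCount I ins τ p := by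
  classical
  have h0 : ∀ p, Cond.Holds I [] p := fun p => by simp [Cond.Holds]
  simp only [cnt, total, if_true, cntAt, insCount]
  refine Finset.sum_congr rfl fun j _ => List.countP_congr fun i _ => ?_
  simp only [h0, true_and, decide_eq_true_eq]

theorem RState.IsEnv.setReg {n d : ℕ} {I : OADInstance n d} {m : RState} (h : m.IsEnv I) {r : ℕ}
    (hr : r ≠ 0 ∧ r ≠ 1 ∧ r ≠ 3 ∧ r ≠ 4) (v : ℤ) : (m.setReg r v).IsEnv I := by
  obtain ⟨h0, h1, h3, h4⟩ := hr
  refine ⟨?_, ?_, ?_, ?_, h.mem⟩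
  · simpa [RState.setReg, h0.symm] using h.zero
  · simpa [RState.setReg, h1.symm] using h.one
  · simpa [RState.setReg, h3.symm] using h.three
  · simpa [RState.setReg, h4.symm] using h.four

theorem RState.IsEnv.bounded {n d : ℕ} {I : OADInstance n d} {m : RState} (h : m.IsEnv I) {M : ℤ}
    (hn : 6 * (n : ℤ) + 20 ≤ M) (hd : (d : ℤ) + 3 ≤ M) {ra : List ℕ}
    (hra : ∀ A ∈ ra, ∀ j, |m.mem A j| ≤ M) {l u j : ℕ} (hl : l ≤ d + 1) (hu : u ≤ d + 1)
    (hj : j ≤ n + 1) : (m.withCounters l u j).Bounded M [0, 1, 2] ra := by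
  refine ⟨fun r hr => ?_, fun A hA i => ?_, hra⟩
  · have e1 := h.zero
    have e2 := h.one
    have e3 := h.three
    have e4 := h.four
    simp only [paramRegs, List.mem_cons, List.not_mem_nil, or_false] at hr
    rcases hr with rfl | rfl | rfl | rfl | rfl | rfl | rfl <;>
      simp [RState.withCounters, RState.setReg, e1, e2, e3, e4] <;> omega
  · have hA' : (m.withCounters l u j).mem A = I.input.mem A := h.mem A (by simp at hA; omega)
    have := I.input_mem_nonneg A i
    rw [hA']
    omega

theorem OADInstance.init_exec {n d : ℕ} (I : OADInstance n d) {W : ℤ} (hn : 6 * (n : ℤ) + 20 ≤ W)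
    (hd : (d : ℤ) + 3 ≤ W) (p : RProg) {t : ℕ} {m' : RState}
    (hp : RExec W p ((I.input.setReg 3 (d + 3 : ℕ)).setReg 4 (6 * n + 20 : ℕ)) t m') :
    RExec W (.seq (.assign 3 (.add (.reg 1) (.const 3)))
      (.seq (.assign 4 (.add (.mul (.const 6) (.reg 0)) (.const 20))) p)) I.input (4 + (6 + t))
          m' := by
  have e0 : I.input.reg 0 = n := by simp [OADInstance.input]
  have e1 : I.input.reg 1 = d := by simp [OADInstance.input]
  have e0' : (I.input.setReg 3 (d + 3 : ℕ)).reg 0 = n := by simpa [RState.setReg] using e0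
  refine .seq _ _ _ _ _ _ _ (RExec.assign_of_eval ⟨trivial, ?_, ?_⟩ ?_)
    (.seq _ _ _ _ _ _ _ (RExec.assign_of_eval ⟨⟨?_, trivial, ?_⟩, ?_, ?_⟩ ?_) hp)
  · simp only [RExpr.Fits]; rw [abs_of_nonneg (by norm_num)]; omega
  · simp only [RExpr.eval, e1]; rw [abs_of_nonneg (by omega)]; omega
  · simp only [RExpr.eval, e1]; push_cast; rfl
  · simp only [RExpr.Fits]; rw [abs_of_nonneg (by norm_num)]; omega
  · simp only [RExpr.eval, e0']; rw [abs_of_nonneg (by omega)]; omega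
  · simp only [RExpr.Fits]; rw [abs_of_nonneg (by norm_num)]; omega
  · simp only [RExpr.eval, e0']; rw [abs_of_nonneg (by omega)]; omega
  · simp only [RExpr.eval, e0']; push_cast; rfl

theorem readFls_exec {n d : ℕ} {I : OADInstance n d} {m : RState} (hm : m.IsEnv I) {M W : ℤ}
    (hM : 1 ≤ M) (hW : M ^ 64 ≤ W) (hn : 6 * (n : ℤ) + 20 ≤ M) (hd : (d : ℤ) + 3 ≤ M) :
    RExec W (.assign 2 (.read 26 (.mul (.mul (.reg 3) (.reg 3)) (.reg 4)))) m 7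
      (m.setReg 2 (m.mem 26 ((Lit.fls : Lit ℕ).code n d))) := by
  have h3 := hm.three
  have h4 := hm.four
  push_cast at h3 h4
  have k2 : ((d : ℤ) + 3) * (d + 3) ≤ M ^ 2 := by nlinarith
  have k3 : ((d : ℤ) + 3) * (d + 3) * (6 * n + 20) ≤ M ^ 3 := by
    rw [pow_succ]
    exact mul_le_mul k2 hn (by omega) (by positivity)
  have p2 : M ^ 2 ≤ M ^ 64 := pow_le_pow_right₀ hM (by norm_num)
  have p3 : M ^ 3 ≤ M ^ 64 := pow_le_pow_right₀ hM (by norm_num)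
  have q2 : (0 : ℤ) ≤ ((d : ℤ) + 3) * (d + 3) := by positivity
  have q3 : (0 : ℤ) ≤ ((d : ℤ) + 3) * (d + 3) * (6 * n + 20) := by positivity
  refine RExec.assign_of_eval ⟨⟨⟨trivial, trivial, ?_⟩, trivial, ?_⟩, ?_⟩ ?_
  · simp only [RExpr.eval, h3]; rw [abs_of_nonneg q2]; omega
  · simp only [RExpr.eval, h3, h4]; rw [abs_of_nonneg q3]; omega
  · simp only [RExpr.eval, h3, h4]; exact q3
  · have : m.reg 3 * m.reg 3 * m.reg 4 = ((Lit.fls : Lit ℕ).code n d : ℤ) := by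
      rw [h3, h4]
      simp only [Lit.code, Lit.fls]
      push_cast
      ring
    simp only [RExpr.eval, this, Int.toNat_natCast]

/-- The program computes the result. -/
theorem bcProg_exec {n d : ℕ} (I : OADInstance n d) {M M' W : ℤ} (hM : 100 ≤ M)
    (hn : 6 * (n : ℤ) + 20 ≤ M) (hd : (d : ℤ) + 3 ≤ M)
    (hM' : M ^ 64 + (((d + 2) * ((d + 2) * ((n + 2) * (netItems oadRules).length)) : ℕ) : ℤ) ≤ M')
    (hW : M' ^ 64 ≤ W) :
    ∃ t ≤ (d + 2) * ((d + 2) * ((n + 2) * (itemsTime (netItems oadRules) + 16) + 16) + 16) +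
        83 * ((d + 2) * ((d + 2) * ((n + 2) * (netItems oadRules).length))) +
        (d + 2) * ((d + 2) * ((n + 2) * (itemsTime outItems + 16) + 16) + 16) + 69,
      ∃ m, RExec W bcProg I.input t m ∧ I.IsResult m := by
  have hlen : (d + 2) * ((d + 2) * ((n + 2) * outItems.length)) ≤
      (d + 2) * ((d + 2) * ((n + 2) * (netItems oadRules).length)) := by
    refine Nat.mul_le_mul_left _ (Nat.mul_le_mul_left _ (Nat.mul_le_mul_left _ ?_))
    decide +kernel
  set Ne := (d + 2) * ((d + 2) * ((n + 2) * (netItems oadRules).length)) with hNe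
  have hM1 : M ≤ M ^ 64 := by
    simpa using pow_le_pow_right₀ (show (1 : ℤ) ≤ M by omega) (show 1 ≤ 64 by norm_num)
  have hM2 : M' ≤ M' ^ 64 := by
    simpa using pow_le_pow_right₀ (show (1 : ℤ) ≤ M' by omega) (show 1 ≤ 64 by norm_num)
  set m₁ := (I.input.setReg 3 (d + 3 : ℕ)).setReg 4 (6 * n + 20 : ℕ) with hm₁
  have henv₁ : m₁.IsEnv I := by
    refine ⟨?_, ?_, ?_, ?_, fun A _ => rfl⟩ <;> simp [hm₁, RState.setReg, OADInstance.input]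
  obtain ⟨t₂, ht₂, m₂, τ, hx₂, henv₂, -, htr, htr01, hgate, hcnt, htru, hcl, hs⟩ :=
    propagation_exec (W := W) hM oadRules_ok oadRules_itemsOk henv₁
      (by simp [hm₁, RState.setReg, OADInstance.input])
      (fun A hA j => by
        have : m₁.mem A j = I.input.mem A j := rfl
        simp only [this, OADInstance.input, show A ≠ 0 by omega, show A ≠ 1 by omega,
          show A ≠ 2 by omega, if_false])
      (by rw [← hNe]; omega) hn hd
  have henv₃ : (m₂.setReg 5 0).IsEnv I := henv₂.setReg (by norm_num) 0
  set v := m₂.mem 26 ((Lit.fls : Lit ℕ).code n d) with hv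
  set m₄ := (m₂.setReg 5 0).setReg 2 v with hm₄
  have henv₄ : m₄.IsEnv I := henv₃.setReg (by norm_num) v
  have hmem₄ : m₄.mem = m₂.mem := rfl
  have hra : ∀ A ∈ [0, 1, 2, 23, 26], ∀ j, |m₄.mem A j| ≤ M' := by
    intro A hA j
    have hin : A ≤ 2 → |m₄.mem A j| ≤ M' := fun h => by
      rw [henv₄.mem A h]
      have := I.input_mem_nonneg A j
      rw [abs_of_nonneg this.1]
      omega
    simp only [List.mem_cons, List.not_mem_nil, or_false] at hA
    rcases hA with rfl | rfl | rfl | rfl | rfl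
    · exact hin (by norm_num)
    · exact hin (by norm_num)
    · exact hin (by norm_num)
    · exact (hgate j).trans hM'
    · rw [hmem₄, abs_of_nonneg (htr01 j).1]
      have := (htr01 j).2
      omega
  have h5 : m₄.reg 5 = 0 := by simp [hm₄, RState.setReg]
  obtain ⟨t₅, ht₅, m₅, hx₅, hmem₅, hreg₅⟩ := boxProg_exec (show 100 ≤ M' by omega) hW outItems
    outItems_ok henv₄.zero henv₄.one h5.ge
    (by rw [h5]; zify at hlen; push_cast at hlen hM' ⊢; omega)
    (fun l hl u hu j hj => henv₄.bounded (by omega) (by omega) hra hl hu hj) (by omega) (by omega)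
  have hx₃ : RExec W (.assign 5 (.const 0)) m₂ 2 (m₂.setReg 5 0) :=
    RExec.assign_of_eval (by simp only [RExpr.Fits, abs_zero]; omega) rfl
  have hx₄ := readFls_exec henv₃ (show 1 ≤ M' by omega) hW (by omega) (by omega)
  refine ⟨4 + (6 + (t₂ + (2 + (7 + t₅)))), by omega, m₅,
    I.init_exec (by omega) (by omega) _ (.seq _ _ _ _ _ _ _ hx₂ (.seq _ _ _ _ _ _ _ hx₃
      (.seq _ _ _ _ _ _ _ hx₄ hx₅))), ?_⟩
  have h2 : m₅.reg 2 = v := by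
    rw [hreg₅ 2 (by norm_num) (by norm_num) (by norm_num), runOps_outItems_reg]
    simp [hm₄, RState.setReg]
  have hiff := hcl.fails_iff htru hs
  by_cases hf : τ .fls
  · exact Or.inl ⟨hiff.2 hf, h2.trans ((htr _).1 hf)⟩
  · refine Or.inr ⟨mt hiff.1 hf, h2.trans ((htr _).2 hf), fun z hz => ?_⟩
    obtain ⟨x, y, hxy, hxyv, hb⟩ := hcl.bounds htru hs hf
    obtain ⟨e1, e2⟩ := outItems_correct henv₄ (τ := τ) htr (fun r ins o hr l hl u hu => by
      have := hcnt r _ ⟨l, u, 0⟩ hr ⟨by simp only; omega, by simp only; omega, Nat.zero_le _⟩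
        fun _ => rfl
      rw [Rule.cnt_total_nil] at this
      exact this.trans (sub_zero _)) hxy hxyv z hz
    rw [hmem₅, e1, e2]
    exact hb z hz

/-- The time bound. -/
theorem box_time_le {n d : ℕ} (hn : 1 ≤ n) (hd : 1 ≤ d) (K : ℕ) :
    (d + 2) * ((d + 2) * ((n + 2) * K + 16) + 16) ≤ (27 * K + 192) * (n * d ^ 2) := by
  have h1 : (n + 2) * K + 16 ≤ n * (3 * K + 16) := by
    have := Nat.mul_le_mul_right K (show n + 2 ≤ n * 3 by omega)
    have := Nat.mul_le_mul_right 16 hn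
    rw [mul_add, ← mul_assoc]
    omega
  have hnd : 1 ≤ n * d := Nat.mul_pos hn hd
  have h2 : (d + 2) * ((n + 2) * K + 16) + 16 ≤ (n * d) * (9 * K + 64) := by
    have := Nat.mul_le_mul (show d + 2 ≤ d * 3 by omega) h1
    nlinarith
  have := Nat.mul_le_mul (show d + 2 ≤ d * 3 by omega) h2
  nlinarith

theorem bcProg_correct : ∃ c : ℕ, ∀ (n d : ℕ), 0 < n → ∀ I : OADInstance n d,
    ∃ (t : ℕ) (m : RState), t ≤ c * (n * d ^ 2) ∧
      RExec (((n + d) ^ c : ℕ) : ℤ) bcProg I.input t m ∧ I.IsResult m := by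
  obtain ⟨K₁, hK₁⟩ : ∃ K, K = itemsTime (netItems oadRules) + 16 := ⟨_, rfl⟩
  obtain ⟨K₂, hK₂⟩ : ∃ K, K = itemsTime outItems + 16 := ⟨_, rfl⟩
  have hlen : (netItems oadRules).length ≤ 2 ^ 8 := by decide +kernel
  obtain ⟨c, hc⟩ : ∃ c, c = 27 * K₁ + 27 * K₂ + 1000000 := ⟨_, rfl⟩
  refine ⟨c, fun n d hn I => ?_⟩
  have hd : 1 ≤ d := by
    obtain ⟨v, hv⟩ := I.dom_nonempty ⟨0, hn⟩
    have := OADInstance.one_le_dom hv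
    omega
  obtain ⟨N, hN⟩ : ∃ N, N = n + d := ⟨_, rfl⟩
  have hN2 : 2 ≤ N := by omega
  have hpow : ∀ {a b : ℕ}, a ≤ b → N ^ a ≤ N ^ b := fun h => Nat.pow_le_pow_right (by omega) h
  have h7 : 2 ^ 7 ≤ N ^ 7 := Nat.pow_le_pow_left hN2 7
  have h8 : 128 * N ≤ N ^ 8 := by
    rw [pow_succ]
    exact Nat.mul_le_mul_right _ h7
  have h2 : N + 1 ≤ N ^ 2 := by nlinarith
  have hbox : ((d + 2) * ((d + 2) * ((n + 2) * (netItems oadRules).length))) ≤ N ^ 14 := by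
    have e : N ^ 14 = N ^ 2 * (N ^ 2 * (N ^ 2 * N ^ 8)) := by ring
    rw [e]
    refine Nat.mul_le_mul (by omega) (Nat.mul_le_mul (by omega) (Nat.mul_le_mul (by omega)
      (hlen.trans (Nat.pow_le_pow_left hN2 8))))
  obtain ⟨e, he⟩ : ∃ e, e = 8 * 64 := ⟨_, rfl⟩
  have hsum : (N ^ 8) ^ 64 + N ^ 14 ≤ N ^ (e + 1) := by
    rw [← pow_mul, ← he, pow_succ N e]
    have := hpow (show 14 ≤ e by omega)
    have := Nat.mul_le_mul_left (N ^ e) hN2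
    omega
  have hW : (N ^ (e + 1)) ^ 64 ≤ N ^ c := by
    rw [← pow_mul]
    exact hpow (by omega)
  obtain ⟨t, ht, m, hx, hr⟩ := bcProg_exec I (M := (N ^ 8 : ℕ)) (M' := (N ^ (e + 1) : ℕ))
    (W := (N ^ c : ℕ)) (by exact_mod_cast (by omega)) (by exact_mod_cast (by omega))
    (by exact_mod_cast (by omega))
    (by exact_mod_cast (Nat.add_le_add_left hbox _).trans hsum) (by exact_mod_cast hW)
  refine ⟨t, m, ?_, hN ▸ hx, hr⟩
  rw [← hK₁, ← hK₂] at ht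
  have b1 := box_time_le hn hd K₁
  have b2 := box_time_le hn hd K₂
  have b3 : (d + 2) * ((d + 2) * ((n + 2) * (netItems oadRules).length)) ≤
      (27 * 2 ^ 8 + 192) * (n * d ^ 2) := by
    refine le_trans ?_ (box_time_le hn hd (2 ^ 8))
    have h1 : (n + 2) * (netItems oadRules).length ≤ (n + 2) * 2 ^ 8 + 16 :=
      (Nat.mul_le_mul_left _ hlen).trans (Nat.le_add_right _ _)
    exact Nat.mul_le_mul_left _ ((Nat.mul_le_mul_left _ h1).trans (Nat.le_add_right _ _))
  have b4 : 1 ≤ n * d ^ 2 := Nat.mul_pos hn (pow_pos hd 2)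
  rw [hc]
  nlinarith

theorem theoremt :
    -- Enforcing bound consistency on the decomposition detects bound disentailment (and it
    -- fails only if the constraint has no solution in the given domains).
    (∀ (n d : ℕ), 0 < n → ∀ I : OADInstance n d,
      (I.overlappingAllDiff.BoundDisentailed I.domains → I.Fails) ∧
      (I.Fails → ¬ ∃ x : Fin n → ℤ, (∀ i, x i ∈ I.dom i) ∧ I.overlappingAllDiff.holds x)) ∧
    -- It takes time `O(n d^2)`, on words of `O(log (n + d))` bits.
    (∃ (p : RProg) (c : ℕ), ∀ (n d : ℕ), 0 < n → ∀ I : OADInstance n d,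
      ∃ (t : ℕ) (m : RState), t ≤ c * (n * d ^ 2) ∧
        RExec (((n + d) ^ c : ℕ) : ℤ) p I.input t m ∧ I.IsResult m) ∧
    -- It does not enforce bound consistency on the constraint: in the example it does not fail,
    -- and it does not remove the value 2 of the second variable, which has no bound support.
    (¬ fourVarExample.Fails ∧
      IsLeast (fourVarExample.closure (.X 1)) 2 ∧
      (¬ ∃ x : Fin 4 → ℤ, x 1 = 2 ∧
        fourVarExample.overlappingAllDiff.IsBoundSupport fourVarExample.domains x) ∧
      ¬ fourVarExample.overlappingAllDiff.BoundConsistent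
        (fun i => fourVarExample.closure (.X i))) := by
  refine ⟨fun n d _ I => ⟨OADInstance.fails_of_boundDisentailed, OADInstance.no_solution_of_fails⟩,
    ⟨bcProg, bcProg_correct⟩, ?_⟩
  have hno : ¬ fourVarExample.Fails :=
    fourVarExample.cons.not_fails fourVarExample.lower_mem fourVarExample.upper_mem
      fourVarExample.lower_le_upper
  exact ⟨hno, fourVarExample.isLeast_closure, fourVarExample.no_support,
    fourVarExample.not_boundConsistent⟩
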